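/- **Conventions.** Let $H$ be a $\mathbb{Q}$-vector space (in the application, a symplectic vector space of dimension $2g$; the symplectic form plays no role here). A *hairy Lie graph* with $k$ trees is a disjoint union of $k$ unitrivalent trees, numbered $1,\dots,k$, each with at least one trivalent vertex, together with: a cyclic ordering of the three half-edges at every trivalent vertex; a collection of disjoint pairs of univalent vertices, each pair joined by a directed *dotted edge*; and a color in $H$ for each remaining univalent vertex (*leaf*). Graphs are taken up to isomorphism. The *Lie degree* is the number of trivalent vertices. Let $C_{k,r}\mathcal{H}^{\mathrm{ord}}(n)$ be the $\mathbb{Q}$-vector space spanned by the hairy Lie graphs with $k$ trees, $r$ dotted edges and Lie degree $n$, modulo the IHX and AS relations in the trees, multilinearity in the colors, and the relation that reversing a dotted edge changes the sign; for $k=1$ write $C_{1,r}\mathcal{H}(n)$. The map $\beta\colon C_{k,r}\mathcal{H}^{\mathrm{ord}}(n)\to C_{k-1,r-1}\mathcal{H}^{\mathrm{ord}}(n)$ sends a graph, in which all dotted edges between the first and the second tree have been directed away from the first tree, to the sum over all ways of changing one of these dotted edges to a solid edge; the tree so obtained comes first and the others keep their order. The *two-loop space* is $$\widetilde{\Omega}_2=\bigoplus_{n\ge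 1} C_{1,2}\mathcal{H}(n)\big/\beta^{n-1}\big(C_{n,n+1}\mathcal{H}^{\mathrm{ord}}(n)\big).$$ Let $\mathcal{T}=\bigoplus_{m\ge0}H^{\otimes m}$ be the tensor algebra, with coproduct the algebra homomorphism determined by $\Delta(a)=a\otimes1+1\otimes a$ for $a\in H$, written $\Delta(u)=u'\otimes u''$ with summation understood, and antipode $\overline{u_1\cdots u_m}=(-1)^m u_m\cdots u_1$ for $u_i \in H$. For pure tensors $t=t_1\cdots t_i$, $u=u_1\cdots u_j$, $v=v_1\cdots v_k$, $w=w_1\cdots w_l$, let $\Theta(t,u,v,w)\in\widetilde{\Omega}_2$ be the class of the following planar tree with two dotted edges (cyclic orders counterclockwise): a vertical edge, from whose upper and lower ends one arm goes to the left and one arm to the right; the end of the lower left arm is joined to the end of the upper left arm by a dotted edge directed upwards, and likewise on the right; hairs point up on the upper arms and down on the lower arms, and their colors, read from left to right, are $t_1,\dots,t_i$ on the lower left arm, $u_1,\dots,u_j$ on the lower right arm, $v_k,\dots,v_1$ on the upper left arm and $w_l,\dots,w_1$ on the upper right arm. **Theorem 1.1.** The assignment $\Theta$ extends to a multilinear map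 $\mathcal{T}^4\to\widetilde{\Omega}_2$, and the $\mathbb{Q}$-vector space $\widetilde{\Omega}_2$ is generated by the elements $\Theta(t,u,v,w)$ for all $t,u,v,w\in\mathcal{T}$ subject to the following (complete set of) relations: (i) multilinearity of $\Theta$ in its four slots; (ii) for all $t,u,v,w\in\mathcal{T}$, $$\Theta(t,u,v,w)=\Theta(\overline{v},\overline{w},\overline{t},\overline{u})=\Theta(\overline{u},\overline{t},\overline{w},\overline{v});$$ (iii) for all $t,u,v,w\in\mathcal{T}$ and $a\in H$, $$\Theta(t,u,v,wa)-\Theta(t,u,av,w)=\Theta(t,au,v,w)-\Theta(ta,u,v,w);$$ (iv) for all $t,u,v,w\in\mathcal{T}$, $$\Theta(t,u,v,w)+\Theta(\overline{t'},t''u,\overline{v'},wv'')+\Theta(tu'',\overline{u'},w''v,\overline{w'})=0.$$ That is, the linear map from the vector space freely spanned by $\mathcal{T}^4$ to $\widetilde{\Omega}_2$ induced by $\Theta$ is surjective, and its kernel is spanned by the relations (i)–(iv). -/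

import Mathlib

/-!
Hairy Lie graphs, the spaces spanned by them, the map `β`, the `r`-loop spaces, and the
presentation of the `2`-loop space by symbols `Θ(t,u,v,w)`.

Everything is over `ℚ`; `H` is the space of colors.
-/

open scoped TensorProduct

namespace HairyLie

/-! ### Unitrivalent trees -/

/-- The label of a univalent vertex: either a color `h ∈ H` (the vertex is then a leaf), or an end
of the dotted edge with name `e`.  `dotted e true` is the end at which the directed dotted edge `e`
starts, and `dotted e false` is the end at which it arrives. -/
inductive Label (H : Type*) where
  | hair (h : H) : Label H
  | dotted (e : ℕ) (s : Bool) : Label H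

/-- Rooted planar binary trees with labeled univalent vertices.  The root is a dangling half-edge;
at the vertex of `node A B` the cyclic order is (root, `A`, `B`). -/
inductive RTree (H : Type*) where
  | leaf (l : Label H) : RTree H
  | node (A B : RTree H) : RTree H

/-- A unitrivalent tree with at least one trivalent vertex and with cyclically oriented trivalent
vertices, presented from one of its trivalent vertices (the base vertex): `fst`, `snd`, `trd` are
the three branches at the base vertex in cyclic order.  Two triples present isomorphic trees if and
only if they are related by rotating the triple and by moving the base vertex along an edge, that is
by the moves `(A, B, C) ↦ (B, C, A)` and `(A, B, node C D) ↦ (node A B, C, D)` and inverses. -/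
structure Tree (H : Type*) where
  fst : RTree H
  snd : RTree H
  trd : RTree H

section Trees

variable {H : Type*}

/-- `l.isEnd e s` is `1` if `l` is the end `s` of the dotted edge `e`, and `0` otherwise. -/
def Label.isEnd (e : ℕ) (s : Bool) : Label H → ℕ
  | .hair _ => 0
  | .dotted e' s' => if e' = e ∧ s' = s then 1 else 0

/-- The number of univalent vertices labeled by the end `s` of the dotted edge `e`. -/
def RTree.ends (e : ℕ) (s : Bool) : RTree H → ℕ
  | .leaf l => l.isEnd e s
  | .node A B => A.ends e s + B.ends e s

/-- The number of univalent vertices labeled by the end `s` of the dotted edge `e`. -/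
def Tree.ends (e : ℕ) (s : Bool) (T : Tree H) : ℕ :=
  T.fst.ends e s + T.snd.ends e s + T.trd.ends e s

/-- The number of trivalent vertices. -/
def RTree.vertices : RTree H → ℕ
  | .leaf _ => 0
  | .node A B => A.vertices + B.vertices + 1

/-- The number of trivalent vertices. -/
def Tree.vertices (T : Tree H) : ℕ :=
  T.fst.vertices + T.snd.vertices + T.trd.vertices + 1

/-- Apply a function to all labels. -/
def RTree.mapLabel (f : Label H → Label H) : RTree H → RTree H
  | .leaf l => .leaf (f l)
  | .node A B => .node (A.mapLabel f) (B.mapLabel f)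

/-- Apply a function to all labels. -/
def Tree.mapLabel (f : Label H → Label H) (T : Tree H) : Tree H :=
  ⟨T.fst.mapLabel f, T.snd.mapLabel f, T.trd.mapLabel f⟩

/-- Change the name of every dotted edge by `σ`. -/
def Label.rename (σ : Equiv.Perm ℕ) : Label H → Label H
  | .hair h => .hair h
  | .dotted e s => .dotted (σ e) s

/-- Switch the direction of the dotted edge with name `e`. -/
def Label.flip (e : ℕ) : Label H → Label H
  | .hair h => .hair h
  | .dotted e' s => .dotted e' (if e' = e then !s else s)

/-- Replace the univalent vertex labeled by the end `s` of `e` by the rooted tree `R`. -/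
def RTree.subst (e : ℕ) (s : Bool) : RTree H → RTree H → RTree H
  | .leaf l, R => if l.isEnd e s = 1 then R else .leaf l
  | .node A B, R => .node (A.subst e s R) (B.subst e s R)

/-- Replace the univalent vertex labeled by the end `s` of `e` by the rooted tree `R`. -/
def Tree.subst (e : ℕ) (s : Bool) (T : Tree H) (R : RTree H) : Tree H :=
  ⟨T.fst.subst e s R, T.snd.subst e s R, T.trd.subst e s R⟩

/-- Consider the tree obtained by joining the roots of `A` and `R` by an edge.  If `A` contains the
end `s` of `e`, this is the same tree, rooted at that univalent vertex (which is removed). -/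
def RTree.reroot (e : ℕ) (s : Bool) : RTree H → RTree H → Option (RTree H)
  | .leaf l, R => if l.isEnd e s = 1 then some R else none
  | .node A B, R => (A.reroot e s (.node B R)).or (B.reroot e s (.node R A))

/-- The tree `T` rooted at its univalent vertex labeled by the end `s` of `e` (which is removed), if
there is such a vertex. -/
def Tree.rootAt (e : ℕ) (s : Bool) (T : Tree H) : Option (RTree H) :=
  ((T.fst.reroot e s (.node T.snd T.trd)).or
    (T.snd.reroot e s (.node T.trd T.fst))).or (T.trd.reroot e s (.node T.fst T.snd))

/-- If the end `s` of the dotted edge `e` lies in `T₁` and its other end lies in `T₂`, the tree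
obtained from `T₁` and `T₂` by changing the dotted edge `e` to a solid edge. -/
def Tree.glue (e : ℕ) (s : Bool) (T₁ T₂ : Tree H) : Option (Tree H) :=
  if T₁.ends e s = 0 then none else (T₂.rootAt e (!s)).map fun R => T₁.subst e s R

theorem Label.isEnd_le (e : ℕ) (s : Bool) (l : Label H) : l.isEnd e s = 0 ∨ l.isEnd e s = 1 := by
  cases l <;> simp only [Label.isEnd]
  · simp
  · split <;> simp

theorem Label.isEnd_of_isEnd {e : ℕ} {s : Bool} {l : Label H} (h : l.isEnd e s = 1) (e' : ℕ)
    (s' : Bool) : l.isEnd e' s' = if e' = e ∧ s' = s then 1 else 0 := by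
  cases l with
  | hair _ => simp [Label.isEnd] at h
  | dotted a b =>
    simp only [Label.isEnd] at h ⊢
    split at h
    · rename_i hab
      obtain ⟨rfl, rfl⟩ := hab
      simp only [eq_comm]
    · simp at h

theorem RTree.ends_subst (e : ℕ) (s : Bool) (R A : RTree H) (e' : ℕ) (s' : Bool) :
    (A.subst e s R).ends e' s' + (if e' = e ∧ s' = s then 1 else 0) * A.ends e s
      = A.ends e' s' + A.ends e s * R.ends e' s' := by
  induction A with
  | leaf l =>
    rcases l.isEnd_le e s with h | h
    · simp [RTree.subst, RTree.ends, h]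
    · simp [RTree.subst, RTree.ends, h, Label.isEnd_of_isEnd h e' s', add_comm]
  | node A B hA hB =>
    simp only [RTree.subst, RTree.ends, mul_add, add_mul]
    omega

theorem Tree.ends_subst (e : ℕ) (s : Bool) (R : RTree H) (T : Tree H) (e' : ℕ) (s' : Bool) :
    (T.subst e s R).ends e' s' + (if e' = e ∧ s' = s then 1 else 0) * T.ends e s
      = T.ends e' s' + T.ends e s * R.ends e' s' := by
  have h₁ := RTree.ends_subst e s R T.fst e' s'
  have h₂ := RTree.ends_subst e s R T.snd e' s'
  have h₃ := RTree.ends_subst e s R T.trd e' s'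
  simp only [Tree.subst, Tree.ends, mul_add, add_mul]
  omega

theorem RTree.ends_reroot {e : ℕ} {s : Bool} {A : RTree H} {R S : RTree H}
    (h : A.reroot e s R = some S) (e' : ℕ) (s' : Bool) :
    S.ends e' s' + (if e' = e ∧ s' = s then 1 else 0) = A.ends e' s' + R.ends e' s' := by
  induction A generalizing R with
  | leaf l =>
    simp only [RTree.reroot] at h
    split at h
    · rename_i hl
      obtain rfl := Option.some.inj h
      simp [RTree.ends, Label.isEnd_of_isEnd hl e' s', add_comm]
    · simp at h
  | node A B hA hB =>
    simp only [RTree.reroot, Option.or_eq_some_iff] at h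
    rcases h with h | ⟨-, h⟩
    · have := hA h
      simp only [RTree.ends] at this ⊢
      omega
    · have := hB h
      simp only [RTree.ends] at this ⊢
      omega

theorem Tree.ends_rootAt {e : ℕ} {s : Bool} {T : Tree H} {S : RTree H}
    (h : T.rootAt e s = some S) (e' : ℕ) (s' : Bool) :
    S.ends e' s' + (if e' = e ∧ s' = s then 1 else 0) = T.ends e' s' := by
  simp only [Tree.rootAt, Option.or_eq_some_iff] at h
  rcases h with (h | ⟨-, h⟩) | ⟨-, h⟩ <;>
  · have := RTree.ends_reroot h e' s'
    simp only [RTree.ends, Tree.ends] at this ⊢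
    omega

theorem Tree.ends_glue {e : ℕ} {s : Bool} {T₁ T₂ T : Tree H} (h : Tree.glue e s T₁ T₂ = some T)
    (h₁ : T₁.ends e s ≤ 1) (e' : ℕ) (s' : Bool) :
    T₁.ends e s = 1 ∧
      T.ends e' s' + (if e' = e then 1 else 0) = T₁.ends e' s' + T₂.ends e' s' := by
  unfold Tree.glue at h
  split at h
  · simp at h
  · rename_i h₀
    have h₁ : T₁.ends e s = 1 := by omega
    obtain ⟨R, hR, rfl⟩ := Option.map_eq_some_iff.1 h
    have a := Tree.ends_rootAt hR e' s'
    have b := Tree.ends_subst e s R T₁ e' s'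
    refine ⟨h₁, ?_⟩
    rw [h₁] at b
    by_cases he : e' = e
    · cases s <;> cases s' <;> simp [he] at a b ⊢ <;> omega
    · simp [he] at a b ⊢
      omega

end Trees

/-! ### Hairy Lie graphs -/

/-- A hairy Lie graph with `k` (ordered) trees and `r` dotted edges.  The field `edges` is the set
of names of its dotted edges, each of which joins two univalent vertices of the trees. -/
structure HairyLieGraph (H : Type*) (k r : ℕ) where
  tree : Fin k → Tree H
  edges : Finset ℕ
  card_edges : edges.card = r
  sum_ends : ∀ e s, ∑ j, (tree j).ends e s = if e ∈ edges then 1 else 0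

/-- The Lie degree: the total number of trivalent vertices. -/
def HairyLieGraph.lieDegree {H : Type*} {k r : ℕ} (X : HairyLieGraph H k r) : ℕ :=
  ∑ j, (X.tree j).vertices

/-- `X`, as an element of the vector space freely spanned by hairy Lie graphs. -/
noncomputable def HairyLieGraph.of {H : Type*} {k r : ℕ} (X : HairyLieGraph H k r) :
    HairyLieGraph H k r →₀ ℚ :=
  Finsupp.single X 1

/-- The relations between hairy Lie graphs with `k` ordered trees and `r` dotted edges.  In each of
them `Y` and `Z` differ from `X` only in the displayed places.  Since any trivalent vertex of a tree
can be made its base vertex, it suffices to state the local relations there. -/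
inductive HairyLieGraph.Rel {H : Type*} [AddCommGroup H] [Module ℚ H] {k r : ℕ} :
    (HairyLieGraph H k r →₀ ℚ) → Prop
  /-- isomorphism: rotation at the base vertex -/
  | rotate (X Y : HairyLieGraph H k r) (j : Fin k) (A B C : RTree H)
      (hX : X.tree j = ⟨A, B, C⟩) (hY : Y.tree = Function.update X.tree j ⟨B, C, A⟩) :
      Rel (X.of - Y.of)
  /-- isomorphism: change of the base vertex -/
  | rebase (X Y : HairyLieGraph H k r) (j : Fin k) (A B C D : RTree H)
      (hX : X.tree j = ⟨A, B, .node C D⟩)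
      (hY : Y.tree = Function.update X.tree j ⟨.node A B, C, D⟩) :
      Rel (X.of - Y.of)
  /-- isomorphism: the names of the dotted edges are immaterial -/
  | rename (X Y : HairyLieGraph H k r) (σ : Equiv.Perm ℕ)
      (hY : ∀ j, Y.tree j = (X.tree j).mapLabel (Label.rename σ)) :
      Rel (X.of - Y.of)
  /-- the IHX relation; `A`, `B`, `C`, `D` are the branches at the top right, top left, bottom left
  and bottom right -/
  | ihx (X Y Z : HairyLieGraph H k r) (j : Fin k) (A B C D : RTree H)
      (hX : X.tree j = ⟨A, B, .node C D⟩)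
      (hY : Y.tree = Function.update X.tree j ⟨.node D A, B, C⟩)
      (hZ : Z.tree = Function.update X.tree j ⟨.node D B, A, C⟩) :
      Rel (X.of - Y.of + Z.of)
  /-- the AS relation -/
  | as (X Y : HairyLieGraph H k r) (j : Fin k) (A B C : RTree H)
      (hX : X.tree j = ⟨A, B, C⟩) (hY : Y.tree = Function.update X.tree j ⟨B, A, C⟩) :
      Rel (X.of + Y.of)
  /-- additivity in the color of a leaf -/
  | add (X Y Z : HairyLieGraph H k r) (j : Fin k) (a b : H) (B C : RTree H)
      (hX : X.tree j = ⟨.leaf (.hair (a + b)), B, C⟩)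
      (hY : Y.tree = Function.update X.tree j ⟨.leaf (.hair a), B, C⟩)
      (hZ : Z.tree = Function.update X.tree j ⟨.leaf (.hair b), B, C⟩) :
      Rel (X.of - (Y.of + Z.of))
  /-- homogeneity in the color of a leaf -/
  | smul (X Y : HairyLieGraph H k r) (j : Fin k) (c : ℚ) (a : H) (B C : RTree H)
      (hX : X.tree j = ⟨.leaf (.hair (c • a)), B, C⟩)
      (hY : Y.tree = Function.update X.tree j ⟨.leaf (.hair a), B, C⟩) :
      Rel (X.of - c • Y.of)
  /-- switching the direction of a dotted edge -/
  | flip (X Y : HairyLieGraph H k r) (e : ℕ) (he : e ∈ X.edges)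
      (hY : ∀ j, Y.tree j = (X.tree j).mapLabel (Label.flip e)) :
      Rel (X.of + Y.of)

/-- The `ℚ`-vector space of hairy Lie graphs with `k` ordered trees and `r` dotted edges, of all Lie
degrees.  For `k = 1`, where there is nothing to order, this is the space spanned by trees with `r`
dotted edges. -/
abbrev HairyLieSpace (H : Type*) [AddCommGroup H] [Module ℚ H] (k r : ℕ) : Type _ :=
  (HairyLieGraph H k r →₀ ℚ) ⧸ Submodule.span ℚ
    {x : HairyLieGraph H k r →₀ ℚ | HairyLieGraph.Rel x}

/-- The class of a formal linear combination of hairy Lie graphs. -/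
noncomputable def HairyLieSpace.mk (H : Type*) [AddCommGroup H] [Module ℚ H] (k r : ℕ) :
    (HairyLieGraph H k r →₀ ℚ) →ₗ[ℚ] HairyLieSpace H k r :=
  Submodule.mkQ _

/-! ### The map `β` -/

/-- If the end `s` of the dotted edge `e` lies in the first tree and its other end lies in the
second tree, the hairy Lie graph obtained by changing `e` to a solid edge.  The tree obtained from
the first two trees comes first, followed by the other trees in their order. -/
def HairyLieGraph.glue {H : Type*} {k r : ℕ} (X : HairyLieGraph H (k + 2) (r + 1)) (e : ℕ)
    (s : Bool) : Option (HairyLieGraph H (k + 1) r) :=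
  match h : Tree.glue e s (X.tree 0) (X.tree 1) with
  | none => none
  | some T => some
    { tree := Fin.cons T fun j => X.tree j.succ.succ
      edges := X.edges.erase e
      card_edges := by
        have hs := X.sum_ends e s
        rw [Fin.sum_univ_succ] at hs
        have h₁ : (X.tree 0).ends e s ≤ 1 := by
          have : (if e ∈ X.edges then 1 else 0) ≤ 1 := by split <;> omega
          omega
        have h₂ := (Tree.ends_glue h h₁ e s).1
        have h₃ : e ∈ X.edges := by
          by_contra hc
          rw [if_neg hc] at hs
          omega
        rw [Finset.card_erase_of_mem h₃, X.card_edges, Nat.add_sub_cancel]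
      sum_ends := by
        intro e' s'
        have hs := X.sum_ends e s
        rw [Fin.sum_univ_succ] at hs
        have h₁ : (X.tree 0).ends e s ≤ 1 := by
          have : (if e ∈ X.edges then 1 else 0) ≤ 1 := by split <;> omega
          omega
        have h₂ := (Tree.ends_glue h h₁ e' s').1
        have h₃ := (Tree.ends_glue h h₁ e' s').2
        have h₄ : e ∈ X.edges := by
          by_contra hc
          rw [if_neg hc] at hs
          omega
        have hs' := X.sum_ends e' s'
        rw [Fin.sum_univ_succ, Fin.sum_univ_succ] at hs'
        rw [Fin.sum_univ_succ]
        simp only [Fin.cons_zero, Fin.cons_succ]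
        have e1 : (Fin.succ 0 : Fin (k + 2)) = 1 := rfl
        rw [e1] at hs'
        by_cases he : e' = e
        · subst he
          simp only [Finset.notMem_erase, if_false]
          rw [if_pos rfl] at h₃
          rw [if_pos h₄] at hs'
          omega
        · rw [if_neg he] at h₃
          simp only [Finset.mem_erase, he, ne_eq, not_false_eq_true, true_and]
          omega }

/-- The map `β`: sum over all ways of changing a dotted edge joining the first and the second tree,
directed from the first tree, to a solid edge.  A dotted edge directed from the second tree to the
first contributes with a minus sign, because reversing its direction is a change of sign. -/
noncomputable def beta (H : Type*) (k r : ℕ) :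
    (HairyLieGraph H (k + 2) (r + 1) →₀ ℚ) →ₗ[ℚ] (HairyLieGraph H (k + 1) r →₀ ℚ) :=
  Finsupp.lift (HairyLieGraph H (k + 1) r →₀ ℚ) ℚ (HairyLieGraph H (k + 2) (r + 1)) fun X =>
    ∑ e ∈ X.edges,
      ((X.glue e true).elim 0 HairyLieGraph.of - (X.glue e false).elim 0 HairyLieGraph.of)

/-- The `j`-th iterate of `β`, from graphs with `j + 1` trees to graphs with one tree. -/
noncomputable def betaIter (H : Type*) (r : ℕ) : (j : ℕ) →
    (HairyLieGraph H (j + 1) (r + j) →₀ ℚ) →ₗ[ℚ] (HairyLieGraph H 1 r →₀ ℚ)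
  | 0 => LinearMap.id
  | j + 1 => (betaIter H r j).comp (beta H j (r + j))

/-! ### Loop spaces -/

/-- The image in the space of trees with `r` dotted edges of the maps `β ^ (n - 1)`, for all
`n = j + 1 ≥ 1`, on the graphs with `n` ordered trees and Lie degree `n` (that is, on ordered unions
of `n` tripods with dotted edges). -/
noncomputable def loopImage (H : Type*) [AddCommGroup H] [Module ℚ H] (r : ℕ) :
    Submodule ℚ (HairyLieSpace H 1 r) :=
  Submodule.span ℚ {x | ∃ (j : ℕ) (X : HairyLieGraph H (j + 1) (r + j)),
    X.lieDegree = j + 1 ∧ x = HairyLieSpace.mk H 1 r (betaIter H r j X.of)}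

/-- The `r`-loop space: trees with `r` dotted edges modulo the images of the maps `β ^ (n - 1)`.
It is the direct sum, over all numbers of leaves, of its homogeneous parts. -/
abbrev LoopSpace (H : Type*) [AddCommGroup H] [Module ℚ H] (r : ℕ) : Type _ :=
  HairyLieSpace H 1 r ⧸ loopImage H r

/-- The class of a tree with `r` dotted edges in the `r`-loop space. -/
noncomputable def LoopSpace.ofGraph {H : Type*} [AddCommGroup H] [Module ℚ H] {r : ℕ}
    (X : HairyLieGraph H 1 r) : LoopSpace H r :=
  (loopImage H r).mkQ (HairyLieSpace.mk H 1 r X.of)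

/-! ### The theta graphs -/

/-- `((E * x₁) * x₂) * ⋯ * xₘ` for `x = [x₁, …, xₘ]`. -/
def hairsRight {H : Type*} (E : RTree H) (x : List H) : RTree H :=
  x.foldl (fun A a => .node A (.leaf (.hair a))) E

/-- `x₁ * (x₂ * ⋯ * (xₘ * E))` for `x = [x₁, …, xₘ]`. -/
def hairsLeft {H : Type*} (x : List H) (E : RTree H) : RTree H :=
  x.foldr (fun a A => .node (.leaf (.hair a)) A) E

theorem ends_hairsRight {H : Type*} (E : RTree H) (x : List H) (e : ℕ) (s : Bool) :
    (hairsRight E x).ends e s = E.ends e s := by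
  induction x generalizing E with
  | nil => rfl
  | cons a x ih =>
    simp only [hairsRight, List.foldl_cons] at ih ⊢
    rw [ih]
    simp [RTree.ends, Label.isEnd]

theorem ends_hairsLeft {H : Type*} (E : RTree H) (x : List H) (e : ℕ) (s : Bool) :
    (hairsLeft x E).ends e s = E.ends e s := by
  induction x with
  | nil => rfl
  | cons a x ih =>
    simp only [hairsLeft, List.foldr_cons] at ih ⊢
    simp [RTree.ends, Label.isEnd, ih]

/-- The hairy Lie graph `Θ(t,u,v,w)` for pure tensors `t`, `u`, `v`, `w`, given as lists of colors.
Its core is the theta graph drawn in the plane as follows, with counterclockwise cyclic orders: a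
vertical edge from the upper vertex `P` to the lower vertex `Q`; from each of `P` and `Q` one arm
to the left and one arm to the right; the two left arms end in the dotted edge `0` and the two right
arms end in the dotted edge `1`, both directed from the lower to the upper arm.  The hairs point
outwards (up on the upper arms, down on the lower arms).  Read from left to right, the hairs on the
lower left arm are `t₁, …, tᵢ`, on the lower right arm `u₁, …, uⱼ`, on the upper left arm
`vₖ, …, v₁`, and on the upper right arm `wₗ, …, w₁`.  The base vertex is `P`, with the branches
right, left, down; the cyclic order at `Q` is up, left, right. -/
def thetaGraph {H : Type*} (t u v w : List H) : HairyLieGraph H 1 2 where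
  tree := fun _ =>
    ⟨hairsRight (.leaf (.dotted 1 false)) w,
     hairsLeft v (.leaf (.dotted 0 false)),
     .node (hairsRight (.leaf (.dotted 0 true)) t) (hairsLeft u (.leaf (.dotted 1 true)))⟩
  edges := {0, 1}
  card_edges := rfl
  sum_ends := by
    intro e s
    simp only [Finset.univ_unique, Finset.sum_singleton, Tree.ends, RTree.ends, ends_hairsRight,
      ends_hairsLeft, Label.isEnd, Finset.mem_insert, Finset.mem_singleton]
    rcases e with _ | _ | e <;> cases s <;> simp

/-! ### The tensor algebra as a Hopf algebra, and the presentation -/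

section Presentation

variable (H : Type*) [AddCommGroup H] [Module ℚ H]

/-- The coproduct of the tensor algebra: the algebra homomorphism with `a ↦ a ⊗ 1 + 1 ⊗ a` for
`a ∈ H`, so that `Δ(u₁ ⋯ uₘ)` is the sum of `u_I ⊗ u_J` over all partitions `I ⊔ J` of
`{1, …, m}`. -/
noncomputable def coproduct : TensorAlgebra ℚ H →ₐ[ℚ] TensorAlgebra ℚ H ⊗[ℚ] TensorAlgebra ℚ H :=
  TensorAlgebra.lift ℚ
    ((Algebra.TensorProduct.includeLeft :
        TensorAlgebra ℚ H →ₐ[ℚ] TensorAlgebra ℚ H ⊗[ℚ] TensorAlgebra ℚ H).toLinearMap ∘ₗ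
          TensorAlgebra.ι ℚ +
      (Algebra.TensorProduct.includeRight :
        TensorAlgebra ℚ H →ₐ[ℚ] TensorAlgebra ℚ H ⊗[ℚ] TensorAlgebra ℚ H).toLinearMap ∘ₗ
          TensorAlgebra.ι ℚ)

variable {H}

/-- The antipode of the tensor algebra: the anti-automorphism with `a ↦ -a` for `a ∈ H`, so that
`u₁ ⋯ uₘ ↦ (-1)ᵐ uₘ ⋯ u₁`. -/
noncomputable def antipode (x : TensorAlgebra ℚ H) : TensorAlgebra ℚ H :=
  (TensorAlgebra.lift ℚ
    (-((MulOpposite.opLinearEquiv ℚ : TensorAlgebra ℚ H ≃ₗ[ℚ] (TensorAlgebra ℚ H)ᵐᵒᵖ).toLinearMap ∘ₗ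
      TensorAlgebra.ι ℚ)) x).unop

/-- The pure tensor `u₁ ⋯ uₘ`. -/
noncomputable def pureTensor (u : List H) : TensorAlgebra ℚ H :=
  (u.map (TensorAlgebra.ι ℚ)).prod

variable (H) in
/-- The vector space freely spanned by the symbols `Θ(t,u,v,w)` for `t, u, v, w` in the tensor
algebra. -/
abbrev Symbols : Type _ :=
  (TensorAlgebra ℚ H × TensorAlgebra ℚ H × TensorAlgebra ℚ H × TensorAlgebra ℚ H) →₀ ℚ

/-- The symbol `Θ(t,u,v,w)`. -/
noncomputable def symbol (t u v w : TensorAlgebra ℚ H) : Symbols H :=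
  Finsupp.single (t, u, v, w) 1

/-- The relations between the symbols. -/
inductive ThetaRel : Symbols H → Prop
  /-- multilinearity in the four slots -/
  | add₁ (t₁ t₂ u v w : TensorAlgebra ℚ H) :
      ThetaRel (symbol (t₁ + t₂) u v w - (symbol t₁ u v w + symbol t₂ u v w))
  | add₂ (t u₁ u₂ v w : TensorAlgebra ℚ H) :
      ThetaRel (symbol t (u₁ + u₂) v w - (symbol t u₁ v w + symbol t u₂ v w))
  | add₃ (t u v₁ v₂ w : TensorAlgebra ℚ H) :
      ThetaRel (symbol t u (v₁ + v₂) w - (symbol t u v₁ w + symbol t u v₂ w))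
  | add₄ (t u v w₁ w₂ : TensorAlgebra ℚ H) :
      ThetaRel (symbol t u v (w₁ + w₂) - (symbol t u v w₁ + symbol t u v w₂))
  | smul₁ (c : ℚ) (t u v w : TensorAlgebra ℚ H) :
      ThetaRel (symbol (c • t) u v w - c • symbol t u v w)
  | smul₂ (c : ℚ) (t u v w : TensorAlgebra ℚ H) :
      ThetaRel (symbol t (c • u) v w - c • symbol t u v w)
  | smul₃ (c : ℚ) (t u v w : TensorAlgebra ℚ H) :
      ThetaRel (symbol t u (c • v) w - c • symbol t u v w)
  | smul₄ (c : ℚ) (t u v w : TensorAlgebra ℚ H) :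
      ThetaRel (symbol t u v (c • w) - c • symbol t u v w)
  /-- the two reflections -/
  | reflect₁ (t u v w : TensorAlgebra ℚ H) :
      ThetaRel (symbol t u v w - symbol (antipode v) (antipode w) (antipode t) (antipode u))
  | reflect₂ (t u v w : TensorAlgebra ℚ H) :
      ThetaRel (symbol t u v w - symbol (antipode u) (antipode t) (antipode w) (antipode v))
  /-- the handle balance relation -/
  | handle (t u v w : TensorAlgebra ℚ H) (a : H) :
      ThetaRel ((symbol t u v (w * TensorAlgebra.ι ℚ a) - symbol t u (TensorAlgebra.ι ℚ a * v) w) -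
        (symbol t (TensorAlgebra.ι ℚ a * u) v w - symbol (t * TensorAlgebra.ι ℚ a) u v w))
  /-- the three-term relation
  `Θ(t,u,v,w) + Θ(S t', t'' u, S v', w v'') + Θ(t u'', S u', w'' v, S w') = 0`, where `S` is the
  antipode and the lists `dt`, `du`, `dv`, `dw` of pairs `(x', x'')` spell out the Sweedler notation
  for the coproducts of `t`, `u`, `v`, `w` -/
  | three (t u v w : TensorAlgebra ℚ H)
      (dt du dv dw : List (TensorAlgebra ℚ H × TensorAlgebra ℚ H))
      (ht : coproduct H t = (dt.map fun p => p.1 ⊗ₜ[ℚ] p.2).sum)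
      (hu : coproduct H u = (du.map fun p => p.1 ⊗ₜ[ℚ] p.2).sum)
      (hv : coproduct H v = (dv.map fun p => p.1 ⊗ₜ[ℚ] p.2).sum)
      (hw : coproduct H w = (dw.map fun p => p.1 ⊗ₜ[ℚ] p.2).sum) :
      ThetaRel (symbol t u v w +
        (dt.map fun p => (dv.map fun q =>
          symbol (antipode p.1) (p.2 * u) (antipode q.1) (w * q.2)).sum).sum +
        (du.map fun p => (dw.map fun q =>
          symbol (t * p.2) (antipode p.1) (q.2 * v) (antipode q.1)).sum).sum)

end Presentation

end HairyLie

/-!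
A function of unitrivalent trees that satisfies the AS and IHX relations is determined by its values
on path trees: choose two univalent vertices, draw the path between them as a straight line, and use
IHX to replace every branch by branches that are single leaves (`exists_path`,
`list_eq_zero_of_leaves`).  For a tree with two dotted edges, take the path that joins the two ends
of one of them.  What remains is a word in `H` that is interrupted by the two ends of the other
edge, that is, a theta graph with hairs on its two left arms and on its middle edge.  The hairs on
the middle edge can be pushed to the arms, which gives the form `mid Θ`.  In this way functions of
trees with two dotted edges that satisfy the relations in the trees are the same as forms `Θ` in
four variables that satisfy the reflection relations (ii) and the handle relation (iii):
`IsInvariant.exists_form` is one direction.  For the other, `realize` reads the colors along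
the path from one end of a dotted edge to its other end; technically, trees are evaluated by
commutators in an endomorphism algebra whose generators consume one letter at a time
(`IsBalanced.isInvariant_realize`, `IsBalanced.realize_thetaGraph`).

It remains to see that dividing by the images of the iterates of `β` amounts to the three-term
relation (iv).  A graph with as many trees as trivalent vertices consists of tripods, and an iterate
of `β` glues them one after the other to the first one (`lift_betaIter`, `joinAll`).

* The three-term relation kills these images (`joinAll_tripod_eq_zero`).  While tripods are being
  glued, the tree acquires, for the first time, one dotted edge with both its ends, and later a
  second one.  A step that only prolongs the tree is a substitution and commutes with everything.
  A step that creates a dotted edge joins two or three ends to a tripod, or one end to a tripod with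
  a dotted loop (`Compat.exists_step`).  By the three-term relation, the function of trees with one
  dotted edge that describes the second such step has a cyclic symmetry along the path that joins
  the ends of this edge (`IsCyclic`, `IsInvariant.isCyclic_join₂`, `IsInvariant.isCyclic_joinLoop`),
  and the two summands of the first such step differ by a cyclic permutation, so they cancel
  (`IsCyclic.join₂_eq_zero`, `IsCyclic.loop`).  If three ends are joined at once, the three summands
  are the three terms of the relation (`IsInvariant.join₃_eq_zero`).

* Conversely, the three-term relation holds in the two-loop space (`isThreeTerm_of_treeClass`).
  Every tree is glued from tripods in a single way, so in the relations one may take the first tree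
  to be any tree without dotted edges (`joinAll_treeClass_eq_zero`).  Gluing a path to a tripod
  along three ends gives the relation for theta graphs without hairs on the upper arms
  (`join₃_treeClass`); gluing it to two tripods, one of which has a hair, gives the cyclic symmetry
  for moving a single hair across a dotted edge (`join₂_treeClass`).  From these two special cases
  the general relation follows by induction on the number of hairs (`IsBalanced.isThreeTerm`).

For balanced forms, `IsBalanced.isThreeTerm_iff` identifies the relation used here, in which hairs
stay on the middle edge, with the one in Sweedler notation.  The form given by the classes of the
theta graphs thus satisfies all relations, and it generates since every tree is a combination of
path trees.  The universal form with values in the space of symbols modulo the relations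
(`universalForm`) satisfies all of them as well, hence it defines a linear map on the two-loop space
that is a left inverse; so there are no further relations.
-/

namespace HairyLie

set_option maxSynthPendingDepth 3
set_option linter.unusedSectionVars false

/-! ### The antipode, and theta symbols with hairs on the middle edge -/

section TensorAlgebra

variable {H : Type*} [AddCommGroup H] [Module ℚ H]

theorem tensor_induction_left {P : TensorAlgebra ℚ H → Prop} (one : P 1)
    (ι_mul : ∀ a x, P x → P (TensorAlgebra.ι ℚ a * x)) (add : ∀ x y, P x → P y → P (x + y))
    (smul : ∀ (c : ℚ) x, P x → P (c • x)) (x : TensorAlgebra ℚ H) : P x := by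
  suffices h : ∀ y, P y → P (x * y) by simpa using h 1 one
  induction x using TensorAlgebra.induction with
  | algebraMap r => intro y hy; rw [Algebra.algebraMap_eq_smul_one, smul_one_mul]; exact smul _ _ hy
  | ι a => exact fun y hy => ι_mul a y hy
  | mul a b ha hb => intro y hy; rw [mul_assoc]; exact ha _ (hb _ hy)
  | add a b ha hb => intro y hy; rw [add_mul]; exact add _ _ (ha _ hy) (hb _ hy)

theorem tensor_induction_right {P : TensorAlgebra ℚ H → Prop} (one : P 1)
    (mul_ι : ∀ a x, P x → P (x * TensorAlgebra.ι ℚ a)) (add : ∀ x y, P x → P y → P (x + y))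
    (smul : ∀ (c : ℚ) x, P x → P (c • x)) (x : TensorAlgebra ℚ H) : P x := by
  suffices h : ∀ y, P y → P (y * x) by simpa using h 1 one
  induction x using TensorAlgebra.induction with
  | algebraMap r => intro y hy; rw [Algebra.algebraMap_eq_smul_one, mul_smul_one]; exact smul _ _ hy
  | ι a => exact fun y hy => mul_ι a y hy
  | mul a b ha hb => intro y hy; rw [← mul_assoc]; exact hb _ (ha _ hy)
  | add a b ha hb => intro y hy; rw [mul_add]; exact add _ _ (ha _ hy) (hb _ hy)

@[simp] theorem antipode_one : antipode (1 : TensorAlgebra ℚ H) = 1 := by simp [antipode]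

@[simp] theorem antipode_ι (a : H) :
    antipode (TensorAlgebra.ι ℚ a) = -TensorAlgebra.ι ℚ a := by simp [antipode]

@[simp] theorem antipode_mul (x y : TensorAlgebra ℚ H) :
    antipode (x * y) = antipode y * antipode x := by simp [antipode]

@[simp] theorem antipode_add (x y : TensorAlgebra ℚ H) :
    antipode (x + y) = antipode x + antipode y := by simp [antipode]

@[simp] theorem antipode_smul (c : ℚ) (x : TensorAlgebra ℚ H) :
    antipode (c • x) = c • antipode x := by simp [antipode]

/-- The antipode as a linear map. -/
noncomputable def antipodeₗ : TensorAlgebra ℚ H →ₗ[ℚ] TensorAlgebra ℚ H where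
  toFun := antipode
  map_add' := antipode_add
  map_smul' := antipode_smul

@[simp] theorem antipodeₗ_apply (x : TensorAlgebra ℚ H) : antipodeₗ x = antipode x := rfl

@[simp] theorem antipode_neg (x : TensorAlgebra ℚ H) : antipode (-x) = -antipode x :=
  map_neg antipodeₗ x

@[simp] theorem antipode_sub (x y : TensorAlgebra ℚ H) :
    antipode (x - y) = antipode x - antipode y :=
  map_sub antipodeₗ x y

@[simp] theorem antipode_antipode (x : TensorAlgebra ℚ H) : antipode (antipode x) = x := by
  induction x using tensor_induction_left with
  | one => simp
  | ι_mul a x h => simp [h]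
  | add x y hx hy => simp [hx, hy]
  | smul c x h => simp [h]

@[simp] theorem pureTensor_nil : pureTensor ([] : List H) = 1 := rfl

@[simp] theorem pureTensor_cons (a : H) (l : List H) :
    pureTensor (a :: l) = TensorAlgebra.ι ℚ a * pureTensor l := by simp [pureTensor]

@[simp] theorem pureTensor_append (l₁ l₂ : List H) :
    pureTensor (l₁ ++ l₂) = pureTensor l₁ * pureTensor l₂ := by simp [pureTensor]

theorem pureTensor_reverse (l : List H) :
    pureTensor l.reverse = (-1 : ℚ) ^ l.length • antipode (pureTensor l) := by
  induction l with
  | nil => simp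
  | cons a l ih => simp [ih, pow_succ]

/-- A property that is stable under linear combinations holds if it holds for pure tensors. -/
theorem tensor_induction_pure {P : TensorAlgebra ℚ H → Prop} (pure : ∀ l, P (pureTensor l))
    (add : ∀ x y, P x → P y → P (x + y))
    (smul : ∀ (c : ℚ) x, P x → P (c • x)) (x : TensorAlgebra ℚ H) : P x := by
  suffices h : ∀ l, P (pureTensor l * x) by simpa using h []
  induction x using tensor_induction_left with
  | one => simpa using pure
  | ι_mul a x h => intro l; simpa [← mul_assoc] using h (l ++ [a])
  | add x y hx hy => intro l; rw [mul_add]; exact add _ _ (hx l) (hy l)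
  | smul c x h => intro l; rw [mul_smul_comm]; exact smul _ _ (h l)

end TensorAlgebra

section Mid

variable {H : Type*} [AddCommGroup H] [Module ℚ H] {M : Type*} [AddCommGroup M] [Module ℚ M]

/-- Forms in four variables from the tensor algebra. -/
abbrev FourForm (H M : Type*) [AddCommGroup H] [Module ℚ H] [AddCommGroup M] [Module ℚ M] :
    Type _ :=
  TensorAlgebra ℚ H →ₗ[ℚ] TensorAlgebra ℚ H →ₗ[ℚ] TensorAlgebra ℚ H →ₗ[ℚ]
    TensorAlgebra ℚ H →ₗ[ℚ] M

/-- The operator on bilinear forms `B` in the colors `t`, `u` of the two lower arms of a theta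
graph that a hair `a` at the bottom of the middle edge induces:
`B(t, u) ↦ B(t a, u) - B(t, a u)`. -/
noncomputable def pushHair (H N : Type*) [AddCommGroup H] [Module ℚ H] [AddCommGroup N]
    [Module ℚ N] : H →ₗ[ℚ]
      Module.End ℚ (TensorAlgebra ℚ H →ₗ[ℚ] TensorAlgebra ℚ H →ₗ[ℚ] N) where
  toFun a :=
    { toFun := fun B => B ∘ₗ LinearMap.mulRight ℚ (TensorAlgebra.ι ℚ a) -
        B.compl₂ (LinearMap.mulLeft ℚ (TensorAlgebra.ι ℚ a))
      map_add' := fun B C => by ext; simp; abel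
      map_smul' := fun c B => by ext; simp [smul_sub] }
  map_add' a b := by
    refine LinearMap.ext fun B => LinearMap.ext fun t => LinearMap.ext fun u => ?_
    simp [mul_add, add_mul]; abel
  map_smul' c a := by
    refine LinearMap.ext fun B => LinearMap.ext fun t => LinearMap.ext fun u => ?_
    simp [smul_sub]

theorem pushHair_apply {N : Type*} [AddCommGroup N] [Module ℚ N] (a : H)
    (B : TensorAlgebra ℚ H →ₗ[ℚ] TensorAlgebra ℚ H →ₗ[ℚ] N) (t u : TensorAlgebra ℚ H) :
    pushHair H N a B t u = B (t * TensorAlgebra.ι ℚ a) u - B t (TensorAlgebra.ι ℚ a * u) := rfl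

/-- `mid Θ m t u v w` is the value of `Θ` on the theta graph with hairs `t`, `u`, `v`, `w` on the
four arms and in addition hairs `m` on the middle edge, which point to the right and are read
upwards.  It is computed by pushing the hairs of the middle edge to the lower arms. -/
noncomputable def mid (Θ : FourForm H M) : TensorAlgebra ℚ H →ₗ[ℚ] FourForm H M :=
  LinearMap.applyₗ Θ ∘ₗ (TensorAlgebra.lift ℚ (pushHair H
    (TensorAlgebra ℚ H →ₗ[ℚ] TensorAlgebra ℚ H →ₗ[ℚ] M))).toLinearMap

variable (Θ : FourForm H M)

@[simp] theorem mid_one : mid Θ 1 = Θ := by simp [mid]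

theorem mid_ι_mul (a : H) (m t u v w : TensorAlgebra ℚ H) :
    mid Θ (TensorAlgebra.ι ℚ a * m) t u v w =
      mid Θ m (t * TensorAlgebra.ι ℚ a) u v w - mid Θ m t (TensorAlgebra.ι ℚ a * u) v w := by
  simp only [mid, LinearMap.comp_apply, AlgHom.toLinearMap_apply, LinearMap.applyₗ_apply_apply,
    map_mul, TensorAlgebra.lift_ι_apply, Module.End.mul_apply, pushHair_apply]
  rfl

/-- Invariance under the reflection that exchanges the two ends of the middle edge. -/
def IsReflective₁ (Θ : FourForm H M) : Prop :=
  ∀ t u v w, Θ t u v w = Θ (antipode v) (antipode w) (antipode t) (antipode u)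

/-- Invariance under the reflection that exchanges left and right. -/
def IsReflective₂ (Θ : FourForm H M) : Prop :=
  ∀ t u v w, Θ t u v w = Θ (antipode u) (antipode t) (antipode w) (antipode v)

/-- The handle balance relation. -/
def IsHandleBalanced (Θ : FourForm H M) : Prop :=
  ∀ t u v w a, Θ t u v (w * TensorAlgebra.ι ℚ a) - Θ t u (TensorAlgebra.ι ℚ a * v) w =
    Θ t (TensorAlgebra.ι ℚ a * u) v w - Θ (t * TensorAlgebra.ι ℚ a) u v w

/-- The reflection relations and the handle balance relation for a form in four variables. -/
structure IsBalanced (Θ : FourForm H M) : Prop where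
  reflect₁ : IsReflective₁ Θ
  reflect₂ : IsReflective₂ Θ
  handle : IsHandleBalanced Θ

/-- The three-term relation, stated with the hairs of the new middle edges left in place. -/
def IsThreeTerm (Θ : FourForm H M) : Prop :=
  ∀ t u v w, Θ t u v w + mid Θ (antipode t * antipode v) 1 u 1 w + mid Θ (u * w) t 1 v 1 = 0

variable {Θ}

theorem IsBalanced.mid_mul_ι (h : IsBalanced Θ) (a : H) (m t u v w : TensorAlgebra ℚ H) :
    mid Θ (m * TensorAlgebra.ι ℚ a) t u v w =
      mid Θ m t u (TensorAlgebra.ι ℚ a * v) w - mid Θ m t u v (w * TensorAlgebra.ι ℚ a) := by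
  induction m using tensor_induction_left generalizing t u with
  | one =>
    have h₁ := mid_ι_mul Θ a 1 t u v w
    have h₂ := h.handle t u v w a
    simp only [mul_one, one_mul, mid_one] at h₁ ⊢
    rw [h₁, ← neg_sub, ← h₂, neg_sub]
  | ι_mul b m ih => rw [mul_assoc]; simp only [mid_ι_mul, ih]; abel
  | add x y hx hy => simp only [add_mul, map_add, LinearMap.add_apply, hx, hy]; abel
  | smul c x hx => simp only [smul_mul_assoc, map_smul, LinearMap.smul_apply, hx, smul_sub]

theorem IsBalanced.mid_reflect₁ (h : IsBalanced Θ) (m t u v w : TensorAlgebra ℚ H) :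
    mid Θ m t u v w =
      mid Θ (antipode m) (antipode v) (antipode w) (antipode t) (antipode u) := by
  induction m using tensor_induction_left generalizing t u with
  | one => simpa using h.reflect₁ t u v w
  | ι_mul b m ih =>
    simp only [mid_ι_mul, ih, antipode_mul, antipode_ι, mul_neg, neg_mul, map_neg,
      LinearMap.neg_apply, h.mid_mul_ι]; abel
  | add x y hx hy => simp only [antipode_add, map_add, LinearMap.add_apply, ← hx, ← hy]
  | smul c x hx => simp only [antipode_smul, map_smul, LinearMap.smul_apply, ← hx]

theorem IsBalanced.mid_reflect₂ (h : IsBalanced Θ) (m t u v w : TensorAlgebra ℚ H) :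
    mid Θ m t u v w = mid Θ m (antipode u) (antipode t) (antipode w) (antipode v) := by
  induction m using tensor_induction_left generalizing t u with
  | one => simpa using h.reflect₂ t u v w
  | ι_mul b m ih =>
    rw [mid_ι_mul, mid_ι_mul, ih, ih]
    simp only [antipode_mul, antipode_ι, mul_neg, neg_mul, map_neg, LinearMap.neg_apply]; abel
  | add x y hx hy => simp only [map_add, LinearMap.add_apply, ← hx, ← hy]
  | smul c x hx => simp only [map_smul, LinearMap.smul_apply, ← hx]

/-- Sweedler sums over the hairs of a lower arm: they compute the effect of pushing hairs of the
middle edge down. -/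
theorem lift_coproduct_lower (u v w s t : TensorAlgebra ℚ H) (B : TensorAlgebra ℚ H →ₗ[ℚ]
      TensorAlgebra ℚ H →ₗ[ℚ] M)
    (hB : ∀ p q, B p q = Θ (s * antipode p) (q * u) v w) :
    TensorProduct.lift B (coproduct H t) = mid Θ (antipode t) s u v w := by
  induction t using tensor_induction_right generalizing s u B with
  | one => simp [coproduct, Algebra.TensorProduct.one_def, hB]
  | mul_ι a t ih =>
    have key : TensorProduct.lift B (coproduct H (t * TensorAlgebra.ι ℚ a)) =
        TensorProduct.lift (B ∘ₗ LinearMap.mulRight ℚ (TensorAlgebra.ι ℚ a)) (coproduct H t) +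
        TensorProduct.lift (B.compl₂ (LinearMap.mulRight ℚ (TensorAlgebra.ι ℚ a)))
          (coproduct H t) := by
      rw [map_mul]
      generalize coproduct H t = z
      induction z using TensorProduct.induction_on with
      | zero => simp
      | tmul x y => simp [coproduct, mul_add]
      | add x y hx hy => rw [add_mul, map_add, hx, hy, map_add, map_add]; abel
    have h₁ := ih u (s * TensorAlgebra.ι ℚ a)
      (-(B ∘ₗ LinearMap.mulRight ℚ (TensorAlgebra.ι ℚ a))) (fun p q => by simp [hB, mul_assoc])
    have h₂ := ih (TensorAlgebra.ι ℚ a * u) s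
      (B.compl₂ (LinearMap.mulRight ℚ (TensorAlgebra.ι ℚ a))) (fun p q => by simp [hB, mul_assoc])
    have h₃ : TensorProduct.lift (-(B ∘ₗ LinearMap.mulRight ℚ (TensorAlgebra.ι ℚ a))) =
        -TensorProduct.lift (B ∘ₗ LinearMap.mulRight ℚ (TensorAlgebra.ι ℚ a)) := by
      ext; simp
    rw [h₃, LinearMap.neg_apply, neg_eq_iff_eq_neg] at h₁
    rw [key, h₁, h₂]
    simp only [antipode_mul, antipode_ι, neg_mul, map_neg, LinearMap.neg_apply,
      mid_ι_mul]
    abel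
  | add x y hx hy =>
    simp only [map_add, antipode_add, LinearMap.add_apply, hx u s B hB, hy u s B hB]
  | smul c x hx => simp only [map_smul, antipode_smul, LinearMap.smul_apply, hx u s B hB]

/-- Sweedler sums over the hairs of an upper arm: they compute the effect of pushing hairs of the
middle edge up. -/
theorem IsBalanced.lift_coproduct_upper (h : IsBalanced Θ) (m t u v r w : TensorAlgebra ℚ H)
    (B : TensorAlgebra ℚ H →ₗ[ℚ] TensorAlgebra ℚ H →ₗ[ℚ] M)
    (hB : ∀ p q, B p q = mid Θ m t u (antipode p * r) (w * q)) :
    TensorProduct.lift B (coproduct H v) = mid Θ (m * antipode v) t u r w := by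
  induction v using tensor_induction_left generalizing r w B with
  | one => simp [coproduct, Algebra.TensorProduct.one_def, hB]
  | ι_mul a v ih =>
    have key : TensorProduct.lift B (coproduct H (TensorAlgebra.ι ℚ a * v)) =
        TensorProduct.lift (B ∘ₗ LinearMap.mulLeft ℚ (TensorAlgebra.ι ℚ a)) (coproduct H v) +
        TensorProduct.lift (B.compl₂ (LinearMap.mulLeft ℚ (TensorAlgebra.ι ℚ a)))
          (coproduct H v) := by
      rw [map_mul]
      generalize coproduct H v = z
      induction z using TensorProduct.induction_on with
      | zero => simp
      | tmul x y => simp [coproduct, add_mul]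
      | add x y hx hy => rw [mul_add, map_add, hx, hy, map_add, map_add]; abel
    have h₁ := ih (TensorAlgebra.ι ℚ a * r) w
      (-(B ∘ₗ LinearMap.mulLeft ℚ (TensorAlgebra.ι ℚ a))) (fun p q => by simp [hB, mul_assoc])
    have h₂ := ih r (w * TensorAlgebra.ι ℚ a)
      (B.compl₂ (LinearMap.mulLeft ℚ (TensorAlgebra.ι ℚ a))) (fun p q => by simp [hB, mul_assoc])
    have h₃ : TensorProduct.lift (-(B ∘ₗ LinearMap.mulLeft ℚ (TensorAlgebra.ι ℚ a))) =
        -TensorProduct.lift (B ∘ₗ LinearMap.mulLeft ℚ (TensorAlgebra.ι ℚ a)) := by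
      ext; simp
    rw [h₃, LinearMap.neg_apply, neg_eq_iff_eq_neg] at h₁
    rw [key, h₁, h₂]
    simp only [antipode_mul, antipode_ι, mul_neg, map_neg, LinearMap.neg_apply, ← mul_assoc, h.mid_mul_ι]
    abel
  | add x y hx hy =>
    simp only [map_add, antipode_add, mul_add, LinearMap.add_apply, hx r w B hB, hy r w B hB]
  | smul c x hx =>
    simp only [map_smul, antipode_smul, mul_smul_comm, LinearMap.smul_apply, hx r w B hB]

end Mid

/-! ### The three-term relation and moving hairs across a dotted edge -/

section ThreeTerm

variable {H : Type*} [AddCommGroup H] [Module ℚ H] {M : Type*} [AddCommGroup M] [Module ℚ M]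
  {Θ : FourForm H M}

/-- The effect of moving the hairs `k` across the right dotted edge of a theta graph whose right
arms carry no other hairs; `α`, `β`, `γ` are the hairs on the lower left arm, the middle edge and
the upper left arm. -/
noncomputable def slide (Θ : FourForm H M) (k α β γ : TensorAlgebra ℚ H) : M :=
  mid Θ β α k γ 1 - mid Θ β α 1 γ k

/-- The three-term relation for a theta graph with hairs `m` on the middle edge, pushed to the lower
arms: in the other two graphs these hairs lie on the lower left and the lower right arm,
respectively, next to the middle edge. -/
theorem IsThreeTerm.mid_top (h₃ : IsThreeTerm Θ) (m t u v w : TensorAlgebra ℚ H) :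
    mid Θ m t u v w + mid Θ (antipode t * antipode v) (antipode m) u 1 w +
      mid Θ (u * w) t m v 1 = 0 := by
  induction m using tensor_induction_left generalizing t u with
  | one => simpa using h₃ t u v w
  | ι_mul a m ih =>
    have h₁ := ih (t * TensorAlgebra.ι ℚ a) u
    have h₂ := ih t (TensorAlgebra.ι ℚ a * u)
    simp only [mid_ι_mul, antipode_mul, antipode_ι, mul_neg, neg_mul, map_neg,
      LinearMap.neg_apply, mul_assoc] at h₁ h₂ ⊢
    linear_combination (norm := abel) h₁ - h₂
  | add x y hx hy =>
    have := congr_arg₂ (· + ·) (hx t u) (hy t u)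
    simp only [antipode_add, map_add, LinearMap.add_apply, add_zero] at this ⊢
    rw [← this]; abel
  | smul c x hx =>
    simp only [antipode_smul, map_smul, LinearMap.smul_apply, ← smul_add, hx, smul_zero]

/-- The variant of `mid_top` in which the hairs of the middle edge are pushed to the upper arms. -/
theorem IsThreeTerm.mid_bottom (h₃ : IsThreeTerm Θ) (h : IsBalanced Θ)
    (m t u v w : TensorAlgebra ℚ H) :
    mid Θ m t u v w + mid Θ (antipode t * antipode v) 1 u (antipode m) w +
      mid Θ (u * w) t 1 v m = 0 := by
  induction m using tensor_induction_right generalizing v w with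
  | one => simpa using h₃ t u v w
  | mul_ι a m ih =>
    have h₁ := ih (TensorAlgebra.ι ℚ a * v) w
    have h₂ := ih v (w * TensorAlgebra.ι ℚ a)
    simp only [h.mid_mul_ι, antipode_mul, antipode_ι, mul_neg, neg_mul, map_neg,
      LinearMap.neg_apply, ← mul_assoc] at h₁ h₂ ⊢
    linear_combination (norm := abel) h₁ - h₂
  | add x y hx hy =>
    have := congr_arg₂ (· + ·) (hx v w) (hy v w)
    simp only [antipode_add, map_add, LinearMap.add_apply, add_zero] at this ⊢
    rw [← this]; abel
  | smul c x hx =>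
    simp only [antipode_smul, map_smul, LinearMap.smul_apply, ← smul_add, hx, smul_zero]

/-- Moving hairs across the left dotted edge does not change `slide`: in the difference of the
three-term relations for the two graphs in `slide`, the third terms cancel, and the second ones
depend only on the product `γ * x * α`. -/
theorem IsThreeTerm.slide_mul (h₃ : IsThreeTerm Θ) (k x α β γ : TensorAlgebra ℚ H) :
    slide Θ k (x * α) β γ = slide Θ k α β (γ * x) := by
  have h₁ := h₃.mid_top β (x * α) k γ 1
  have h₂ := h₃.mid_top β (x * α) 1 γ k
  have h₁' := h₃.mid_top β α k (γ * x) 1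
  have h₂' := h₃.mid_top β α 1 (γ * x) k
  simp only [antipode_mul, mul_assoc, mul_one, one_mul] at h₁ h₂ h₁' h₂'
  simp only [slide]
  linear_combination (norm := abel) h₁ - h₂ - h₁' + h₂'

theorem IsBalanced.slide_antipode (h : IsBalanced Θ) {k : TensorAlgebra ℚ H}
    (hk : antipode k = -k) (α β γ : TensorAlgebra ℚ H) :
    slide Θ k (antipode α) (antipode β) (antipode γ) = slide Θ k γ β α := by
  simp only [slide]
  rw [h.mid_reflect₁ _ (antipode α) k, h.mid_reflect₁ _ (antipode α) 1]
  simp only [antipode_antipode, antipode_one, hk, map_neg, LinearMap.neg_apply]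
  abel

/-- Moving the hairs on the left arms past the right dotted edge changes the sign of `slide`.
Together with `slide_mul` this says that `slide` depends only on the cyclic order along the path
that joins the ends of the left dotted edge. -/
theorem IsThreeTerm.slide_add_slide (h₃ : IsThreeTerm Θ) (h : IsBalanced Θ)
    {k : TensorAlgebra ℚ H} (hk : antipode k = -k) (β γ : TensorAlgebra ℚ H) :
    slide Θ k 1 β γ + slide Θ k β γ 1 = 0 := by
  have h₁ := h₃.mid_bottom h β 1 k γ 1
  have h₂ := h₃.mid_bottom h β 1 1 γ k
  rw [h.mid_reflect₁ (antipode 1 * antipode γ)] at h₁ h₂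
  simp only [antipode_antipode, antipode_one, mul_one, one_mul, hk, map_neg,
    LinearMap.neg_apply] at h₁ h₂
  simp only [slide]
  linear_combination (norm := abel) h₁ - h₂

/-- For a theta graph without hairs on its right arms, the first and the third term of the relation
are equal, and the second depends only on the product of the hairs on the left arms. -/
theorem IsThreeTerm.loop_mul (h₃ : IsThreeTerm Θ) (x t v : TensorAlgebra ℚ H) :
    Θ (x * t) 1 v 1 = Θ t 1 (v * x) 1 := by
  have h₁ := h₃ (x * t) 1 v 1
  have h₂ := h₃ t 1 (v * x) 1
  simp only [antipode_mul, mul_assoc, mul_one, mid_one] at h₁ h₂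
  have h₄ : (2 : ℚ) • (Θ (x * t) 1 v 1 - Θ t 1 (v * x) 1) = 0 := by
    rw [two_smul]; linear_combination (norm := abel) h₁ - h₂
  exact sub_eq_zero.1 ((smul_eq_zero_iff_right two_ne_zero).1 h₄)

theorem IsThreeTerm.apply_one (h₃ : IsThreeTerm Θ) : Θ 1 1 1 1 = 0 := by
  have h₁ := h₃ 1 1 1 1
  simp only [antipode_one, mul_one, mid_one] at h₁
  have h₄ : (3 : ℚ) • Θ 1 1 1 1 = 0 := by
    rw [← h₁, show (3 : ℚ) = 1 + 1 + 1 by norm_num, add_smul, add_smul, one_smul]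
  exact (smul_eq_zero_iff_right three_ne_zero).1 h₄

/-- The three-term relation without hairs on the upper arms: it is the sum over the three ways of
gluing a path tree to a tripod that has the other ends of its three dotted edges. -/
theorem IsThreeTerm.tripod (h₃ : IsThreeTerm Θ) (h : IsBalanced Θ) (α γ : TensorAlgebra ℚ H) :
    Θ α γ 1 1 + mid Θ (antipode α) 1 γ 1 1 + mid Θ γ 1 (antipode α) 1 1 = 0 := by
  have h₁ := h₃ α γ 1 1
  rwa [h.mid_reflect₂ (γ * 1), antipode_one, mul_one, mul_one] at h₁

/-- The three-term relation holds as soon as it holds without hairs on the upper arms and moving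
a single hair across the right dotted edge has the symmetries `slide_mul` and `slide_add_slide`.
-/
theorem IsBalanced.isThreeTerm (h : IsBalanced Θ)
    (tripod : ∀ α γ, Θ α γ 1 1 + mid Θ (antipode α) 1 γ 1 1 + mid Θ γ 1 (antipode α) 1 1 = 0)
    (slide_mul : ∀ (k x : H) α β γ, slide Θ (TensorAlgebra.ι ℚ k) (TensorAlgebra.ι ℚ x * α) β γ =
      slide Θ (TensorAlgebra.ι ℚ k) α β (γ * TensorAlgebra.ι ℚ x))
    (slide_add : ∀ (k : H) β γ, slide Θ (TensorAlgebra.ι ℚ k) 1 β γ +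
      slide Θ (TensorAlgebra.ι ℚ k) β γ 1 = 0) : IsThreeTerm Θ := by
  have mul (k : H) (x α β γ : TensorAlgebra ℚ H) : slide Θ (TensorAlgebra.ι ℚ k) (x * α) β γ =
      slide Θ (TensorAlgebra.ι ℚ k) α β (γ * x) := by
    induction x using tensor_induction_left generalizing γ with
    | one => simp
    | ι_mul a x ih => rw [mul_assoc, slide_mul, ih, mul_assoc]
    | add x y hx hy =>
      have h₁ := hx γ
      have h₂ := hy γ
      simp only [slide, add_mul, mul_add, map_add, LinearMap.add_apply] at h₁ h₂ ⊢
      linear_combination (norm := abel) h₁ + h₂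
    | smul c x hx =>
      have h₁ := hx γ
      simp only [slide, smul_mul_assoc, mul_smul_comm, map_smul, LinearMap.smul_apply,
        ← smul_sub] at h₁ ⊢
      rw [h₁]
  -- Moving a hair across the right dotted edge changes the first two terms of the relation in
  -- opposite ways.  The words `m₁`, `m₂` are the hairs below and above the point at which the
  -- middle edge is cut in the second term.
  have move (k : H) (t m₁ m₂ u v w : TensorAlgebra ℚ H) :
      (mid Θ (m₁ * m₂) t (u * TensorAlgebra.ι ℚ k) v w -
        mid Θ (m₁ * m₂) t u v (TensorAlgebra.ι ℚ k * w)) +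
      (mid Θ (antipode t * antipode v) (antipode m₁) (u * TensorAlgebra.ι ℚ k) (antipode m₂) w -
        mid Θ (antipode t * antipode v) (antipode m₁) u (antipode m₂) (TensorAlgebra.ι ℚ k * w)) =
      0 := by
    induction u using tensor_induction_left generalizing t m₁ with
    | one =>
      induction w using tensor_induction_right generalizing v m₂ with
      | one =>
        have h₁ := h.slide_antipode (antipode_ι k) m₁ (v * t) m₂
        have h₂ := mul k v t (m₁ * m₂) 1
        have h₃ := mul k m₁ m₂ (v * t) 1
        have h₄ := mul k (v * t) 1 (m₁ * m₂) 1
        have h₅ := slide_add k (m₁ * m₂) (v * t)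
        simp only [slide, mul_one, one_mul, antipode_mul] at h₁ h₂ h₃ h₄ h₅ ⊢
        linear_combination (norm := abel) h₁ - h₂ - h₃ + h₄ + h₅
      | mul_ι a w ih =>
        have h₁ := ih m₂ (TensorAlgebra.ι ℚ a * v)
        have h₂ := ih (m₂ * TensorAlgebra.ι ℚ a) v
        simp only [← mul_assoc, h.mid_mul_ι, antipode_mul, antipode_ι, mul_neg, neg_mul, map_neg,
          LinearMap.neg_apply] at h₁ h₂ ⊢
        linear_combination (norm := abel) h₁ - h₂
      | add x y hx hy =>
        have h₁ := hx m₂ v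
        have h₂ := hy m₂ v
        simp only [mul_add, map_add] at h₁ h₂ ⊢
        linear_combination (norm := abel) h₁ + h₂
      | smul c x hx =>
        simp only [mul_smul_comm, map_smul, ← smul_sub, ← smul_add, hx, smul_zero]
    | ι_mul a u ih =>
      have h₁ := ih (t * TensorAlgebra.ι ℚ a) m₁
      have h₂ := ih t (TensorAlgebra.ι ℚ a * m₁)
      simp only [mul_assoc, mid_ι_mul, antipode_mul, antipode_ι, mul_neg, neg_mul, map_neg,
        LinearMap.neg_apply] at h₁ h₂ ⊢
      linear_combination (norm := abel) h₁ - h₂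
    | add x y hx hy =>
      have h₁ := hx t m₁
      have h₂ := hy t m₁
      simp only [add_mul, map_add, LinearMap.add_apply] at h₁ h₂ ⊢
      linear_combination (norm := abel) h₁ + h₂
    | smul c x hx =>
      simp only [smul_mul_assoc, map_smul, LinearMap.smul_apply, ← smul_sub, ← smul_add, hx,
        smul_zero]
  -- Hence all hairs of the upper right arm can be moved to the lower right arm.
  have right (t u v w : TensorAlgebra ℚ H) :
      Θ t u v w + mid Θ (antipode t * antipode v) 1 u 1 w + mid Θ (u * w) t 1 v 1 =
      Θ t (u * w) v 1 + mid Θ (antipode t * antipode v) 1 (u * w) 1 1 +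
        mid Θ (u * w) t 1 v 1 := by
    induction w using tensor_induction_left generalizing u with
    | one => simp
    | ι_mul a w ih =>
      have h₁ := ih (u * TensorAlgebra.ι ℚ a)
      have h₂ := move a t 1 1 u v w
      simp only [mul_one, mid_one, antipode_one, ← mul_assoc] at h₁ h₂ ⊢
      linear_combination (norm := abel) h₁ - h₂
    | add x y hx hy =>
      have h₁ := hx u
      have h₂ := hy u
      simp only [mul_add, map_add, LinearMap.add_apply] at h₁ h₂ ⊢
      linear_combination (norm := abel) h₁ + h₂
    | smul c x hx =>
      simp only [mul_smul_comm, map_smul, LinearMap.smul_apply, ← smul_add, hx]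
  intro t u v w
  rw [right t u v w]
  have h₁ := right (antipode (u * w)) (antipode t) 1 (antipode v)
  have h₂ := tripod (antipode (u * w)) (antipode t * antipode v)
  rw [h.reflect₂, h.mid_reflect₂ _ 1, h.mid_reflect₂ _ t]
  rw [h.mid_reflect₂ (antipode t * antipode v) 1, antipode_one] at h₂
  simp only [antipode_one, mul_one, antipode_antipode] at h₁ h₂ ⊢
  linear_combination (norm := abel) h₁ + h₂

end ThreeTerm

/-! ### Local functions of trees and their values on path trees -/

section Combs

variable {H : Type*}

/-- `R₁ * (R₂ * ⋯ * (Rₘ * Y))` for a list `[R₁, …, Rₘ]` of rooted trees. -/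
def comb (Rs : List (RTree H)) (Y : RTree H) : RTree H := Rs.foldr .node Y

/-- `((Z * R₁) * R₂) * ⋯ * Rₘ` for a list `[R₁, …, Rₘ]` of rooted trees. -/
def lcomb (Z : RTree H) (Rs : List (RTree H)) : RTree H := Rs.foldl .node Z

/-- The leaves with the given colors. -/
def hairs (t : List H) : List (RTree H) := t.map fun h => .leaf (.hair h)

theorem hairs_append (t u : List H) : hairs (t ++ u) = hairs t ++ hairs u := List.map_append

/-- The number of univalent vertices labeled by the end `s` of `e` in a list of rooted trees. -/
def listEnds (e : ℕ) (s : Bool) (Rs : List (RTree H)) : ℕ := (Rs.map (RTree.ends e s)).sum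

@[simp] theorem listEnds_nil (e : ℕ) (s : Bool) : listEnds e s ([] : List (RTree H)) = 0 := rfl

@[simp] theorem listEnds_cons (e : ℕ) (s : Bool) (R : RTree H) (Rs : List (RTree H)) :
    listEnds e s (R :: Rs) = R.ends e s + listEnds e s Rs := by simp [listEnds]

@[simp] theorem listEnds_append (e : ℕ) (s : Bool) (Rs Ss : List (RTree H)) :
    listEnds e s (Rs ++ Ss) = listEnds e s Rs + listEnds e s Ss := by simp [listEnds]

@[simp] theorem listEnds_hairs (e : ℕ) (s : Bool) (t : List H) : listEnds e s (hairs t) = 0 := by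
  induction t with
  | nil => rfl
  | cons a t ih => simp_all [hairs, RTree.ends, Label.isEnd]

theorem ends_comb (e : ℕ) (s : Bool) (Rs : List (RTree H)) (Y : RTree H) :
    (comb Rs Y).ends e s = listEnds e s Rs + Y.ends e s := by
  induction Rs with
  | nil => simp [comb]
  | cons R Rs ih => simp only [comb, List.foldr_cons] at ih ⊢; simp [RTree.ends, ih, add_assoc]

/-- The value of `f` on the path tree: a path from the root of `Z` to the root of `Y` along which
the rooted trees of the list are attached, all on the same side.  The value is `0` for the empty
list, for which there is no trivalent vertex on the path. -/
def pathVal {M : Type*} [Zero M] (f : Tree H → M) (Z : RTree H) : List (RTree H) → RTree H → M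
  | [], _ => 0
  | R :: Rs, Y => f ⟨Z, R, comb Rs Y⟩

theorem pathVal_append_right {M : Type*} [Zero M] {f : Tree H → M} (Z : RTree H)
    {Ls : List (RTree H)} (hLs : Ls ≠ []) (Rs : List (RTree H)) (Y : RTree H) :
    pathVal f Z (Ls ++ Rs) Y = pathVal f Z Ls (comb Rs Y) := by
  cases Ls with
  | nil => exact absurd rfl hLs
  | cons L Ls => simp [pathVal, comb]

/-- A function of lists of rooted trees that satisfies the IHX relation vanishes as soon as it
vanishes on lists of leaves.  The predicate `P` restricts the labels that occur. -/
theorem list_eq_zero_of_leaves {M : Type*} [AddCommGroup M]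
    {g : List (RTree H) → M} {P : List (RTree H) → Prop}
    (hP : ∀ Ls A B Rs, P (Ls ++ .node A B :: Rs) → P (Ls ++ A :: B :: Rs) ∧
      P (Ls ++ B :: A :: Rs))
    (ihx : ∀ Ls A B Rs, P (Ls ++ .node A B :: Rs) → g (Ls ++ .node A B :: Rs) =
      g (Ls ++ A :: B :: Rs) - g (Ls ++ B :: A :: Rs))
    (leaves : ∀ w : List (Label H), P (w.map .leaf) → g (w.map .leaf) = 0)
    (Rs : List (RTree H)) (hRs : P Rs) : g Rs = 0 := by
  generalize hn : (Rs.map RTree.vertices).sum = n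
  induction n using Nat.strong_induction_on generalizing Rs with
  | _ n ih =>
    by_cases h : ∃ A B, RTree.node A B ∈ Rs
    · obtain ⟨A, B, hAB⟩ := h
      obtain ⟨L₁, L₂, rfl⟩ := List.append_of_mem hAB
      have hlt : ((L₁ ++ A :: B :: L₂).map RTree.vertices).sum < n := by
        simp [RTree.vertices] at hn ⊢; omega
      have hlt' : ((L₁ ++ B :: A :: L₂).map RTree.vertices).sum < n := by
        simp [RTree.vertices] at hn ⊢; omega
      rw [ihx _ _ _ _ hRs, ih _ hlt _ (hP _ _ _ _ hRs).1 rfl, ih _ hlt' _ (hP _ _ _ _ hRs).2 rfl,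
        sub_zero]
    · have : ∃ w : List (Label H), w.map RTree.leaf = Rs := by
        refine ⟨Rs.map fun R => match R with | .leaf l => l | .node _ _ => .dotted 0 true, ?_⟩
        rw [List.map_map]
        conv_rhs => rw [← List.map_id Rs]
        refine List.map_congr_left fun R hR => ?_
        cases R with
        | leaf l => rfl
        | node A B => exact absurd ⟨A, B, hR⟩ h
      obtain ⟨w, rfl⟩ := this
      exact leaves w hRs

end Combs

section Local

variable {H : Type*} [AddCommGroup H] [Module ℚ H] {M : Type*} [AddCommGroup M] [Module ℚ M]

/-- A function of trees is local if it is invariant under change of the base vertex, satisfies the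
AS and IHX relations, and is linear in the colors. -/
structure IsLocal (f : Tree H → M) : Prop where
  rotate : ∀ A B C, f ⟨A, B, C⟩ = f ⟨B, C, A⟩
  rebase : ∀ A B C D, f ⟨A, B, .node C D⟩ = f ⟨.node A B, C, D⟩
  ihx : ∀ A B C D, f ⟨A, B, .node C D⟩ - f ⟨.node D A, B, C⟩ + f ⟨.node D B, A, C⟩ = 0
  as : ∀ A B C, f ⟨A, B, C⟩ + f ⟨B, A, C⟩ = 0
  add : ∀ a b B C, f ⟨.leaf (.hair (a + b)), B, C⟩ =
    f ⟨.leaf (.hair a), B, C⟩ + f ⟨.leaf (.hair b), B, C⟩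
  smul : ∀ (c : ℚ) a B C, f ⟨.leaf (.hair (c • a)), B, C⟩ = c • f ⟨.leaf (.hair a), B, C⟩

variable {f : Tree H → M}

theorem IsLocal.pathVal_cons (hf : IsLocal f) (Z R : RTree H) {Rs : List (RTree H)}
    (hRs : Rs ≠ []) (Y : RTree H) : pathVal f Z (R :: Rs) Y = pathVal f (.node Z R) Rs Y := by
  cases Rs with
  | nil => exact absurd rfl hRs
  | cons S Rs => exact hf.rebase _ _ _ _

theorem IsLocal.pathVal_append (hf : IsLocal f) (Z : RTree H) (Ls : List (RTree H))
    {Rs : List (RTree H)} (hRs : Rs ≠ []) (Y : RTree H) :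
    pathVal f Z (Ls ++ Rs) Y = pathVal f (lcomb Z Ls) Rs Y := by
  induction Ls generalizing Z with
  | nil => rfl
  | cons L Ls ih =>
    rw [List.cons_append, hf.pathVal_cons _ _ (by simp [hRs]), ih]
    rfl

theorem IsLocal.swap₁₂ (hf : IsLocal f) (A B C : RTree H) : f ⟨A, B, C⟩ = -f ⟨B, A, C⟩ :=
  eq_neg_of_add_eq_zero_left (hf.as A B C)

theorem IsLocal.swap₂₃ (hf : IsLocal f) (A B C : RTree H) : f ⟨A, B, C⟩ = -f ⟨A, C, B⟩ := by
  rw [hf.rotate, hf.swap₁₂, hf.rotate, hf.rotate]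

theorem IsLocal.swap₁₃ (hf : IsLocal f) (A B C : RTree H) : f ⟨A, B, C⟩ = -f ⟨C, B, A⟩ := by
  rw [hf.swap₁₂, hf.rotate, hf.rotate]

theorem IsLocal.swap_trd (hf : IsLocal f) (A B C D : RTree H) :
    f ⟨A, B, .node C D⟩ = -f ⟨A, B, .node D C⟩ := by
  rw [hf.rebase, hf.rebase, hf.swap₂₃]

/-- The IHX relation moves a branch of a path tree that is a node to two consecutive branches. -/
theorem IsLocal.pathVal_ihx (hf : IsLocal f) (Z : RTree H) (Ls : List (RTree H)) (A B : RTree H)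
    (Rs : List (RTree H)) (Y : RTree H) : pathVal f Z (Ls ++ .node A B :: Rs) Y =
      pathVal f Z (Ls ++ A :: B :: Rs) Y - pathVal f Z (Ls ++ B :: A :: Rs) Y := by
  rw [hf.pathVal_append _ _ (by simp), hf.pathVal_append _ _ (by simp),
    hf.pathVal_append _ _ (by simp)]
  generalize lcomb Z Ls = Z
  simp only [pathVal, comb, List.foldr_cons]
  generalize Rs.foldr RTree.node Y = C
  have h₁ := hf.ihx C Z A B
  rw [hf.rotate C Z, hf.rotate (.node B C), ← hf.rebase B Z C A, hf.rotate B Z,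
    hf.swap₂₃ Z (.node C A), hf.swap_trd Z B C A, neg_neg] at h₁
  rw [← sub_eq_zero, ← h₁]
  abel

theorem IsLocal.pathVal_neg_right (hf : IsLocal f) (Z : RTree H) {Ls : List (RTree H)}
    (hLs : Ls ≠ []) (A B : RTree H) :
    pathVal f Z Ls (.node A B) = -pathVal f Z Ls (.node B A) := by
  obtain ⟨Ls, L, rfl⟩ := List.eq_nil_or_concat'  Ls |>.resolve_left hLs
  rw [hf.pathVal_append _ _ (by simp), hf.pathVal_append _ _ (by simp)]
  exact hf.swap_trd _ _ _ _

/-- Turning a path tree upside down reverses the order of the branches and moves each of them to the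
other side of the path, which costs a sign for each branch. -/
theorem IsLocal.pathVal_reverse (hf : IsLocal f) (Z : RTree H) (Rs : List (RTree H))
    (Y : RTree H) : pathVal f Z Rs Y = (-1 : ℚ) ^ Rs.length • pathVal f Y Rs.reverse Z := by
  induction Rs generalizing Z with
  | nil => simp [pathVal]
  | cons R Rs ih =>
    rcases eq_or_ne Rs [] with rfl | hRs
    · simp [pathVal, comb, hf.swap₁₃ Z R Y]
    · have hr : Rs.reverse ≠ [] := by simpa using hRs
      rw [hf.pathVal_cons _ _ hRs, ih, hf.pathVal_neg_right _ hr, List.reverse_cons,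
        pathVal_append_right _ hr, List.length_cons, pow_succ]
      simp [comb]

theorem IsLocal.pathVal_add (hf : IsLocal f) (Z : RTree H) (Ls : List (RTree H)) (a b : H)
    (Rs : List (RTree H)) (Y : RTree H) : pathVal f Z (Ls ++ .leaf (.hair (a + b)) :: Rs) Y =
      pathVal f Z (Ls ++ .leaf (.hair a) :: Rs) Y +
        pathVal f Z (Ls ++ .leaf (.hair b) :: Rs) Y := by
  simp only [hf.pathVal_append _ Ls (List.cons_ne_nil _ _)]
  generalize lcomb Z Ls = Z
  simp only [pathVal, hf.rotate Z, hf.add]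

theorem IsLocal.pathVal_smul (hf : IsLocal f) (Z : RTree H) (Ls : List (RTree H)) (c : ℚ) (a : H)
    (Rs : List (RTree H)) (Y : RTree H) : pathVal f Z (Ls ++ .leaf (.hair (c • a)) :: Rs) Y =
      c • pathVal f Z (Ls ++ .leaf (.hair a) :: Rs) Y := by
  simp only [hf.pathVal_append _ Ls (List.cons_ne_nil _ _)]
  generalize lcomb Z Ls = Z
  simp only [pathVal, hf.rotate Z, hf.smul]

/-- Any tree can be presented as a tree rooted at a given univalent vertex. -/
theorem exists_root (M : Type*) [AddCommGroup M] [Module ℚ M] (e : ℕ) (s : Bool) (T : Tree H)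
    (hT : T.ends e s ≠ 0) : ∃ A B : RTree H,
      (∀ a b, T.ends a b = Tree.ends a b ⟨.leaf (.dotted e s), A, B⟩) ∧
      ∀ f : Tree H → M, IsLocal f → f T = f ⟨.leaf (.dotted e s), A, B⟩ := by
  have key (A : RTree H) (hA : A.ends e s ≠ 0) : ∀ B C : RTree H, ∃ A' B' : RTree H,
      (∀ a b, Tree.ends a b ⟨A, B, C⟩ = Tree.ends a b ⟨.leaf (.dotted e s), A', B'⟩) ∧
      ∀ f : Tree H → M, IsLocal f → f ⟨A, B, C⟩ = f ⟨.leaf (.dotted e s), A', B'⟩ := by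
    induction A with
    | leaf l =>
      intro B C
      cases l with
      | hair h => simp [RTree.ends, Label.isEnd] at hA
      | dotted e' s' =>
        simp only [RTree.ends, Label.isEnd, ne_eq, ite_eq_right_iff, one_ne_zero, imp_false,
          not_not] at hA
        obtain ⟨rfl, rfl⟩ := hA
        exact ⟨B, C, fun _ _ => rfl, fun _ _ => rfl⟩
    | node A₁ A₂ ih₁ ih₂ =>
      intro B C
      by_cases h : A₁.ends e s = 0
      · have h₂ : A₂.ends e s ≠ 0 := by simpa [RTree.ends, h] using hA
        obtain ⟨A', B', hc, hf⟩ := ih₂ h₂ (.node B C) A₁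
        refine ⟨A', B', fun a b => ?_, fun f hl => ?_⟩
        · rw [← hc]; simp [Tree.ends, RTree.ends]; omega
        · rw [← hf f hl, ← hl.rebase, hl.rotate]
      · obtain ⟨A', B', hc, hf⟩ := ih₁ h A₂ (.node B C)
        refine ⟨A', B', fun a b => ?_, fun f hl => ?_⟩
        · rw [← hc]; simp [Tree.ends, RTree.ends]; omega
        · rw [← hf f hl, ← hl.rebase]
  obtain ⟨A, B, C⟩ := T
  by_cases hA : A.ends e s = 0
  · by_cases hB : B.ends e s = 0
    · have hC : C.ends e s ≠ 0 := by simpa [Tree.ends, hA, hB] using hT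
      obtain ⟨A', B', hc, hf⟩ := key C hC A B
      refine ⟨A', B', fun a b => ?_, fun f hl => ?_⟩
      · rw [← hc]; simp [Tree.ends]; omega
      · rw [← hf f hl, hl.rotate C]
    · obtain ⟨A', B', hc, hf⟩ := key B hB C A
      refine ⟨A', B', fun a b => ?_, fun f hl => ?_⟩
      · rw [← hc]; simp [Tree.ends]; omega
      · rw [← hf f hl, hl.rotate A]
  · exact key A hA B C

/-- Any tree with two given univalent vertices can be presented, up to sign, as a path tree for
the path that joins them. -/
theorem exists_path (M : Type*) [AddCommGroup M] [Module ℚ M] {e e' : ℕ} {s s' : Bool}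
    (hne : ¬ (e = e' ∧ s = s')) (T : Tree H) (hT : T.ends e s ≠ 0) (hT' : T.ends e' s' ≠ 0) :
    ∃ Rs : List (RTree H), Rs ≠ [] ∧
      (∀ a b, T.ends a b = (Label.dotted e s : Label H).isEnd a b + listEnds a b Rs +
        (Label.dotted e' s' : Label H).isEnd a b) ∧
      ∀ f : Tree H → M, IsLocal f →
        pathVal f (.leaf (.dotted e s)) Rs (.leaf (.dotted e' s')) = 0 → f T = 0 := by
  have key (R : RTree H) (hR : R.ends e' s' ≠ 0) : ∃ Rs : List (RTree H),
      (∀ a b, R.ends a b = listEnds a b Rs + (Label.dotted e' s' : Label H).isEnd a b) ∧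
      ∀ f : Tree H → M, IsLocal f → ∀ Z Ls, Ls ≠ [] →
        pathVal f Z (Ls ++ Rs) (.leaf (.dotted e' s')) = 0 → pathVal f Z Ls R = 0 := by
    induction R with
    | leaf l =>
      cases l with
      | hair h => simp [RTree.ends, Label.isEnd] at hR
      | dotted e₁ s₁ =>
        simp only [RTree.ends, Label.isEnd, ne_eq, ite_eq_right_iff, one_ne_zero, imp_false,
          not_not] at hR
        obtain ⟨rfl, rfl⟩ := hR
        exact ⟨[], by simp [RTree.ends], fun f hf Z Ls _ h => by simpa using h⟩
    | node A B ihA ihB =>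
      by_cases hB : B.ends e' s' = 0
      · have hA : A.ends e' s' ≠ 0 := by simpa [RTree.ends, hB] using hR
        obtain ⟨Rs, hc, h⟩ := ihA hA
        refine ⟨B :: Rs, fun a b => by simp [RTree.ends, hc]; omega, fun f hf Z Ls hLs h₀ => ?_⟩
        rw [hf.pathVal_neg_right _ hLs, neg_eq_zero]
        have := h f hf Z (Ls ++ [B]) (by simp) (by simpa using h₀)
        rwa [pathVal_append_right _ hLs] at this
      · obtain ⟨Rs, hc, h⟩ := ihB hB
        refine ⟨A :: Rs, fun a b => by simp [RTree.ends, hc]; omega, fun f hf Z Ls hLs h₀ => ?_⟩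
        have := h f hf Z (Ls ++ [A]) (by simp) (by simpa using h₀)
        rwa [pathVal_append_right _ hLs] at this
  obtain ⟨A, B, hc, hf⟩ := exists_root M e s T hT
  have hAB : A.ends e' s' + B.ends e' s' ≠ 0 := by
    have : (Label.dotted e s : Label H).isEnd e' s' = 0 := by simpa [Label.isEnd] using hne
    rw [hc] at hT'
    simpa [Tree.ends, RTree.ends, this] using hT'
  by_cases hB : B.ends e' s' = 0
  · obtain ⟨Rs, hc', h⟩ := key A (by simpa [hB] using hAB)
    refine ⟨B :: Rs, by simp, fun a b => by rw [hc]; simp [Tree.ends, RTree.ends, hc']; omega,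
      fun f hl h₀ => ?_⟩
    rw [hf f hl, hl.swap₂₃, neg_eq_zero]
    exact h f hl _ [B] (by simp) (by simpa using h₀)
  · obtain ⟨Rs, hc', h⟩ := key B hB
    refine ⟨A :: Rs, by simp, fun a b => by rw [hc]; simp [Tree.ends, RTree.ends, hc']; omega,
      fun f hl h₀ => ?_⟩
    rw [hf f hl]
    exact h f hl _ [A] (by simp) (by simpa using h₀)

end Local

/-! ### Evaluation of trees in an associative algebra -/

section Evaluation

variable {H : Type*} [AddCommGroup H] [Module ℚ H] {M : Type*} [AddCommGroup M] [Module ℚ M]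
  {𝔤 : Type*} [Ring 𝔤] [Algebra ℚ 𝔤]

/-- The value of a rooted tree, with given values of the labels, when trivalent vertices are
evaluated as commutators. -/
def ringVal (val : Label H → 𝔤) : RTree H → 𝔤
  | .leaf l => val l
  | .node A B => ringVal val A * ringVal val B - ringVal val B * ringVal val A

/-- The coadjoint companion of `ringVal`: here one of the univalent vertices is evaluated by a
linear form, and the tree is reinterpreted with this univalent vertex as its root. -/
noncomputable def coVal (val : Label H → 𝔤) (coval : Label H → 𝔤 →ₗ[ℚ] M) :
    RTree H → 𝔤 →ₗ[ℚ] M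
  | .leaf l => coval l
  | .node A B =>
    coVal val coval A ∘ₗ (LinearMap.mulLeft ℚ (ringVal val B) -
      LinearMap.mulRight ℚ (ringVal val B)) -
    coVal val coval B ∘ₗ (LinearMap.mulLeft ℚ (ringVal val A) -
      LinearMap.mulRight ℚ (ringVal val A))

theorem coVal_node (val : Label H → 𝔤) (coval : Label H → 𝔤 →ₗ[ℚ] M) (A B : RTree H) (x : 𝔤) :
    coVal val coval (.node A B) x =
      coVal val coval A (ringVal val B * x - x * ringVal val B) -
      coVal val coval B (ringVal val A * x - x * ringVal val A) := rfl

/-- The value of a tree: the sum over the univalent vertices of the value of the linear form at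
this vertex on the tree rooted there. -/
noncomputable def treeVal (val : Label H → 𝔤) (coval : Label H → 𝔤 →ₗ[ℚ] M) (T : Tree H) : M :=
  coVal val coval T.fst (ringVal val T.snd * ringVal val T.trd -
    ringVal val T.trd * ringVal val T.snd) +
  coVal val coval T.snd (ringVal val T.trd * ringVal val T.fst -
    ringVal val T.fst * ringVal val T.trd) +
  coVal val coval T.trd (ringVal val T.fst * ringVal val T.snd -
    ringVal val T.snd * ringVal val T.fst)

/-- The AS and IHX relations hold because nodes are evaluated as commutators; the condition on
`coval` makes the value multilinear in the colors, each of which then enters through exactly one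
`val`. -/
theorem isLocal_treeVal {val : Label H → 𝔤} {coval : Label H → 𝔤 →ₗ[ℚ] M}
    (add : ∀ a b, val (.hair (a + b)) = val (.hair a) + val (.hair b))
    (smul : ∀ (c : ℚ) a, val (.hair (c • a)) = c • val (.hair a))
    (hair : ∀ a, coval (.hair a) = 0) : IsLocal (treeVal val coval) where
  rotate A B C := by simp only [treeVal]; abel
  rebase A B C D := by
    simp only [treeVal, coVal_node, ringVal, mul_sub, sub_mul, map_sub, mul_assoc]; abel
  ihx A B C D := by
    simp only [treeVal, coVal_node, ringVal, mul_sub, sub_mul, map_sub, mul_assoc]; abel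
  as A B C := by simp only [treeVal, map_sub]; abel
  add a b B C := by
    simp only [treeVal, coVal, ringVal, add, hair, mul_add, add_mul, map_sub, map_add,
      LinearMap.zero_apply]; abel
  smul c a B C := by
    simp only [treeVal, coVal, ringVal, smul, hair, mul_smul_comm, smul_mul_assoc, map_sub,
      map_smul, LinearMap.zero_apply, smul_add, smul_sub, smul_zero]

theorem coVal_eq_zero {val : Label H → 𝔤} {coval : Label H → 𝔤 →ₗ[ℚ] M} {e : ℕ} {s : Bool}
    (h : ∀ l : Label H, l.isEnd e s = 0 → coval l = 0) {R : RTree H} (hR : R.ends e s = 0) :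
    coVal val coval R = 0 := by
  induction R with
  | leaf l => exact h l hR
  | node A B hA hB =>
    simp only [RTree.ends, Nat.add_eq_zero_iff] at hR
    simp [coVal, hA hR.1, hB hR.2]

end Evaluation

/-! ### The function of trees that reads off the colors along the path between two ends -/

section Reading

variable {H : Type*} [AddCommGroup H] [Module ℚ H] {M : Type*} [AddCommGroup M] [Module ℚ M]

/-- Trilinear forms, with the last variable first. -/
abbrev ThreeForm (H M : Type*) [AddCommGroup H] [Module ℚ H] [AddCommGroup M] [Module ℚ M] :
    Type _ :=
  TensorAlgebra ℚ H →ₗ[ℚ] TensorAlgebra ℚ H →ₗ[ℚ] TensorAlgebra ℚ H →ₗ[ℚ] M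

/-- The states of a machine that reads a word `α x β y γ` from right to left, where `x` and `y`
are separators.  A state consists of the dependence of the result on what is still to be read,
before any separator, before `y` or `x` respectively, and before both, and of a scalar, which is
nonzero only before the first step. -/
abbrev Reader (H M : Type*) [AddCommGroup H] [Module ℚ H] [AddCommGroup M] [Module ℚ M] :
    Type _ :=
  (TensorAlgebra ℚ H →ₗ[ℚ] M) × (TensorAlgebra ℚ H →ₗ[ℚ] TensorAlgebra ℚ H →ₗ[ℚ] M) ×
    (TensorAlgebra ℚ H →ₗ[ℚ] TensorAlgebra ℚ H →ₗ[ℚ] M) × ThreeForm H M × ℚ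

/-- Reading a color. -/
noncomputable def readHair (a : H) : Module.End ℚ (Reader H M) where
  toFun F := (F.1 ∘ₗ LinearMap.mulRight ℚ (TensorAlgebra.ι ℚ a),
    F.2.1 ∘ₗ LinearMap.mulRight ℚ (TensorAlgebra.ι ℚ a),
    F.2.2.1 ∘ₗ LinearMap.mulRight ℚ (TensorAlgebra.ι ℚ a),
    F.2.2.2.1 ∘ₗ LinearMap.mulRight ℚ (TensorAlgebra.ι ℚ a), 0)
  map_add' F G := by simp [LinearMap.add_comp]
  map_smul' c F := by simp [LinearMap.smul_comp]

/-- Reading the separator `x`. -/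
noncomputable def readX : Module.End ℚ (Reader H M) where
  toFun F := (F.2.1 1, 0, -F.2.2.2.1 1, 0, 0)
  map_add' F G := by simp; abel
  map_smul' c F := by simp

/-- Reading the separator `y`. -/
noncomputable def readY : Module.End ℚ (Reader H M) where
  toFun F := (F.2.2.1 1, F.2.2.2.1 1, 0, 0, 0)
  map_add' F G := by simp
  map_smul' c F := by simp

/-- Starting to read. -/
noncomputable def readStart (ψ : ThreeForm H M) : Module.End ℚ (Reader H M) where
  toFun F := (0, 0, 0, F.2.2.2.2 • ψ, 0)
  map_add' F G := by simp [add_smul]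
  map_smul' c F := by simp [mul_smul]

/-- The result of a reading. -/
noncomputable def readResult (H M : Type*) [AddCommGroup H] [Module ℚ H] [AddCommGroup M]
    [Module ℚ M] : Module.End ℚ (Reader H M) →ₗ[ℚ] M where
  toFun g := (g (0, 0, 0, 0, 1)).1 1
  map_add' F G := by simp
  map_smul' c F := by simp

/-- The action of a label on the reader, for the path from the end `s` of `e` to the other end,
with the ends `s'` and `!s'` of `e'` as the separators `x` and `y`. -/
noncomputable def readLabel (ψ : ThreeForm H M) (e : ℕ) (s : Bool) (e' : ℕ) (s' : Bool) :
    Label H → Module.End ℚ (Reader H M)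
  | .hair a => readHair a
  | .dotted d b =>
    if d = e then (if b = s then 0 else readStart ψ)
    else if d = e' then (if b = s' then readX else readY)
    else 0

/-- The linear form at a label: only the end `s` of `e` contributes. -/
noncomputable def readRoot (H M : Type*) [AddCommGroup H] [Module ℚ H] [AddCommGroup M]
    [Module ℚ M] (e : ℕ) (s : Bool) (l : Label H) : Module.End ℚ (Reader H M) →ₗ[ℚ] M :=
  if l.isEnd e s = 1 then readResult H M else 0

/-- The local function of trees that reads off the colors along the path from the end `s` of the
dotted edge `e` to its other end. -/
noncomputable def reading (ψ : ThreeForm H M) (e : ℕ) (s : Bool) (e' : ℕ) (s' : Bool) :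
    Tree H → M :=
  treeVal (readLabel ψ e s e' s') (readRoot H M e s)

variable (ψ : ThreeForm H M) (e : ℕ) (s : Bool) (e' : ℕ) (s' : Bool)

theorem isLocal_reading : IsLocal (reading ψ e s e' s') := by
  refine isLocal_treeVal (fun a b => ?_) (fun c a => ?_) fun a => ?_
  · refine LinearMap.ext fun F => ?_
    simp only [readLabel, readHair, map_add, LinearMap.coe_mk, AddHom.coe_mk,
      LinearMap.add_apply, Prod.mk_add_mk, add_zero]
    refine Prod.ext ?_ (Prod.ext ?_ (Prod.ext ?_ (Prod.ext ?_ rfl))) <;>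
    · refine LinearMap.ext fun x => ?_
      simp [mul_add]
  · refine LinearMap.ext fun F => ?_
    simp only [readLabel, readHair, map_smul, LinearMap.coe_mk, AddHom.coe_mk,
      LinearMap.smul_apply, Prod.smul_mk, smul_zero]
    refine Prod.ext ?_ (Prod.ext ?_ (Prod.ext ?_ (Prod.ext ?_ rfl))) <;>
    · refine LinearMap.ext fun x => ?_
      simp
  · simp [readRoot, Label.isEnd]

theorem ringVal_readLabel_start {R : RTree H} (hR : R.ends e (!s) = 0) :
    ringVal (readLabel ψ e s e' s') R (0, 0, 0, 0, 1) = 0 := by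
  induction R with
  | leaf l =>
    cases l with
    | hair a => simp [ringVal, readLabel, readHair]
    | dotted d b =>
      simp only [ringVal, readLabel]
      split_ifs with h₁ h₂ h₃ h₄
      · rfl
      · subst h₁
        exfalso
        have : b = !s := by cases b <;> cases s <;> simp_all
        simp [RTree.ends, Label.isEnd, this] at hR
      · simp [readX]
      · simp [readY]
      · rfl
  | node A B hA hB =>
    simp only [RTree.ends, Nat.add_eq_zero_iff] at hR
    simp [ringVal, hA hR.1, hB hR.2]

theorem ringVal_comb (Rs : List (RTree H)) (hRs : listEnds e (!s) Rs = 0) :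
    ringVal (readLabel ψ e s e' s') (comb Rs (.leaf (.dotted e (!s)))) (0, 0, 0, 0, 1) =
      (Rs.map (ringVal (readLabel ψ e s e' s'))).prod (0, 0, 0, ψ, 0) := by
  induction Rs with
  | nil => simp [comb, ringVal, readLabel, readStart]
  | cons R Rs ih =>
    simp only [listEnds_cons, Nat.add_eq_zero_iff] at hRs
    have : comb (R :: Rs) (.leaf (.dotted e (!s))) =
      .node R (comb Rs (.leaf (.dotted e (!s)))) := rfl
    rw [this, ringVal, LinearMap.sub_apply, Module.End.mul_apply, Module.End.mul_apply,
      ringVal_readLabel_start ψ e s e' s' hRs.1, map_zero, sub_zero, ih hRs.2, List.map_cons,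
      List.prod_cons, Module.End.mul_apply]

theorem pathVal_reading {Rs : List (RTree H)} (hne : Rs ≠ []) (hRs : ∀ b, listEnds e b Rs = 0) :
    pathVal (reading ψ e s e' s') (.leaf (.dotted e s)) Rs (.leaf (.dotted e (!s))) =
      ((Rs.map (ringVal (readLabel ψ e s e' s'))).prod (0, 0, 0, ψ, 0)).1 1 := by
  cases Rs with
  | nil => exact absurd rfl hne
  | cons R Rs =>
    have hz (l : Label H) (hl : l.isEnd e s = 0) : readRoot H M e s l = 0 := by
      simp [readRoot, hl]
    have h₁ := hRs s
    have h₂ := hRs (!s)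
    simp only [listEnds_cons, Nat.add_eq_zero_iff] at h₁ h₂
    have h₃ : (comb Rs (.leaf (.dotted e (!s)) : RTree H)).ends e s = 0 := by
      rw [ends_comb, h₁.2]; simp [RTree.ends, Label.isEnd]
    simp only [pathVal, reading, treeVal]
    rw [coVal_eq_zero hz h₁.1, coVal_eq_zero hz h₃]
    simp only [coVal, readRoot, Label.isEnd, and_self, if_true, LinearMap.zero_apply, add_zero,
      readResult, LinearMap.coe_mk, AddHom.coe_mk, LinearMap.sub_apply, Module.End.mul_apply]
    rw [ringVal_readLabel_start ψ e s e' s' h₂.1, map_zero, sub_zero, ringVal_comb _ _ _ _ _ _ h₂.2,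
      List.map_cons, List.prod_cons, Module.End.mul_apply]

theorem prod_hairs (t : List H) (a b b' c) :
    ((hairs t).map (ringVal (readLabel ψ e s e' s'))).prod (a, b, b', c, 0) =
      (a ∘ₗ LinearMap.mulRight ℚ (pureTensor t), b ∘ₗ LinearMap.mulRight ℚ (pureTensor t),
        b' ∘ₗ LinearMap.mulRight ℚ (pureTensor t),
        c ∘ₗ LinearMap.mulRight ℚ (pureTensor t), 0) := by
  induction t with
  | nil =>
    refine Prod.ext ?_ (Prod.ext ?_ (Prod.ext ?_ (Prod.ext ?_ rfl))) <;>
    · refine LinearMap.ext fun x => ?_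
      simp [hairs]
  | cons h t ih =>
    simp only [hairs, List.map_cons, List.prod_cons, Module.End.mul_apply] at ih ⊢
    rw [ih]
    simp only [ringVal, readLabel, readHair, LinearMap.coe_mk, AddHom.coe_mk]
    refine Prod.ext ?_ (Prod.ext ?_ (Prod.ext ?_ (Prod.ext ?_ rfl))) <;>
    · refine LinearMap.ext fun x => ?_
      simp [mul_assoc]

variable {e e'}

/-- Reading a word in which the separator `x` comes before the separator `y` gives the value of the
form. -/
theorem pathVal_reading_xy (hne : e ≠ e') (α β γ : List H) :
    pathVal (reading ψ e s e' s') (.leaf (.dotted e s))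
      (hairs α ++ .leaf (.dotted e' s') :: (hairs β ++ .leaf (.dotted e' (!s')) :: hairs γ))
      (.leaf (.dotted e (!s))) = ψ (pureTensor γ) (pureTensor β) (pureTensor α) := by
  rw [pathVal_reading _ _ _ _ _ (by simp)
    (fun b => by simp [RTree.ends, Label.isEnd, hne.symm])]
  simp only [List.map_append, List.map_cons, List.prod_append, List.prod_cons,
    Module.End.mul_apply, prod_hairs]
  simp [ringVal, readLabel, hne.symm, readX, readY, prod_hairs]

/-- Reading the separators in the other order gives the opposite sign. -/
theorem pathVal_reading_yx (hne : e ≠ e') (α β γ : List H) :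
    pathVal (reading ψ e s e' s') (.leaf (.dotted e s))
      (hairs α ++ .leaf (.dotted e' (!s')) :: (hairs β ++ .leaf (.dotted e' s') :: hairs γ))
      (.leaf (.dotted e (!s))) = -ψ (pureTensor γ) (pureTensor β) (pureTensor α) := by
  rw [pathVal_reading _ _ _ _ _ (by simp)
    (fun b => by simp [RTree.ends, Label.isEnd, hne.symm])]
  simp only [List.map_append, List.map_cons, List.prod_append, List.prod_cons,
    Module.End.mul_apply, prod_hairs]
  simp [ringVal, readLabel, hne.symm, readX, readY, prod_hairs]

end Reading

/-! ### Path trees of theta graphs -/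

section Combinatorics

variable {H : Type*}

theorem hairsRight_eq_lcomb (E : RTree H) (x : List H) : hairsRight E x = lcomb E (hairs x) := by
  simp [hairsRight, lcomb, hairs, List.foldl_map]

theorem hairsLeft_eq_comb (x : List H) (E : RTree H) : hairsLeft x E = comb (hairs x) E := by
  simp [hairsLeft, comb, hairs, List.foldr_map]

/-- The rooted trees attached to the left arc of a theta graph, if the path that joins the two ends
of the dotted edge on the left arc is taken as the base line; `e` is the other dotted edge. -/
def thetaPath (e : ℕ) (s : Bool) (t u m v w : List H) : List (RTree H) :=
  hairs t ++ hairsLeft u (.leaf (.dotted e s)) ::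
    (hairs m ++ hairsRight (.leaf (.dotted e (!s))) w :: hairs v)

theorem listEnds_thetaPath (e : ℕ) (s : Bool) (t u m v w : List H) (a : ℕ) (b : Bool) :
    listEnds a b (thetaPath e s t u m v w) = if a = e then 1 else 0 := by
  simp only [thetaPath, listEnds_append, listEnds_hairs, listEnds_cons, ends_hairsLeft,
    ends_hairsRight, RTree.ends, Label.isEnd]
  by_cases h : e = a <;> cases s <;> cases b <;> simp [h, eq_comm]

/-- Every word in the labels is a word in the colors, or has a first dotted end. -/
theorem exists_first_dotted (w : List (Label H)) :
    (∃ t, w.map RTree.leaf = hairs t) ∨ ∃ (t : List H) (e : ℕ) (s : Bool) (w' : List (Label H)),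
      w.map RTree.leaf = hairs t ++ .leaf (.dotted e s) :: w'.map RTree.leaf := by
  induction w with
  | nil => exact .inl ⟨[], rfl⟩
  | cons l w ih =>
    cases l with
    | dotted e s => exact .inr ⟨[], e, s, w, rfl⟩
    | hair h =>
      rcases ih with ⟨t, ht⟩ | ⟨t, e, s, w', hw⟩
      · exact .inl ⟨h :: t, by simp [ht, hairs]⟩
      · exact .inr ⟨h :: t, e, s, w', by simp [hw, hairs]⟩

theorem exists_hairs_of_listEnds (w : List (Label H))
    (hw : ∀ a b, listEnds a b (w.map RTree.leaf) = 0) : ∃ t, w.map RTree.leaf = hairs t := by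
  rcases exists_first_dotted w with h | ⟨t, e, s, w', h⟩
  · exact h
  · have := hw e s
    rw [h] at this
    simp [RTree.ends, Label.isEnd] at this

/-- A word in which exactly the two ends of the dotted edge `e` occur consists of three words in the
colors that are separated by these two ends. -/
theorem exists_word_of_listEnds {e : ℕ} (w : List (Label H))
    (hw : ∀ a b, listEnds a b (w.map RTree.leaf) = if a = e then 1 else 0) :
    ∃ s α β γ, w.map RTree.leaf = hairs α ++ .leaf (.dotted e s) ::
      (hairs β ++ .leaf (.dotted e (!s)) :: hairs γ) := by
  rcases exists_first_dotted w with ⟨t, h⟩ | ⟨t, e₁, s₁, w₁, h⟩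
  · have := hw e true
    rw [h] at this
    simp at this
  · rcases exists_first_dotted w₁ with ⟨t₂, h₂⟩ | ⟨t₂, e₂, s₂, w₂, h₂⟩
    · have h₃ := hw e (!s₁)
      rw [h, h₂] at h₃
      simp [RTree.ends, Label.isEnd] at h₃
    · rw [h₂] at h
      rw [h] at hw ⊢
      simp only [listEnds_append, listEnds_hairs, listEnds_cons, RTree.ends, Label.isEnd] at hw
      have a₁ : e₁ = e := by
        have := hw e₁ s₁
        by_contra hc
        simp [hc] at this
      have a₂ : e₂ = e := by
        have := hw e₂ s₂
        by_contra hc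
        simp [hc] at this
      subst a₁ a₂
      have a₃ : s₂ = !s₁ := by
        have h₃ := hw e₂ s₁
        by_contra hc
        have h₄ : s₂ = s₁ := by cases s₂ <;> cases s₁ <;> simp_all
        subst h₄
        simp at h₃
      subst a₃
      obtain ⟨t₃, h₃⟩ := exists_hairs_of_listEnds w₂ fun a b => by
        have := hw a b
        by_cases ha : e₂ = a
        · subst ha
          cases b <;> cases s₁ <;> simp at this <;> omega
        · simpa [ha, Ne.symm ha] using this
      exact ⟨s₁, t, t₂, t₃, by rw [h₃]⟩

end Combinatorics

section PathFormula

variable {H : Type*} [AddCommGroup H] [Module ℚ H] {M : Type*} [AddCommGroup M] [Module ℚ M]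
  {f : Tree H → M} {Θ : FourForm H M}

theorem IsLocal.sub {g : Tree H → M} (hf : IsLocal f) (hg : IsLocal g) :
    IsLocal fun T => f T - g T where
  rotate A B C := by rw [hf.rotate, hg.rotate]
  rebase A B C D := by rw [hf.rebase, hg.rebase]
  ihx A B C D := by
    linear_combination (norm := abel) hf.ihx A B C D - hg.ihx A B C D
  as A B C := by linear_combination (norm := abel) hf.as A B C - hg.as A B C
  add a b B C := by rw [hf.add, hg.add]; abel
  smul c a B C := by rw [hf.smul, hg.smul, smul_sub]

theorem IsLocal.const_smul (hf : IsLocal f) (c : ℚ) : IsLocal fun T => c • f T where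
  rotate A B C := by rw [hf.rotate]
  rebase A B C D := by rw [hf.rebase]
  ihx A B C D := by rw [← smul_sub, ← smul_add, hf.ihx, smul_zero]
  as A B C := by rw [← smul_add, hf.as, smul_zero]
  add a b B C := by rw [hf.add, smul_add]
  smul c a B C := by rw [hf.smul, smul_comm]

theorem IsLocal.add' {g : Tree H → M} (hf : IsLocal f) (hg : IsLocal g) :
    IsLocal fun T => f T + g T := by
  have := hf.sub (hg.const_smul (-1))
  simpa only [neg_one_smul, sub_neg_eq_add] using this

theorem pathVal_sub (f g : Tree H → M) (Z : RTree H) (Rs : List (RTree H)) (Y : RTree H) :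
    pathVal (fun T => f T - g T) Z Rs Y = pathVal f Z Rs Y - pathVal g Z Rs Y := by
  cases Rs <;> simp [pathVal]

theorem pathVal_add_fun (f g : Tree H → M) (Z : RTree H) (Rs : List (RTree H)) (Y : RTree H) :
    pathVal (fun T => f T + g T) Z Rs Y = pathVal f Z Rs Y + pathVal g Z Rs Y := by
  cases Rs <;> simp [pathVal]

theorem IsLocal.pathVal_neg_mid (hf : IsLocal f) (Z : RTree H) (Ls : List (RTree H)) (A B : RTree H)
    (Rs : List (RTree H)) (Y : RTree H) : pathVal f Z (Ls ++ .node A B :: Rs) Y =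
      -pathVal f Z (Ls ++ .node B A :: Rs) Y := by
  rw [hf.pathVal_ihx, hf.pathVal_ihx]; abel

theorem IsLocal.pathVal_lcomb_mid (hf : IsLocal f) (Z E : RTree H) (Rs : List (RTree H))
    (Y : RTree H) : ∀ Ls Ls' : List (RTree H), pathVal f Z (Ls ++ lcomb E Rs :: Ls') Y =
      (-1 : ℚ) ^ Rs.length • pathVal f Z (Ls ++ comb Rs.reverse E :: Ls') Y := by
  induction Rs using List.reverseRecOn with
  | nil => intro Ls Ls'; simp [lcomb, comb]
  | append_singleton Rs R ih =>
    intro Ls Ls'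
    have h₁ : lcomb E (Rs ++ [R]) = .node (lcomb E Rs) R := by simp [lcomb]
    have h₂ : comb (Rs ++ [R]).reverse E = .node R (comb Rs.reverse E) := by simp [comb]
    have h₃ := ih (Ls ++ [R]) Ls'
    have h₄ := ih Ls (R :: Ls')
    simp only [List.append_assoc, List.singleton_append] at h₃
    rw [h₁, h₂, hf.pathVal_neg_mid, hf.pathVal_ihx, hf.pathVal_ihx, h₃, h₄, List.length_append,
      pow_add, List.length_singleton, pow_one, mul_neg_one, neg_smul, smul_sub]

/-- If the values of a local function on path trees without hairs on the right arms are given by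
a balanced form, then so are all its values on path trees of theta graphs. -/
theorem IsLocal.pathVal_thetaPath_of_word (hf : IsLocal f) (hΘ : IsBalanced Θ) {c : ℚ}
    {Z Y : RTree H} {e : ℕ} {s : Bool}
    (h : ∀ α β γ : List H, pathVal f Z (hairs α ++ .leaf (.dotted e s) ::
      (hairs β ++ .leaf (.dotted e (!s)) :: hairs γ)) Y =
        c • mid Θ (pureTensor β) (pureTensor α) 1 (pureTensor γ) 1)
    (t u m v w : List H) : pathVal f Z (thetaPath e s t u m v w) Y =
      c • mid Θ (pureTensor m) (pureTensor t) (pureTensor u) (pureTensor v) (pureTensor w) := by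
  induction u generalizing t m with
  | nil =>
    induction w using List.reverseRecOn generalizing m v with
    | nil => simpa [thetaPath, hairsLeft, hairsRight] using h t m v
    | append_singleton w a ih =>
      have h₁ := ih (a :: v) m
      have h₂ := ih v (m ++ [a])
      have h₃ : thetaPath e s t [] m v (w ++ [a]) =
        (hairs t ++ hairsLeft [] (.leaf (.dotted e s)) :: hairs m) ++
          .node (hairsRight (.leaf (.dotted e (!s))) w) (.leaf (.hair a)) :: hairs v := by
        simp [thetaPath, hairsRight]
      have h₄ := hΘ.mid_mul_ι a (pureTensor m) (pureTensor t) (pureTensor []) (pureTensor v)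
        (pureTensor w)
      rw [h₃, hf.pathVal_ihx]
      simp only [thetaPath, hairs_append, pureTensor_append, pureTensor_cons, pureTensor_nil,
        mul_one] at h₁ h₂ h₄ ⊢
      simp only [hairs, List.map_cons, List.map_nil, List.append_assoc, List.cons_append,
        List.nil_append] at h₁ h₂ ⊢
      rw [h₁, h₂, h₄, ← smul_sub, sub_sub_cancel]
  | cons a u ih =>
    have h₁ := ih (t ++ [a]) m
    have h₂ := ih t (a :: m)
    have h₃ : thetaPath e s t (a :: u) m v w = hairs t ++
        .node (.leaf (.hair a)) (hairsLeft u (.leaf (.dotted e s))) ::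
          (hairs m ++ hairsRight (.leaf (.dotted e (!s))) w :: hairs v) := by
      simp [thetaPath, hairsLeft]
    have h₄ := mid_ι_mul Θ a (pureTensor m) (pureTensor t) (pureTensor u) (pureTensor v)
      (pureTensor w)
    rw [h₃, hf.pathVal_ihx]
    simp only [thetaPath, hairs_append, pureTensor_append, pureTensor_cons, pureTensor_nil,
      mul_one] at h₁ h₂ ⊢
    simp only [hairs, List.map_cons, List.map_nil, List.append_assoc, List.cons_append,
      List.nil_append] at h₁ h₂ ⊢
    rw [h₁, h₂, h₄, ← smul_sub, sub_sub_cancel]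

/-- If the values of a local function on path trees of theta graphs without hairs on the middle edge
are given by a form in four variables, then its values on all path trees of theta graphs are
given by the extension of this form. -/
theorem IsLocal.pathVal_thetaPath_of_theta (hf : IsLocal f) {c : ℚ}
    {Z Y : RTree H} {e : ℕ} {s : Bool}
    (h : ∀ t u v w : List H, pathVal f Z (thetaPath e s t u [] v w) Y =
        c • Θ (pureTensor t) (pureTensor u) (pureTensor v) (pureTensor w))
    (t u m v w : List H) : pathVal f Z (thetaPath e s t u m v w) Y =
      c • mid Θ (pureTensor m) (pureTensor t) (pureTensor u) (pureTensor v) (pureTensor w) := by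
  induction m generalizing t u with
  | nil => simpa using h t u v w
  | cons a m ih =>
    have h₁ := ih (t ++ [a]) u
    have h₂ := ih t (a :: u)
    have h₃ : thetaPath e s t (a :: u) m v w = hairs t ++
        .node (.leaf (.hair a)) (hairsLeft u (.leaf (.dotted e s))) ::
          (hairs m ++ hairsRight (.leaf (.dotted e (!s))) w :: hairs v) := by
      simp [thetaPath, hairsLeft]
    rw [h₃, hf.pathVal_ihx] at h₂
    rw [pureTensor_cons, mid_ι_mul]
    simp only [thetaPath, hairs_append, pureTensor_append, pureTensor_cons, pureTensor_nil,
      mul_one] at h₁ h₂ ⊢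
    simp only [hairs, List.map_cons, List.map_nil, List.append_assoc, List.cons_append,
      List.nil_append] at h₁ h₂ ⊢
    rw [h₁] at h₂
    rw [smul_sub, ← h₂, sub_sub_cancel]

theorem IsLocal.thetaTree (hf : IsLocal f) (e e' : ℕ) (s s' : Bool) (t u v w : List H) :
    f ⟨hairsRight (.leaf (.dotted e' (!s'))) w, hairsLeft v (.leaf (.dotted e (!s))),
      .node (hairsRight (.leaf (.dotted e s)) t) (hairsLeft u (.leaf (.dotted e' s')))⟩ =
    pathVal f (.leaf (.dotted e s)) (thetaPath e' s' t u [] v w) (.leaf (.dotted e (!s))) := by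
  have h : pathVal f (.leaf (.dotted e s)) (thetaPath e' s' t u [] v w)
      (.leaf (.dotted e (!s))) = pathVal f (.leaf (.dotted e s)) (hairs t ++
        ([hairsLeft u (.leaf (.dotted e' s')), hairsRight (.leaf (.dotted e' (!s'))) w] ++
          hairs v)) (.leaf (.dotted e (!s))) := by simp [thetaPath, hairs]
  rw [h, hf.pathVal_append _ _ (by simp), pathVal_append_right _ (by simp), ← hairsRight_eq_lcomb,
    ← hairsLeft_eq_comb]
  simp only [pathVal, comb, List.foldr_cons, List.foldr_nil]
  rw [hf.rotate, hf.rotate, hf.rebase]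

/-- A theta graph is a path tree for the path that joins the two ends of the dotted edge on its left
side. -/
theorem IsLocal.thetaGraph (hf : IsLocal f) (t u v w : List H) :
    f ((thetaGraph t u v w).tree 0) = pathVal f (.leaf (.dotted 0 true))
      (thetaPath 1 true t u [] v w) (.leaf (.dotted 0 false)) := hf.thetaTree 0 1 true true t u v w

/-- A local function vanishes on a tree with dotted edges `e` and `e'` if it vanishes on path trees
for the path that joins the two ends of `e`, with only leaves attached. -/
theorem IsLocal.eq_zero_of_words (hf : IsLocal f) {e e' : ℕ} (hne : e ≠ e') (s : Bool)
    (h : ∀ s' α β γ, pathVal f (.leaf (.dotted e s)) (hairs α ++ .leaf (.dotted e' s') ::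
      (hairs β ++ .leaf (.dotted e' (!s')) :: hairs γ)) (.leaf (.dotted e (!s))) = 0)
    {T : Tree H} (hT : ∀ a b, T.ends a b = if a = e ∨ a = e' then 1 else 0) : f T = 0 := by
  obtain ⟨Rs, -, hc, hRs⟩ := exists_path M (e := e) (e' := e) (s := s) (s' := !s)
    (by simp) T (by simp [hT]) (by simp [hT])
  refine hRs f hf ?_
  refine list_eq_zero_of_leaves
    (P := fun Rs => ∀ a b, listEnds a b Rs = if a = e' then 1 else 0)
    (g := fun Rs => pathVal f (.leaf (.dotted e s)) Rs (.leaf (.dotted e (!s))))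
    (fun Ls A B Rs hP => ?_) (fun Ls A B Rs _ => hf.pathVal_ihx _ _ _ _ _ _)
    (fun w hw => ?_) Rs fun a b => ?_
  · constructor <;> intro a b <;> rw [← hP a b] <;> simp [RTree.ends] <;> omega
  · obtain ⟨s', α, β, γ, hw'⟩ := exists_word_of_listEnds w hw
    simp only [hw']
    exact h s' α β γ
  · have := hc a b
    rw [hT] at this
    by_cases ha : a = e
    · subst ha
      cases s <;> cases b <;> simp [Label.isEnd, hne] at this ⊢ <;> omega
    · have ha' : e ≠ a := fun h => ha h.symm
      simpa [Label.isEnd, ha, ha', eq_comm] using this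

end PathFormula

/-! ### Invariant functions of trees with two dotted edges -/

section Relabeling

variable {H : Type*}

/-- The dotted edges of the tree are `e` and `e'`, and both of their ends lie in the tree. -/
def Tree.HasEdges (T : Tree H) (e e' : ℕ) : Prop :=
  e ≠ e' ∧ ∀ a s, T.ends a s = if a = e ∨ a = e' then 1 else 0

theorem Tree.HasEdges.eq_or {T : Tree H} {e e' a a' : ℕ} (h : T.HasEdges e e')
    (h' : T.HasEdges a a') : (a = e ∧ a' = e') ∨ (a = e' ∧ a' = e) := by
  have h₁ := h.2 a true
  have h₂ := h.2 a' true
  rw [h'.2] at h₁ h₂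
  have h₃ : a = e ∨ a = e' := by by_contra hc; simp [hc] at h₁
  have h₄ : a' = e ∨ a' = e' := by by_contra hc; simp [hc] at h₂
  have := h.1
  have := h'.1
  omega

theorem pathVal_congr {M : Type*} [Zero M] {f g : Tree H → M} {Z Y : RTree H}
    {Rs : List (RTree H)}
    (h : ∀ T : Tree H, (∀ a b, T.ends a b = Z.ends a b + listEnds a b Rs + Y.ends a b) →
      f T = g T) : pathVal f Z Rs Y = pathVal g Z Rs Y := by
  cases Rs with
  | nil => rfl
  | cons R Rs => exact h _ fun a b => by simp [Tree.ends, ends_comb]; omega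

theorem pathVal_mapLabel {M : Type*} [Zero M] (f : Tree H → M) (φ : Label H → Label H)
    (Z : RTree H) (Rs : List (RTree H)) (Y : RTree H) :
    pathVal (fun T => f (T.mapLabel φ)) Z Rs Y =
      pathVal f (Z.mapLabel φ) (Rs.map (RTree.mapLabel φ)) (Y.mapLabel φ) := by
  have h (Rs : List (RTree H)) : (comb Rs Y).mapLabel φ =
      comb (Rs.map (RTree.mapLabel φ)) (Y.mapLabel φ) := by
    induction Rs with
    | nil => rfl
    | cons R Rs ih => simp only [comb, List.foldr_cons] at ih ⊢; simp [RTree.mapLabel, ih]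
  cases Rs with
  | nil => rfl
  | cons R Rs => simp [pathVal, Tree.mapLabel, h]

theorem mapLabel_thetaPath {φ : Label H → Label H} (hφ : ∀ a, φ (.hair a) = .hair a) {e e' : ℕ}
    {s s' : Bool} (h : φ (.dotted e s) = .dotted e' s') (h' : φ (.dotted e (!s)) = .dotted e' (!s'))
    (t u m v w : List H) : (thetaPath e s t u m v w).map (RTree.mapLabel φ) =
      thetaPath e' s' t u m v w := by
  have h₁ (t : List H) : (hairs t).map (RTree.mapLabel φ) = hairs t := by
    simp only [hairs, List.map_map]
    exact List.map_congr_left fun a _ => by simp [RTree.mapLabel, hφ]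
  have h₂ (t : List H) (E : RTree H) : (hairsLeft t E).mapLabel φ =
      hairsLeft t (E.mapLabel φ) := by
    induction t with
    | nil => rfl
    | cons a t ih =>
      simp only [hairsLeft, List.foldr_cons] at ih ⊢; simp [RTree.mapLabel, ih, hφ]
  have h₃ (t : List H) (E : RTree H) : (hairsRight E t).mapLabel φ =
      hairsRight (E.mapLabel φ) t := by
    induction t generalizing E with
    | nil => rfl
    | cons a t ih =>
      simp only [hairsRight, List.foldl_cons] at ih ⊢; simp [RTree.mapLabel, ih, hφ]
  simp [thetaPath, h₁, h₂, h₃, RTree.mapLabel, h, h']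

theorem RTree.ends_mapLabel_rename (σ : Equiv.Perm ℕ) (R : RTree H) (a : ℕ) (s : Bool) :
    (R.mapLabel (Label.rename σ)).ends (σ a) s = R.ends a s := by
  induction R with
  | leaf l => cases l <;> simp [RTree.mapLabel, RTree.ends, Label.rename, Label.isEnd]
  | node A B hA hB => simp [RTree.mapLabel, RTree.ends, hA, hB]

theorem Tree.ends_mapLabel_rename (σ : Equiv.Perm ℕ) (T : Tree H) (a : ℕ) (s : Bool) :
    (T.mapLabel (Label.rename σ)).ends (σ a) s = T.ends a s := by
  simp [Tree.ends, Tree.mapLabel, RTree.ends_mapLabel_rename]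

theorem RTree.ends_mapLabel_flip (e : ℕ) (R : RTree H) (a : ℕ) (s : Bool) :
    (R.mapLabel (Label.flip e)).ends a s = R.ends a (if a = e then !s else s) := by
  induction R with
  | leaf l =>
    cases l with
    | hair h => simp [RTree.mapLabel, RTree.ends, Label.flip, Label.isEnd]
    | dotted d b =>
      simp only [RTree.mapLabel, RTree.ends, Label.flip, Label.isEnd]
      by_cases h : d = a
      · subst h; by_cases h' : d = e <;> cases b <;> cases s <;> simp [h']
      · simp [h]
  | node A B hA hB => simp [RTree.mapLabel, RTree.ends, hA, hB]

theorem Tree.ends_mapLabel_flip (e : ℕ) (T : Tree H) (a : ℕ) (s : Bool) :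
    (T.mapLabel (Label.flip e)).ends a s = T.ends a (if a = e then !s else s) := by
  simp [Tree.ends, Tree.mapLabel, RTree.ends_mapLabel_flip]

theorem Tree.HasEdges.rename {T : Tree H} {e e' : ℕ} (h : T.HasEdges e e') (σ : Equiv.Perm ℕ) :
    (T.mapLabel (Label.rename σ)).HasEdges (σ e) (σ e') := by
  refine ⟨by simpa using h.1, fun a s => ?_⟩
  obtain ⟨a, rfl⟩ := σ.surjective a
  simp [Tree.ends_mapLabel_rename, h.2]

theorem Tree.HasEdges.flip {T : Tree H} {e e' : ℕ} (h : T.HasEdges e e') (d : ℕ) :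
    (T.mapLabel (Label.flip d)).HasEdges e e' :=
  ⟨h.1, fun a s => by rw [Tree.ends_mapLabel_flip, h.2]⟩

theorem Tree.mapLabel_rename_symm (σ : Equiv.Perm ℕ) (T : Tree H) :
    (T.mapLabel (Label.rename σ)).mapLabel (Label.rename σ.symm) = T := by
  have h (R : RTree H) : (R.mapLabel (Label.rename σ)).mapLabel (Label.rename σ.symm) = R := by
    induction R with
    | leaf l => cases l <;> simp [RTree.mapLabel, Label.rename]
    | node A B hA hB => simp [RTree.mapLabel, hA, hB]
  simp [Tree.mapLabel, h]

end Relabeling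

section Invariant

variable {H : Type*} [AddCommGroup H] [Module ℚ H] {M : Type*} [AddCommGroup M] [Module ℚ M]

/-- The sign of an end of a dotted edge. -/
def endSign (s : Bool) : ℚ := if s then 1 else -1

@[simp] theorem endSign_true : endSign true = 1 := rfl
@[simp] theorem endSign_false : endSign false = -1 := rfl
@[simp] theorem endSign_not (s : Bool) : endSign (!s) = -endSign s := by cases s <;> simp
@[simp] theorem endSign_mul_self (s : Bool) : endSign s * endSign s = 1 := by cases s <;> simp

/-- A function of trees that satisfies all relations of the space of trees with two dotted edges,
extended by zero to all other trees. -/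
structure IsInvariant (f : Tree H → M) : Prop extends IsLocal f where
  support : ∀ T, f T ≠ 0 → ∃ e e', T.HasEdges e e'
  rename : ∀ (σ : Equiv.Perm ℕ) T, f (T.mapLabel (Label.rename σ)) = f T
  flip : ∀ e T, T.ends e true ≠ 0 → f (T.mapLabel (Label.flip e)) = -f T

/-- The values of an invariant function on path trees of theta graphs do not depend on the names of
the dotted edges, and they depend on the directions by a sign. -/
theorem IsInvariant.pathVal_thetaPath_nil {f : Tree H → M} (hf : IsInvariant f)
    {e e' : ℕ} (hne : e ≠ e') (s s' : Bool) (t u v w : List H) :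
    pathVal f (.leaf (.dotted e s)) (thetaPath e' s' t u [] v w) (.leaf (.dotted e (!s))) =
      (endSign s * endSign s') • f ((thetaGraph t u v w).tree 0) := by
  have h₁ : pathVal f (.leaf (.dotted e true)) (thetaPath e' true t u [] v w)
      (.leaf (.dotted e false)) =
        f ((thetaGraph t u v w).tree 0) := by
    set σ : Equiv.Perm ℕ := Equiv.swap (Equiv.swap 0 e 1) e' * Equiv.swap 0 e with hσ
    have hσ₀ : σ 0 = e := by
      have h₂ : Equiv.swap 0 e 1 ≠ e := by
        intro h
        have h₃ := congrArg (Equiv.swap 0 e) h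
        rw [Equiv.swap_apply_self, Equiv.swap_apply_right] at h₃
        exact one_ne_zero h₃
      rw [hσ, Equiv.Perm.mul_apply, Equiv.swap_apply_left,
        Equiv.swap_apply_of_ne_of_ne h₂.symm hne]
    have hσ₁ : σ 1 = e' := by rw [hσ, Equiv.Perm.mul_apply, Equiv.swap_apply_left]
    have h₃ := pathVal_mapLabel f (Label.rename σ) (.leaf (.dotted 0 true))
      (thetaPath 1 true t u [] v w) (.leaf (.dotted 0 false))
    rw [funext (hf.rename σ), mapLabel_thetaPath (fun _ => rfl) (e' := e') (s' := true)
      (by simp [Label.rename, hσ₁]) (by simp [Label.rename, hσ₁])] at h₃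
    rw [hf.thetaGraph, h₃]
    simp [RTree.mapLabel, Label.rename, hσ₀]
  have h₂ : pathVal f (.leaf (.dotted e s)) (thetaPath e' true t u [] v w)
      (.leaf (.dotted e (!s))) = endSign s •
        f ((thetaGraph t u v w).tree 0) := by
    cases s with
    | true => simpa using h₁
    | false =>
      have h₃ := pathVal_mapLabel f (Label.flip e) (.leaf (.dotted e true))
        (thetaPath e' true t u [] v w) (.leaf (.dotted e false))
      rw [pathVal_congr (g := fun T => 0 - f T) fun T hT => by
        rw [hf.flip e T (by rw [hT]; simp [RTree.ends, Label.isEnd]), zero_sub], pathVal_sub,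
        mapLabel_thetaPath (fun _ => rfl) (e' := e') (s' := true)
          (by simp [Label.flip, hne.symm]) (by simp [Label.flip, hne.symm]), h₁] at h₃
      simp only [RTree.mapLabel, Label.flip, if_true, Bool.not_true, Bool.not_false] at h₃ ⊢
      rw [← h₃]
      simp [thetaPath]
      cases t <;> simp [hairs, pathVal]
  cases s' with
  | true => simpa using h₂
  | false =>
    have h₃ := pathVal_mapLabel f (Label.flip e') (.leaf (.dotted e s))
      (thetaPath e' true t u [] v w) (.leaf (.dotted e (!s)))
    rw [pathVal_congr (g := fun T => 0 - f T) fun T hT => by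
      rw [hf.flip e' T (by rw [hT, listEnds_thetaPath]; simp), zero_sub], pathVal_sub,
      mapLabel_thetaPath (fun _ => rfl) (e' := e') (s' := false)
        (by simp [Label.flip]) (by simp [Label.flip]), h₂] at h₃
    simp only [RTree.mapLabel, Label.flip, hne, if_false] at h₃
    rw [← h₃]
    cases t <;> simp [thetaPath, hairs, pathVal]

/-- The values of an invariant function on path trees of theta graphs with hairs on the middle
edge. -/
theorem IsInvariant.pathVal_thetaPath {f : Tree H → M} (hf : IsInvariant f) {Θ : FourForm H M}
    (hΘ : ∀ t u v w, f ((thetaGraph t u v w).tree 0) =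
      Θ (pureTensor t) (pureTensor u) (pureTensor v) (pureTensor w))
    {e e' : ℕ} (hne : e ≠ e') (s s' : Bool) (t u m v w : List H) :
    pathVal f (.leaf (.dotted e s)) (thetaPath e' s' t u m v w) (.leaf (.dotted e (!s))) =
      (endSign s * endSign s') •
        mid Θ (pureTensor m) (pureTensor t) (pureTensor u) (pureTensor v) (pureTensor w) :=
  hf.toIsLocal.pathVal_thetaPath_of_theta
    (fun t u v w => by rw [hf.pathVal_thetaPath_nil hne, hΘ]) t u m v w

end Invariant

/-! ### The invariant function that a balanced form determines -/

section Realization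

variable {H : Type*} [AddCommGroup H] [Module ℚ H] {M : Type*} [AddCommGroup M] [Module ℚ M]

/-- The values of a form on theta graphs without hairs on the right arms. -/
noncomputable def leftForm (Θ : FourForm H M) : ThreeForm H M :=
  LinearMap.mk₂ ℚ (fun γ β =>
    { toFun := fun α => mid Θ β α 1 γ 1
      map_add' := fun x y => by simp
      map_smul' := fun c x => by simp })
    (fun x y z => by ext; simp) (fun c x y => by ext; simp)
    (fun x y z => by ext; simp) (fun c x y => by ext; simp)

theorem leftForm_apply (Θ : FourForm H M) (α β γ : TensorAlgebra ℚ H) :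
    leftForm Θ γ β α = mid Θ β α 1 γ 1 := rfl

theorem treeVal_mapLabel {𝔤 : Type*} [Ring 𝔤] [Algebra ℚ 𝔤] {val val' : Label H → 𝔤}
    {coval coval' : Label H → 𝔤 →ₗ[ℚ] M} {φ : Label H → Label H} (h : ∀ l, val' (φ l) = val l)
    (h' : ∀ l, coval' (φ l) = coval l) (T : Tree H) :
    treeVal val' coval' (T.mapLabel φ) = treeVal val coval T := by
  have h₁ (R : RTree H) : ringVal val' (R.mapLabel φ) = ringVal val R := by
    induction R with
    | leaf l => exact h l
    | node A B hA hB => simp only [RTree.mapLabel, ringVal, hA, hB]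
  have h₂ (R : RTree H) : coVal val' coval' (R.mapLabel φ) = coVal val coval R := by
    induction R with
    | leaf l => exact h' l
    | node A B hA hB => simp only [RTree.mapLabel, coVal, hA, hB, h₁]
  simp only [treeVal, Tree.mapLabel, h₁, h₂]

section

variable (ψ : ThreeForm H M) {e e' : ℕ} (s s' : Bool)

theorem reading_rename (σ : Equiv.Perm ℕ) (T : Tree H) :
    reading ψ (σ e) s (σ e') s' (T.mapLabel (Label.rename σ)) = reading ψ e s e' s' T :=
  treeVal_mapLabel (fun l => by cases l <;> simp [Label.rename, readLabel])
    (fun l => by cases l <;> simp [Label.rename, readRoot, Label.isEnd]) T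

theorem reading_flip_left (T : Tree H) : reading ψ e s e' s' (T.mapLabel (Label.flip e)) =
    reading ψ e (!s) e' s' T := by
  refine treeVal_mapLabel (fun l => ?_) (fun l => ?_) T
  · cases l with
    | hair a => rfl
    | dotted d b =>
      by_cases h : d = e <;> cases b <;> cases s <;> simp [Label.flip, readLabel, h]
  · cases l with
    | hair a => rfl
    | dotted d b =>
      by_cases h : d = e <;> cases b <;> cases s <;>
        simp [Label.flip, readRoot, Label.isEnd, h]

theorem reading_flip_right (hne : e ≠ e') (T : Tree H) :
    reading ψ e s e' s' (T.mapLabel (Label.flip e')) = reading ψ e s e' (!s') T := by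
  refine treeVal_mapLabel (fun l => ?_) (fun l => ?_) T
  · cases l with
    | hair a => rfl
    | dotted d b =>
      by_cases h : d = e'
      · subst h
        cases b <;> cases s' <;> simp [Label.flip, readLabel, hne.symm]
      · simp [Label.flip, readLabel, h]
  · cases l with
    | hair a => rfl
    | dotted d b =>
      by_cases h : d = e'
      · subst h
        simp [Label.flip, readRoot, Label.isEnd, hne.symm]
      · simp [Label.flip, readRoot, Label.isEnd, h]

/-- Exchanging the names of the two separators changes the sign, since the two values of the reader
for a word differ by a sign. -/
theorem Tree.HasEdges.reading_not_right {T : Tree H} (h : T.HasEdges e e') :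
    reading ψ e s e' (!s') T = -reading ψ e s e' s' T := by
  rw [← add_eq_zero_iff_eq_neg]
  refine ((isLocal_reading ψ e s e' (!s')).add' (isLocal_reading ψ e s e' s')).eq_zero_of_words
    h.1 s (fun b α β γ => ?_) h.2
  rw [pathVal_add_fun]
  obtain rfl | rfl : b = s' ∨ b = !s' := by cases b <;> cases s' <;> simp
  · have := pathVal_reading_yx ψ s (!b) h.1 α β γ
    rw [Bool.not_not] at this
    rw [this, pathVal_reading_xy ψ s b h.1, neg_add_cancel]
  · have := pathVal_reading_xy ψ s (!s') h.1 α β γ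
    rw [this, Bool.not_not, pathVal_reading_yx ψ s s' h.1, add_neg_cancel]

end

variable {Θ : FourForm H M} {e e' : ℕ} {T : Tree H}

theorem hairs_reverse (t : List H) : hairs t.reverse = (hairs t).reverse := by simp [hairs]

@[simp] theorem length_hairs (t : List H) : (hairs t).length = t.length := by simp [hairs]

theorem neg_one_pow_smul_self (n : ℕ) (x : M) :
    (-1 : ℚ) ^ n • (-1 : ℚ) ^ n • x = x := by
  rw [smul_smul, ← mul_pow]; simp

/-- Reversing the path that joins the two ends of `e` is compatible with the first reflection. -/
theorem IsBalanced.reading_not_left (hΘ : IsBalanced Θ) (h : T.HasEdges e e') (s s' : Bool) :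
    reading (leftForm Θ) e (!s) e' s' T = -reading (leftForm Θ) e s e' s' T := by
  rw [← add_eq_zero_iff_eq_neg]
  refine ((isLocal_reading (leftForm Θ) e (!s) e' s').add'
    (isLocal_reading (leftForm Θ) e s e' s')).eq_zero_of_words h.1 s (fun b α β γ => ?_) h.2
  have key : leftForm Θ (pureTensor α.reverse) (pureTensor β.reverse) (pureTensor γ.reverse) =
      (-1 : ℚ) ^ (α.length + β.length + γ.length) •
        leftForm Θ (pureTensor γ) (pureTensor β) (pureTensor α) := by
    simp only [leftForm_apply, pureTensor_reverse, map_smul, LinearMap.smul_apply]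
    rw [hΘ.mid_reflect₁ (antipode (pureTensor β))]
    simp only [antipode_antipode, antipode_one, smul_smul, ← pow_add]
    congr 2
    ring
  have hr : ∀ b : Bool, (hairs α ++ .leaf (.dotted e' b) :: (hairs β ++
      .leaf (.dotted e' (!b)) :: hairs γ) : List (RTree H)).reverse = hairs γ.reverse ++
        .leaf (.dotted e' (!b)) :: (hairs β.reverse ++ .leaf (.dotted e' b) :: hairs α.reverse) := by
    intro b; simp [hairs_reverse]
  have hlen : (-1 : ℚ) ^ (hairs α ++ .leaf (.dotted e' b) :: (hairs β ++
      .leaf (.dotted e' (!b)) :: hairs γ) : List (RTree H)).length =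
        (-1) ^ (α.length + β.length + γ.length) := by
    simp only [List.length_append, List.length_cons, length_hairs]
    rw [show α.length + (β.length + (γ.length + 1) + 1) = α.length + β.length + γ.length + 2 by
      ring, pow_add]
    simp
  rw [pathVal_add_fun, (isLocal_reading (leftForm Θ) e (!s) e' s').pathVal_reverse, hr, hlen]
  obtain rfl | rfl : b = s' ∨ b = !s' := by cases b <;> cases s' <;> simp
  · have := pathVal_reading_yx (leftForm Θ) (!s) b h.1 γ.reverse β.reverse α.reverse
    rw [Bool.not_not] at this
    rw [this, pathVal_reading_xy _ s b h.1, key, smul_neg, neg_one_pow_smul_self, neg_add_cancel]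
  · have := pathVal_reading_xy (leftForm Θ) (!s) s' h.1 γ.reverse β.reverse α.reverse
    rw [Bool.not_not] at this ⊢
    rw [this, pathVal_reading_yx _ s s' h.1, key, neg_one_pow_smul_self, add_neg_cancel]

/-- Exchanging the roles of the two dotted edges is compatible with the second reflection. -/
theorem IsBalanced.reading_swap (hΘ : IsBalanced Θ) (h : T.HasEdges e e') (s s' : Bool) :
    reading (leftForm Θ) e' s' e s T = reading (leftForm Θ) e s e' s' T := by
  -- The path between the ends of `e'` in a path tree for the ends of `e`.
  have key (f : Tree H → M) (hf : IsLocal f) (b : Bool) (α β γ : List H) :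
      pathVal f (.leaf (.dotted e s)) (hairs α ++ .leaf (.dotted e' b) ::
        (hairs β ++ .leaf (.dotted e' (!b)) :: hairs γ)) (.leaf (.dotted e (!s))) =
      (-1 : ℚ) ^ (α.length + γ.length) • pathVal f (.leaf (.dotted e' b))
        (thetaPath e s [] α.reverse β [] γ.reverse) (.leaf (.dotted e' (!b))) := by
    have h₁ : comb (hairs γ) (.leaf (.dotted e (!s))) =
        comb (hairs γ.reverse).reverse (.leaf (.dotted e (!s))) := by simp [hairs_reverse]
    rw [hf.pathVal_append _ _ (by simp), ← List.cons_append,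
      show RTree.leaf (.dotted e' b) :: hairs β ++ .leaf (.dotted e' (!b)) :: hairs γ =
        (RTree.leaf (.dotted e' b) :: hairs β ++ [.leaf (.dotted e' (!b))]) ++ hairs γ by simp,
      pathVal_append_right _ (by simp)]
    have h₂ (Z Y : RTree H) : pathVal f Z (RTree.leaf (.dotted e' b) :: hairs β ++
        [.leaf (.dotted e' (!b))]) Y = pathVal f (.leaf (.dotted e' b)) ([] ++ Z :: (hairs β ++ [Y]))
          (.leaf (.dotted e' (!b))) := by
      have h₃ : pathVal f Z (RTree.leaf (.dotted e' b) :: hairs β) (.node (.leaf (.dotted e' (!b))) Y)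
          = pathVal f Z (RTree.leaf (.dotted e' b) :: hairs β ++ [.leaf (.dotted e' (!b))]) Y := by
        rw [pathVal_append_right _ (by simp)]; rfl
      have h₄ : pathVal f (.leaf (.dotted e' b)) (Z :: hairs β) (.node Y (.leaf (.dotted e' (!b))))
          = pathVal f (.leaf (.dotted e' b)) (Z :: (hairs β ++ [Y])) (.leaf (.dotted e' (!b))) := by
        rw [← List.cons_append, pathVal_append_right _ (by simp)]; rfl
      rw [← h₃, List.nil_append, ← h₄, hf.pathVal_neg_right _ (by simp)]
      exact (hf.swap₁₂ _ _ _).symm ▸ by simp [pathVal]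
    rw [h₂, hf.pathVal_lcomb_mid]
    have h₅ := hf.pathVal_lcomb_mid (.leaf (.dotted e' b)) (.leaf (.dotted e (!s)))
      (hairs γ.reverse) (.leaf (.dotted e' (!b)))
      (hairsLeft α.reverse (.leaf (.dotted e s)) :: hairs β) []
    rw [← h₁] at h₅
    have h₆ := neg_one_pow_smul_self γ.length (pathVal f (.leaf (.dotted e' b))
      (hairsLeft α.reverse (.leaf (.dotted e s)) :: hairs β ++
        [comb (hairs γ) (.leaf (.dotted e (!s)))]) (.leaf (.dotted e' (!b))))
    rw [length_hairs, List.length_reverse] at h₅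
    rw [← h₅] at h₆
    rw [hairsLeft_eq_comb, hairs_reverse] at h₆
    rw [length_hairs, pow_add, mul_smul]
    congr 1
    rw [List.nil_append, ← List.cons_append, ← h₆, thetaPath, hairsLeft_eq_comb,
      hairsRight_eq_lcomb, hairs_reverse]
    simp [hairs]
  -- The comparison for a word in which the separator `s'` comes first.
  have main (s₁ : Bool) (α β γ : List H) :
      pathVal (reading (leftForm Θ) e' s₁ e s) (.leaf (.dotted e s))
        (hairs α ++ .leaf (.dotted e' s₁) :: (hairs β ++ .leaf (.dotted e' (!s₁)) :: hairs γ))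
        (.leaf (.dotted e (!s))) = leftForm Θ (pureTensor γ) (pureTensor β) (pureTensor α) := by
    rw [key _ (isLocal_reading _ _ _ _ _),
      (isLocal_reading _ _ _ _ _).pathVal_thetaPath_of_word hΘ (c := 1) fun α β γ => by
        rw [pathVal_reading_xy _ _ _ h.1.symm, one_smul, leftForm_apply], one_smul,
      hΘ.mid_reflect₂, leftForm_apply]
    simp only [pureTensor_reverse, antipode_smul, antipode_antipode, map_smul,
      LinearMap.smul_apply, pureTensor_nil, antipode_one, smul_smul, ← pow_add]
    rw [show α.length + γ.length + (γ.length + α.length) = 2 * (α.length + γ.length) by ring,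
      pow_mul]
    simp
  rw [← sub_eq_zero]
  refine ((isLocal_reading (leftForm Θ) e' s' e s).sub
    (isLocal_reading (leftForm Θ) e s e' s')).eq_zero_of_words h.1 s (fun b α β γ => ?_) h.2
  rw [pathVal_sub]
  obtain rfl | rfl : b = s' ∨ b = !s' := by cases b <;> cases s' <;> simp
  · rw [main, pathVal_reading_xy _ _ _ h.1, sub_self]
  · have h₁ : pathVal (reading (leftForm Θ) e' s' e s) (.leaf (.dotted e s))
        (hairs α ++ .leaf (.dotted e' (!s')) :: (hairs β ++ .leaf (.dotted e' (!!s')) :: hairs γ))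
        (.leaf (.dotted e (!s))) = -pathVal (reading (leftForm Θ) e' (!s') e s)
        (.leaf (.dotted e s)) (hairs α ++ .leaf (.dotted e' (!s')) ::
          (hairs β ++ .leaf (.dotted e' (!!s')) :: hairs γ)) (.leaf (.dotted e (!s))) := by
      rw [← zero_sub, ← sub_eq_zero]
      rw [pathVal_congr (f := reading (leftForm Θ) e' s' e s)
        (g := fun T => (fun _ => 0) T - reading (leftForm Θ) e' (!s') e s T), pathVal_sub]
      · have : pathVal (fun _ => (0 : M)) (.leaf (.dotted e s)) (hairs α ++
          .leaf (.dotted e' (!s')) :: (hairs β ++ .leaf (.dotted e' (!!s')) :: hairs γ))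
          (.leaf (.dotted e (!s))) = 0 := by cases α <;> rfl
        rw [this, sub_self]
      · intro T hT
        rw [hΘ.reading_not_left (e := e') (e' := e), zero_sub, neg_neg]
        refine ⟨h.1.symm, fun a c => ?_⟩
        rw [hT]
        have := h.1
        by_cases h₁ : e = a
        · subst h₁
          cases c <;> cases s <;> simp [RTree.ends, Label.isEnd, h.1, h.1.symm]
        · by_cases h₂ : e' = a
          · subst h₂
            cases c <;> cases s' <;> simp [RTree.ends, Label.isEnd, h.1]
          · simp [RTree.ends, Label.isEnd, h₁, h₂, Ne.symm h₁, Ne.symm h₂]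
    rw [h₁, main, Bool.not_not, pathVal_reading_yx _ _ _ h.1, sub_self]

open Classical in
/-- The function of trees with two dotted edges that a form determines. -/
noncomputable def realize (Θ : FourForm H M) (T : Tree H) : M :=
  if h : ∃ e e', T.HasEdges e e' then
    reading (leftForm Θ) h.choose true h.choose_spec.choose true T
  else 0

theorem IsBalanced.realize_eq (hΘ : IsBalanced Θ) (h : T.HasEdges e e') :
    realize Θ T = reading (leftForm Θ) e true e' true T := by
  have hex : ∃ e e', T.HasEdges e e' := ⟨e, e', h⟩
  rw [realize, dif_pos hex]
  have key (a a' : ℕ) (h' : T.HasEdges a a') : reading (leftForm Θ) a true a' true T =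
      reading (leftForm Θ) e true e' true T := by
    rcases h.eq_or h' with ⟨rfl, rfl⟩ | ⟨rfl, rfl⟩
    · rfl
    · exact hΘ.reading_swap h _ _
  exact key _ _ hex.choose_spec.choose_spec

theorem realize_eq_zero (h : ¬ ∃ e e', T.HasEdges e e') : realize Θ T = 0 := by
  rw [realize, dif_neg h]

theorem HasEdges_congr {T T' : Tree H} (h : ∀ a s, T.ends a s = T'.ends a s)
    (hT : T.HasEdges e e') : T'.HasEdges e e' := ⟨hT.1, fun a s => by rw [← h, hT.2]⟩

/-- The function of trees that a balanced form determines satisfies all relations. Reversal of a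
dotted edge is compatible by `reading_not_left` and `reading_not_right`, and the choice of the edge
along which colors are read does not matter by `reading_swap`. -/
theorem IsBalanced.isInvariant_realize (hΘ : IsBalanced Θ) : IsInvariant (realize Θ) where
  rotate A B C := by
    by_cases h : ∃ e e', Tree.HasEdges ⟨A, B, C⟩ e e'
    · obtain ⟨e, e', h⟩ := h
      have h' : Tree.HasEdges ⟨B, C, A⟩ e e' :=
        HasEdges_congr (fun a s => by simp [Tree.ends]; omega) h
      rw [hΘ.realize_eq h, hΘ.realize_eq h', (isLocal_reading _ _ _ _ _).rotate]
    · rw [realize_eq_zero h, realize_eq_zero fun ⟨e, e', h'⟩ => h ⟨e, e',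
        HasEdges_congr (fun a s => by simp [Tree.ends]; omega) h'⟩]
  rebase A B C D := by
    by_cases h : ∃ e e', Tree.HasEdges ⟨A, B, .node C D⟩ e e'
    · obtain ⟨e, e', h⟩ := h
      have h' : Tree.HasEdges ⟨.node A B, C, D⟩ e e' :=
        HasEdges_congr (fun a s => by simp [Tree.ends, RTree.ends]; omega) h
      rw [hΘ.realize_eq h, hΘ.realize_eq h', (isLocal_reading _ _ _ _ _).rebase]
    · rw [realize_eq_zero h, realize_eq_zero fun ⟨e, e', h'⟩ => h ⟨e, e',
        HasEdges_congr (fun a s => by simp [Tree.ends, RTree.ends]; omega) h'⟩]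
  ihx A B C D := by
    by_cases h : ∃ e e', Tree.HasEdges ⟨A, B, .node C D⟩ e e'
    · obtain ⟨e, e', h⟩ := h
      have h₁ : Tree.HasEdges ⟨.node D A, B, C⟩ e e' :=
        HasEdges_congr (fun a s => by simp [Tree.ends, RTree.ends]; omega) h
      have h₂ : Tree.HasEdges ⟨.node D B, A, C⟩ e e' :=
        HasEdges_congr (fun a s => by simp [Tree.ends, RTree.ends]; omega) h
      rw [hΘ.realize_eq h, hΘ.realize_eq h₁, hΘ.realize_eq h₂, (isLocal_reading _ _ _ _ _).ihx]
    · rw [realize_eq_zero h, realize_eq_zero fun ⟨e, e', h'⟩ => h ⟨e, e',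
        HasEdges_congr (fun a s => by simp [Tree.ends, RTree.ends]; omega) h'⟩,
        realize_eq_zero fun ⟨e, e', h'⟩ => h ⟨e, e',
        HasEdges_congr (fun a s => by simp [Tree.ends, RTree.ends]; omega) h'⟩]
      simp
  as A B C := by
    by_cases h : ∃ e e', Tree.HasEdges ⟨A, B, C⟩ e e'
    · obtain ⟨e, e', h⟩ := h
      have h' : Tree.HasEdges ⟨B, A, C⟩ e e' :=
        HasEdges_congr (fun a s => by simp [Tree.ends]; omega) h
      rw [hΘ.realize_eq h, hΘ.realize_eq h', (isLocal_reading _ _ _ _ _).as]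
    · rw [realize_eq_zero h, realize_eq_zero fun ⟨e, e', h'⟩ => h ⟨e, e',
        HasEdges_congr (fun a s => by simp [Tree.ends]; omega) h'⟩, add_zero]
  add a b B C := by
    by_cases h : ∃ e e', Tree.HasEdges ⟨.leaf (.hair (a + b)), B, C⟩ e e'
    · obtain ⟨e, e', h⟩ := h
      have h₁ : Tree.HasEdges ⟨.leaf (.hair a), B, C⟩ e e' := HasEdges_congr (fun a s => rfl) h
      have h₂ : Tree.HasEdges ⟨.leaf (.hair b), B, C⟩ e e' := HasEdges_congr (fun a s => rfl) h
      rw [hΘ.realize_eq h, hΘ.realize_eq h₁, hΘ.realize_eq h₂, (isLocal_reading _ _ _ _ _).add]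
    · rw [realize_eq_zero h, realize_eq_zero (T := ⟨.leaf (.hair a), B, C⟩)
          fun ⟨e, e', h'⟩ => h ⟨e, e', HasEdges_congr (fun a s => rfl) h'⟩,
        realize_eq_zero (T := ⟨.leaf (.hair b), B, C⟩)
          fun ⟨e, e', h'⟩ => h ⟨e, e', HasEdges_congr (fun a s => rfl) h'⟩, add_zero]
  smul c a B C := by
    by_cases h : ∃ e e', Tree.HasEdges ⟨.leaf (.hair (c • a)), B, C⟩ e e'
    · obtain ⟨e, e', h⟩ := h
      have h₁ : Tree.HasEdges ⟨.leaf (.hair a), B, C⟩ e e' := HasEdges_congr (fun a s => rfl) h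
      rw [hΘ.realize_eq h, hΘ.realize_eq h₁, (isLocal_reading _ _ _ _ _).smul]
    · rw [realize_eq_zero h, realize_eq_zero (T := ⟨.leaf (.hair a), B, C⟩)
          fun ⟨e, e', h'⟩ => h ⟨e, e', HasEdges_congr (fun a s => rfl) h'⟩, smul_zero]
  support T h := by
    by_contra hc
    exact h (realize_eq_zero hc)
  rename σ T := by
    by_cases h : ∃ e e', T.HasEdges e e'
    · obtain ⟨e, e', h⟩ := h
      rw [hΘ.realize_eq h, hΘ.realize_eq (h.rename σ), reading_rename]
    · rw [realize_eq_zero h, realize_eq_zero]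
      rintro ⟨e, e', h'⟩
      have := h'.rename σ.symm
      rw [Tree.mapLabel_rename_symm] at this
      exact h ⟨_, _, this⟩
  flip d T hd := by
    by_cases h : ∃ e e', T.HasEdges e e'
    · obtain ⟨e, e', h⟩ := h
      rw [hΘ.realize_eq h, hΘ.realize_eq (h.flip d)]
      have hd' : d = e ∨ d = e' := by
        by_contra hc
        rw [h.2] at hd
        simp [hc] at hd
      rcases hd' with rfl | rfl
      · rw [reading_flip_left, hΘ.reading_not_left h]
      · rw [reading_flip_right _ _ _ h.1, h.reading_not_right]
    · rw [realize_eq_zero h, realize_eq_zero, neg_zero]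
      rintro ⟨e, e', h'⟩
      refine h ⟨e, e', h'.1, fun a s => ?_⟩
      have := h'.2 a (if a = d then !s else s)
      rw [Tree.ends_mapLabel_flip] at this
      by_cases ha : a = d <;> simpa [ha] using this

/-- The form is recovered from the values on the theta graphs, so that balanced forms and invariant
functions correspond to each other. -/
theorem IsBalanced.realize_thetaGraph (hΘ : IsBalanced Θ) (t u v w : List H) :
    realize Θ ((thetaGraph t u v w).tree 0) =
      Θ (pureTensor t) (pureTensor u) (pureTensor v) (pureTensor w) := by
  have h₁ : ((thetaGraph t u v w).tree 0).HasEdges 0 1 := by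
    refine ⟨zero_ne_one, fun a s => ?_⟩
    have := (thetaGraph t u v w).sum_ends a s
    simpa [thetaGraph] using this
  rw [hΘ.realize_eq h₁, (isLocal_reading _ _ _ _ _).thetaGraph,
    (isLocal_reading _ _ _ _ _).pathVal_thetaPath_of_word hΘ (c := 1) fun α β γ => by
      exact (pathVal_reading_xy (leftForm Θ) true true zero_ne_one α β γ).trans
        (by rw [one_smul, leftForm_apply])]
  simp

end Realization

/-! ### Iterated joining of tripods -/

section Joining

variable {H : Type*}

/-- The labels of the univalent vertices of a tripod, in cyclic order. -/
abbrev Tripod (H : Type*) := Label H × Label H × Label H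

/-- The tripod as a tree. -/
def Tripod.tree (v : Tripod H) : Tree H := ⟨.leaf v.1, .leaf v.2.1, .leaf v.2.2⟩

/-- The number of univalent vertices of a tripod labeled by the end `s` of `e`. -/
def Tripod.ends (e : ℕ) (s : Bool) (v : Tripod H) : ℕ :=
  v.1.isEnd e s + v.2.1.isEnd e s + v.2.2.isEnd e s

theorem Tripod.ends_tree (e : ℕ) (s : Bool) (v : Tripod H) : v.tree.ends e s = v.ends e s := rfl

section

variable {M : Type*} [AddCommGroup M] [Module ℚ M]

/-- The value of `f` on the tree obtained from `T` by gluing it to `R` with an extra univalent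
vertex labeled `l` at its root, along the dotted edge that ends in `l`.  It comes with the sign of
the end of this dotted edge in `T`, and is `0` if there is no such end. -/
def joinAt (f : Tree H → M) (l : Label H) (R : RTree H) (T : Tree H) : M :=
  match l with
  | .hair _ => 0
  | .dotted e s => if T.ends e (!s) = 0 then 0 else endSign (!s) • f (T.subst e (!s) R)

/-- The sum of the values of `f` over all ways of gluing `T` to the tripod `v`. -/
def joinTripod (f : Tree H → M) (v : Tripod H) (T : Tree H) : M :=
  joinAt f v.1 (.node (.leaf v.2.1) (.leaf v.2.2)) T +
    joinAt f v.2.1 (.node (.leaf v.2.2) (.leaf v.1)) T +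
    joinAt f v.2.2 (.node (.leaf v.1) (.leaf v.2.1)) T

/-- The sum of the values of `f` over all ways of gluing `T` to the tripods in a list, one after
the other. -/
def joinAll (f : Tree H → M) : List (Tripod H) → Tree H → M
  | [], T => f T
  | v :: L, T => joinTripod (joinAll f L) v T

/-- The sum over all dotted edges between `T` and a tripod in the definition of `β`. -/
theorem sum_glue_tripod (f : Tree H → M) (v : Tripod H) (T : Tree H) (E : Finset ℕ)
    (hv : ∀ e s, v.ends e s ≤ 1) (hE : ∀ e s, v.ends e s ≠ 0 → e ∈ E) :
    ∑ e ∈ E, ((Tree.glue e true T v.tree).elim 0 f - (Tree.glue e false T v.tree).elim 0 f) =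
      joinTripod f v T := by
  set J : Label H → RTree H → ℕ → Bool → M := fun l R e s =>
    if l.isEnd e (!s) = 1 then (if T.ends e s = 0 then 0 else f (T.subst e s R)) else 0 with hJ
  have h₁ (e : ℕ) (s : Bool) : (Tree.glue e s T v.tree).elim 0 f =
      J v.1 (.node (.leaf v.2.1) (.leaf v.2.2)) e s + J v.2.1 (.node (.leaf v.2.2) (.leaf v.1)) e s +
        J v.2.2 (.node (.leaf v.1) (.leaf v.2.1)) e s := by
    have h := hv e (!s)
    simp only [Tripod.ends] at h
    simp only [hJ, Tree.glue, Tripod.tree, Tree.rootAt, RTree.reroot]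
    rcases v.1.isEnd_le e (!s) with h₁ | h₁ <;> rcases v.2.1.isEnd_le e (!s) with h₂ | h₂ <;>
      rcases v.2.2.isEnd_le e (!s) with h₃ | h₃ <;> simp only [h₁, h₂, h₃] at h ⊢ <;>
      first
      | omega
      | by_cases hT : T.ends e s = 0 <;> simp [hT]
  have h₂ (l : Label H) (R : RTree H) (hl : ∀ e s, l.isEnd e s ≠ 0 → e ∈ E) :
      ∑ e ∈ E, (J l R e true - J l R e false) = joinAt f l R T := by
    cases l with
    | hair a => simp [hJ, joinAt, Label.isEnd]
    | dotted d b =>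
      rw [Finset.sum_eq_single_of_mem d (hl d b (by simp [Label.isEnd])) fun e _ he => by
        simp [hJ, Label.isEnd, he.symm]]
      cases b
      · by_cases hT : T.ends d true = 0 <;> simp [hJ, joinAt, Label.isEnd, hT]
      · by_cases hT : T.ends d false = 0 <;> simp [hJ, joinAt, Label.isEnd, hT]
  simp only [h₁, joinTripod]
  rw [← h₂ _ _ fun e s h => hE e s fun h' => h (by simp only [Tripod.ends] at h'; omega),
    ← h₂ _ _ fun e s h => hE e s fun h' => h (by simp only [Tripod.ends] at h'; omega),
    ← h₂ _ _ fun e s h => hE e s fun h' => h (by simp only [Tripod.ends] at h'; omega),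
    ← Finset.sum_add_distrib, ← Finset.sum_add_distrib]
  exact Finset.sum_congr rfl fun e _ => by abel

theorem HairyLieGraph.glue_cases {k r : ℕ} (X : HairyLieGraph H (k + 2) (r + 1)) (e : ℕ)
    (s : Bool) : (Tree.glue e s (X.tree 0) (X.tree 1) = none ∧ X.glue e s = none) ∨
      ∃ Y : HairyLieGraph H (k + 1) r, X.glue e s = some Y ∧
        Tree.glue e s (X.tree 0) (X.tree 1) = some (Y.tree 0) ∧
        ∀ j : Fin k, Y.tree j.succ = X.tree j.succ.succ := by
  unfold HairyLieGraph.glue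
  split
  · rename_i h; exact .inl ⟨h, rfl⟩
  · rename_i T h; exact .inr ⟨_, rfl, h, fun j => rfl⟩

/-- Iterating `β` on a graph whose trees, except possibly the first one, are tripods amounts to
joining these tripods one after the other. -/
theorem lift_betaIter {r : ℕ} {g : HairyLieGraph H 1 r → M} {f : Tree H → M}
    (hgf : ∀ X, g X = f (X.tree 0)) {j : ℕ} (X : HairyLieGraph H (j + 1) (r + j))
    (v : Fin j → Tripod H) (hv : ∀ i, X.tree i.succ = (v i).tree) :
    Finsupp.lift M ℚ _ g (betaIter H r j X.of) = joinAll f (List.ofFn v) (X.tree 0) := by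
  induction j with
  | zero => simp [betaIter, HairyLieGraph.of, hgf, joinAll]
  | succ j ih =>
    have h₁ (e : ℕ) (s : Bool) :
        Finsupp.lift M ℚ _ g (betaIter H r j ((X.glue e s).elim 0 HairyLieGraph.of)) =
          (Tree.glue e s (X.tree 0) (v 0).tree).elim 0
            (joinAll f (List.ofFn fun i => v i.succ)) := by
      have h0 : X.tree 1 = (v 0).tree := hv 0
      rcases X.glue_cases e s with ⟨h, h'⟩ | ⟨Y, h, h', hY⟩
      · rw [h', ← h0, h]; simp
      · rw [h, ← h0, h']
        exact ih Y _ fun i => by rw [hY, hv]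
    rw [List.ofFn_succ, joinAll, ← sum_glue_tripod _ _ _ X.edges]
    · simp only [← h₁, betaIter, LinearMap.comp_apply, beta, HairyLieGraph.of]
      simp [Finsupp.lift_apply, Finsupp.sum_single_index, map_sum, map_sub]
    · intro e s
      have h := X.sum_ends e s
      rw [← Tripod.ends_tree, ← hv]
      refine (Finset.single_le_sum (f := fun j => (X.tree j).ends e s) (fun _ _ => Nat.zero_le _)
        (Finset.mem_univ (Fin.succ 0))).trans ?_
      rw [h]; split <;> omega
    · intro e s hne
      by_contra hc
      have h := X.sum_ends e s
      rw [if_neg hc, Finset.sum_eq_zero_iff] at h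
      rw [← Tripod.ends_tree, ← hv] at hne
      exact hne (h _ (Finset.mem_univ _))

end

end Joining

section JoinLocal

variable {H : Type*} [AddCommGroup H] [Module ℚ H] {M : Type*} [AddCommGroup M] [Module ℚ M]
  {f : Tree H → M}

theorem IsLocal.zero : IsLocal fun _ : Tree H => (0 : M) where
  rotate _ _ _ := rfl
  rebase _ _ _ _ := rfl
  ihx _ _ _ _ := by simp
  as _ _ _ := by simp
  add _ _ _ _ := by simp
  smul _ _ _ _ := by simp

theorem IsLocal.subst (hf : IsLocal f) (e : ℕ) (s : Bool) (R : RTree H) :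
    IsLocal fun T => f (T.subst e s R) where
  rotate A B C := hf.rotate _ _ _
  rebase A B C D := hf.rebase _ _ _ _
  ihx A B C D := hf.ihx _ _ _ _
  as A B C := hf.as _ _ _
  add a b B C := by simpa [Tree.subst, RTree.subst, Label.isEnd] using hf.add a b _ _
  smul c a B C := by simpa [Tree.subst, RTree.subst, Label.isEnd] using hf.smul c a _ _

theorem IsLocal.ite_ends (hf : IsLocal f) (e : ℕ) (s : Bool) :
    IsLocal fun T => if T.ends e s = 0 then 0 else f T where
  rotate A B C := by
    rw [hf.rotate]; congr 2; simp [Tree.ends]; omega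
  rebase A B C D := by
    rw [hf.rebase]; congr 2; simp [Tree.ends, RTree.ends]; omega
  ihx A B C D := by
    have h := hf.ihx A B C D
    have h₁ : Tree.ends e s ⟨.node D A, B, C⟩ = Tree.ends e s ⟨A, B, .node C D⟩ := by
      simp [Tree.ends, RTree.ends]; omega
    have h₂ : Tree.ends e s ⟨.node D B, A, C⟩ = Tree.ends e s ⟨A, B, .node C D⟩ := by
      simp [Tree.ends, RTree.ends]; omega
    simp only [h₁, h₂]
    split_ifs
    · simp
    · exact h
  as A B C := by
    have h₁ : Tree.ends e s ⟨B, A, C⟩ = Tree.ends e s ⟨A, B, C⟩ := by simp [Tree.ends]; omega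
    simp only [h₁]
    split_ifs
    · simp
    · exact hf.as A B C
  add a b B C := by
    have h₁ : Tree.ends e s ⟨.leaf (.hair (a + b)), B, C⟩ =
      Tree.ends e s ⟨.leaf (.hair a), B, C⟩ := rfl
    have h₂ : Tree.ends e s ⟨.leaf (.hair b), B, C⟩ =
      Tree.ends e s ⟨.leaf (.hair a), B, C⟩ := rfl
    simp only [h₁, h₂]
    split_ifs
    · simp
    · exact hf.add a b B C
  smul c a B C := by
    have h₁ : Tree.ends e s ⟨.leaf (.hair (c • a)), B, C⟩ =
      Tree.ends e s ⟨.leaf (.hair a), B, C⟩ := rfl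
    simp only [h₁]
    split_ifs
    · simp
    · exact hf.smul c a B C

theorem IsLocal.joinAt (hf : IsLocal f) (l : Label H) (R : RTree H) :
    IsLocal (joinAt f l R) := by
  cases l with
  | hair a => exact IsLocal.zero
  | dotted e s => exact ((hf.subst e (!s) R).const_smul (endSign (!s))).ite_ends e (!s)

theorem IsLocal.joinTripod (hf : IsLocal f) (v : Tripod H) : IsLocal (joinTripod f v) :=
  ((hf.joinAt _ _).add' (hf.joinAt _ _)).add' (hf.joinAt _ _)

theorem IsLocal.joinAll (hf : IsLocal f) (L : List (Tripod H)) : IsLocal (joinAll f L) := by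
  induction L with
  | nil => exact hf
  | cons v L ih => exact ih.joinTripod v

end JoinLocal

/-! ### Joining a tripod along two or three dotted edges -/

section Colors

variable {H : Type*} [AddCommGroup H] [Module ℚ H] {M : Type*} [AddCommGroup M] [Module ℚ M]

/-- The element of the free Lie algebra that a rooted tree represents, in the tensor algebra.  Ends
of dotted edges are evaluated as zero. -/
noncomputable def lieVal : RTree H → TensorAlgebra ℚ H :=
  ringVal fun l => match l with
    | .hair a => TensorAlgebra.ι ℚ a
    | .dotted _ _ => 0

theorem lieVal_hair (a : H) : lieVal (.leaf (.hair a)) = TensorAlgebra.ι ℚ a := rfl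

theorem lieVal_dotted (e : ℕ) (s : Bool) : lieVal (.leaf (.dotted e s) : RTree H) = 0 := rfl

theorem lieVal_node (A B : RTree H) :
    lieVal (.node A B) = lieVal A * lieVal B - lieVal B * lieVal A := rfl

theorem antipode_lieVal (R : RTree H) : antipode (lieVal R) = -lieVal R := by
  induction R with
  | leaf l =>
    cases l with
    | hair a => simp [lieVal_hair]
    | dotted e s => exact (map_zero antipodeₗ).trans (by simp [lieVal_dotted])
  | node A B hA hB => simp [lieVal_node, hA, hB]

theorem mid_lieVal_mul (Θ : FourForm H M) (R : RTree H) (m t u v w : TensorAlgebra ℚ H) :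
    mid Θ (lieVal R * m) t u v w =
      mid Θ m (t * lieVal R) u v w - mid Θ m t (lieVal R * u) v w := by
  induction R generalizing m t u with
  | leaf l =>
    cases l with
    | hair a => exact mid_ι_mul Θ a m t u v w
    | dotted e s => simp [lieVal_dotted]
  | node A B hA hB =>
    simp only [lieVal_node, sub_mul, mul_sub, map_sub, LinearMap.sub_apply, mul_assoc, hA, hB]
    abel

theorem IsBalanced.mid_mul_lieVal {Θ : FourForm H M} (hΘ : IsBalanced Θ) (R : RTree H)
    (m t u v w : TensorAlgebra ℚ H) : mid Θ (m * lieVal R) t u v w =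
      mid Θ m t u (lieVal R * v) w - mid Θ m t u v (w * lieVal R) := by
  induction R generalizing m v w with
  | leaf l =>
    cases l with
    | hair a => exact hΘ.mid_mul_ι a m t u v w
    | dotted e s => simp [lieVal_dotted]
  | node A B hA hB =>
    simp only [lieVal_node, sub_mul, mul_sub, map_sub, LinearMap.sub_apply, ← mul_assoc, hA, hB]
    abel

/-- The product of the elements represented by a list of rooted trees. -/
noncomputable def listLieVal (Rs : List (RTree H)) : TensorAlgebra ℚ H := (Rs.map lieVal).prod

theorem listLieVal_append (Rs Ss : List (RTree H)) :
    listLieVal (Rs ++ Ss) = listLieVal Rs * listLieVal Ss := by simp [listLieVal]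

theorem listLieVal_cons (R : RTree H) (Rs : List (RTree H)) :
    listLieVal (R :: Rs) = lieVal R * listLieVal Rs := by simp [listLieVal]

@[simp] theorem listLieVal_nil : listLieVal ([] : List (RTree H)) = 1 := rfl

@[simp] theorem listLieVal_hairs (t : List H) : listLieVal (hairs t) = pureTensor t := by
  simp only [listLieVal, hairs, List.map_map, pureTensor]
  rfl

/-- A function of lists of rooted trees without dotted ends that satisfies the IHX relation is
determined by its values on lists of colors. -/
theorem eq_of_hairs {g : List (RTree H) → M} (G : TensorAlgebra ℚ H →ₗ[ℚ] M)
    (ihx : ∀ Ls A B Rs, g (Ls ++ .node A B :: Rs) = g (Ls ++ A :: B :: Rs) - g (Ls ++ B :: A :: Rs))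
    (h : ∀ t, g (hairs t) = G (pureTensor t)) (Rs : List (RTree H))
    (hRs : ∀ a b, listEnds a b Rs = 0) : g Rs = G (listLieVal Rs) := by
  rw [← sub_eq_zero]
  refine list_eq_zero_of_leaves (P := fun Rs => ∀ a b, listEnds a b Rs = 0)
    (g := fun Rs => g Rs - G (listLieVal Rs)) (fun Ls A B Rs hP => ?_) (fun Ls A B Rs hP => ?_)
    (fun w hw => ?_) Rs hRs
  · constructor <;> intro a b <;> rw [← hP a b] <;> simp [RTree.ends] <;> omega
  · simp only [ihx, listLieVal_append, listLieVal_cons, lieVal_node, sub_mul, mul_sub, map_sub,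
      mul_assoc]
    abel
  · obtain ⟨t, ht⟩ := exists_hairs_of_listEnds w hw
    simp only [ht, h, listLieVal_hairs, sub_self]

/-- The value of a local function on a word with two separators, with rooted trees in place of
colors. -/
theorem IsLocal.pathVal_of_word {f : Tree H → M} (hf : IsLocal f) (ψ : ThreeForm H M)
    {Z Y E E' : RTree H}
    (h : ∀ α β γ : List H, pathVal f Z (hairs α ++ E :: (hairs β ++ E' :: hairs γ)) Y =
      ψ (pureTensor γ) (pureTensor β) (pureTensor α)) {As Bs Cs : List (RTree H)}
    (hA : ∀ a b, listEnds a b As = 0) (hB : ∀ a b, listEnds a b Bs = 0)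
    (hC : ∀ a b, listEnds a b Cs = 0) : pathVal f Z (As ++ E :: (Bs ++ E' :: Cs)) Y =
      ψ (listLieVal Cs) (listLieVal Bs) (listLieVal As) := by
  refine eq_of_hairs (ψ (listLieVal Cs) (listLieVal Bs))
    (g := fun As => pathVal f Z (As ++ E :: (Bs ++ E' :: Cs)) Y) (fun Ls A B Rs => by
      simpa using hf.pathVal_ihx Z Ls A B (Rs ++ E :: (Bs ++ E' :: Cs)) Y) (fun α => ?_) As hA
  refine eq_of_hairs ((ψ (listLieVal Cs)).flip (pureTensor α))
    (g := fun Bs => pathVal f Z (hairs α ++ E :: (Bs ++ E' :: Cs)) Y) (fun Ls A B Rs => by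
      simpa using hf.pathVal_ihx Z (hairs α ++ E :: Ls) A B (Rs ++ E' :: Cs) Y) (fun β => ?_) Bs hB
  refine eq_of_hairs ((ψ.flip (pureTensor β)).flip (pureTensor α))
    (g := fun Cs => pathVal f Z (hairs α ++ E :: (hairs β ++ E' :: Cs)) Y) (fun Ls A B Rs => by
      simpa using hf.pathVal_ihx Z (hairs α ++ E :: (hairs β ++ E' :: Ls)) A B Rs Y)
    (fun γ => ?_) Cs hC
  exact h α β γ

end Colors

section Subst

variable {H : Type*}

theorem RTree.subst_of_ends {e : ℕ} {s : Bool} {A : RTree H} (h : A.ends e s = 0) (R : RTree H) :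
    A.subst e s R = A := by
  induction A with
  | leaf l => simp only [RTree.ends] at h; simp [RTree.subst, h]
  | node A B hA hB =>
    simp only [RTree.ends, Nat.add_eq_zero_iff] at h
    simp [RTree.subst, hA h.1, hB h.2]

theorem map_subst_of_listEnds {e : ℕ} {s : Bool} {Rs : List (RTree H)} (h : listEnds e s Rs = 0)
    (R : RTree H) : Rs.map (fun A => A.subst e s R) = Rs := by
  induction Rs with
  | nil => rfl
  | cons A Rs ih =>
    simp only [listEnds_cons, Nat.add_eq_zero_iff] at h
    simp [RTree.subst_of_ends h.1, ih h.2]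

theorem map_subst_hairs (e : ℕ) (s : Bool) (t : List H) (R : RTree H) :
    (hairs t).map (fun A => A.subst e s R) = hairs t :=
  map_subst_of_listEnds (listEnds_hairs e s t) R

theorem RTree.subst_dotted (d : ℕ) (b : Bool) (e : ℕ) (s : Bool) (R : RTree H) :
    (RTree.leaf (.dotted d b)).subst e s R = if d = e ∧ b = s then R else .leaf (.dotted d b) := by
  by_cases h : d = e ∧ b = s <;> simp [RTree.subst, Label.isEnd, h]

theorem pathVal_subst {M : Type*} [Zero M] (f : Tree H → M) (e : ℕ) (s : Bool) (R Z : RTree H)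
    (Rs : List (RTree H)) (Y : RTree H) : pathVal (fun T => f (T.subst e s R)) Z Rs Y =
      pathVal f (Z.subst e s R) (Rs.map fun A => A.subst e s R) (Y.subst e s R) := by
  have h (Rs : List (RTree H)) : (comb Rs Y).subst e s R =
      comb (Rs.map fun A => A.subst e s R) (Y.subst e s R) := by
    induction Rs with
    | nil => rfl
    | cons R Rs ih => simp only [comb, List.foldr_cons] at ih ⊢; simp [RTree.subst, ih]
  cases Rs with
  | nil => rfl
  | cons R Rs => simp [pathVal, Tree.subst, h]

variable {M : Type*} [AddCommGroup M] [Module ℚ M]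

theorem pathVal_smul_fun (c : ℚ) (f : Tree H → M) (Z : RTree H) (Rs : List (RTree H))
    (Y : RTree H) : pathVal (fun T => c • f T) Z Rs Y = c • pathVal f Z Rs Y := by
  cases Rs <;> simp [pathVal]

/-- Joining a tree along its ends `s₁` of `e₁` and `s₂` of `e₂` to a tripod that has the other
ends of these dotted edges and a third branch `K`. -/
def join₂ (f : Tree H → M) (e₁ : ℕ) (s₁ : Bool) (e₂ : ℕ) (s₂ : Bool) (K : RTree H)
    (T : Tree H) : M :=
  endSign s₁ • f (T.subst e₁ s₁ (.node (.leaf (.dotted e₂ (!s₂))) K)) +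
    endSign s₂ • f (T.subst e₂ s₂ (.node K (.leaf (.dotted e₁ (!s₁)))))

/-- Joining a tree along three ends of dotted edges to a tripod that has the other ends. -/
def join₃ (f : Tree H → M) (e₁ : ℕ) (s₁ : Bool) (e₂ : ℕ) (s₂ : Bool) (e₃ : ℕ) (s₃ : Bool)
    (T : Tree H) : M :=
  endSign s₁ • f (T.subst e₁ s₁ (.node (.leaf (.dotted e₂ (!s₂))) (.leaf (.dotted e₃ (!s₃))))) +
    endSign s₂ • f (T.subst e₂ s₂ (.node (.leaf (.dotted e₃ (!s₃))) (.leaf (.dotted e₁ (!s₁))))) +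
    endSign s₃ • f (T.subst e₃ s₃ (.node (.leaf (.dotted e₁ (!s₁))) (.leaf (.dotted e₂ (!s₂)))))

/-- Joining a tree along its end `s₁` of `e₁` to a tripod two of whose univalent vertices are the
ends of the dotted edge `e₂`. -/
def joinLoop (f : Tree H → M) (e₁ : ℕ) (s₁ : Bool) (e₂ : ℕ) (s₂ : Bool) (T : Tree H) : M :=
  f (T.subst e₁ s₁ (.node (.leaf (.dotted e₂ s₂)) (.leaf (.dotted e₂ (!s₂)))))

end Subst

section Values

variable {H : Type*} [AddCommGroup H] [Module ℚ H] {M : Type*} [AddCommGroup M] [Module ℚ M]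
  {f : Tree H → M} {Θ : FourForm H M}

theorem IsLocal.join₂ (hf : IsLocal f) (e₁ : ℕ) (s₁ : Bool) (e₂ : ℕ) (s₂ : Bool) (K : RTree H) :
    IsLocal (join₂ f e₁ s₁ e₂ s₂ K) :=
  ((hf.subst _ _ _).const_smul _).add' ((hf.subst _ _ _).const_smul _)

theorem IsLocal.join₃ (hf : IsLocal f) (e₁ : ℕ) (s₁ : Bool) (e₂ : ℕ) (s₂ : Bool) (e₃ : ℕ)
    (s₃ : Bool) : IsLocal (join₃ f e₁ s₁ e₂ s₂ e₃ s₃) :=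
  (((hf.subst _ _ _).const_smul _).add' ((hf.subst _ _ _).const_smul _)).add'
    ((hf.subst _ _ _).const_smul _)

theorem IsLocal.joinLoop (hf : IsLocal f) (e₁ : ℕ) (s₁ : Bool) (e₂ : ℕ) (s₂ : Bool) :
    IsLocal (joinLoop f e₁ s₁ e₂ s₂) := hf.subst _ _ _

theorem IsInvariant.pathVal_word (hf : IsInvariant f)
    (hΘ : ∀ t u v w, f ((thetaGraph t u v w).tree 0) =
      Θ (pureTensor t) (pureTensor u) (pureTensor v) (pureTensor w))
    {e e' : ℕ} (hne : e ≠ e') (s s' : Bool) {As Bs Cs : List (RTree H)}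
    (hA : ∀ a b, listEnds a b As = 0) (hB : ∀ a b, listEnds a b Bs = 0)
    (hC : ∀ a b, listEnds a b Cs = 0) :
    pathVal f (.leaf (.dotted e s)) (As ++ .leaf (.dotted e' s') ::
      (Bs ++ .leaf (.dotted e' (!s')) :: Cs)) (.leaf (.dotted e (!s))) =
      (endSign s * endSign s') • mid Θ (listLieVal Bs) (listLieVal As) 1 (listLieVal Cs) 1 := by
  refine hf.toIsLocal.pathVal_of_word ((endSign s * endSign s') • leftForm Θ)
    (fun α β γ => ?_) hA hB hC
  have := hf.pathVal_thetaPath hΘ hne s s' α [] β γ []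
  simpa [thetaPath, hairsLeft, hairsRight, leftForm_apply] using this

/-- The value of `join₂` on a word with two separators. -/
theorem IsInvariant.pathVal_join₂ (hf : IsInvariant f) (hb : IsBalanced Θ)
    (hΘ : ∀ t u v w, f ((thetaGraph t u v w).tree 0) =
      Θ (pureTensor t) (pureTensor u) (pureTensor v) (pureTensor w))
    {e e₁ e₂ : ℕ} (h₁ : e ≠ e₁) (h₂ : e ≠ e₂) (h₁₂ : e₁ ≠ e₂) (s s₁ s₂ : Bool) {K : RTree H}
    (hK : ∀ a b, K.ends a b = 0) (α β γ : List H) :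
    pathVal (join₂ f e₁ s₁ e₂ s₂ K) (.leaf (.dotted e s)) (hairs α ++ .leaf (.dotted e₁ s₁) ::
      (hairs β ++ .leaf (.dotted e₂ s₂) :: hairs γ)) (.leaf (.dotted e (!s))) =
      endSign s • (endSign s₁ * endSign s₂) •
        slide Θ (lieVal K) (pureTensor α) (pureTensor β) (pureTensor γ) ∧
    pathVal (join₂ f e₁ s₁ e₂ s₂ K) (.leaf (.dotted e s)) (hairs α ++ .leaf (.dotted e₂ s₂) ::
      (hairs β ++ .leaf (.dotted e₁ s₁) :: hairs γ)) (.leaf (.dotted e (!s))) =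
      -(endSign s • (endSign s₁ * endSign s₂) •
        slide Θ (lieVal K) (pureTensor α) (pureTensor β) (pureTensor γ)) := by
  have key (d : ℕ) (b : Bool) (hd : e ≠ d) {As Bs Cs : List (RTree H)}
      (hA : ∀ a b, listEnds a b As = 0) (hB : ∀ a b, listEnds a b Bs = 0)
      (hC : ∀ a b, listEnds a b Cs = 0) := hf.pathVal_word hΘ hd s b hA hB hC
  have hK' : ∀ a b, listEnds a b [K] = 0 := fun a b => by simp [hK]
  constructor
  · have a₁ := key e₂ (!s₂) h₂ (As := hairs α) (Bs := K :: hairs β) (Cs := hairs γ)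
      (by simp) (by simp [hK]) (by simp)
    have a₂ := key e₂ (!s₂) h₂ (As := hairs α ++ [K]) (Bs := hairs β) (Cs := hairs γ)
      (by simp [hK]) (by simp) (by simp)
    have a₃ := key e₁ s₁ h₁ (As := hairs α) (Bs := hairs β ++ [K]) (Cs := hairs γ)
      (by simp) (by simp [hK]) (by simp)
    have a₄ := key e₁ s₁ h₁ (As := hairs α) (Bs := hairs β) (Cs := K :: hairs γ)
      (by simp) (by simp) (by simp [hK])
    have b₁ := hf.pathVal_ihx (.leaf (.dotted e s)) (hairs α) (.leaf (.dotted e₂ (!s₂))) K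
      (hairs β ++ .leaf (.dotted e₂ s₂) :: hairs γ) (.leaf (.dotted e (!s)))
    have b₂ := hf.pathVal_ihx (.leaf (.dotted e s)) (hairs α ++ .leaf (.dotted e₁ s₁) :: hairs β)
      K (.leaf (.dotted e₁ (!s₁))) (hairs γ) (.leaf (.dotted e (!s)))
    simp only [List.append_assoc, List.cons_append, List.nil_append, Bool.not_not,
      listLieVal_cons, listLieVal_append, listLieVal_hairs, listLieVal_nil, mul_one] at a₁ a₂ a₃ a₄ b₁ b₂
    unfold HairyLie.join₂
    rw [pathVal_add_fun, pathVal_smul_fun, pathVal_smul_fun, pathVal_subst, pathVal_subst]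
    simp only [List.map_append, List.map_cons, map_subst_hairs, RTree.subst_dotted, h₁, h₂, h₁₂,
      h₁₂.symm, false_and, and_self, if_true, if_false]
    rw [b₁, b₂, a₁, a₂, a₃, a₄, mid_lieVal_mul, hb.mid_mul_lieVal, mul_one, one_mul, slide]
    cases s <;> cases s₁ <;> cases s₂ <;> simp <;> abel
  · have a₁ := key e₂ s₂ h₂ (As := hairs α) (Bs := hairs β) (Cs := K :: hairs γ)
      (by simp) (by simp) (by simp [hK])
    have a₂ := key e₂ s₂ h₂ (As := hairs α) (Bs := hairs β ++ [K]) (Cs := hairs γ)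
      (by simp) (by simp [hK]) (by simp)
    have a₃ := key e₁ (!s₁) h₁ (As := hairs α ++ [K]) (Bs := hairs β) (Cs := hairs γ)
      (by simp [hK]) (by simp) (by simp)
    have a₄ := key e₁ (!s₁) h₁ (As := hairs α) (Bs := K :: hairs β) (Cs := hairs γ)
      (by simp) (by simp [hK]) (by simp)
    have b₁ := hf.pathVal_ihx (.leaf (.dotted e s)) (hairs α ++ .leaf (.dotted e₂ s₂) :: hairs β)
      (.leaf (.dotted e₂ (!s₂))) K (hairs γ) (.leaf (.dotted e (!s)))
    have b₂ := hf.pathVal_ihx (.leaf (.dotted e s)) (hairs α)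
      K (.leaf (.dotted e₁ (!s₁))) (hairs β ++ .leaf (.dotted e₁ s₁) :: hairs γ)
      (.leaf (.dotted e (!s)))
    simp only [List.append_assoc, List.cons_append, List.nil_append, Bool.not_not,
      listLieVal_cons, listLieVal_append, listLieVal_hairs, listLieVal_nil, mul_one] at a₁ a₂ a₃ a₄ b₁ b₂
    unfold HairyLie.join₂
    rw [pathVal_add_fun, pathVal_smul_fun, pathVal_smul_fun, pathVal_subst, pathVal_subst]
    simp only [List.map_append, List.map_cons, map_subst_hairs, RTree.subst_dotted, h₁, h₂, h₁₂,
      h₁₂.symm, false_and, and_self, if_true, if_false]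
    rw [b₁, b₂, a₁, a₂, a₃, a₄, mid_lieVal_mul, hb.mid_mul_lieVal, mul_one, one_mul, slide]
    cases s <;> cases s₁ <;> cases s₂ <;> simp <;> abel

/-- The value of `joinLoop` on a word with one separator. -/
theorem IsInvariant.pathVal_joinLoop (hf : IsInvariant f)
    (hΘ : ∀ t u v w, f ((thetaGraph t u v w).tree 0) =
      Θ (pureTensor t) (pureTensor u) (pureTensor v) (pureTensor w))
    {e e₁ e₂ : ℕ} (h₁ : e ≠ e₁) (h₂ : e ≠ e₂) (s s₁ s₂ : Bool) (α γ : List H) :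
    pathVal (joinLoop f e₁ s₁ e₂ s₂) (.leaf (.dotted e s)) (hairs α ++ .leaf (.dotted e₁ s₁) ::
      hairs γ) (.leaf (.dotted e (!s))) =
      endSign s • (2 * endSign s₂) • Θ (pureTensor α) 1 (pureTensor γ) 1 := by
  have key (b : Bool) := hf.pathVal_word hΘ h₂ s b (As := hairs α) (Bs := []) (Cs := hairs γ)
      (by simp) (by simp) (by simp)
  have a₁ := key s₂
  have a₂ := key (!s₂)
  simp only [Bool.not_not, List.nil_append] at a₁ a₂
  unfold HairyLie.joinLoop
  rw [pathVal_subst]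
  simp only [List.map_append, List.map_cons, map_subst_hairs, RTree.subst_dotted, h₁,
    false_and, and_self, if_true, if_false]
  rw [hf.pathVal_ihx, a₁, a₂]
  simp only [listLieVal_nil, mid_one, listLieVal_hairs, endSign_not]
  module

/-- The value of `join₃` on a word with one separator. -/
theorem IsInvariant.pathVal_join₃ (hf : IsInvariant f) (hb : IsBalanced Θ)
    (hΘ : ∀ t u v w, f ((thetaGraph t u v w).tree 0) =
      Θ (pureTensor t) (pureTensor u) (pureTensor v) (pureTensor w))
    {e₁ e₂ e₃ : ℕ} (h₁₂ : e₁ ≠ e₂) (h₁₃ : e₁ ≠ e₃) (h₂₃ : e₂ ≠ e₃) (s₁ s₂ s₃ : Bool)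
    (α γ : List H) :
    pathVal (join₃ f e₁ s₁ e₂ s₂ e₃ s₃) (.leaf (.dotted e₁ s₁)) (hairs α ++
      .leaf (.dotted e₂ s₂) :: hairs γ) (.leaf (.dotted e₃ s₃)) =
      -(endSign s₁ * endSign s₂ * endSign s₃) • (Θ (pureTensor α) (pureTensor γ) 1 1 +
        mid Θ (antipode (pureTensor α)) 1 (pureTensor γ) 1 1 +
        mid Θ (pureTensor γ) 1 (antipode (pureTensor α)) 1 1) := by
  have a₁ := hf.pathVal_thetaPath hΘ h₂₃.symm (!s₃) (!s₂) [] [] α γ []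
  have a₂ := hf.pathVal_thetaPath hΘ h₁₃ s₁ s₃ α γ [] [] []
  have a₃ := hf.pathVal_thetaPath hΘ h₁₂ s₁ s₂ α [] γ [] []
  simp only [thetaPath, Bool.not_not, hairs, List.map_nil, List.nil_append, hairsLeft,
    hairsRight, List.foldr_nil, List.foldl_nil] at a₁ a₂ a₃
  simp only [← hairs.eq_1] at a₁ a₂ a₃
  have c₁ : mid Θ (antipode (pureTensor α)) 1 (pureTensor γ) 1 1 =
      mid Θ (pureTensor α) 1 1 (pureTensor γ) 1 := by
    rw [hb.mid_reflect₁, hb.mid_reflect₂]; simp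
  have c₂ : mid Θ (pureTensor γ) 1 (antipode (pureTensor α)) 1 1 =
      mid Θ (pureTensor γ) (pureTensor α) 1 1 1 := by
    rw [hb.mid_reflect₂]; simp
  have b₁ : pathVal f (.node (.leaf (.dotted e₂ (!s₂))) (.leaf (.dotted e₃ (!s₃))))
      (hairs α ++ .leaf (.dotted e₂ s₂) :: hairs γ) (.leaf (.dotted e₃ s₃)) =
      -pathVal f (.leaf (.dotted e₃ (!s₃))) (.leaf (.dotted e₂ (!s₂)) :: (hairs α ++
        .leaf (.dotted e₂ s₂) :: hairs γ)) (.leaf (.dotted e₃ s₃)) := by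
    rw [← hf.pathVal_cons _ _ (by simp)]
    generalize hR : hairs α ++ .leaf (.dotted e₂ s₂) :: hairs γ = Rs
    exact hf.swap₁₂ _ _ _
  have b₂ : pathVal f (.leaf (.dotted e₁ s₁)) (hairs α ++
      .node (.leaf (.dotted e₃ (!s₃))) (.leaf (.dotted e₁ (!s₁))) :: hairs γ)
        (.leaf (.dotted e₃ s₃)) = -pathVal f (.leaf (.dotted e₁ s₁)) (hairs α ++
          [hairsLeft γ (.leaf (.dotted e₃ s₃)), .leaf (.dotted e₃ (!s₃))])
            (.leaf (.dotted e₁ (!s₁))) := by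
    rw [hf.pathVal_append _ _ (by simp), hf.pathVal_append _ _ (by simp), hairsLeft_eq_comb]
    exact hf.swap₂₃ _ _ _
  have b₃ : pathVal f (.leaf (.dotted e₁ s₁)) (hairs α ++ .leaf (.dotted e₂ s₂) :: hairs γ)
      (.node (.leaf (.dotted e₁ (!s₁))) (.leaf (.dotted e₂ (!s₂)))) =
      -pathVal f (.leaf (.dotted e₁ s₁)) (hairs α ++ .leaf (.dotted e₂ s₂) ::
        (hairs γ ++ [.leaf (.dotted e₂ (!s₂))])) (.leaf (.dotted e₁ (!s₁))) := by
    have := pathVal_append_right (f := f) (.leaf (.dotted e₁ s₁)) (Ls := hairs α ++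
      .leaf (.dotted e₂ s₂) :: hairs γ) (by simp) [.leaf (.dotted e₂ (!s₂))]
      (.leaf (.dotted e₁ (!s₁)))
    rw [hf.pathVal_neg_right _ (by simp)]
    simpa [comb] using this.symm
  have c₃ : hairsLeft γ (.leaf (.dotted e₃ s₃)) = List.foldr
      (fun a A => RTree.node (.leaf (.hair a)) A) (.leaf (.dotted e₃ s₃)) γ := rfl
  rw [← c₃] at a₂
  unfold HairyLie.join₃
  rw [pathVal_add_fun, pathVal_add_fun, pathVal_smul_fun, pathVal_smul_fun, pathVal_smul_fun,
    pathVal_subst, pathVal_subst, pathVal_subst]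
  simp only [List.map_append, List.map_cons, map_subst_hairs, RTree.subst_dotted, h₁₂, h₁₃, h₂₃,
    h₁₂.symm, h₁₃.symm, h₂₃.symm, false_and, and_self, if_true, if_false]
  rw [b₁, b₂, b₃, a₁, a₂, a₃, c₁, c₂]
  simp only [pureTensor_nil, mid_one, endSign_not]
  cases s₁ <;> cases s₂ <;> cases s₃ <;> simp <;> abel

end Values

/-! ### Functions with cyclic symmetry -/

section Words

variable {H : Type*}

/-- The numbers of ends of dotted edges in a tree that has the end `s` of `e` and no other. -/
def oneEnd (e : ℕ) (s : Bool) (a : ℕ) (b : Bool) : ℕ := if a = e ∧ b = s then 1 else 0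

theorem isEnd_dotted (e : ℕ) (s : Bool) (a : ℕ) (b : Bool) :
    (Label.dotted e s : Label H).isEnd a b = oneEnd e s a b := by
  simp only [Label.isEnd, oneEnd, eq_comm]

theorem ends_leaf_dotted (e : ℕ) (s : Bool) (a : ℕ) (b : Bool) :
    (RTree.leaf (.dotted e s) : RTree H).ends a b = oneEnd e s a b := isEnd_dotted e s a b

theorem oneEnd_of_ne {e a : ℕ} (h : a ≠ e) (s b : Bool) : oneEnd e s a b = 0 := by
  simp [oneEnd, h]

@[simp] theorem oneEnd_self (e : ℕ) (s : Bool) : oneEnd e s e s = 1 := by simp [oneEnd]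

@[simp] theorem oneEnd_not_self (e : ℕ) (s : Bool) : oneEnd e s e (!s) = 0 := by simp [oneEnd]

theorem eq_of_oneEnd_ne_zero {e a : ℕ} {s b : Bool} (h : oneEnd e s a b ≠ 0) : a = e ∧ b = s := by
  by_contra hc
  simp [oneEnd, hc] at h

theorem exists_word_one {e : ℕ} {s : Bool} (w : List (Label H))
    (hw : ∀ a b, listEnds a b (w.map RTree.leaf) = oneEnd e s a b) :
    ∃ α γ, w.map RTree.leaf = hairs α ++ .leaf (.dotted e s) :: hairs γ := by
  rcases exists_first_dotted w with ⟨t, h⟩ | ⟨t, e₁, s₁, w₁, h⟩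
  · have := hw e s
    rw [h] at this
    simp at this
  · rw [h] at hw ⊢
    simp only [listEnds_append, listEnds_hairs, listEnds_cons, ends_leaf_dotted, zero_add] at hw
    obtain ⟨rfl, rfl⟩ : e₁ = e ∧ s₁ = s := by
      refine eq_of_oneEnd_ne_zero (fun h => ?_)
      have := hw e₁ s₁
      simp [h] at this
    obtain ⟨t₂, h₂⟩ := exists_hairs_of_listEnds w₁ fun a b => by have := hw a b; omega
    exact ⟨t, t₂, by rw [h₂]⟩

theorem exists_word_two {e₁ e₂ : ℕ} {s₁ s₂ : Bool} (w : List (Label H))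
    (hw : ∀ a b, listEnds a b (w.map RTree.leaf) = oneEnd e₁ s₁ a b + oneEnd e₂ s₂ a b) :
    ∃ α β γ, w.map RTree.leaf = hairs α ++ .leaf (.dotted e₁ s₁) ::
        (hairs β ++ .leaf (.dotted e₂ s₂) :: hairs γ) ∨
      w.map RTree.leaf = hairs α ++ .leaf (.dotted e₂ s₂) ::
        (hairs β ++ .leaf (.dotted e₁ s₁) :: hairs γ) := by
  rcases exists_first_dotted w with ⟨t, h⟩ | ⟨t, e, s, w₁, h⟩
  · have := hw e₁ s₁
    rw [h] at this
    simp at this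
    omega
  · rw [h] at hw ⊢
    simp only [listEnds_append, listEnds_hairs, listEnds_cons, ends_leaf_dotted, zero_add] at hw
    have hor : (e = e₁ ∧ s = s₁) ∨ (e = e₂ ∧ s = s₂) := by
      by_contra hc
      have := hw e s
      rw [not_or] at hc
      simp [oneEnd, hc.1, hc.2] at this
    rcases hor with ⟨rfl, rfl⟩ | ⟨rfl, rfl⟩
    · obtain ⟨β, γ, h₂⟩ := exists_word_one (e := e₂) (s := s₂) w₁ fun a b => by
        have := hw a b; omega
      exact ⟨t, β, γ, .inl (by rw [h₂])⟩
    · obtain ⟨β, γ, h₂⟩ := exists_word_one (e := e₁) (s := s₁) w₁ fun a b => by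
        have := hw a b; omega
      exact ⟨t, β, γ, .inr (by rw [h₂])⟩

end Words

section Cyclic

variable {H : Type*} [AddCommGroup H] [Module ℚ H] {M : Type*} [AddCommGroup M] [Module ℚ M]

theorem endSign_smul_smul (s : Bool) (x : M) : endSign s • endSign s • x = x := by
  rw [smul_smul, endSign_mul_self, one_smul]

/-- A local function `h` has cyclic symmetry, on trees in which besides the two ends of one dotted
edge there are the ends of dotted edges counted by `c`, if its value on path trees for the path
that joins the two ends of the former dotted edge is invariant under cyclic permutations of the
rooted trees along this path.  The values must not depend on the name of this dotted edge, which is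
not in the set `F`, except for a sign for its direction.  If the path has just a single leaf, then
the value has to be zero. -/
structure IsCyclic (h : Tree H → M) (F : Finset ℕ) (c : ℕ → Bool → ℕ) : Prop extends
    IsLocal h where
  names : ∀ e ∉ F, ∀ b, c e b = 0
  cycle : ∀ e ∉ F, ∀ e' ∉ F, ∀ (s s' : Bool) (K : RTree H) (Rs : List (RTree H)),
    (∀ a b, listEnds a b (K :: Rs) = c a b) →
      endSign s • pathVal h (.leaf (.dotted e s)) (K :: Rs) (.leaf (.dotted e (!s))) =
        endSign s' • pathVal h (.leaf (.dotted e' s')) (Rs ++ [K]) (.leaf (.dotted e' (!s')))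
  loop_leaf : ∀ e ∉ F, ∀ (s : Bool) (l : Label H), (∀ a b, l.isEnd a b = c a b) →
    h ⟨.leaf (.dotted e s), .leaf (.dotted e (!s)), .leaf l⟩ = 0

variable {h : Tree H → M} {F : Finset ℕ} {c : ℕ → Bool → ℕ}

/-- Cyclic symmetry can be checked on words. -/
theorem IsLocal.cycle_of_words (hl : IsLocal h)
    (hw : ∀ e ∉ F, ∀ e' ∉ F, ∀ (s s' : Bool) (l : Label H) (w : List (Label H)),
      (∀ a b, listEnds a b ((l :: w).map RTree.leaf) = c a b) →
      endSign s • pathVal h (.leaf (.dotted e s)) ((l :: w).map RTree.leaf)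
          (.leaf (.dotted e (!s))) =
        endSign s' • pathVal h (.leaf (.dotted e' s')) ((w ++ [l]).map RTree.leaf)
          (.leaf (.dotted e' (!s'))))
    (K : RTree H) : ∀ e ∉ F, ∀ e' ∉ F, ∀ (s s' : Bool) (Rs : List (RTree H)),
    (∀ a b, listEnds a b (K :: Rs) = c a b) →
      endSign s • pathVal h (.leaf (.dotted e s)) (K :: Rs) (.leaf (.dotted e (!s))) =
        endSign s' • pathVal h (.leaf (.dotted e' s')) (Rs ++ [K])
          (.leaf (.dotted e' (!s'))) := by
  intro e he e' he' s s'
  have ihx (e : ℕ) (s : Bool) (Ls : List (RTree H)) (A B : RTree H) (Rs : List (RTree H)) :=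
    hl.pathVal_ihx (.leaf (.dotted e s)) Ls A B Rs (.leaf (.dotted e (!s)))
  -- Independence of the name of the dotted edge.
  have ind (Rs : List (RTree H)) (hRs : ∀ a b, listEnds a b Rs = c a b) :
      endSign s • pathVal h (.leaf (.dotted e s)) Rs (.leaf (.dotted e (!s))) =
        endSign s' • pathVal h (.leaf (.dotted e' s')) Rs (.leaf (.dotted e' (!s'))) := by
    rw [← sub_eq_zero]
    refine list_eq_zero_of_leaves (P := fun Rs => ∀ a b, listEnds a b Rs = c a b)
      (g := fun Rs => endSign s • pathVal h (.leaf (.dotted e s)) Rs (.leaf (.dotted e (!s))) -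
        endSign s' • pathVal h (.leaf (.dotted e' s')) Rs (.leaf (.dotted e' (!s'))))
      (fun Ls A B Rs hP => ?_) (fun Ls A B Rs hP => ?_) (fun w hP => ?_) Rs hRs
    · constructor <;> intro a b <;> rw [← hP a b] <;> simp [RTree.ends] <;> omega
    · simp only [ihx]; module
    · rcases List.eq_nil_or_concat' w with rfl | ⟨w, l, rfl⟩
      · simp [pathVal]
      · have hP' : ∀ a b, listEnds a b ((l :: w).map RTree.leaf) = c a b := by
          intro a b; rw [← hP]; simp; omega
        rw [← hw e he e' he' s s' l w hP', ← hw e he e he s s l w hP', sub_self]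
  induction K with
  | leaf l =>
    intro Rs hRs
    rw [← sub_eq_zero]
    refine list_eq_zero_of_leaves (P := fun Rs => ∀ a b, listEnds a b (.leaf l :: Rs) = c a b)
      (g := fun Rs => endSign s • pathVal h (.leaf (.dotted e s)) (.leaf l :: Rs)
          (.leaf (.dotted e (!s))) -
        endSign s' • pathVal h (.leaf (.dotted e' s')) (Rs ++ [.leaf l])
          (.leaf (.dotted e' (!s'))))
      (fun Ls A B Rs hP => ?_) (fun Ls A B Rs hP => ?_) (fun w hP => ?_) Rs hRs
    · constructor <;> intro a b <;> rw [← hP a b] <;> simp [RTree.ends] <;> omega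
    · have h₁ := ihx e s (.leaf l :: Ls) A B Rs
      have h₂ := ihx e' s' Ls A B (Rs ++ [.leaf l])
      simp only [List.cons_append, List.append_assoc] at h₁ h₂ ⊢
      rw [h₁, h₂]; module
    · rw [sub_eq_zero]
      simpa using hw e he e' he' s s' l w hP
  | node A B ihA ihB =>
    intro Rs hRs
    have hAB : ∀ a b, listEnds a b (A :: B :: Rs) = c a b := fun a b => by
      rw [← hRs]; simp [RTree.ends]; omega
    have h₁ := ihx e s [] A B Rs
    have h₂ := ihx e' s' Rs A B []
    have h₃ := ihA (B :: Rs) hAB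
    have h₄ := ihB (Rs ++ [A]) fun a b => by rw [← hAB]; simp; omega
    have h₅ := ihB (A :: Rs) fun a b => by rw [← hAB]; simp; omega
    have h₆ := ihA (Rs ++ [B]) fun a b => by rw [← hAB]; simp; omega
    have h₇ := ind (B :: (Rs ++ [A])) fun a b => by rw [← hAB]; simp; omega
    have h₈ := ind (A :: (Rs ++ [B])) fun a b => by rw [← hAB]; simp; omega
    simp only [List.append_assoc, List.cons_append, List.nil_append] at h₁ h₂ h₃ h₄ h₅ h₆ h₇ h₈
    rw [h₁, h₂, smul_sub, smul_sub]
    linear_combination (norm := abel) h₃ + h₄ - h₅ - h₆ - h₇ + h₈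

/-- A tripod with a dotted loop is zero: if its third branch is a node, then the two terms that the
IHX relation gives are related by a cyclic permutation. -/
theorem IsCyclic.loop (hc : IsCyclic h F c) {e : ℕ} (he : e ∉ F) (s : Bool) {A : RTree H}
    (hA : ∀ a b, A.ends a b = c a b) :
    h ⟨.leaf (.dotted e s), .leaf (.dotted e (!s)), A⟩ = 0 := by
  cases A with
  | leaf l => exact hc.loop_leaf e he s l hA
  | node A B =>
    have h₁ := hc.pathVal_ihx (.leaf (.dotted e s)) [] A B [] (.leaf (.dotted e (!s)))
    have h₂ := hc.cycle e he e he s s A [B] fun a b => by rw [← hA]; simp [RTree.ends]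
    have h₃ := congrArg (endSign s • ·) h₂
    simp only [smul_smul, endSign_mul_self, one_smul] at h₃
    rw [hc.swap₂₃, neg_eq_zero]
    simp only [List.nil_append, List.cons_append] at h₁ h₃
    rw [h₃, sub_self] at h₁
    exact h₁

/-- Joining a path to a tripod along its two end points. -/
theorem IsLocal.pathVal_join₂_ends (hl : IsLocal h) {e₁ e₂ : ℕ} (h₁₂ : e₁ ≠ e₂) {s₁ s₂ : Bool}
    {Rs : List (RTree H)} (a₁ : ∀ b, listEnds e₁ b Rs = 0) (a₂ : ∀ b, listEnds e₂ b Rs = 0)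
    (hne : Rs ≠ []) (K : RTree H) :
    pathVal (HairyLie.join₂ h e₁ s₁ e₂ s₂ K) (.leaf (.dotted e₁ s₁)) Rs (.leaf (.dotted e₂ s₂)) =
      endSign s₁ • pathVal h (.leaf (.dotted e₂ (!s₂))) (K :: Rs) (.leaf (.dotted e₂ s₂)) +
        endSign s₂ • pathVal h (.leaf (.dotted e₁ s₁)) (Rs ++ [K]) (.leaf (.dotted e₁ (!s₁))) := by
  have hpos : pathVal h (.leaf (.dotted e₁ s₁)) Rs (.node K (.leaf (.dotted e₁ (!s₁)))) =
      pathVal h (.leaf (.dotted e₁ s₁)) (Rs ++ [K]) (.leaf (.dotted e₁ (!s₁))) ∧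
      pathVal h (.node (.leaf (.dotted e₂ (!s₂))) K) Rs (.leaf (.dotted e₂ s₂)) =
      pathVal h (.leaf (.dotted e₂ (!s₂))) (K :: Rs) (.leaf (.dotted e₂ s₂)) :=
    ⟨by rw [pathVal_append_right _ hne]; rfl, (hl.pathVal_cons _ _ hne _).symm⟩
  unfold HairyLie.join₂
  rw [pathVal_add_fun, pathVal_smul_fun, pathVal_smul_fun, pathVal_subst, pathVal_subst,
    map_subst_of_listEnds (a₁ _), map_subst_of_listEnds (a₂ _)]
  simp only [RTree.subst_dotted, h₁₂, h₁₂.symm, false_and, and_self, if_true, if_false]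
  rw [hpos.1, hpos.2]

/-- Joining two ends to a tripod is zero for functions with cyclic symmetry: the two terms are
related by a cyclic permutation that moves the third branch of the tripod from the beginning of the
path to its end. -/
theorem IsCyclic.join₂_eq_zero (hc : IsCyclic h F c) {e₁ e₂ : ℕ} (h₁ : e₁ ∉ F) (h₂ : e₂ ∉ F)
    (h₁₂ : e₁ ≠ e₂) {s₁ s₂ : Bool} {K : RTree H} (hK₁ : ∀ b, K.ends e₁ b = 0)
    (hK₂ : ∀ b, K.ends e₂ b = 0) {T : Tree H}
    (hT : ∀ a b, T.ends a b + K.ends a b = c a b + oneEnd e₁ s₁ a b + oneEnd e₂ s₂ a b) :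
    join₂ h e₁ s₁ e₂ s₂ K T = 0 := by
  have hT₁ (b : Bool) : T.ends e₁ b = oneEnd e₁ s₁ e₁ b := by
    have := hT e₁ b
    rwa [hK₁, hc.names _ h₁, oneEnd_of_ne h₁₂, zero_add, add_zero, add_zero] at this
  have hT₂ (b : Bool) : T.ends e₂ b = oneEnd e₂ s₂ e₂ b := by
    have := hT e₂ b
    rwa [hK₂, hc.names _ h₂, oneEnd_of_ne h₁₂.symm, zero_add, add_zero, zero_add] at this
  obtain ⟨Rs, hne, hRs, hr⟩ := exists_path M (e := e₁) (e' := e₂) (s := s₁) (s' := s₂)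
    (by simp [h₁₂]) T (by simp [hT₁]) (by simp [hT₂])
  simp only [isEnd_dotted] at hRs
  refine hr _ (hc.toIsLocal.join₂ _ _ _ _ _) ?_
  have a₁ (b : Bool) : listEnds e₁ b Rs = 0 := by
    have := hRs e₁ b
    rw [hT₁, oneEnd_of_ne h₁₂] at this
    omega
  have a₂ (b : Bool) : listEnds e₂ b Rs = 0 := by
    have := hRs e₂ b
    rw [hT₂, oneEnd_of_ne h₁₂.symm] at this
    omega
  have hcyc := hc.cycle e₂ h₂ e₁ h₁ (!s₂) s₁ K Rs fun a b => by
    have := hRs a b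
    have := hT a b
    rw [listEnds_cons]
    omega
  rw [hc.toIsLocal.pathVal_join₂_ends h₁₂ a₁ a₂ hne]
  rw [Bool.not_not] at hcyc
  cases s₁ <;> cases s₂ <;> simp at hcyc ⊢ <;>
    first
    | linear_combination (norm := abel1) hcyc
    | linear_combination (norm := abel1) -hcyc

variable {f : Tree H → M} {Θ : FourForm H M}

/-- Joining two ends to a tripod turns the three-term relation into cyclic symmetry: on words,
cyclic permutation of a color is `slide_mul`, and cyclic permutation of an end is `slide_add_slide`.
-/
theorem IsInvariant.isCyclic_join₂ (hf : IsInvariant f) (hb : IsBalanced Θ) (h₃ : IsThreeTerm Θ)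
    (hΘ : ∀ t u v w, f ((thetaGraph t u v w).tree 0) =
      Θ (pureTensor t) (pureTensor u) (pureTensor v) (pureTensor w))
    {e₁ e₂ : ℕ} (h₁₂ : e₁ ≠ e₂) (s₁ s₂ : Bool) {K : RTree H} (hK : ∀ a b, K.ends a b = 0) :
    IsCyclic (join₂ f e₁ s₁ e₂ s₂ K) {e₁, e₂}
      (fun a b => oneEnd e₁ s₁ a b + oneEnd e₂ s₂ a b) where
  toIsLocal := hf.toIsLocal.join₂ _ _ _ _ _
  names e he b := by
    simp only [Finset.mem_insert, Finset.mem_singleton, not_or] at he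
    simp [oneEnd, he.1, he.2]
  loop_leaf e _ s l hl := by
    exfalso
    have hl₁ := hl e₁ s₁
    have hl₂ := hl e₂ s₂
    cases l with
    | hair a => simp [Label.isEnd] at hl₁; omega
    | dotted d b =>
      simp only [isEnd_dotted, oneEnd_self] at hl₁ hl₂
      have b₁ := eq_of_oneEnd_ne_zero (e := d) (s := b) (a := e₁) (b := s₁) (by omega)
      have b₂ := eq_of_oneEnd_ne_zero (e := d) (s := b) (a := e₂) (b := s₂) (by omega)
      exact h₁₂ (b₁.1.trans b₂.1.symm)
  cycle e he e' he' s s' K' Rs hRs := by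
    refine (hf.toIsLocal.join₂ _ _ _ _ _).cycle_of_words (F := {e₁, e₂})
      (c := fun a b => oneEnd e₁ s₁ a b + oneEnd e₂ s₂ a b) ?_ K' e he e' he' s s' Rs hRs
    intro e he e' he' s s' l w hw
    simp only [Finset.mem_insert, Finset.mem_singleton, not_or] at he he'
    have v₁ (α β γ : List H) := hf.pathVal_join₂ hb hΘ he.1 he.2 h₁₂ s s₁ s₂ hK α β γ
    have v₂ (α β γ : List H) := hf.pathVal_join₂ hb hΘ he'.1 he'.2 h₁₂ s' s₁ s₂ hK α β γ
    have sl (a : H) (α β γ : List H) := h₃.slide_mul (lieVal K) (TensorAlgebra.ι ℚ a)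
      (pureTensor α) (pureTensor β) (pureTensor γ)
    have sl' (β γ : List H) := h₃.slide_add_slide hb (antipode_lieVal K) (pureTensor β)
      (pureTensor γ)
    obtain ⟨α, β, γ, h⟩ := exists_word_two (l :: w) hw
    rw [List.map_append]
    rcases h with h | h <;> rw [h] <;> rw [List.map_cons] at h
    · cases α with
      | nil =>
        simp only [hairs, List.map_nil, List.nil_append, List.cons.injEq] at h
        rw [(v₁ [] β γ).1, h.2, List.map_singleton, h.1]
        have := (v₂ β γ []).2
        simp only [hairs, List.map_nil, List.append_assoc, List.cons_append] at this ⊢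
        rw [this, endSign_smul_smul, smul_neg, endSign_smul_smul, eq_neg_iff_add_eq_zero,
          ← smul_add, pureTensor_nil, sl', smul_zero]
      | cons a α =>
        simp only [hairs, List.map_cons, List.cons_append, List.cons.injEq] at h
        rw [(v₁ (a :: α) β γ).1, h.2, List.map_singleton, h.1]
        have := (v₂ α β (γ ++ [a])).1
        simp only [hairs, List.map_nil, List.append_assoc, List.cons_append, List.map_append,
          List.map_cons] at this ⊢
        rw [this, endSign_smul_smul, endSign_smul_smul, pureTensor_cons, sl]
        simp
    · cases α with
      | nil =>
        simp only [hairs, List.map_nil, List.nil_append, List.cons.injEq] at h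
        rw [(v₁ [] β γ).2, h.2, List.map_singleton, h.1]
        have := (v₂ β γ []).1
        simp only [hairs, List.map_nil, List.append_assoc, List.cons_append] at this ⊢
        rw [this, endSign_smul_smul, smul_neg, endSign_smul_smul, neg_eq_iff_add_eq_zero,
          ← smul_add, pureTensor_nil, sl', smul_zero]
      | cons a α =>
        simp only [hairs, List.map_cons, List.cons_append, List.cons.injEq] at h
        rw [(v₁ (a :: α) β γ).2, h.2, List.map_singleton, h.1]
        have := (v₂ α β (γ ++ [a])).2
        simp only [hairs, List.map_nil, List.append_assoc, List.cons_append, List.map_append,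
          List.map_cons] at this ⊢
        rw [this, smul_neg, endSign_smul_smul, smul_neg, endSign_smul_smul, pureTensor_cons, sl]
        simp

/-- Joining one end to a tripod with a dotted loop also gives cyclic symmetry, by `loop_mul`; that
the theta graph without hairs is zero is needed when both ends of the path meet in a tripod. -/
theorem IsInvariant.isCyclic_joinLoop (hf : IsInvariant f) (h₃ : IsThreeTerm Θ)
    (hΘ : ∀ t u v w, f ((thetaGraph t u v w).tree 0) =
      Θ (pureTensor t) (pureTensor u) (pureTensor v) (pureTensor w))
    (e₁ e₂ : ℕ) (s₁ s₂ : Bool) :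
    IsCyclic (joinLoop f e₁ s₁ e₂ s₂) {e₁, e₂} (oneEnd e₁ s₁) where
  toIsLocal := hf.toIsLocal.joinLoop _ _ _ _
  names e he b := by
    simp only [Finset.mem_insert, Finset.mem_singleton, not_or] at he
    simp [oneEnd, he.1]
  loop_leaf e he s l hl := by
    simp only [Finset.mem_insert, Finset.mem_singleton, not_or] at he
    have hl₁ := hl e₁ s₁
    cases l with
    | hair a => simp [Label.isEnd] at hl₁
    | dotted d b =>
      simp only [isEnd_dotted, oneEnd_self] at hl₁
      obtain ⟨rfl, rfl⟩ := eq_of_oneEnd_ne_zero (e := d) (s := b) (a := e₁) (b := s₁) (by omega)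
      have := hf.pathVal_joinLoop hΘ he.1 he.2 s s₁ s₂ [] []
      rw [pureTensor_nil, h₃.apply_one, smul_zero, smul_zero] at this
      rw [(hf.toIsLocal.joinLoop _ _ _ _).swap₂₃, neg_eq_zero]
      exact this
  cycle e he e' he' s s' K' Rs hRs := by
    refine (hf.toIsLocal.joinLoop _ _ _ _).cycle_of_words (F := {e₁, e₂})
      (c := oneEnd e₁ s₁) ?_ K' e he e' he' s s' Rs hRs
    intro e he e' he' s s' l w hw
    simp only [Finset.mem_insert, Finset.mem_singleton, not_or] at he he'
    have v₁ (α γ : List H) := hf.pathVal_joinLoop hΘ he.1 he.2 s s₁ s₂ α γ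
    have v₂ (α γ : List H) := hf.pathVal_joinLoop hΘ he'.1 he'.2 s' s₁ s₂ α γ
    obtain ⟨α, γ, h⟩ := exists_word_one (l :: w) hw
    rw [List.map_append]
    rw [h]; rw [List.map_cons] at h
    cases α with
    | nil =>
      simp only [hairs, List.map_nil, List.nil_append, List.cons.injEq] at h
      rw [v₁ [] γ, h.2, List.map_singleton, h.1]
      have := v₂ γ []
      simp only [hairs, List.map_nil] at this
      rw [this, endSign_smul_smul, endSign_smul_smul, pureTensor_nil]
      have := h₃.loop_mul (pureTensor γ) 1 1
      rw [mul_one, one_mul] at this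
      rw [this]
    | cons a α =>
      simp only [hairs, List.map_cons, List.cons_append, List.cons.injEq] at h
      rw [v₁ (a :: α) γ, h.2, List.map_singleton, h.1]
      have := v₂ α (γ ++ [a])
      simp only [hairs, List.map_append, List.map_cons, List.map_nil, List.append_assoc,
        List.cons_append] at this ⊢
      rw [this, endSign_smul_smul, endSign_smul_smul, pureTensor_cons,
        h₃.loop_mul]
      simp

end Cyclic

/-! ### Bookkeeping for iterated joining -/

section Bind

variable {H : Type*}

/-- Replace every univalent vertex by the rooted tree that `σ` assigns to its label. -/
def RTree.bind (σ : Label H → RTree H) : RTree H → RTree H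
  | .leaf l => σ l
  | .node A B => .node (A.bind σ) (B.bind σ)

/-- Replace every univalent vertex by the rooted tree that `σ` assigns to its label. -/
def Tree.bind (σ : Label H → RTree H) (T : Tree H) : Tree H :=
  ⟨T.fst.bind σ, T.snd.bind σ, T.trd.bind σ⟩

/-- A substitution for the ends of dotted edges that keeps the dotted edges in `P` and does not
create new ones with names in `P`. -/
structure IsAdmissible (P : Finset ℕ) (σ : Label H → RTree H) : Prop where
  hair : ∀ a, σ (.hair a) = .leaf (.hair a)
  mem : ∀ e ∈ P, ∀ s, σ (.dotted e s) = .leaf (.dotted e s)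
  not_mem : ∀ e ∉ P, ∀ s, ∀ a ∈ P, ∀ b, (σ (.dotted e s)).ends a b = 0

variable {P : Finset ℕ} {σ : Label H → RTree H}

theorem IsAdmissible.rEnds_bind (hσ : IsAdmissible P σ) {a : ℕ} (ha : a ∈ P) (b : Bool)
    (R : RTree H) : (R.bind σ).ends a b = R.ends a b := by
  induction R with
  | leaf l =>
    cases l with
    | hair x => rw [RTree.bind, hσ.hair]
    | dotted e s =>
      by_cases he : e ∈ P
      · rw [RTree.bind, hσ.mem e he]
      · rw [RTree.bind, hσ.not_mem e he s a ha b, ends_leaf_dotted,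
          oneEnd_of_ne (by rintro rfl; exact he ha)]
  | node A B hA hB => simp only [RTree.bind, RTree.ends, hA, hB]

theorem IsAdmissible.ends_bind (hσ : IsAdmissible P σ) {a : ℕ} (ha : a ∈ P) (b : Bool)
    (T : Tree H) : (T.bind σ).ends a b = T.ends a b := by
  simp only [Tree.bind, Tree.ends, hσ.rEnds_bind ha]

theorem eq_dotted_of_isEnd {l : Label H} {e : ℕ} {s : Bool} (h : l.isEnd e s ≠ 0) :
    l = .dotted e s := by
  cases l with
  | hair a => simp [Label.isEnd] at h
  | dotted d b =>
    obtain ⟨rfl, rfl⟩ := eq_of_oneEnd_ne_zero (isEnd_dotted (H := H) d b e s ▸ h)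
    rfl

theorem IsAdmissible.rBind_subst (hσ : IsAdmissible P σ) {e : ℕ} (he : e ∈ P) (s : Bool)
    (X R : RTree H) : (R.subst e s X).bind σ = (R.bind σ).subst e s (X.bind σ) := by
  induction R with
  | leaf l =>
    by_cases hl : l.isEnd e s = 1
    · obtain rfl := eq_dotted_of_isEnd (l := l) (e := e) (s := s) (by omega)
      simp [RTree.subst, RTree.bind, hσ.mem e he, Label.isEnd]
    · have h₀ : l.isEnd e s = 0 := by have := l.isEnd_le e s; omega
      rw [RTree.subst, if_neg hl, RTree.subst_of_ends]
      rw [hσ.rEnds_bind he]; exact h₀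
  | node A B hA hB => simp only [RTree.bind, RTree.subst, hA, hB]

theorem IsAdmissible.bind_subst (hσ : IsAdmissible P σ) {e : ℕ} (he : e ∈ P) (s : Bool)
    (X : RTree H) (T : Tree H) : (T.subst e s X).bind σ = (T.bind σ).subst e s (X.bind σ) := by
  simp only [Tree.bind, Tree.subst, hσ.rBind_subst he]

/-- Joining at the end `s` of `e` is itself a substitution on trees that do not have the other end
of `e`. -/
theorem IsAdmissible.exists_bind_subst {e : ℕ} (hσ : IsAdmissible (P ∪ {e}) σ) (he : e ∉ P)
    (s : Bool) {X : RTree H} (hX : ∀ a ∈ P, ∀ b, X.ends a b = 0) : ∃ σ', IsAdmissible P σ' ∧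
      ∀ T : Tree H, T.ends e (!s) = 0 → (T.subst e s X).bind σ = T.bind σ' := by
  -- The other end of `e` does not occur in `T`: any rooted tree without dotted ends in `P`, such as
  -- `.node X X`, can serve as the value there.
  refine ⟨fun l => if l.isEnd e s = 1 then X.bind σ else
    match l with
    | .hair a => .leaf (.hair a)
    | .dotted d b => if d = e then .node X X else σ (.dotted d b), ⟨fun a => ?_, fun d hd b => ?_,
      fun d hd b a ha b' => ?_⟩, fun T hT => ?_⟩
  · simp [Label.isEnd]
  · have hde : d ≠ e := by rintro rfl; exact he hd
    simp [isEnd_dotted, oneEnd, hde, hde.symm, hσ.mem d (Finset.mem_union_left _ hd)]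
  · have h₁ := hσ.rEnds_bind (Finset.mem_union_left _ ha) b' X
    by_cases hde : d = e
    · simp only [hde, if_true]
      split_ifs
      · rw [h₁, hX a ha]
      · simp [RTree.ends, hX a ha]
    · have : e ≠ d := fun h => hde h.symm
      simp only [isEnd_dotted, oneEnd, this, false_and, if_false, hde, zero_ne_one]
      exact hσ.not_mem d (by simp [hd, hde]) b a (Finset.mem_union_left _ ha) b'
  · have key (R : RTree H) (hR : R.ends e (!s) = 0) : (R.subst e s X).bind σ = R.bind fun l =>
        if l.isEnd e s = 1 then X.bind σ else
        match l with
        | .hair a => .leaf (.hair a)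
        | .dotted d b => if d = e then .node X X else σ (.dotted d b) := by
      induction R with
      | leaf l =>
        by_cases hl : l.isEnd e s = 1
        · simp [RTree.subst, RTree.bind, hl]
        · simp only [RTree.subst, RTree.bind, hl, if_false]
          cases l with
          | hair a => exact hσ.hair a
          | dotted d b =>
            have hde : d ≠ e := by
              rintro rfl
              simp only [RTree.ends, Label.isEnd] at hl hR
              cases b <;> cases s <;> simp at hl hR
            simp [hde]
      | node A B hA hB =>
        simp only [RTree.ends, Nat.add_eq_zero_iff] at hR
        simp only [RTree.bind, RTree.subst, hA hR.1, hB hR.2]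
    simp only [Tree.ends, Nat.add_eq_zero_iff] at hT
    simp only [Tree.bind, Tree.subst, key _ hT.1.1, key _ hT.1.2, key _ hT.2]

/-- A tree all of whose dotted edges are in `P` does not change under some admissible
substitution. -/
theorem exists_bind_eq_self (P : Finset ℕ) : ∃ σ : Label H → RTree H, IsAdmissible P σ ∧
    ∀ T : Tree H, (∀ e ∉ P, ∀ s, T.ends e s = 0) → T.bind σ = T := by
  refine ⟨.leaf, ⟨fun _ => rfl, fun _ _ _ => rfl, fun e he s a ha b => ?_⟩, fun T _ => ?_⟩
  · rw [ends_leaf_dotted, oneEnd_of_ne (by rintro rfl; exact he ha)]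
  · have key (R : RTree H) : R.bind .leaf = R := by
      induction R with
      | leaf l => rfl
      | node A B hA hB => simp [RTree.bind, hA, hB]
    simp only [Tree.bind, key]

end Bind

section Steps

variable {H : Type*}

/-- The number of univalent vertices labeled by the end `s` of `e` in a list of tripods. -/
def tripodEnds (e : ℕ) (s : Bool) (L : List (Tripod H)) : ℕ := (L.map (Tripod.ends e s)).sum

@[simp] theorem tripodEnds_nil (e : ℕ) (s : Bool) : tripodEnds e s ([] : List (Tripod H)) = 0 := rfl

@[simp] theorem tripodEnds_cons (e : ℕ) (s : Bool) (v : Tripod H) (L : List (Tripod H)) :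
    tripodEnds e s (v :: L) = v.ends e s + tripodEnds e s L := by simp [tripodEnds]

/-- The tree `T` has both ends of `m` of the dotted edges in `P`, and none of the ends of the others;
the ends of dotted edges that are not in `P` are counted by `o`. -/
structure Fits (P : Finset ℕ) (o : ℕ → Bool → ℕ) (m : ℕ) (T : Tree H) : Prop where
  ends_eq : ∀ e ∉ P, ∀ s, T.ends e s = o e s
  pairs : ∃ S ⊆ P, S.card = m ∧ ∀ e ∈ P, ∀ s, T.ends e s = if e ∈ S then 1 else 0

/-- A tree whose ends of dotted edges not in `P` are counted by `o` and the tripods in the list `L`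
together have both or none of the ends of every dotted edge not in `P`, but the tree has at most
one of them.  The tripods have no ends of dotted edges in `P`. -/
structure Compat (P : Finset ℕ) (o : ℕ → Bool → ℕ) (L : List (Tripod H)) : Prop where
  disjoint : ∀ e ∈ P, ∀ s, tripodEnds e s L = 0
  total : ∀ e ∉ P, o e true + tripodEnds e true L = o e false + tripodEnds e false L
  le_one : ∀ e ∉ P, ∀ s, o e s + tripodEnds e s L ≤ 1
  one_end : ∀ e ∉ P, o e true = 0 ∨ o e false = 0

variable {P : Finset ℕ} {o : ℕ → Bool → ℕ} {v : Tripod H} {L : List (Tripod H)} {m : ℕ}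
  {T : Tree H}

theorem Compat.step (hc : Compat P o (v :: L)) (G : Finset ℕ)
    (hG : ∀ e ∈ G, e ∉ P → ∀ s, 1 ≤ o e s + v.ends e s)
    (hn : ∀ e ∉ P ∪ G, o e true + v.ends e true = 0 ∨ o e false + v.ends e false = 0) :
    Compat (P ∪ G) (fun e s => o e s + v.ends e s) L where
  disjoint e he s := by
    by_cases heP : e ∈ P
    · have := hc.disjoint e heP s
      rw [tripodEnds_cons] at this; omega
    · have h₁ := hG e (by simpa [heP] using he) heP s
      have := hc.le_one e heP s
      rw [tripodEnds_cons] at this; omega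
  total e he := by
    have := hc.total e (fun h => he (Finset.mem_union_left _ h))
    rw [tripodEnds_cons, tripodEnds_cons] at this; omega
  le_one e he s := by
    have := hc.le_one e (fun h => he (Finset.mem_union_left _ h)) s
    rw [tripodEnds_cons] at this; omega
  one_end := hn

theorem Fits.ends_subst {e₁ : ℕ} {s₁ : Bool} (h : T.ends e₁ s₁ = 1) (R : RTree H) (e : ℕ)
    (s : Bool) : (T.subst e₁ s₁ R).ends e s + oneEnd e₁ s₁ e s = T.ends e s + R.ends e s := by
  have := Tree.ends_subst e₁ s₁ R T e s
  rw [h, mul_one, one_mul] at this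
  exact this

theorem Fits.subst (hT : Fits P o m T) {e₁ : ℕ} {s₁ : Bool} {R : RTree H} (G G' : Finset ℕ)
    (he₁ : e₁ ∈ G) (hPG : ∀ e ∈ G, e ∉ P) (hG' : G' ⊆ G) (ho : o e₁ s₁ = 1)
    (hR : ∀ e ∈ P, ∀ s, R.ends e s = 0)
    (hRG : ∀ e ∈ G, ∀ s, oneEnd e₁ s₁ e s + (if e ∈ G' then 1 else 0) = o e s + R.ends e s)
    (hRv : ∀ e ∉ P ∪ G, ∀ s, R.ends e s = v.ends e s) :
    Fits (P ∪ G) (fun e s => o e s + v.ends e s) (m + G'.card) (T.subst e₁ s₁ R) := by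
  have h₁ := Fits.ends_subst (T := T) (e₁ := e₁) (s₁ := s₁)
    (by rw [hT.ends_eq e₁ (hPG e₁ he₁), ho]) R
  obtain ⟨S, hS, hcard, hTS⟩ := hT.pairs
  refine ⟨fun e he s => ?_, S ∪ G', Finset.union_subset_union hS hG', ?_, fun e he s => ?_⟩
  · have h₂ := h₁ e s
    rw [oneEnd_of_ne (by rintro rfl; exact he (Finset.mem_union_right _ he₁)), hRv e he s,
      hT.ends_eq e fun h => he (Finset.mem_union_left _ h)] at h₂
    omega
  · rw [Finset.card_union_of_disjoint, hcard]
    exact Finset.disjoint_left.2 fun e heS heG => hPG e (hG' heG) (hS heS)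
  · have h₂ := h₁ e s
    by_cases heP : e ∈ P
    · have heG : e ∉ G' := fun h => hPG e (hG' h) heP
      rw [oneEnd_of_ne (by rintro rfl; exact hPG _ he₁ heP), hR e heP, hTS e heP] at h₂
      simpa [heG] using h₂
    · have heG : e ∈ G := by simpa [heP] using he
      have heS : e ∉ S := fun h => heP (hS h)
      have h₃ := hRG e heG s
      rw [hT.ends_eq e heP] at h₂
      simp only [Finset.mem_union, heS, false_or]
      omega

theorem Label.isEnd_true_or_false (l : Label H) (e : ℕ) :
    l.isEnd e true = 0 ∨ l.isEnd e false = 0 := by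
  cases l with
  | hair a => simp [Label.isEnd]
  | dotted d b => cases b <;> simp [Label.isEnd]

/-- The label `l` is the other end of an end of a dotted edge counted by `o`. -/
def Label.IsBack (o : ℕ → Bool → ℕ) (l : Label H) : Prop :=
  ∃ e s, l = .dotted e (!s) ∧ o e s ≠ 0

theorem Label.isEnd_eq_zero_of_not_isBack {l : Label H} (hl : ¬ l.IsBack o) {e : ℕ} {s : Bool}
    (h : o e s ≠ 0) : l.isEnd e (!s) = 0 := by
  by_contra hc
  exact hl ⟨e, s, eq_dotted_of_isEnd hc, h⟩

/-- The rotation of a tripod. -/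
def Tripod.rotate (v : Tripod H) : Tripod H := (v.2.1, v.2.2, v.1)

theorem Tripod.ends_rotate (v : Tripod H) (e : ℕ) (s : Bool) :
    v.rotate.ends e s = v.ends e s := by
  simp only [Tripod.rotate, Tripod.ends]; omega

theorem Compat.rotate (hc : Compat P o (v :: L)) : Compat P o (v.rotate :: L) where
  disjoint e he s := by
    have := hc.disjoint e he s
    rw [tripodEnds_cons] at this; rwa [tripodEnds_cons, v.ends_rotate]
  total e he := by
    have := hc.total e he
    rw [tripodEnds_cons, tripodEnds_cons] at this
    rwa [tripodEnds_cons, tripodEnds_cons, v.ends_rotate, v.ends_rotate]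
  le_one e he s := by
    have := hc.le_one e he s
    rw [tripodEnds_cons] at this; rwa [tripodEnds_cons, v.ends_rotate]
  one_end := hc.one_end

section Cases

variable {M : Type*} [AddCommGroup M] [Module ℚ M]

theorem joinTripod_rotate (f : Tree H → M) (v : Tripod H) : joinTripod f v.rotate = joinTripod f v := by
  funext T
  simp only [joinTripod, Tripod.rotate]
  abel

theorem joinAt_of_isBack {f : Tree H → M} {e : ℕ} {s : Bool} (R : RTree H)
    (h : T.ends e s ≠ 0) : joinAt f (.dotted e (!s)) R T = endSign s • f (T.subst e s R) := by
  simp [joinAt, h]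

/-- A label of the tripod whose other end is not in the tree does not contribute. -/
theorem Fits.joinAt_of_not_isBack (hT : Fits P o m T) {l : Label H}
    (hP : ∀ e ∈ P, ∀ s, l.isEnd e s = 0) (hl : ¬ l.IsBack o) (f : Tree H → M) (R : RTree H) :
    joinAt f l R T = 0 := by
  cases l with
  | hair a => rfl
  | dotted e s =>
    have he : e ∉ P := fun h => by
      have := hP e h s
      simp [isEnd_dotted] at this
    simp only [joinAt, ite_eq_left_iff]
    intro h
    rw [hT.ends_eq e he] at h
    exact absurd ⟨e, !s, by simp, h⟩ hl

/-- The possibilities for the labels of the first tripod, up to rotation: it has no end of a dotted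
edge of the tree, one such end, two such ends, one such end and both ends of another dotted edge, or
three such ends. -/
inductive Step (M : Type*) [AddCommGroup M] [Module ℚ M] (P : Finset ℕ) (o : ℕ → Bool → ℕ)
    (v : Tripod H) (L : List (Tripod H)) : Prop
  | zero (h : ∀ m T, Fits P o m T → ∀ f : Tree H → M, joinTripod f v T = 0)
  | one (e : ℕ) (s : Bool) (R : RTree H) (he : e ∉ P) (ho : o e (!s) = 0)
      (hR : ∀ a ∈ P, ∀ b, R.ends a b = 0)
      (hc : Compat (P ∪ {e}) (fun a b => o a b + v.ends a b) L)
      (h : ∀ m T, Fits P o m T →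
        Fits (P ∪ {e}) (fun a b => o a b + v.ends a b) m (T.subst e s R) ∧
        (∀ b, (T.subst e s R).ends e b = 0) ∧
        ∀ f : Tree H → M, joinTripod f v T = endSign s • f (T.subst e s R))
  | two (e₁ : ℕ) (s₁ : Bool) (e₂ : ℕ) (s₂ : Bool) (K : RTree H) (he₁ : e₁ ∉ P) (he₂ : e₂ ∉ P)
      (h₁₂ : e₁ ≠ e₂) (ho₁ : ∀ b, o e₁ b = oneEnd e₁ s₁ e₁ b)
      (ho₂ : ∀ b, o e₂ b = oneEnd e₂ s₂ e₂ b)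
      (hK : ∀ a ∈ P ∪ {e₁, e₂}, ∀ b, K.ends a b = 0)
      (hc : Compat (P ∪ {e₁, e₂}) (fun a b => o a b + v.ends a b) L)
      (h : ∀ m T, Fits P o m T →
        Fits (P ∪ {e₁, e₂}) (fun a b => o a b + v.ends a b) (m + 1)
          (T.subst e₁ s₁ (.node (.leaf (.dotted e₂ (!s₂))) K)) ∧
        Fits (P ∪ {e₁, e₂}) (fun a b => o a b + v.ends a b) (m + 1)
          (T.subst e₂ s₂ (.node K (.leaf (.dotted e₁ (!s₁))))) ∧
        ∀ f : Tree H → M, joinTripod f v T = join₂ f e₁ s₁ e₂ s₂ K T)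
  | loop (e₁ : ℕ) (s₁ : Bool) (e₂ : ℕ) (s₂ : Bool) (he₁ : e₁ ∉ P) (he₂ : e₂ ∉ P)
      (h₁₂ : e₁ ≠ e₂) (ho₁ : ∀ b, o e₁ b = oneEnd e₁ s₁ e₁ b) (ho₂ : ∀ b, o e₂ b = 0)
      (hc : Compat (P ∪ {e₁, e₂}) (fun a b => o a b + v.ends a b) L)
      (h : ∀ m T, Fits P o m T →
        Fits (P ∪ {e₁, e₂}) (fun a b => o a b + v.ends a b) (m + 1)
          (T.subst e₁ s₁ (.node (.leaf (.dotted e₂ s₂)) (.leaf (.dotted e₂ (!s₂))))) ∧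
        ∀ f : Tree H → M, joinTripod f v T = endSign s₁ • joinLoop f e₁ s₁ e₂ s₂ T)
  | three (e₁ : ℕ) (s₁ : Bool) (e₂ : ℕ) (s₂ : Bool) (e₃ : ℕ) (s₃ : Bool) (he₁ : e₁ ∉ P)
      (he₂ : e₂ ∉ P) (he₃ : e₃ ∉ P) (h₁₂ : e₁ ≠ e₂) (h₁₃ : e₁ ≠ e₃) (h₂₃ : e₂ ≠ e₃)
      (ho₁ : ∀ b, o e₁ b = oneEnd e₁ s₁ e₁ b) (ho₂ : ∀ b, o e₂ b = oneEnd e₂ s₂ e₂ b)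
      (ho₃ : ∀ b, o e₃ b = oneEnd e₃ s₃ e₃ b)
      (hc : Compat (P ∪ {e₁, e₂, e₃}) (fun a b => o a b + v.ends a b) L)
      (h : ∀ m T, Fits P o m T →
        Fits (P ∪ {e₁, e₂, e₃}) (fun a b => o a b + v.ends a b) (m + 2)
          (T.subst e₁ s₁ (.node (.leaf (.dotted e₂ (!s₂))) (.leaf (.dotted e₃ (!s₃))))) ∧
        Fits (P ∪ {e₁, e₂, e₃}) (fun a b => o a b + v.ends a b) (m + 2)
          (T.subst e₂ s₂ (.node (.leaf (.dotted e₃ (!s₃))) (.leaf (.dotted e₁ (!s₁))))) ∧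
        Fits (P ∪ {e₁, e₂, e₃}) (fun a b => o a b + v.ends a b) (m + 2)
          (T.subst e₃ s₃ (.node (.leaf (.dotted e₁ (!s₁))) (.leaf (.dotted e₂ (!s₂))))) ∧
        ∀ f : Tree H → M, joinTripod f v T = join₃ f e₁ s₁ e₂ s₂ e₃ s₃ T)

theorem Step.of_rotate (h : Step M P o v.rotate L) : Step M P o v L := by
  cases h with
  | zero h => exact .zero (by simpa only [joinTripod_rotate] using h)
  | one e s R he ho hR hc h =>
    simp only [joinTripod_rotate, v.ends_rotate] at hc h
    exact .one e s R he ho hR hc h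
  | two e₁ s₁ e₂ s₂ K he₁ he₂ h₁₂ ho₁ ho₂ hK hc h =>
    simp only [joinTripod_rotate, v.ends_rotate] at hc h
    exact .two e₁ s₁ e₂ s₂ K he₁ he₂ h₁₂ ho₁ ho₂ hK hc h
  | loop e₁ s₁ e₂ s₂ he₁ he₂ h₁₂ ho₁ ho₂ hc h =>
    simp only [joinTripod_rotate, v.ends_rotate] at hc h
    exact .loop e₁ s₁ e₂ s₂ he₁ he₂ h₁₂ ho₁ ho₂ hc h
  | three e₁ s₁ e₂ s₂ e₃ s₃ he₁ he₂ he₃ h₁₂ h₁₃ h₂₃ ho₁ ho₂ ho₃ hc h =>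
    simp only [joinTripod_rotate, v.ends_rotate] at hc h
    exact .three e₁ s₁ e₂ s₂ e₃ s₃ he₁ he₂ he₃ h₁₂ h₁₃ h₂₃ ho₁ ho₂ ho₃ hc h

end Cases

end Steps

section StepCases

variable {H : Type*} {M : Type*} [AddCommGroup M] [Module ℚ M] {P : Finset ℕ}
  {o : ℕ → Bool → ℕ} {l₁ l₂ l₃ : Label H} {L : List (Tripod H)}

theorem Compat.isEnd_eq_zero {v : Tripod H} (hc : Compat P o (v :: L)) {e : ℕ} (he : e ∈ P)
    (s : Bool) : v.1.isEnd e s = 0 ∧ v.2.1.isEnd e s = 0 ∧ v.2.2.isEnd e s = 0 := by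
  have := hc.disjoint e he s
  simp only [tripodEnds_cons, Tripod.ends] at this
  omega

/-- What a label of the first tripod that is the other end of an end counted by `o` implies. -/
theorem Compat.back {v : Tripod H} (hc : Compat P o (v :: L)) {l : Label H}
    (hl : ∀ e s, l.isEnd e s ≤ v.ends e s) {e : ℕ} {s : Bool} (h : l = .dotted e (!s))
    (ho : o e s ≠ 0) : e ∉ P ∧ (∀ b, o e b = oneEnd e s e b) ∧
      (∀ b, v.ends e b = oneEnd e (!s) e b) := by
  subst h
  have h₁ := hl e (!s)
  rw [isEnd_dotted, oneEnd_self] at h₁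
  have heP : e ∉ P := fun he => by
    have := hc.disjoint e he (!s)
    rw [tripodEnds_cons] at this
    omega
  have h₂ := hc.le_one e heP s
  have h₃ := hc.le_one e heP (!s)
  rw [tripodEnds_cons] at h₂ h₃
  have h₄ := hc.one_end e heP
  refine ⟨heP, fun b => ?_, fun b => ?_⟩ <;> cases s <;> cases b <;>
    simp only [Bool.not_true, Bool.not_false] at * <;> simp [oneEnd] <;> omega

theorem Step.mk_one (hc : Compat P o ((l₁, l₂, l₃) :: L)) (h₁ : l₁.IsBack o) (h₂ : ¬ l₂.IsBack o)
    (h₃ : ¬ l₃.IsBack o) : Step M P o (l₁, l₂, l₃) L := by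
  obtain ⟨e, s, hl₁, ho⟩ := h₁
  obtain ⟨he, ho', hv⟩ := hc.back (l := l₁) (fun e s => by simp [Tripod.ends]; omega) hl₁ ho
  have hR (a : ℕ) (b : Bool) : (RTree.node (.leaf l₂) (.leaf l₃)).ends a b + oneEnd e (!s) a b =
      Tripod.ends a b (l₁, l₂, l₃) := by
    simp only [RTree.ends, Tripod.ends, hl₁, isEnd_dotted]; omega
  have hPz := fun (a : ℕ) (ha : a ∈ P) b => hc.isEnd_eq_zero ha b
  have hjoin (m : ℕ) (T : Tree H) (hT : Fits P o m T) (f : Tree H → M) :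
      joinTripod f (l₁, l₂, l₃) T =
        endSign s • f (T.subst e s (.node (.leaf l₂) (.leaf l₃))) := by
    simp only [joinTripod]
    rw [hT.joinAt_of_not_isBack (fun a ha b => (hPz a ha b).2.1) h₂,
      hT.joinAt_of_not_isBack (fun a ha b => (hPz a ha b).2.2) h₃, hl₁, add_zero, add_zero,
      joinAt_of_isBack _ (by rw [hT.ends_eq e he]; exact ho)]
  have hz₁ : ∀ a, a ≠ e → ∀ b, l₁.isEnd a b = 0 := fun a ha b => by
    rw [hl₁, isEnd_dotted, oneEnd_of_ne ha]
  by_cases hloop : ∃ a b, l₂.isEnd a b ≠ 0 ∧ l₃.isEnd a (!b) ≠ 0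
  · obtain ⟨a, b, ha₂, ha₃⟩ := hloop
    have hl₂ := eq_dotted_of_isEnd ha₂
    have hl₃ := eq_dotted_of_isEnd ha₃
    have hea : e ≠ a := by
      rintro rfl
      have h₄ := hv b
      have h₅ := hv (!b)
      simp only [Tripod.ends, hl₁, hl₂, hl₃, isEnd_dotted] at h₄ h₅
      cases b <;> cases s <;> simp [oneEnd] at h₄ h₅
    have haP : a ∉ P := fun h => by
      have := (hPz a h b).2.1
      exact ha₂ this
    have hoa (c : Bool) : o a c = 0 := by
      have := hc.le_one a haP c
      simp only [tripodEnds_cons, Tripod.ends, hl₁, hl₂, hl₃, isEnd_dotted] at this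
      cases b <;> cases c <;> simp [oneEnd] at this ⊢ <;> omega
    refine .loop e s a b he haP hea ho' hoa
      (hc.step {e, a} (fun d hd _ c => ?_) fun d hd => ?_) fun m T hT => ⟨?_, fun f => ?_⟩
    · simp only [Finset.mem_insert, Finset.mem_singleton] at hd
      rcases hd with rfl | rfl
      · rw [ho', hv]; cases s <;> cases c <;> simp [oneEnd]
      · simp only [Tripod.ends, hl₁, hl₂, hl₃, isEnd_dotted]
        cases b <;> cases c <;> simp [oneEnd] <;> omega
    · simp only [Finset.mem_union, Finset.mem_insert, Finset.mem_singleton, not_or] at hd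
      have := hc.one_end d hd.1
      simp only [Tripod.ends, hl₁, hl₂, hl₃, isEnd_dotted, oneEnd_of_ne hd.2.1,
        oneEnd_of_ne hd.2.2]
      omega
    · have h₅ := hT.subst (v := (l₁, l₂, l₃)) (e₁ := e) (s₁ := s)
        (R := .node (.leaf (.dotted a b)) (.leaf (.dotted a (!b)))) {e, a} {a} (by simp)
        (by simp [he, haP]) (by simp) (by rw [ho', oneEnd_self]) (fun d hd c => ?_)
        (fun d hd c => ?_) fun d hd c => ?_
      · simpa using h₅
      · rw [← hl₂, ← hl₃]; simp [RTree.ends, (hPz d hd c).2.1, (hPz d hd c).2.2]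
      · simp only [Finset.mem_insert, Finset.mem_singleton] at hd
        simp only [RTree.ends, isEnd_dotted, Finset.mem_singleton]
        rcases hd with rfl | rfl
        · rw [ho', if_neg hea, oneEnd_of_ne hea, oneEnd_of_ne hea]
        · rw [hoa, oneEnd_of_ne hea.symm, if_pos rfl]; cases b <;> cases c <;> simp [oneEnd]
      · have h₄ := hR d c
        simp only [Finset.mem_union, Finset.mem_insert, Finset.mem_singleton, not_or] at hd
        rw [oneEnd_of_ne hd.2.1, add_zero] at h₄
        rw [← hl₂, ← hl₃, h₄]
    · rw [hjoin m T hT, hl₂, hl₃]; rfl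
  · have hloop' (a : ℕ) (b : Bool) : l₂.isEnd a b = 0 ∨ l₃.isEnd a (!b) = 0 := by
      by_contra hcon
      rw [not_or] at hcon
      exact hloop ⟨a, b, hcon⟩
    have hR₀ (a : ℕ) (ha : a ∈ P) (b : Bool) : (RTree.node (.leaf l₂) (.leaf l₃)).ends a b = 0 := by
      simp [RTree.ends, (hPz a ha b).2.1, (hPz a ha b).2.2]
    have hRe (b : Bool) : (RTree.node (.leaf l₂) (.leaf l₃)).ends e b = 0 := by
      have := hR e b
      rw [hv] at this
      omega
    refine .one e s (.node (.leaf l₂) (.leaf l₃)) he (by rw [ho', oneEnd_not_self]) hR₀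
      (hc.step {e} (fun d hd _ c => ?_) fun d hd => ?_)
      fun m T hT => ⟨?_, fun b => ?_, hjoin m T hT⟩
    · rw [Finset.mem_singleton.1 hd, ho', hv]; cases s <;> cases c <;> simp [oneEnd]
    · simp only [Finset.mem_union, Finset.mem_singleton, not_or] at hd
      have h₄ := hc.one_end d hd.1
      have h₅ := hz₁ d hd.2
      have h₆ := h₅ true
      have h₇ := h₅ false
      have a₁ := hloop' d true
      have a₂ := hloop' d false
      have a₃ := l₂.isEnd_true_or_false d
      have a₄ := l₃.isEnd_true_or_false d
      simp only [Tripod.ends, Bool.not_true, Bool.not_false] at a₁ a₂ ⊢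
      by_cases ht : o d true = 0
      · by_cases hf : o d false = 0
        · omega
        · have b₁ := Label.isEnd_eq_zero_of_not_isBack h₂ hf
          have b₂ := Label.isEnd_eq_zero_of_not_isBack h₃ hf
          simp only [Bool.not_false] at b₁ b₂
          omega
      · have b₁ := Label.isEnd_eq_zero_of_not_isBack h₂ ht
        have b₂ := Label.isEnd_eq_zero_of_not_isBack h₃ ht
        simp only [Bool.not_true] at b₁ b₂
        omega
    · have h₅ := hT.subst (v := (l₁, l₂, l₃)) (e₁ := e) (s₁ := s)
        (R := .node (.leaf l₂) (.leaf l₃)) {e} ∅ (by simp)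
        (by simp [he]) (by simp) (by rw [ho', oneEnd_self]) hR₀
        (fun d hd c => ?_) fun d hd c => ?_
      · simpa using h₅
      · rw [Finset.mem_singleton.1 hd, ho', hRe]; simp
      · have h₄ := hR d c
        simp only [Finset.mem_union, Finset.mem_singleton, not_or] at hd
        rwa [oneEnd_of_ne hd.2, add_zero] at h₄
    · have h₄ := Fits.ends_subst (T := T) (e₁ := e) (s₁ := s)
        (by rw [hT.ends_eq e he, ho', oneEnd_self]) (.node (.leaf l₂) (.leaf l₃)) e b
      rw [hRe, hT.ends_eq e he, ho'] at h₄
      omega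

theorem Step.mk_two (hc : Compat P o ((l₁, l₂, l₃) :: L)) (h₁ : l₁.IsBack o) (h₂ : l₂.IsBack o)
    (h₃ : ¬ l₃.IsBack o) : Step M P o (l₁, l₂, l₃) L := by
  obtain ⟨e₁, s₁, hl₁, ho₁⟩ := h₁
  obtain ⟨e₂, s₂, hl₂, ho₂⟩ := h₂
  obtain ⟨he₁, ho₁', hv₁⟩ := hc.back (l := l₁) (fun e s => by simp [Tripod.ends]; omega) hl₁ ho₁
  obtain ⟨he₂, ho₂', hv₂⟩ := hc.back (l := l₂) (fun e s => by simp [Tripod.ends]; omega) hl₂ ho₂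
  have hPz := fun (a : ℕ) (ha : a ∈ P) b => hc.isEnd_eq_zero ha b
  have h₁₂ : e₁ ≠ e₂ := by
    rintro rfl
    have h₄ := hv₁ (!s₁)
    have h₅ := ho₁' s₂
    rw [ho₂', oneEnd_self] at h₅
    obtain ⟨-, rfl⟩ := eq_of_oneEnd_ne_zero (e := e₁) (s := s₁) (a := e₁) (b := s₂) (by omega)
    simp only [Tripod.ends, hl₁, hl₂, isEnd_dotted, oneEnd_self] at h₄
    omega
  have hK₁ (b : Bool) : l₃.isEnd e₁ b = 0 := by
    have := hv₁ b
    simp only [Tripod.ends, hl₁, hl₂, isEnd_dotted] at this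
    omega
  have hK₂ (b : Bool) : l₃.isEnd e₂ b = 0 := by
    have := hv₂ b
    simp only [Tripod.ends, hl₁, hl₂, isEnd_dotted] at this
    omega
  refine .two e₁ s₁ e₂ s₂ (.leaf l₃) he₁ he₂ h₁₂ ho₁' ho₂' (fun a ha b => ?_)
    (hc.step {e₁, e₂} (fun d hd _ c => ?_) fun d hd => ?_) fun m T hT => ⟨?_, ?_, fun f => ?_⟩
  · simp only [Finset.mem_union, Finset.mem_insert, Finset.mem_singleton] at ha
    rcases ha with ha | rfl | rfl
    · exact (hPz a ha b).2.2
    · exact hK₁ b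
    · exact hK₂ b
  · simp only [Finset.mem_insert, Finset.mem_singleton] at hd
    rcases hd with rfl | rfl
    · rw [ho₁', hv₁]; cases s₁ <;> cases c <;> simp [oneEnd]
    · rw [ho₂', hv₂]; cases s₂ <;> cases c <;> simp [oneEnd]
  · simp only [Finset.mem_union, Finset.mem_insert, Finset.mem_singleton, not_or] at hd
    have h₄ := hc.one_end d hd.1
    have a₄ := l₃.isEnd_true_or_false d
    simp only [Tripod.ends, hl₁, hl₂, isEnd_dotted, oneEnd_of_ne hd.2.1,
        oneEnd_of_ne hd.2.2]
    by_cases ht : o d true = 0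
    · by_cases hf : o d false = 0
      · omega
      · have b₂ := Label.isEnd_eq_zero_of_not_isBack h₃ hf
        simp only [Bool.not_false] at b₂
        omega
    · have b₂ := Label.isEnd_eq_zero_of_not_isBack h₃ ht
      simp only [Bool.not_true] at b₂
      omega
  · refine hT.subst (v := (l₁, l₂, l₃)) {e₁, e₂} {e₂} (by simp)
        (by simp [he₁, he₂]) (by simp) (by rw [ho₁', oneEnd_self]) (fun d hd c => ?_)
        (fun d hd c => ?_) fun d hd c => ?_
    · rw [← hl₂]; simp [RTree.ends, (hPz d hd c).2.1, (hPz d hd c).2.2]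
    · simp only [Finset.mem_insert, Finset.mem_singleton] at hd
      simp only [RTree.ends, isEnd_dotted, Finset.mem_singleton]
      rcases hd with rfl | rfl
      · rw [ho₁', if_neg h₁₂, oneEnd_of_ne h₁₂, hK₁]
      · rw [ho₂', oneEnd_of_ne h₁₂.symm, if_pos rfl, hK₂]
        cases s₂ <;> cases c <;> simp [oneEnd]
    · simp only [Finset.mem_union, Finset.mem_insert, Finset.mem_singleton, not_or] at hd
      simp [RTree.ends, Tripod.ends, hl₁, hl₂, isEnd_dotted, oneEnd_of_ne hd.2.1]
  · refine hT.subst (v := (l₁, l₂, l₃)) {e₁, e₂} {e₁} (by simp)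
        (by simp [he₁, he₂]) (by simp) (by rw [ho₂', oneEnd_self]) (fun d hd c => ?_)
        (fun d hd c => ?_) fun d hd c => ?_
    · rw [← hl₁]; simp [RTree.ends, (hPz d hd c).1, (hPz d hd c).2.2]
    · simp only [Finset.mem_insert, Finset.mem_singleton] at hd
      simp only [RTree.ends, isEnd_dotted, Finset.mem_singleton]
      rcases hd with rfl | rfl
      · rw [ho₁', oneEnd_of_ne h₁₂, if_pos rfl, hK₁]
        cases s₁ <;> cases c <;> simp [oneEnd]
      · rw [ho₂', if_neg h₁₂.symm, oneEnd_of_ne h₁₂.symm, hK₂]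
    · simp only [Finset.mem_union, Finset.mem_insert, Finset.mem_singleton, not_or] at hd
      simp [RTree.ends, Tripod.ends, hl₁, hl₂, isEnd_dotted, oneEnd_of_ne hd.2.2, add_comm]
  · simp only [joinTripod]
    rw [hT.joinAt_of_not_isBack (fun a ha b => (hPz a ha b).2.2) h₃, hl₁, hl₂, add_zero,
      joinAt_of_isBack _ (by rw [hT.ends_eq e₁ he₁]; exact ho₁),
      joinAt_of_isBack _ (by rw [hT.ends_eq e₂ he₂]; exact ho₂)]
    rfl

theorem Step.mk_three (hc : Compat P o ((l₁, l₂, l₃) :: L)) (h₁ : l₁.IsBack o) (h₂ : l₂.IsBack o)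
    (h₃ : l₃.IsBack o) : Step M P o (l₁, l₂, l₃) L := by
  obtain ⟨e₁, s₁, hl₁, ho₁⟩ := h₁
  obtain ⟨e₂, s₂, hl₂, ho₂⟩ := h₂
  obtain ⟨e₃, s₃, hl₃, ho₃⟩ := h₃
  obtain ⟨he₁, ho₁', hv₁⟩ := hc.back (l := l₁) (fun e s => by simp [Tripod.ends]; omega) hl₁ ho₁
  obtain ⟨he₂, ho₂', hv₂⟩ := hc.back (l := l₂) (fun e s => by simp [Tripod.ends]; omega) hl₂ ho₂
  obtain ⟨he₃, ho₃', hv₃⟩ := hc.back (l := l₃) (fun e s => by simp [Tripod.ends]) hl₃ ho₃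
  have hPz := fun (a : ℕ) (ha : a ∈ P) b => hc.isEnd_eq_zero ha b
  have hne {e s d t} (ho : ∀ b, o e b = oneEnd e s e b) (ho' : ∀ b, o d b = oneEnd d t d b)
      (hv : ∀ b, Tripod.ends e b (l₁, l₂, l₃) = oneEnd e (!s) e b)
      (h : (Label.dotted e (!s) : Label H).isEnd e (!s) + (Label.dotted d (!t) : Label H).isEnd e (!s)
        ≤ Tripod.ends e (!s) (l₁, l₂, l₃)) : e ≠ d := by
    rintro rfl
    have h₅ := ho t
    rw [ho', oneEnd_self] at h₅
    obtain ⟨-, rfl⟩ := eq_of_oneEnd_ne_zero (e := e) (s := s) (a := e) (b := t) (by omega)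
    rw [hv, isEnd_dotted, oneEnd_self] at h
    omega
  have h₁₂ : e₁ ≠ e₂ := hne ho₁' ho₂' hv₁ (by simp only [Tripod.ends, hl₁, hl₂]; omega)
  have h₁₃ : e₁ ≠ e₃ := hne ho₁' ho₃' hv₁ (by simp only [Tripod.ends, hl₁, hl₃]; omega)
  have h₂₃ : e₂ ≠ e₃ := hne ho₂' ho₃' hv₂ (by simp only [Tripod.ends, hl₂, hl₃]; omega)
  have hG : ∀ d ∈ ({e₁, e₂, e₃} : Finset ℕ), d ∉ P := by simp [he₁, he₂, he₃]
  refine .three e₁ s₁ e₂ s₂ e₃ s₃ he₁ he₂ he₃ h₁₂ h₁₃ h₂₃ ho₁' ho₂' ho₃'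
    (hc.step {e₁, e₂, e₃} (fun d hd _ c => ?_) fun d hd => ?_)
    fun m T hT => ⟨?_, ?_, ?_, fun f => ?_⟩
  · simp only [Finset.mem_insert, Finset.mem_singleton] at hd
    rcases hd with rfl | rfl | rfl
    · rw [ho₁', hv₁]; cases s₁ <;> cases c <;> simp [oneEnd]
    · rw [ho₂', hv₂]; cases s₂ <;> cases c <;> simp [oneEnd]
    · rw [ho₃', hv₃]; cases s₃ <;> cases c <;> simp [oneEnd]
  · simp only [Finset.mem_union, Finset.mem_insert, Finset.mem_singleton, not_or] at hd
    have h₄ := hc.one_end d hd.1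
    simp only [Tripod.ends, hl₁, hl₂, hl₃, isEnd_dotted, oneEnd_of_ne hd.2.1,
        oneEnd_of_ne hd.2.2.1, oneEnd_of_ne hd.2.2.2]
    omega
  · have h₅ := hT.subst (v := (l₁, l₂, l₃)) (e₁ := e₁) (s₁ := s₁)
      (R := .node (.leaf (.dotted e₂ (!s₂))) (.leaf (.dotted e₃ (!s₃)))) {e₁, e₂, e₃} {e₂, e₃}
      (by simp) hG (by simp) (by rw [ho₁', oneEnd_self]) (fun d hd c => ?_)
      (fun d hd c => ?_) fun d hd c => ?_
    · rwa [Finset.card_pair h₂₃] at h₅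
    · rw [← hl₂, ← hl₃]; simp [RTree.ends, (hPz d hd c).2.1, (hPz d hd c).2.2]
    · simp only [Finset.mem_insert, Finset.mem_singleton] at hd
      simp only [RTree.ends, isEnd_dotted]
      rcases hd with rfl | rfl | rfl
      · simp [ho₁', h₁₂, h₁₃, oneEnd_of_ne h₁₂, oneEnd_of_ne h₁₃]
      · rw [ho₂', oneEnd_of_ne h₁₂.symm, oneEnd_of_ne h₂₃]
        cases s₂ <;> cases c <;> simp [oneEnd]
      · rw [ho₃', oneEnd_of_ne h₁₃.symm, oneEnd_of_ne h₂₃.symm]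
        cases s₃ <;> cases c <;> simp [oneEnd]
    · simp only [Finset.mem_union, Finset.mem_insert, Finset.mem_singleton, not_or] at hd
      simp [RTree.ends, Tripod.ends, hl₁, hl₂, hl₃, isEnd_dotted, oneEnd_of_ne hd.2.1]
  · have h₅ := hT.subst (v := (l₁, l₂, l₃)) (e₁ := e₂) (s₁ := s₂)
      (R := .node (.leaf (.dotted e₃ (!s₃))) (.leaf (.dotted e₁ (!s₁)))) {e₁, e₂, e₃} {e₃, e₁}
      (by simp) hG (by simp [Finset.insert_subset_iff]) (by rw [ho₂', oneEnd_self])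
      (fun d hd c => ?_) (fun d hd c => ?_) fun d hd c => ?_
    · rwa [Finset.card_pair h₁₃.symm] at h₅
    · rw [← hl₁, ← hl₃]; simp [RTree.ends, (hPz d hd c).1, (hPz d hd c).2.2]
    · simp only [Finset.mem_insert, Finset.mem_singleton] at hd
      simp only [RTree.ends, isEnd_dotted]
      rcases hd with rfl | rfl | rfl
      · rw [ho₁', oneEnd_of_ne h₁₂, oneEnd_of_ne h₁₃]
        cases s₁ <;> cases c <;> simp [oneEnd]
      · simp [ho₂', h₁₂.symm, h₂₃, oneEnd_of_ne h₁₂.symm, oneEnd_of_ne h₂₃]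
      · rw [ho₃', oneEnd_of_ne h₁₃.symm, oneEnd_of_ne h₂₃.symm]
        cases s₃ <;> cases c <;> simp [oneEnd]
    · simp only [Finset.mem_union, Finset.mem_insert, Finset.mem_singleton, not_or] at hd
      simp [RTree.ends, Tripod.ends, hl₁, hl₂, hl₃, isEnd_dotted, oneEnd_of_ne hd.2.2.1, add_comm]
  · have h₅ := hT.subst (v := (l₁, l₂, l₃)) (e₁ := e₃) (s₁ := s₃)
      (R := .node (.leaf (.dotted e₁ (!s₁))) (.leaf (.dotted e₂ (!s₂)))) {e₁, e₂, e₃} {e₁, e₂}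
      (by simp) hG (by simp [Finset.insert_subset_iff]) (by rw [ho₃', oneEnd_self])
      (fun d hd c => ?_) (fun d hd c => ?_) fun d hd c => ?_
    · rwa [Finset.card_pair h₁₂] at h₅
    · rw [← hl₁, ← hl₂]; simp [RTree.ends, (hPz d hd c).1, (hPz d hd c).2.1]
    · simp only [Finset.mem_insert, Finset.mem_singleton] at hd
      simp only [RTree.ends, isEnd_dotted]
      rcases hd with rfl | rfl | rfl
      · rw [ho₁', oneEnd_of_ne h₁₂, oneEnd_of_ne h₁₃]
        cases s₁ <;> cases c <;> simp [oneEnd]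
      · rw [ho₂', oneEnd_of_ne h₁₂.symm, oneEnd_of_ne h₂₃]
        cases s₂ <;> cases c <;> simp [oneEnd]
      · simp [ho₃', h₁₃.symm, h₂₃.symm, oneEnd_of_ne h₁₃.symm, oneEnd_of_ne h₂₃.symm]
    · simp only [Finset.mem_union, Finset.mem_insert, Finset.mem_singleton, not_or] at hd
      simp [RTree.ends, Tripod.ends, hl₁, hl₂, hl₃, isEnd_dotted, oneEnd_of_ne hd.2.2.2]
  · simp only [joinTripod]
    rw [hl₁, hl₂, hl₃,
      joinAt_of_isBack _ (by rw [hT.ends_eq e₁ he₁]; exact ho₁),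
      joinAt_of_isBack _ (by rw [hT.ends_eq e₂ he₂]; exact ho₂),
      joinAt_of_isBack _ (by rw [hT.ends_eq e₃ he₃]; exact ho₃)]
    rfl

/-- Rotate the tripod such that the labels whose other ends are in the tree come first. -/
theorem Compat.exists_step {v : Tripod H} (hc : Compat P o (v :: L)) : Step M P o v L := by
  obtain ⟨l₁, l₂, l₃⟩ := v
  by_cases h₁ : l₁.IsBack o <;> by_cases h₂ : l₂.IsBack o <;> by_cases h₃ : l₃.IsBack o
  · exact .mk_three hc h₁ h₂ h₃
  · exact .mk_two hc h₁ h₂ h₃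
  · exact .of_rotate (.of_rotate (.mk_two hc.rotate.rotate h₃ h₁ h₂))
  · exact .mk_one hc h₁ h₂ h₃
  · exact .of_rotate (.mk_two hc.rotate h₂ h₃ h₁)
  · exact .of_rotate (.mk_one hc.rotate h₂ h₃ h₁)
  · exact .of_rotate (.of_rotate (.mk_one hc.rotate.rotate h₃ h₁ h₂))
  · refine .zero fun m T hT f => ?_
    have hPz := fun (a : ℕ) (ha : a ∈ P) b => hc.isEnd_eq_zero ha b
    simp only [joinTripod]
    rw [hT.joinAt_of_not_isBack (fun a ha b => (hPz a ha b).1) h₁,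
      hT.joinAt_of_not_isBack (fun a ha b => (hPz a ha b).2.1) h₂,
      hT.joinAt_of_not_isBack (fun a ha b => (hPz a ha b).2.2) h₃, add_zero, add_zero]

end StepCases

/-! ### Joining trees to a cycle of tripods is zero -/

section Machines

variable {H : Type*} [AddCommGroup H] [Module ℚ H] {M : Type*} [AddCommGroup M] [Module ℚ M]
  {f : Tree H → M} {Θ : FourForm H M} {P : Finset ℕ} {o : ℕ → Bool → ℕ} {m : ℕ} {T : Tree H}
  {L : List (Tripod H)} {v : Tripod H}

/-- Joining three ends to a tripod is zero: on the path between two of the ends this is the relation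
`IsThreeTerm.tripod`. -/
theorem IsInvariant.join₃_eq_zero (hf : IsInvariant f) (hb : IsBalanced Θ) (h₃ : IsThreeTerm Θ)
    (hΘ : ∀ t u v w, f ((thetaGraph t u v w).tree 0) =
      Θ (pureTensor t) (pureTensor u) (pureTensor v) (pureTensor w))
    {e₁ e₂ e₃ : ℕ} (h₁₂ : e₁ ≠ e₂) (h₁₃ : e₁ ≠ e₃) (h₂₃ : e₂ ≠ e₃) {s₁ s₂ s₃ : Bool}
    (hT : ∀ a b, T.ends a b = oneEnd e₁ s₁ a b + oneEnd e₂ s₂ a b + oneEnd e₃ s₃ a b) :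
    join₃ f e₁ s₁ e₂ s₂ e₃ s₃ T = 0 := by
  obtain ⟨Rs, hne, hRs, hr⟩ := exists_path M (e := e₁) (e' := e₃) (s := s₁) (s' := s₃)
    (by simp [h₁₃]) T (by simp [hT]) (by simp [hT])
  simp only [isEnd_dotted] at hRs
  have hl := hf.toIsLocal.join₃ e₁ s₁ e₂ s₂ e₃ s₃
  refine hr _ hl ?_
  refine list_eq_zero_of_leaves (P := fun Rs => ∀ a b, listEnds a b Rs = oneEnd e₂ s₂ a b)
    (g := fun Rs => pathVal (HairyLie.join₃ f e₁ s₁ e₂ s₂ e₃ s₃) (.leaf (.dotted e₁ s₁)) Rs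
      (.leaf (.dotted e₃ s₃)))
    (fun Ls A B Rs hP => ?_) (fun Ls A B Rs hP => hl.pathVal_ihx _ _ _ _ _ _) (fun w hP => ?_) Rs
    fun a b => ?_
  · constructor <;> intro a b <;> rw [← hP a b] <;> simp [RTree.ends] <;> omega
  · obtain ⟨α, γ, h⟩ := exists_word_one w hP
    simp only [h]
    rw [hf.pathVal_join₃ hb hΘ h₁₂ h₁₃ h₂₃, h₃.tripod hb, smul_zero]
  · have := hRs a b
    have := hT a b
    omega

/-- Only trees with exactly two dotted edges contribute. -/
theorem Fits.eq_two (hT : Fits P o m T) (ho : ∀ e ∉ P, o e true = 0 ∨ o e false = 0) {e e' : ℕ}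
    (h : T.HasEdges e e') : m = 2 := by
  obtain ⟨S, hsub, rfl, hS⟩ := hT.pairs
  have h₁ (d : ℕ) : d ∈ S ∧ d ∈ P ∨ T.ends d true = 0 ∨ T.ends d false = 0 := by
    by_cases hP : d ∈ P
    · by_cases hd : d ∈ S
      · exact .inl ⟨hd, hP⟩
      · right; left; rw [hS d hP, if_neg hd]
    · rw [hT.ends_eq d hP, hT.ends_eq d hP]; exact .inr (ho d hP)
  have he : e ∈ S ∧ e ∈ P := by simpa [h.2] using h₁ e
  have he' : e' ∈ S ∧ e' ∈ P := by simpa [h.2] using h₁ e'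
  have : S = {e, e'} := by
    ext d
    simp only [Finset.mem_insert, Finset.mem_singleton]
    refine ⟨fun hd => ?_, by rintro (rfl | rfl) <;> simp [he, he']⟩
    by_contra hc
    have h₂ := h.2 d true
    by_cases hP : d ∈ P
    · rw [hS d hP, if_pos hd, if_neg hc] at h₂; omega
    · exact hP (hsub hd)
  rw [this, Finset.card_pair h.1]

end Machines

section Machines

variable {H : Type*} [AddCommGroup H] [Module ℚ H] {M : Type*} [AddCommGroup M] [Module ℚ M]
  {f : Tree H → M} {Θ : FourForm H M} {P : Finset ℕ} {o : ℕ → Bool → ℕ} {m : ℕ} {T : Tree H}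
  {L : List (Tripod H)} {v : Tripod H} {Λ : (Tree H → M) → M}
  {𝒯 : (Tree H → M) → Finset ℕ → (ℕ → Bool → ℕ) → Prop}

theorem IsAdmissible.mono {σ : Label H → RTree H} {P' : Finset ℕ} (hσ : IsAdmissible P' σ)
    (h : P ⊆ P') : IsAdmissible P σ where
  hair := hσ.hair
  mem e he := hσ.mem e (h he)
  not_mem e he s a ha b := by
    by_cases he' : e ∈ P'
    · rw [hσ.mem e he', ends_leaf_dotted, oneEnd_of_ne (by rintro rfl; exact he ha)]
    · exact hσ.not_mem e he' s a (h ha) b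

/-- The functional `Λ` on functions of trees depends only on the values at the trees that fit `P`,
`o` and `m`, and it is zero at the functions `T ↦ h (T.bind σ)`, where `h` belongs to the class `𝒯`
and the substitution `σ` makes the ends of dotted edges outside `P` those that `h` requires. -/
structure IsNull (𝒯 : (Tree H → M) → Finset ℕ → (ℕ → Bool → ℕ) → Prop) (P : Finset ℕ)
    (o : ℕ → Bool → ℕ) (m : ℕ) (Λ : (Tree H → M) → M) : Prop where
  congr : ∀ g g', (∀ T, Fits P o m T → g T = g' T) → Λ g = Λ g'
  smul : ∀ (c : ℚ) g, Λ (fun T => c • g T) = c • Λ g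
  null : ∀ h F c, 𝒯 h F c → (∀ e ∈ F, e ∉ P) → ∀ σ, IsAdmissible P σ →
    (∀ T, Fits P o m T → ∀ a ∉ P, ∀ b, (T.bind σ).ends a b = c a b) →
    Λ (fun T => h (T.bind σ)) = 0

theorem IsNull.zero (hΛ : IsNull 𝒯 P o m Λ) {g : Tree H → M} (hg : ∀ T, Fits P o m T → g T = 0) :
    Λ g = 0 := by
  have h := hΛ.smul 0 g
  rw [zero_smul] at h
  rw [← h]
  exact hΛ.congr _ _ fun T hT => by rw [hg T hT, smul_zero]

/-- Joining a tripod at a single univalent vertex is a substitution. -/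
theorem IsNull.subst (hΛ : IsNull 𝒯 P o m Λ) (h𝒯 : ∀ h F c, 𝒯 h F c → ∀ e ∉ F, ∀ b, c e b = 0)
    {o' : ℕ → Bool → ℕ} {e : ℕ} {s : Bool} {R : RTree H} (he : e ∉ P) (ho : o e (!s) = 0)
    (hR : ∀ a ∈ P, ∀ b, R.ends a b = 0)
    (h : ∀ T, Fits P o m T → Fits (P ∪ {e}) o' m (T.subst e s R) ∧
      ∀ b, (T.subst e s R).ends e b = 0) :
    IsNull 𝒯 (P ∪ {e}) o' m (fun g => Λ fun T => endSign s • g (T.subst e s R)) where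
  congr g g' hg := hΛ.congr _ _ fun T hT => by rw [hg _ (h T hT).1]
  smul c g := by
    rw [← hΛ.smul]
    congr 1
    funext T
    rw [smul_comm]
  null k F c hk hF σ hσ hc := by
    obtain ⟨σ', hσ', hb⟩ := hσ.exists_bind_subst he s hR
    have hb' (T : Tree H) (hT : Fits P o m T) : (T.subst e s R).bind σ = T.bind σ' :=
      hb T (by rw [hT.ends_eq e he, ho])
    rw [hΛ.congr _ (fun T => endSign s • k (T.bind σ')) fun T hT => by simp only [hb' T hT], hΛ.smul,
      hΛ.null k F c hk (fun a ha h => hF a ha (Finset.mem_union_left _ h)) σ' hσ', smul_zero]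
    intro T hT a ha b
    rw [← hb' T hT]
    by_cases hae : a = e
    · subst hae
      rw [hσ.ends_bind (by simp), (h T hT).2, h𝒯 k F c hk a fun h => hF a h (by simp)]
    · exact hc _ (h T hT).1 a (by simp [ha, hae]) b

/-- Gluing never decreases the number of dotted edges with both ends in the tree, and an invariant
function is zero on trees with more than two of them. -/
theorem Fits.joinAll_eq_zero (hf : IsInvariant f) (hm : 3 ≤ m) (hc : Compat P o L)
    (hT : Fits P o m T) : joinAll f L T = 0 := by
  induction L generalizing P o m T with
  | nil =>
    by_contra h
    obtain ⟨e, e', he⟩ := hf.support T h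
    have := hT.eq_two hc.one_end he
    omega
  | cons v L ih =>
    have hs : Step M P o v L := hc.exists_step
    rw [joinAll]
    cases hs with
    | zero h => exact h m T hT _
    | one e s R he ho hR hc h => rw [(h m T hT).2.2, ih hm hc (h m T hT).1, smul_zero]
    | two e₁ s₁ e₂ s₂ K he₁ he₂ h₁₂ ho₁ ho₂ hK hc h =>
      obtain ⟨a₁, a₂, a₃⟩ := h m T hT
      rw [a₃, join₂, ih (by omega) hc a₁, ih (by omega) hc a₂, smul_zero, smul_zero, add_zero]
    | loop e₁ s₁ e₂ s₂ he₁ he₂ h₁₂ ho₁ ho₂ hc h =>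
      obtain ⟨a₁, a₃⟩ := h m T hT
      rw [a₃, joinLoop, ih (by omega) hc a₁, smul_zero]
    | three e₁ s₁ e₂ s₂ e₃ s₃ he₁ he₂ he₃ h₁₂ h₁₃ h₂₃ ho₁ ho₂ ho₃ hc h =>
      obtain ⟨a₁, a₂, a₃, a₄⟩ := h m T hT
      rw [a₄, join₃, ih (by omega) hc a₁, ih (by omega) hc a₂, ih (by omega) hc a₃]
      simp

/-- The class that consists of the function `f` for trees without further ends of dotted edges. -/
def IsClosedAt (f h : Tree H → M) (F : Finset ℕ) (c : ℕ → Bool → ℕ) : Prop :=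
  h = f ∧ F = ∅ ∧ ∀ a b, c a b = 0

/-- If the tree already has two dotted edges, then only tripods joined at a single end contribute,
and these do not change the class of functions on which the functional vanishes. -/
theorem IsNull.joinAll_two (hf : IsInvariant f) (hΛ : IsNull (IsClosedAt f) P o 2 Λ)
    (hc : Compat P o L) : Λ (joinAll f L) = 0 := by
  induction L generalizing P o Λ with
  | nil =>
    have ho (e : ℕ) (he : e ∉ P) (s : Bool) : o e s = 0 := by
      have h₁ := hc.one_end e he
      have h₂ := hc.total e he
      simp only [tripodEnds_nil, add_zero] at h₂
      cases s <;> omega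
    obtain ⟨σ, hσ, hb⟩ := exists_bind_eq_self (H := H) P
    have hb' (T : Tree H) (hT : Fits P o 2 T) : T.bind σ = T :=
      hb T fun e he s => by rw [hT.ends_eq e he, ho e he]
    rw [hΛ.congr _ (fun T => f (T.bind σ)) fun T hT => by rw [hb' T hT]; rfl]
    exact hΛ.null f ∅ (fun _ _ => 0) ⟨rfl, rfl, fun _ _ => rfl⟩ (by simp) σ hσ
      fun T hT a ha b => by rw [hb' T hT, hT.ends_eq a ha, ho a ha]
  | cons v L ih =>
    have hs : Step M P o v L := hc.exists_step
    cases hs with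
    | zero h => exact hΛ.zero fun T hT => h 2 T hT _
    | one e s R he ho hR hc h =>
      refine (hΛ.congr _ (fun T => endSign s • joinAll f L (T.subst e s R)) fun T hT =>
        (h 2 T hT).2.2 _).trans ?_
      exact ih (hΛ.subst (by rintro h F c ⟨-, -, h⟩ e - b; exact h e b) he ho hR fun T hT =>
        ⟨(h 2 T hT).1, (h 2 T hT).2.1⟩) hc
    | two e₁ s₁ e₂ s₂ K he₁ he₂ h₁₂ ho₁ ho₂ hK hc h =>
      refine hΛ.zero fun T hT => ?_
      obtain ⟨a₁, a₂, a₃⟩ := h 2 T hT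
      rw [joinAll, a₃, join₂, a₁.joinAll_eq_zero hf le_rfl hc, a₂.joinAll_eq_zero hf le_rfl hc]
      simp
    | loop e₁ s₁ e₂ s₂ he₁ he₂ h₁₂ ho₁ ho₂ hc h =>
      refine hΛ.zero fun T hT => ?_
      obtain ⟨a₁, a₃⟩ := h 2 T hT
      rw [joinAll, a₃, joinLoop, a₁.joinAll_eq_zero hf le_rfl hc, smul_zero]
    | three e₁ s₁ e₂ s₂ e₃ s₃ he₁ he₂ he₃ h₁₂ h₁₃ h₂₃ ho₁ ho₂ ho₃ hc h =>
      refine hΛ.zero fun T hT => ?_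
      obtain ⟨a₁, a₂, a₃, a₄⟩ := h 2 T hT
      rw [joinAll, a₄, join₃, a₁.joinAll_eq_zero hf (by omega) hc,
        a₂.joinAll_eq_zero hf (by omega) hc, a₃.joinAll_eq_zero hf (by omega) hc]
      simp

theorem bind_leaf_dotted {σ : Label H → RTree H} (hσ : IsAdmissible P σ) {e : ℕ} (he : e ∈ P)
    (s : Bool) : (RTree.leaf (.dotted e s)).bind σ = .leaf (.dotted e s) := hσ.mem e he s

/-- Ends of dotted edges after a substitution, at the names that are not in `P`. -/
theorem IsAdmissible.ends_bind_add {σ : Label H → RTree H} (hσ : IsAdmissible P σ) {e : ℕ}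
    (he : e ∈ P) {s : Bool} {T : Tree H} (hT : T.ends e s = 1) (X : RTree H) {a : ℕ} (ha : a ∉ P)
    (b : Bool) : ((T.subst e s X).bind σ).ends a b =
      (T.bind σ).ends a b + (X.bind σ).ends a b := by
  have h := Fits.ends_subst (T := T.bind σ) (by rw [hσ.ends_bind he]; exact hT) (X.bind σ) a b
  rwa [oneEnd_of_ne (by rintro rfl; exact ha he), add_zero, ← hσ.bind_subst he] at h

theorem IsAdmissible.join₂_bind {σ : Label H → RTree H} (hσ : IsAdmissible P σ) {e₁ e₂ : ℕ}
    (h₁ : e₁ ∈ P) (h₂ : e₂ ∈ P) (g : Tree H → M) (s₁ s₂ : Bool) (K : RTree H) (T : Tree H) :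
    join₂ (fun T => g (T.bind σ)) e₁ s₁ e₂ s₂ K T =
      join₂ g e₁ s₁ e₂ s₂ (K.bind σ) (T.bind σ) := by
  simp only [join₂, hσ.bind_subst h₁, hσ.bind_subst h₂, RTree.bind, hσ.mem _ h₁, hσ.mem _ h₂]

theorem IsAdmissible.join₃_bind {σ : Label H → RTree H} (hσ : IsAdmissible P σ) {e₁ e₂ e₃ : ℕ}
    (h₁ : e₁ ∈ P) (h₂ : e₂ ∈ P) (h₃ : e₃ ∈ P) (g : Tree H → M) (s₁ s₂ s₃ : Bool) (T : Tree H) :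
    join₃ (fun T => g (T.bind σ)) e₁ s₁ e₂ s₂ e₃ s₃ T =
      join₃ g e₁ s₁ e₂ s₂ e₃ s₃ (T.bind σ) := by
  simp only [join₃, hσ.bind_subst h₁, hσ.bind_subst h₂, hσ.bind_subst h₃, RTree.bind,
    hσ.mem _ h₁, hσ.mem _ h₂, hσ.mem _ h₃]

theorem IsAdmissible.joinLoop_bind {σ : Label H → RTree H} (hσ : IsAdmissible P σ) {e₁ e₂ : ℕ}
    (h₁ : e₁ ∈ P) (h₂ : e₂ ∈ P) (g : Tree H → M) (s₁ s₂ : Bool) (T : Tree H) :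
    joinLoop (fun T => g (T.bind σ)) e₁ s₁ e₂ s₂ T = joinLoop g e₁ s₁ e₂ s₂ (T.bind σ) := by
  simp only [joinLoop, hσ.bind_subst h₁, RTree.bind, hσ.mem _ h₂]

/-- The functional is zero if no tree fits, so one may assume that some tree does. -/
theorem IsNull.of_nonempty (hΛ : IsNull 𝒯 P o m Λ) {g : Tree H → M}
    (h : ∀ T : Tree H, Fits P o m T → Λ g = 0) : Λ g = 0 := by
  by_cases hT : ∃ T : Tree H, Fits P o m T
  · exact h _ hT.choose_spec
  · exact hΛ.zero fun T h => (hT ⟨T, h⟩).elim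

/-- If a second dotted edge is created by joining two ends to a tripod, then the functional vanishes
since `join₂ f` has cyclic symmetry. -/
theorem IsNull.join₂ (hf : IsInvariant f) (hb : IsBalanced Θ) (h₃ : IsThreeTerm Θ)
    (hΘ : ∀ t u v w, f ((thetaGraph t u v w).tree 0) =
      Θ (pureTensor t) (pureTensor u) (pureTensor v) (pureTensor w))
    (hΛ : IsNull IsCyclic P o 1 Λ) {o' : ℕ → Bool → ℕ} {e₁ e₂ : ℕ} {s₁ s₂ : Bool} {K : RTree H}
    (he₁ : e₁ ∉ P) (he₂ : e₂ ∉ P) (h₁₂ : e₁ ≠ e₂) (ho₁ : ∀ b, o e₁ b = oneEnd e₁ s₁ e₁ b)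
    (ho₂ : ∀ b, o e₂ b = oneEnd e₂ s₂ e₂ b) (hK : ∀ a ∈ P ∪ {e₁, e₂}, ∀ b, K.ends a b = 0)
    (h : ∀ T, Fits P o 1 T →
      Fits (P ∪ {e₁, e₂}) o' 2 (T.subst e₁ s₁ (.node (.leaf (.dotted e₂ (!s₂))) K)) ∧
      Fits (P ∪ {e₁, e₂}) o' 2 (T.subst e₂ s₂ (.node K (.leaf (.dotted e₁ (!s₁)))))) :
    IsNull (IsClosedAt f) (P ∪ {e₁, e₂}) o' 2 (fun g => Λ (HairyLie.join₂ g e₁ s₁ e₂ s₂ K)) where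
  congr g g' hg := hΛ.congr _ _ fun T hT => by
    rw [HairyLie.join₂, HairyLie.join₂, hg _ (h T hT).1, hg _ (h T hT).2]
  smul c g := by
    rw [← hΛ.smul]
    congr 1
    funext T
    simp only [HairyLie.join₂, smul_add, smul_comm c]
  null k F c hk _ σ hσ hc := by
    obtain ⟨rfl, -, hc₀⟩ := hk
    have m₁ : e₁ ∈ P ∪ {e₁, e₂} := by simp
    have m₂ : e₂ ∈ P ∪ {e₁, e₂} := by simp
    refine hΛ.of_nonempty fun T₀ hT₀ => ?_
    have key (T : Tree H) (hT : Fits P o 1 T) (a : ℕ) (ha : a ∉ P ∪ {e₁, e₂}) (b : Bool) :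
        (T.bind σ).ends a b = 0 ∧ (K.bind σ).ends a b = 0 := by
      have h₁ := hc _ (h T hT).1 a ha b
      rw [hσ.ends_bind_add m₁ (by rw [hT.ends_eq _ he₁, ho₁, oneEnd_self]) _ ha, hc₀, RTree.bind,
        RTree.ends] at h₁
      omega
    have hK₀ (a : ℕ) (b : Bool) : (K.bind σ).ends a b = 0 := by
      by_cases ha : a ∈ P ∪ {e₁, e₂}
      · rw [hσ.rEnds_bind ha, hK a ha]
      · exact (key T₀ hT₀ a ha b).2
    simp only [funext (hσ.join₂_bind m₁ m₂ k s₁ s₂ K)]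
    refine hΛ.null _ _ _ (hf.isCyclic_join₂ hb h₃ hΘ h₁₂ s₁ s₂ hK₀) (by simp [he₁, he₂]) σ
      (hσ.mono Finset.subset_union_left) fun T hT a ha b => ?_
    by_cases ha' : a ∈ P ∪ {e₁, e₂}
    · rw [hσ.ends_bind ha', hT.ends_eq a ha]
      simp only [Finset.mem_union, ha, Finset.mem_insert, Finset.mem_singleton, false_or] at ha'
      rcases ha' with rfl | rfl
      · rw [ho₁, oneEnd_of_ne h₁₂, add_zero]
      · rw [ho₂, oneEnd_of_ne h₁₂.symm, zero_add]
    · rw [(key T hT a ha' b).1]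
      simp only [Finset.mem_union, Finset.mem_insert, Finset.mem_singleton, not_or] at ha'
      rw [oneEnd_of_ne ha'.2.1, oneEnd_of_ne ha'.2.2]

/-- If a second dotted edge is created by joining to a tripod with a dotted loop, then the
functional vanishes since `joinLoop f` has cyclic symmetry. -/
theorem IsNull.joinLoop (hf : IsInvariant f) (h₃ : IsThreeTerm Θ)
    (hΘ : ∀ t u v w, f ((thetaGraph t u v w).tree 0) =
      Θ (pureTensor t) (pureTensor u) (pureTensor v) (pureTensor w))
    (hΛ : IsNull IsCyclic P o 1 Λ) {o' : ℕ → Bool → ℕ} {e₁ e₂ : ℕ} {s₁ s₂ : Bool}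
    (he₁ : e₁ ∉ P) (he₂ : e₂ ∉ P) (h₁₂ : e₁ ≠ e₂) (ho₁ : ∀ b, o e₁ b = oneEnd e₁ s₁ e₁ b)
    (ho₂ : ∀ b, o e₂ b = 0)
    (h : ∀ T : Tree H, Fits P o 1 T → Fits (P ∪ {e₁, e₂}) o' 2
      (T.subst e₁ s₁ (.node (.leaf (.dotted e₂ s₂)) (.leaf (.dotted e₂ (!s₂)))))) :
    IsNull (IsClosedAt f) (P ∪ {e₁, e₂}) o' 2
      (fun g => Λ fun T => endSign s₁ • HairyLie.joinLoop g e₁ s₁ e₂ s₂ T) where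
  congr g g' hg := hΛ.congr _ _ fun T hT => by
    rw [HairyLie.joinLoop, HairyLie.joinLoop, hg _ (h T hT)]
  smul c g := by
    rw [← hΛ.smul]
    congr 1
    funext T
    simp only [HairyLie.joinLoop, smul_comm c]
  null k F c hk _ σ hσ hc := by
    obtain ⟨rfl, -, hc₀⟩ := hk
    have m₁ : e₁ ∈ P ∪ {e₁, e₂} := by simp
    have m₂ : e₂ ∈ P ∪ {e₁, e₂} := by simp
    simp only [hσ.joinLoop_bind m₁ m₂ k s₁ s₂]
    rw [hΛ.smul, hΛ.null _ _ _ (hf.isCyclic_joinLoop h₃ hΘ e₁ e₂ s₁ s₂) (by simp [he₁, he₂]) σ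
      (hσ.mono Finset.subset_union_left), smul_zero]
    intro T hT a ha b
    by_cases ha' : a ∈ P ∪ {e₁, e₂}
    · rw [hσ.ends_bind ha', hT.ends_eq a ha]
      simp only [Finset.mem_union, ha, Finset.mem_insert, Finset.mem_singleton, false_or] at ha'
      rcases ha' with rfl | rfl
      · rw [ho₁]
      · rw [ho₂, oneEnd_of_ne h₁₂.symm]
    · have h₁ := hc _ (h T hT) a ha' b
      rw [hσ.ends_bind_add m₁ (by rw [hT.ends_eq _ he₁, ho₁, oneEnd_self]) _ ha', hc₀] at h₁
      simp only [Finset.mem_union, Finset.mem_insert, Finset.mem_singleton, not_or] at ha'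
      rw [oneEnd_of_ne ha'.2.1]
      omega

/-- A functional that vanishes on functions with cyclic symmetry vanishes on iterated joins starting
from trees with one dotted edge: the second dotted edge is created by `join₂` or `joinLoop`. -/
theorem IsNull.joinAll_one (hf : IsInvariant f) (hb : IsBalanced Θ) (h₃ : IsThreeTerm Θ)
    (hΘ : ∀ t u v w, f ((thetaGraph t u v w).tree 0) =
      Θ (pureTensor t) (pureTensor u) (pureTensor v) (pureTensor w))
    (hΛ : IsNull IsCyclic P o 1 Λ) (hc : Compat P o L) : Λ (joinAll f L) = 0 := by
  induction L generalizing P o Λ with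
  | nil =>
    refine hΛ.zero fun T hT => ?_
    by_contra h
    obtain ⟨e, e', he⟩ := hf.support T h
    exact absurd (hT.eq_two hc.one_end he) (by norm_num)
  | cons v L ih =>
    have hs : Step M P o v L := hc.exists_step
    cases hs with
    | zero h => exact hΛ.zero fun T hT => h 1 T hT _
    | one e s R he ho hR hc h =>
      refine (hΛ.congr _ (fun T => endSign s • joinAll f L (T.subst e s R)) fun T hT =>
        (h 1 T hT).2.2 _).trans ?_
      exact ih (hΛ.subst (fun h F c hc => hc.names) he ho hR fun T hT =>
        ⟨(h 1 T hT).1, (h 1 T hT).2.1⟩) hc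
    | two e₁ s₁ e₂ s₂ K he₁ he₂ h₁₂ ho₁ ho₂ hK hc h =>
      refine (hΛ.congr _ (HairyLie.join₂ (joinAll f L) e₁ s₁ e₂ s₂ K) fun T hT =>
        (h 1 T hT).2.2 _).trans ?_
      exact (hΛ.join₂ hf hb h₃ hΘ he₁ he₂ h₁₂ ho₁ ho₂ hK fun T hT =>
        ⟨(h 1 T hT).1, (h 1 T hT).2.1⟩).joinAll_two hf hc
    | loop e₁ s₁ e₂ s₂ he₁ he₂ h₁₂ ho₁ ho₂ hc h =>
      refine (hΛ.congr _ (fun T => endSign s₁ • HairyLie.joinLoop (joinAll f L) e₁ s₁ e₂ s₂ T)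
        fun T hT => (h 1 T hT).2 _).trans ?_
      exact (hΛ.joinLoop hf h₃ hΘ he₁ he₂ h₁₂ ho₁ ho₂ fun T hT => (h 1 T hT).1).joinAll_two hf hc
    | three e₁ s₁ e₂ s₂ e₃ s₃ he₁ he₂ he₃ h₁₂ h₁₃ h₂₃ ho₁ ho₂ ho₃ hc h =>
      refine hΛ.zero fun T hT => ?_
      obtain ⟨a₁, a₂, a₃, a₄⟩ := h 1 T hT
      rw [joinAll, a₄, join₃, a₁.joinAll_eq_zero hf (by omega) hc,
        a₂.joinAll_eq_zero hf (by omega) hc, a₃.joinAll_eq_zero hf (by omega) hc]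
      simp

end Machines

section Machines

variable {H : Type*} [AddCommGroup H] [Module ℚ H] {M : Type*} [AddCommGroup M] [Module ℚ M]
  {f : Tree H → M} {Θ : FourForm H M} {P : Finset ℕ} {o : ℕ → Bool → ℕ} {m : ℕ} {T : Tree H}
  {L : List (Tripod H)} {v : Tripod H}

/-- The first dotted edge is created by joining two ends to a tripod: this is zero on functions with
cyclic symmetry by `IsCyclic.join₂_eq_zero`. -/
theorem Fits.isNull_join₂ (hT : Fits P o 0 T) {o' : ℕ → Bool → ℕ} {e₁ e₂ : ℕ} {s₁ s₂ : Bool}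
    {K : RTree H} (he₁ : e₁ ∉ P) (he₂ : e₂ ∉ P) (h₁₂ : e₁ ≠ e₂)
    (ho₁ : ∀ b, o e₁ b = oneEnd e₁ s₁ e₁ b) (ho₂ : ∀ b, o e₂ b = oneEnd e₂ s₂ e₂ b)
    (hK : ∀ a ∈ P ∪ {e₁, e₂}, ∀ b, K.ends a b = 0)
    (h : Fits (P ∪ {e₁, e₂}) o' 1 (T.subst e₁ s₁ (.node (.leaf (.dotted e₂ (!s₂))) K)) ∧
      Fits (P ∪ {e₁, e₂}) o' 1 (T.subst e₂ s₂ (.node K (.leaf (.dotted e₁ (!s₁)))))) :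
    IsNull (M := M) IsCyclic (P ∪ {e₁, e₂}) o' 1 (fun g => join₂ g e₁ s₁ e₂ s₂ K T) where
  congr g g' hg := by rw [join₂, join₂, hg _ h.1, hg _ h.2]
  smul c g := by simp only [join₂, smul_add, smul_comm c]
  null k F c hk hF σ hσ hc := by
    have m₁ : e₁ ∈ P ∪ {e₁, e₂} := by simp
    have m₂ : e₂ ∈ P ∪ {e₁, e₂} := by simp
    rw [hσ.join₂_bind m₁ m₂]
    refine hk.join₂_eq_zero (fun h => hF _ h m₁) (fun h => hF _ h m₂) h₁₂
      (fun b => by rw [hσ.rEnds_bind m₁, hK _ m₁]) (fun b => by rw [hσ.rEnds_bind m₂, hK _ m₂])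
      fun a b => ?_
    by_cases ha : a ∈ P ∪ {e₁, e₂}
    · rw [hσ.ends_bind ha, hσ.rEnds_bind ha, hK a ha, hk.names a fun h => hF a h ha]
      by_cases haP : a ∈ P
      · obtain ⟨S, -, hS, h₀⟩ := hT.pairs
        rw [h₀ a haP, Finset.card_eq_zero.1 hS, oneEnd_of_ne (by rintro rfl; exact he₁ haP),
          oneEnd_of_ne (by rintro rfl; exact he₂ haP)]
        simp
      · rw [hT.ends_eq a haP]
        simp only [Finset.mem_union, haP, Finset.mem_insert, Finset.mem_singleton,
          false_or] at ha
        rcases ha with rfl | rfl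
        · rw [ho₁, oneEnd_of_ne h₁₂]; omega
        · rw [ho₂, oneEnd_of_ne h₁₂.symm]; omega
    · have h₁ := hc _ h.1 a ha b
      rw [hσ.ends_bind_add m₁ (by rw [hT.ends_eq _ he₁, ho₁, oneEnd_self]) _ ha, RTree.bind,
        bind_leaf_dotted hσ m₂, RTree.ends, ends_leaf_dotted,
        oneEnd_of_ne (by rintro rfl; exact ha m₂)] at h₁
      rw [oneEnd_of_ne (by rintro rfl; exact ha m₁), oneEnd_of_ne (by rintro rfl; exact ha m₂)]
      omega

/-- The first dotted edge is created by joining to a tripod with a dotted loop: this is zero on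
functions with cyclic symmetry by `IsCyclic.loop`. -/
theorem Fits.isNull_joinLoop (hT : Fits P o 0 T) {o' : ℕ → Bool → ℕ} {e₁ e₂ : ℕ} {s₁ s₂ : Bool}
    (he₁ : e₁ ∉ P) (he₂ : e₂ ∉ P) (h₁₂ : e₁ ≠ e₂) (ho₁ : ∀ b, o e₁ b = oneEnd e₁ s₁ e₁ b)
    (ho₂ : ∀ b, o e₂ b = 0)
    (h : Fits (P ∪ {e₁, e₂}) o' 1
      (T.subst e₁ s₁ (.node (.leaf (.dotted e₂ s₂)) (.leaf (.dotted e₂ (!s₂)))))) :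
    IsNull (M := M) IsCyclic (P ∪ {e₁, e₂}) o' 1
      (fun g => endSign s₁ • joinLoop g e₁ s₁ e₂ s₂ T) where
  congr g g' hg := by rw [joinLoop, joinLoop, hg _ h]
  smul c g := by simp only [joinLoop, smul_comm c]
  null k F c hk hF σ hσ hc := by
    have m₁ : e₁ ∈ P ∪ {e₁, e₂} := by simp
    have m₂ : e₂ ∈ P ∪ {e₁, e₂} := by simp
    have hT₁ : T.ends e₁ s₁ = 1 := by rw [hT.ends_eq _ he₁, ho₁, oneEnd_self]
    rw [hσ.joinLoop_bind m₁ m₂]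
    obtain ⟨A, B, hAB, hr⟩ := exists_root M e₁ s₁ (T.bind σ) (by rw [hσ.ends_bind m₁]; omega)
    have hAB' (a : ℕ) (b : Bool) : (T.bind σ).ends a b =
        oneEnd e₁ s₁ a b + (RTree.node A B).ends a b := by
      rw [hAB]; simp only [Tree.ends, ends_leaf_dotted, RTree.ends.eq_2]; omega
    have h₀ : A.ends e₁ s₁ = 0 ∧ B.ends e₁ s₁ = 0 := by
      have := hAB' e₁ s₁
      rw [hσ.ends_bind m₁, hT₁, oneEnd_self, RTree.ends] at this
      omega
    rw [hr _ (hk.toIsLocal.joinLoop _ _ _ _), joinLoop, Tree.subst, RTree.subst_of_ends h₀.1,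
      RTree.subst_of_ends h₀.2, RTree.subst_dotted, if_pos ⟨rfl, rfl⟩, ← hk.rotate,
      ← hk.rotate, hk.rebase, hk.rotate, hk.loop (fun h => hF _ h m₂), smul_zero]
    intro a b
    have h₁ := hAB' a b
    by_cases ha : a ∈ P ∪ {e₁, e₂}
    · rw [hk.names a fun h => hF a h ha]
      rw [hσ.ends_bind ha] at h₁
      by_cases haP : a ∈ P
      · obtain ⟨S, -, hS, h₀⟩ := hT.pairs
        rw [h₀ a haP, Finset.card_eq_zero.1 hS] at h₁
        simp at h₁
        omega
      · rw [hT.ends_eq a haP] at h₁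
        simp only [Finset.mem_union, haP, Finset.mem_insert, Finset.mem_singleton,
          false_or] at ha
        rcases ha with rfl | rfl
        · rw [ho₁] at h₁; omega
        · rw [ho₂] at h₁; omega
    · have h₂ := hc _ h a ha b
      rw [hσ.ends_bind_add m₁ hT₁ _ ha, RTree.bind, bind_leaf_dotted hσ m₂,
        bind_leaf_dotted hσ m₂, RTree.ends, ends_leaf_dotted, ends_leaf_dotted,
        oneEnd_of_ne (by rintro rfl; exact ha m₂), oneEnd_of_ne (by rintro rfl; exact ha m₂)] at h₂
      rw [oneEnd_of_ne (by rintro rfl; exact ha m₁)] at h₁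
      omega

/-- The first two dotted edges are created at once, by joining three ends to a tripod. -/
theorem Fits.isNull_join₃ (hf : IsInvariant f) (hb : IsBalanced Θ) (h₃ : IsThreeTerm Θ)
    (hΘ : ∀ t u v w, f ((thetaGraph t u v w).tree 0) =
      Θ (pureTensor t) (pureTensor u) (pureTensor v) (pureTensor w))
    (hT : Fits P o 0 T) {o' : ℕ → Bool → ℕ} {e₁ e₂ e₃ : ℕ}
    {s₁ s₂ s₃ : Bool} (he₁ : e₁ ∉ P) (he₂ : e₂ ∉ P) (he₃ : e₃ ∉ P) (h₁₂ : e₁ ≠ e₂) (h₁₃ : e₁ ≠ e₃)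
    (h₂₃ : e₂ ≠ e₃) (ho₁ : ∀ b, o e₁ b = oneEnd e₁ s₁ e₁ b) (ho₂ : ∀ b, o e₂ b = oneEnd e₂ s₂ e₂ b)
    (ho₃ : ∀ b, o e₃ b = oneEnd e₃ s₃ e₃ b)
    (h : Fits (P ∪ {e₁, e₂, e₃}) o' 2
        (T.subst e₁ s₁ (.node (.leaf (.dotted e₂ (!s₂))) (.leaf (.dotted e₃ (!s₃))))) ∧
      Fits (P ∪ {e₁, e₂, e₃}) o' 2
        (T.subst e₂ s₂ (.node (.leaf (.dotted e₃ (!s₃))) (.leaf (.dotted e₁ (!s₁))))) ∧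
      Fits (P ∪ {e₁, e₂, e₃}) o' 2
        (T.subst e₃ s₃ (.node (.leaf (.dotted e₁ (!s₁))) (.leaf (.dotted e₂ (!s₂)))))) :
    IsNull (IsClosedAt f) (P ∪ {e₁, e₂, e₃}) o' 2 (fun g => join₃ g e₁ s₁ e₂ s₂ e₃ s₃ T) where
  congr g g' hg := by rw [join₃, join₃, hg _ h.1, hg _ h.2.1, hg _ h.2.2]
  smul c g := by simp only [join₃, smul_add, smul_comm c]
  null k F c hk _ σ hσ hc := by
    obtain ⟨rfl, -, hc₀⟩ := hk
    have m₁ : e₁ ∈ P ∪ {e₁, e₂, e₃} := by simp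
    have m₂ : e₂ ∈ P ∪ {e₁, e₂, e₃} := by simp
    have m₃ : e₃ ∈ P ∪ {e₁, e₂, e₃} := by simp
    rw [hσ.join₃_bind m₁ m₂ m₃]
    refine hf.join₃_eq_zero hb h₃ hΘ h₁₂ h₁₃ h₂₃ fun a b => ?_
    by_cases ha : a ∈ P ∪ {e₁, e₂, e₃}
    · rw [hσ.ends_bind ha]
      by_cases haP : a ∈ P
      · obtain ⟨S, -, hS, h₀⟩ := hT.pairs
        rw [h₀ a haP, Finset.card_eq_zero.1 hS, oneEnd_of_ne (by rintro rfl; exact he₁ haP),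
          oneEnd_of_ne (by rintro rfl; exact he₂ haP), oneEnd_of_ne (by rintro rfl; exact he₃ haP)]
        simp
      · rw [hT.ends_eq a haP]
        simp only [Finset.mem_union, haP, Finset.mem_insert, Finset.mem_singleton,
          false_or] at ha
        rcases ha with rfl | rfl | rfl
        · rw [ho₁, oneEnd_of_ne h₁₂, oneEnd_of_ne h₁₃]; omega
        · rw [ho₂, oneEnd_of_ne h₁₂.symm, oneEnd_of_ne h₂₃]; omega
        · rw [ho₃, oneEnd_of_ne h₁₃.symm, oneEnd_of_ne h₂₃.symm]; omega
    · have h₁ := hc _ h.1 a ha b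
      rw [hσ.ends_bind_add m₁ (by rw [hT.ends_eq _ he₁, ho₁, oneEnd_self]) _ ha, hc₀] at h₁
      rw [oneEnd_of_ne (by rintro rfl; exact ha m₁), oneEnd_of_ne (by rintro rfl; exact ha m₂),
        oneEnd_of_ne (by rintro rfl; exact ha m₃)]
      omega

/-- Iterated joins starting from a tree without dotted edges are zero. -/
theorem Fits.joinAll_zero (hf : IsInvariant f) (hb : IsBalanced Θ) (h₃ : IsThreeTerm Θ)
    (hΘ : ∀ t u v w, f ((thetaGraph t u v w).tree 0) =
      Θ (pureTensor t) (pureTensor u) (pureTensor v) (pureTensor w))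
    (hT : Fits P o 0 T) (hc : Compat P o L) : joinAll f L T = 0 := by
  induction L generalizing P o T with
  | nil =>
    by_contra h
    obtain ⟨e, e', he⟩ := hf.support T h
    exact absurd (hT.eq_two hc.one_end he) (by norm_num)
  | cons v L ih =>
    have hs : Step M P o v L := hc.exists_step
    rw [joinAll]
    cases hs with
    | zero h => exact h 0 T hT _
    | one e s R he ho hR hc h => rw [(h 0 T hT).2.2, ih (h 0 T hT).1 hc, smul_zero]
    | two e₁ s₁ e₂ s₂ K he₁ he₂ h₁₂ ho₁ ho₂ hK hc h =>
      obtain ⟨a₁, a₂, a₃⟩ := h 0 T hT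
      rw [a₃]
      exact (hT.isNull_join₂ he₁ he₂ h₁₂ ho₁ ho₂ hK ⟨a₁, a₂⟩).joinAll_one hf hb h₃ hΘ hc
    | loop e₁ s₁ e₂ s₂ he₁ he₂ h₁₂ ho₁ ho₂ hc h =>
      obtain ⟨a₁, a₃⟩ := h 0 T hT
      rw [a₃]
      exact (hT.isNull_joinLoop he₁ he₂ h₁₂ ho₁ ho₂ a₁).joinAll_one hf hb h₃ hΘ hc
    | three e₁ s₁ e₂ s₂ e₃ s₃ he₁ he₂ he₃ h₁₂ h₁₃ h₂₃ ho₁ ho₂ ho₃ hc h =>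
      obtain ⟨a₁, a₂, a₃, a₄⟩ := h 0 T hT
      rw [a₄]
      exact (hT.isNull_join₃ hf hb h₃ hΘ he₁ he₂ he₃ h₁₂ h₁₃ h₂₃ ho₁ ho₂ ho₃
        ⟨a₁, a₂, a₃⟩).joinAll_two hf hc

/-- The case of a first tripod two of whose univalent vertices are joined by a dotted edge. -/
theorem joinAll_tripod_loop (hf : IsInvariant f) (hb : IsBalanced Θ) (h₃ : IsThreeTerm Θ)
    (hΘ : ∀ t u v w, f ((thetaGraph t u v w).tree 0) =
      Θ (pureTensor t) (pureTensor u) (pureTensor v) (pureTensor w))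
    {e : ℕ} {s : Bool} {l : Label H} {L : List (Tripod H)}
    (h : ∀ a b, tripodEnds a b ((Label.dotted e s, Label.dotted e (!s), l) :: L) ≤ 1)
    (h' : ∀ a, tripodEnds a true ((Label.dotted e s, Label.dotted e (!s), l) :: L) =
      tripodEnds a false ((Label.dotted e s, Label.dotted e (!s), l) :: L)) :
    joinAll f L (Tripod.tree (.dotted e s, .dotted e (!s), l)) = 0 := by
  have he (b : Bool) : l.isEnd e b = 0 ∧ tripodEnds e b L = 0 := by
    have := h e b
    simp only [tripodEnds_cons, Tripod.ends, isEnd_dotted] at this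
    cases s <;> cases b <;> simp [oneEnd] at this <;> omega
  have hne (a : ℕ) (ha : a ∉ ({e} : Finset ℕ)) (b : Bool) :
      tripodEnds a b ((Label.dotted e s, Label.dotted e (!s), l) :: L) =
        l.isEnd a b + tripodEnds a b L := by
    rw [Finset.mem_singleton] at ha
    rw [tripodEnds_cons, Tripod.ends, isEnd_dotted, isEnd_dotted, oneEnd_of_ne ha,
      oneEnd_of_ne ha, zero_add, zero_add]
  have hfit : Fits {e} (fun a b => l.isEnd a b) 1
      (Tripod.tree (.dotted e s, .dotted e (!s), l)) := by
    refine ⟨fun a ha b => ?_, {e}, subset_rfl, rfl, fun a ha b => ?_⟩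
    · rw [Finset.mem_singleton] at ha
      rw [Tripod.ends_tree, Tripod.ends, isEnd_dotted, isEnd_dotted, oneEnd_of_ne ha,
        oneEnd_of_ne ha, zero_add, zero_add]
    · rw [if_pos ha, Finset.mem_singleton.1 ha, Tripod.ends_tree, Tripod.ends, (he b).1,
        isEnd_dotted, isEnd_dotted]
      cases s <;> cases b <;> simp [oneEnd]
  have hnull : IsNull (M := M) IsCyclic {e} (fun a b => l.isEnd a b) 1
      (fun g => g (Tripod.tree (.dotted e s, .dotted e (!s), l))) := by
    refine ⟨fun g g' hg => hg _ hfit, fun c g => rfl, fun k F c hk hF σ hσ hc => ?_⟩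
    have m : e ∈ ({e} : Finset ℕ) := by simp
    have hcF : e ∉ F := fun h => hF e h m
    have hA : (Tripod.tree (.dotted e s, .dotted e (!s), l)).bind σ =
        ⟨.leaf (.dotted e s), .leaf (.dotted e (!s)), σ l⟩ := by
      simp only [Tripod.tree, Tree.bind, bind_leaf_dotted hσ m, RTree.bind]
    simp only [hA]
    refine hk.loop hcF s fun a b => ?_
    by_cases ha : a = e
    · subst ha
      rw [hk.names _ hcF]
      have := hσ.rEnds_bind m b (.leaf l)
      rw [RTree.bind, RTree.ends, (he b).1] at this
      exact this
    · have := hc _ hfit a (by simpa using ha) b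
      rw [hA] at this
      simpa only [Tree.ends, ends_leaf_dotted, oneEnd_of_ne ha, zero_add] using this
  refine hnull.joinAll_one hf hb h₃ hΘ ⟨fun a ha b => ?_, fun a ha => ?_, fun a ha b => ?_,
    fun a _ => l.isEnd_true_or_false a⟩
  · rw [Finset.mem_singleton.1 ha]; exact (he b).2
  · rw [← hne a ha, ← hne a ha, h']
  · rw [← hne a ha]; exact h a b

/-- Joining tripods one after the other gives zero if every dotted edge has both its ends in them.
-/
theorem joinAll_tripod_eq_zero (hf : IsInvariant f) (hb : IsBalanced Θ) (h₃ : IsThreeTerm Θ)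
    (hΘ : ∀ t u v w, f ((thetaGraph t u v w).tree 0) =
      Θ (pureTensor t) (pureTensor u) (pureTensor v) (pureTensor w))
    {v : Tripod H} {L : List (Tripod H)} (h : ∀ a b, tripodEnds a b (v :: L) ≤ 1)
    (h' : ∀ a, tripodEnds a true (v :: L) = tripodEnds a false (v :: L)) :
    joinAll f L v.tree = 0 := by
  have hloc := hf.toIsLocal.joinAll L
  obtain ⟨l₁, l₂, l₃⟩ := v
  have aux {l l' : Label H} {e : ℕ} (h₁ : l.isEnd e true ≠ 0) (h₂ : l'.isEnd e false ≠ 0) :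
      (∃ s, l = .dotted e s ∧ l' = .dotted e (!s)) ∧ ∃ s, l' = .dotted e s ∧ l = .dotted e (!s) :=
    ⟨⟨true, eq_dotted_of_isEnd h₁, eq_dotted_of_isEnd h₂⟩,
      ⟨false, eq_dotted_of_isEnd h₂, eq_dotted_of_isEnd h₁⟩⟩
  by_cases hself : ∀ e, Tripod.ends e true (l₁, l₂, l₃) = 0 ∨ Tripod.ends e false (l₁, l₂, l₃) = 0
  · refine Fits.joinAll_zero (P := ∅) (o := fun a b => Tripod.ends a b (l₁, l₂, l₃)) hf hb h₃ hΘ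
      ⟨fun a _ b => Tripod.ends_tree a b _, ∅, by simp, rfl, by simp⟩
      ⟨by simp, fun a _ => ?_, fun a _ b => ?_, fun a _ => hself a⟩
    · simpa using h' a
    · simpa using h a b
  · push Not at hself
    obtain ⟨e, ht, hf'⟩ := hself
    simp only [Tripod.ends] at ht hf'
    have perm {l₁ l₂ l₃ l₁' l₂' l₃' : Label H}
        (hp : ∀ a b, Tripod.ends a b (l₁', l₂', l₃') = Tripod.ends a b (l₁, l₂, l₃))
        (h : ∀ a b, tripodEnds a b ((l₁, l₂, l₃) :: L) ≤ 1)
        (h' : ∀ a, tripodEnds a true ((l₁, l₂, l₃) :: L) =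
          tripodEnds a false ((l₁, l₂, l₃) :: L)) {s : Bool} (hs : l₁' = .dotted e s)
        (hs' : l₂' = .dotted e (!s)) :
        joinAll f L (Tripod.tree (l₁', l₂', l₃')) = 0 := by
      subst hs hs'
      refine joinAll_tripod_loop hf hb h₃ hΘ (fun a b => ?_) fun a => ?_
      · have := h a b
        rw [tripodEnds_cons] at this ⊢
        rwa [hp]
      · have := h' a
        rw [tripodEnds_cons, tripodEnds_cons] at this ⊢
        rwa [hp, hp]
    have p₁ (a : ℕ) (b : Bool) : Tripod.ends a b (l₂, l₃, l₁) = Tripod.ends a b (l₁, l₂, l₃) := by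
      simp only [Tripod.ends]; omega
    have p₂ (a : ℕ) (b : Bool) : Tripod.ends a b (l₃, l₁, l₂) = Tripod.ends a b (l₁, l₂, l₃) := by
      simp only [Tripod.ends]; omega
    have one {l : Label H} : l.isEnd e true = 0 ∨ l.isEnd e false = 0 := l.isEnd_true_or_false e
    have o₁ := one (l := l₁)
    have o₂ := one (l := l₂)
    have o₃ := one (l := l₃)
    have r₁ : joinAll f L (Tripod.tree (l₁, l₂, l₃)) = joinAll f L (Tripod.tree (l₂, l₃, l₁)) :=
      hloc.rotate _ _ _
    have r₂ : joinAll f L (Tripod.tree (l₂, l₃, l₁)) = joinAll f L (Tripod.tree (l₃, l₁, l₂)) :=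
      hloc.rotate _ _ _
    have hor : (∃ s, l₁ = .dotted e s ∧ l₂ = .dotted e (!s)) ∨
        (∃ s, l₂ = .dotted e s ∧ l₃ = .dotted e (!s)) ∨
        ∃ s, l₃ = .dotted e s ∧ l₁ = .dotted e (!s) := by
      by_cases t₁ : l₁.isEnd e true = 0
      · by_cases t₂ : l₂.isEnd e true = 0
        · have t₃ : l₃.isEnd e true ≠ 0 := by omega
          by_cases f₁ : l₁.isEnd e false = 0
          · exact .inr (.inl (aux t₃ (by omega)).2)
          · exact .inr (.inr (aux t₃ f₁).1)
        · by_cases f₁ : l₁.isEnd e false = 0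
          · exact .inr (.inl (aux t₂ (by omega)).1)
          · exact .inl (aux t₂ f₁).2
      · by_cases f₂ : l₂.isEnd e false = 0
        · exact .inr (.inr (aux t₁ (by omega)).2)
        · exact .inl (aux t₁ f₂).1
    rcases hor with ⟨s, hs, hs'⟩ | ⟨s, hs, hs'⟩ | ⟨s, hs, hs'⟩
    · exact perm (fun _ _ => rfl) h h' hs hs'
    · rw [r₁]; exact perm p₁ h h' hs hs'
    · rw [r₁, r₂]; exact perm p₂ h h' hs hs'

end Machines

/-! ### The form that an invariant function determines -/

section Extension

variable {H : Type*} [AddCommGroup H] [Module ℚ H] {M : Type*} [AddCommGroup M] [Module ℚ M]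

/-- A function of lists of colors is multilinear if it is linear in every color. -/
structure IsListLinear (F : List H → M) : Prop where
  add : ∀ l a b r, F (l ++ (a + b) :: r) = F (l ++ a :: r) + F (l ++ b :: r)
  smul : ∀ l (c : ℚ) a r, F (l ++ (c • a) :: r) = c • F (l ++ a :: r)

variable (H M) in
/-- The space of multilinear functions of lists of colors. -/
def listLinear : Submodule ℚ (List H → M) where
  carrier := {F | IsListLinear F}
  zero_mem' := ⟨by simp, by simp⟩
  add_mem' hF hG := ⟨fun l a b r => by simp only [Pi.add_apply, hF.add, hG.add]; abel,
    fun l c a r => by simp only [Pi.add_apply, hF.smul, hG.smul, smul_add]⟩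
  smul_mem' k F hF := ⟨fun l a b r => by simp only [Pi.smul_apply, hF.add, smul_add],
    fun l c a r => by simp only [Pi.smul_apply, hF.smul, smul_comm c]⟩

/-- A color acts on multilinear functions of lists by being appended to the list. -/
def appendColor : H →ₗ[ℚ] Module.End ℚ (listLinear H M) where
  toFun a :=
    { toFun := fun F => ⟨fun l => F.1 (l ++ [a]),
        fun l b c r => by simpa using F.2.add l b c (r ++ [a]),
        fun l c b r => by simpa using F.2.smul l c b (r ++ [a])⟩
      map_add' := fun F G => rfl
      map_smul' := fun c F => rfl }
  map_add' a b := by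
    refine LinearMap.ext fun F => Subtype.ext (funext fun l => ?_)
    exact F.2.add l a b []
  map_smul' c a := by
    refine LinearMap.ext fun F => Subtype.ext (funext fun l => ?_)
    exact F.2.smul l c a []

/-- A multilinear function of lists of colors extends to a linear map from the tensor algebra. -/
theorem IsListLinear.exists_extension {F : List H → M} (hF : IsListLinear F) :
    ∃ G : TensorAlgebra ℚ H →ₗ[ℚ] M, ∀ l, G (pureTensor l) = F l := by
  set A := TensorAlgebra.lift ℚ (appendColor (H := H) (M := M)) with hA
  have key (l l' : List H) (F : listLinear H M) : (A (pureTensor l) F).1 l' = F.1 (l' ++ l) := by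
    induction l generalizing l' with
    | nil => simp
    | cons a l ih =>
      have : A (pureTensor (a :: l)) F = appendColor a (A (pureTensor l) F) := by
        rw [pureTensor_cons, map_mul, hA, TensorAlgebra.lift_ι_apply]; rfl
      rw [this]
      exact (ih (l' ++ [a])).trans (by simp)
  refine ⟨LinearMap.proj [] ∘ₗ (listLinear H M).subtype ∘ₗ
    LinearMap.applyₗ ⟨F, hF⟩ ∘ₗ A.toLinearMap, fun l => ?_⟩
  exact (key l [] ⟨F, hF⟩).trans (by simp)

theorem ext_pureTensor {G G' : TensorAlgebra ℚ H →ₗ[ℚ] M}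
    (h : ∀ l, G (pureTensor l) = G' (pureTensor l)) : G = G' :=
  LinearMap.ext fun x => by
    induction x using tensor_induction_pure with
    | pure l => exact h l
    | add x y hx hy => simp only [map_add, hx, hy]
    | smul c x hx => simp only [map_smul, hx]

/-- A function of four lists of colors that is multilinear in each of them extends to a form. -/
theorem exists_fourForm (F : List H → List H → List H → List H → M)
    (h₁ : ∀ u v w, IsListLinear fun t => F t u v w) (h₂ : ∀ t v w, IsListLinear fun u => F t u v w)
    (h₃ : ∀ t u w, IsListLinear fun v => F t u v w) (h₄ : ∀ t u v, IsListLinear (F t u v)) :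
    ∃ Θ : FourForm H M, ∀ t u v w,
      Θ (pureTensor t) (pureTensor u) (pureTensor v) (pureTensor w) = F t u v w := by
  choose G₁ hG₁ using fun t u v => (h₄ t u v).exists_extension
  have l₁ (t u : List H) : IsListLinear (G₁ t u) :=
    ⟨fun l a b r => ext_pureTensor fun w => by simp [hG₁, (h₃ t u w).add],
      fun l c a r => ext_pureTensor fun w => by simp [hG₁, (h₃ t u w).smul]⟩
  choose G₂ hG₂ using fun t u => (l₁ t u).exists_extension
  have l₂ (t : List H) : IsListLinear (G₂ t) :=
    ⟨fun l a b r => ext_pureTensor fun v => ext_pureTensor fun w => by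
        simp [hG₁, hG₂, (h₂ t v w).add],
      fun l c a r => ext_pureTensor fun v => ext_pureTensor fun w => by
        simp [hG₁, hG₂, (h₂ t v w).smul]⟩
  choose G₃ hG₃ using fun t => (l₂ t).exists_extension
  have l₃ : IsListLinear G₃ :=
    ⟨fun l a b r => ext_pureTensor fun u => ext_pureTensor fun v => ext_pureTensor fun w => by
        simp [hG₁, hG₂, hG₃, (h₁ u v w).add],
      fun l c a r => ext_pureTensor fun u => ext_pureTensor fun v => ext_pureTensor fun w => by
        simp [hG₁, hG₂, hG₃, (h₁ u v w).smul]⟩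
  obtain ⟨Θ, hΘ⟩ := l₃.exists_extension
  exact ⟨Θ, fun t u v w => by rw [hΘ, hG₃, hG₂, hG₁]⟩

theorem antipode_pureTensor (l : List H) :
    antipode (pureTensor l) = (-1 : ℚ) ^ l.length • pureTensor l.reverse := by
  rw [pureTensor_reverse, smul_smul, ← mul_pow]; simp

end Extension

section Relations

variable {H : Type*} [AddCommGroup H] [Module ℚ H] {M : Type*} [AddCommGroup M] [Module ℚ M]
  {f : Tree H → M}

theorem IsLocal.hairsRight_mid (hf : IsLocal f) (Z E Y : RTree H) (x : List H) :
    f ⟨Z, hairsRight E x, Y⟩ = (-1 : ℚ) ^ x.length • f ⟨Z, hairsLeft x.reverse E, Y⟩ := by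
  have := hf.pathVal_lcomb_mid Z E (hairs x) Y [] []
  rw [← hairs_reverse, ← hairsRight_eq_lcomb, ← hairsLeft_eq_comb, length_hairs] at this
  exact this

theorem IsLocal.hairsLeft_mid (hf : IsLocal f) (Z E Y : RTree H) (x : List H) :
    f ⟨Z, hairsLeft x E, Y⟩ = (-1 : ℚ) ^ x.length • f ⟨Z, hairsRight E x.reverse, Y⟩ := by
  rw [hf.hairsRight_mid, List.reverse_reverse, List.length_reverse, smul_smul, ← mul_pow]
  simp

/-- Reverse the path along the left dotted edge, and reverse both dotted edges. -/
theorem IsInvariant.thetaGraph_reflect₁ (hf : IsInvariant f) (t u v w : List H) :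
    f ((thetaGraph t u v w).tree 0) =
      (-1 : ℚ) ^ (t.length + u.length + v.length + w.length) •
        f ((thetaGraph v.reverse w.reverse t.reverse u.reverse).tree 0) := by
  have h₁ := hf.pathVal_thetaPath_nil zero_ne_one false false v.reverse w.reverse t.reverse
    u.reverse
  have h₂ (Ls Ls' : List (RTree H)) (Z Y : RTree H) := hf.toIsLocal.pathVal_lcomb_mid Z
    (.leaf (.dotted 1 false)) (hairs w) Y Ls Ls'
  have h₃ (Ls Ls' : List (RTree H)) (Z Y : RTree H) := hf.toIsLocal.pathVal_lcomb_mid Z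
    (.leaf (.dotted 1 true)) (hairs u.reverse) Y Ls Ls'
  simp only [← hairs_reverse, ← hairsRight_eq_lcomb, ← hairsLeft_eq_comb, length_hairs,
    List.reverse_reverse, List.length_reverse] at h₂ h₃
  rw [hf.thetaGraph, hf.pathVal_reverse]
  simp only [thetaPath, hairs, List.map_nil, List.nil_append, Bool.not_true, Bool.not_false] at h₁ ⊢
  simp only [← hairs.eq_1] at h₁ ⊢
  simp only [List.reverse_append, List.reverse_cons, List.append_assoc, List.cons_append,
    List.nil_append, ← hairs_reverse]
  rw [h₂]
  have h₄ := h₃ (hairs v.reverse ++ [hairsLeft w.reverse (.leaf (.dotted 1 false))])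
    (hairs t.reverse) (.leaf (.dotted 0 false)) (.leaf (.dotted 0 true))
  simp only [List.append_assoc, List.singleton_append] at h₄
  rw [h₄] at h₁
  have h₅ := congrArg (fun x => (-1 : ℚ) ^ u.length • x) h₁
  simp only [smul_smul, ← mul_pow] at h₅
  simp only [endSign_false, mul_neg, mul_one, neg_neg, one_pow, one_smul] at h₅
  rw [h₅, smul_smul, smul_smul]
  congr 1
  simp only [List.length_append, List.length_cons, length_hairs]
  ring

/-- Exchange the roles of the two dotted edges, and rotate the tree. -/
theorem IsInvariant.thetaGraph_reflect₂ (hf : IsInvariant f) (t u v w : List H) :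
    f ((thetaGraph t u v w).tree 0) =
      (-1 : ℚ) ^ (t.length + u.length + v.length + w.length) •
        f ((thetaGraph u.reverse t.reverse w.reverse v.reverse).tree 0) := by
  have h₁ := hf.pathVal_thetaPath_nil one_ne_zero true true u.reverse t.reverse w.reverse
    v.reverse
  rw [← hf.toIsLocal.thetaTree, endSign_true, mul_one, one_smul] at h₁
  rw [← h₁]
  change f ⟨hairsRight (.leaf (.dotted 1 false)) w, hairsLeft v (.leaf (.dotted 0 false)),
    .node (hairsRight (.leaf (.dotted 0 true)) t) (hairsLeft u (.leaf (.dotted 1 true)))⟩ = _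
  rw [hf.swap₁₂, hf.swap_trd, neg_neg, hf.hairsRight_mid, hf.rotate, hf.rotate, hf.hairsLeft_mid,
    hf.rotate, hf.rebase, hf.hairsLeft_mid, hf.rotate, hf.hairsRight_mid, hf.rotate, hf.rotate,
    ← hf.rebase, smul_smul, smul_smul, smul_smul]
  congr 1
  ring

theorem IsInvariant.thetaGraph_handle (hf : IsInvariant f) (t u v w : List H) (a : H) :
    f ((thetaGraph t u v (w ++ [a])).tree 0) - f ((thetaGraph t u (a :: v) w).tree 0) =
      f ((thetaGraph t (a :: u) v w).tree 0) - f ((thetaGraph (t ++ [a]) u v w).tree 0) := by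
  simp only [hf.thetaGraph, thetaPath, Bool.not_true]
  have h₁ := hf.pathVal_ihx (.leaf (.dotted 0 true)) (hairs t) (.leaf (.hair a))
    (hairsLeft u (.leaf (.dotted 1 true))) (hairsRight (.leaf (.dotted 1 false)) w :: hairs v)
    (.leaf (.dotted 0 false))
  have h₂ := hf.pathVal_ihx (.leaf (.dotted 0 true))
    (hairs t ++ [hairsLeft u (.leaf (.dotted 1 true))])
    (hairsRight (.leaf (.dotted 1 false)) w) (.leaf (.hair a)) (hairs v) (.leaf (.dotted 0 false))
  have h₃ : hairsRight (.leaf (.dotted 1 false)) (w ++ [a]) =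
      .node (hairsRight (.leaf (.dotted 1 false)) w) (.leaf (.hair a)) := by simp [hairsRight]
  have h₄ : hairsLeft (a :: u) (.leaf (.dotted 1 true)) =
      .node (.leaf (.hair a)) (hairsLeft u (.leaf (.dotted 1 true))) := rfl
  rw [h₃, h₄]
  simp only [hairs, List.map_append, List.map_cons, List.map_nil, List.append_assoc,
    List.cons_append, List.nil_append] at h₁ h₂ ⊢
  rw [h₁, h₂]
  abel

theorem IsInvariant.isListLinear_thetaGraph (hf : IsInvariant f) (u v w : List H) :
    IsListLinear fun t => f ((thetaGraph t u v w).tree 0) := by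
  constructor
  · intro l a b r
    simp only [hf.thetaGraph, thetaPath, hairs, List.map_append, List.map_cons, List.append_assoc,
      List.cons_append]
    exact hf.pathVal_add _ _ _ _ _ _
  · intro l c a r
    simp only [hf.thetaGraph, thetaPath, hairs, List.map_append, List.map_cons, List.append_assoc,
      List.cons_append]
    exact hf.pathVal_smul _ _ _ _ _ _

theorem IsListLinear.reverse {F : List H → M} (hF : IsListLinear F) (n : ℕ) :
    IsListLinear fun l => (-1 : ℚ) ^ (l.length + n) • F l.reverse := by
  constructor
  · intro l a b r
    have := hF.add r.reverse a b l.reverse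
    simp only [List.reverse_append, List.reverse_cons, List.append_assoc, List.singleton_append,
      List.length_append, List.length_cons, this, smul_add]
  · intro l c a r
    have := hF.smul r.reverse c a l.reverse
    simp only [List.reverse_append, List.reverse_cons, List.append_assoc, List.singleton_append,
      List.length_append, List.length_cons, this, smul_comm c]

/-- The values of an invariant function on the theta graphs are given by a balanced form. -/
theorem IsInvariant.exists_form (hf : IsInvariant f) : ∃ Θ : FourForm H M, IsBalanced Θ ∧
    ∀ t u v w, f ((thetaGraph t u v w).tree 0) =
      Θ (pureTensor t) (pureTensor u) (pureTensor v) (pureTensor w) := by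
  have l₁ := hf.isListLinear_thetaGraph
  have l₂ (t v w : List H) : IsListLinear fun u => f ((thetaGraph t u v w).tree 0) := by
    have := (l₁ t.reverse w.reverse v.reverse).reverse (t.length + v.length + w.length)
    convert this using 2 with u
    rw [hf.thetaGraph_reflect₂]
    congr 2; ring
  have l₃ (t u w : List H) : IsListLinear fun v => f ((thetaGraph t u v w).tree 0) := by
    have := (l₁ w.reverse t.reverse u.reverse).reverse (t.length + u.length + w.length)
    convert this using 2 with v
    rw [hf.thetaGraph_reflect₁]
    congr 2; ring
  have l₄ (t u v : List H) : IsListLinear fun w => f ((thetaGraph t u v w).tree 0) := by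
    have := (l₃ u.reverse t.reverse v.reverse).reverse (t.length + u.length + v.length)
    convert this using 2 with w
    rw [hf.thetaGraph_reflect₂]
    congr 2; ring
  obtain ⟨Θ, hΘ⟩ := exists_fourForm _ l₁ l₂ l₃ l₄
  refine ⟨Θ, ⟨fun t u v w => ?_, fun t u v w => ?_, fun t u v w a => ?_⟩, fun t u v w =>
    (hΘ t u v w).symm⟩
  all_goals
    induction t using tensor_induction_pure with
    | add x y hx hy =>
      simp only [map_add, antipode_add, LinearMap.add_apply, add_mul]
      linear_combination (norm := abel) hx + hy
    | smul c x hx =>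
      simp only [map_smul, antipode_smul, LinearMap.smul_apply, smul_mul_assoc, ← smul_sub, hx]
    | pure t =>
    induction u using tensor_induction_pure with
    | add x y hx hy =>
      simp only [map_add, antipode_add, LinearMap.add_apply, mul_add]
      linear_combination (norm := abel) hx + hy
    | smul c x hx =>
      simp only [map_smul, antipode_smul, LinearMap.smul_apply, mul_smul_comm, ← smul_sub, hx]
    | pure u =>
    induction v using tensor_induction_pure with
    | add x y hx hy =>
      simp only [map_add, antipode_add, LinearMap.add_apply, mul_add]
      linear_combination (norm := abel) hx + hy
    | smul c x hx =>
      simp only [map_smul, antipode_smul, LinearMap.smul_apply, mul_smul_comm, ← smul_sub, hx]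
    | pure v =>
    induction w using tensor_induction_pure with
    | add x y hx hy =>
      simp only [map_add, antipode_add, LinearMap.add_apply, add_mul]
      linear_combination (norm := abel) hx + hy
    | smul c x hx =>
      simp only [map_smul, antipode_smul, LinearMap.smul_apply, smul_mul_assoc, ← smul_sub, hx]
    | pure w =>
      have hι (a : H) (l : List H) :
        pureTensor l * TensorAlgebra.ι ℚ a = pureTensor (l ++ [a]) := by simp
      simp only [antipode_pureTensor, map_smul, LinearMap.smul_apply, smul_smul, hι,
        ← pureTensor_cons, hΘ]
      first
      | exact hf.thetaGraph_handle t u v w _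
      | exact (hf.thetaGraph_reflect₁ t u v w).trans (congrArg (· • _) (by ring))
      | exact (hf.thetaGraph_reflect₂ t u v w).trans (congrArg (· • _) (by ring))

end Relations

/-! ### Invariant functions and the two-loop space -/

section Descent

variable {H : Type*} [AddCommGroup H] [Module ℚ H] {M : Type*} [AddCommGroup M] [Module ℚ M]
  {f : Tree H → M} {Θ : FourForm H M}

theorem HairyLieGraph.exists_hasEdges (X : HairyLieGraph H 1 2) :
    ∃ e e', X.edges = {e, e'} ∧ (X.tree 0).HasEdges e e' := by
  obtain ⟨e, e', hne, h⟩ := Finset.card_eq_two.1 X.card_edges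
  refine ⟨e, e', h, hne, fun a s => ?_⟩
  have := X.sum_ends a s
  simpa [h] using this

theorem tree_eq_of_update {k : ℕ} {X Y : Fin k → Tree H} {j : Fin k} (i : Fin k) (hk : k = 1)
    {T : Tree H} (hY : Y = Function.update X j T) : Y i = T := by
  subst hk
  rw [hY, Subsingleton.elim i j, Function.update_self]

/-- An invariant function of trees defines a linear map on the space of hairy Lie graphs with one
tree and two dotted edges. -/
theorem IsInvariant.lift_eq_zero (hf : IsInvariant f) {x : HairyLieGraph H 1 2 →₀ ℚ}
    (hx : HairyLieGraph.Rel x) : Finsupp.lift M ℚ _ (fun X => f (X.tree 0)) x = 0 := by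
  have h₁ (X : HairyLieGraph H 1 2) :
      Finsupp.lift M ℚ _ (fun X : HairyLieGraph H 1 2 => f (X.tree 0)) X.of = f (X.tree 0) := by
    simp [HairyLieGraph.of]
  cases hx with
  | rotate X Y j A B C hX hY =>
    rw [map_sub, h₁, h₁, tree_eq_of_update 0 rfl hY, Subsingleton.elim 0 j, hX, hf.rotate, sub_self]
  | rebase X Y j A B C D hX hY =>
    rw [map_sub, h₁, h₁, tree_eq_of_update 0 rfl hY, Subsingleton.elim 0 j, hX, hf.rebase, sub_self]
  | rename X Y σ hY => rw [map_sub, h₁, h₁, hY, hf.rename, sub_self]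
  | ihx X Y Z j A B C D hX hY hZ =>
    rw [map_add, map_sub, h₁, h₁, h₁, tree_eq_of_update 0 rfl hY, tree_eq_of_update 0 rfl hZ,
      Subsingleton.elim 0 j, hX, hf.ihx]
  | as X Y j A B C hX hY =>
    rw [map_add, h₁, h₁, tree_eq_of_update 0 rfl hY, Subsingleton.elim 0 j, hX, hf.as]
  | add X Y Z j a b B C hX hY hZ =>
    rw [map_sub, map_add, h₁, h₁, h₁, tree_eq_of_update 0 rfl hY, tree_eq_of_update 0 rfl hZ,
      Subsingleton.elim 0 j, hX, hf.add, sub_self]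
  | smul X Y j c a B C hX hY =>
    rw [map_sub, map_smul, h₁, h₁, tree_eq_of_update 0 rfl hY, Subsingleton.elim 0 j, hX, hf.smul,
      sub_self]
  | flip X Y e he hY =>
    have := X.sum_ends e true
    rw [if_pos he] at this
    simp only [Finset.univ_unique, Finset.sum_singleton] at this
    rw [map_add, h₁, h₁, hY, hf.flip e _ (by rw [← Fin.default_eq_zero, this]; simp),
      add_neg_cancel]

theorem Tree.exists_tripod {T : Tree H} (hT : T.vertices = 1) : ∃ v : Tripod H, T = v.tree := by
  obtain ⟨A, B, C⟩ := T
  cases A <;> cases B <;> cases C <;> simp [Tree.vertices, RTree.vertices] at hT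
  exact ⟨(_, _, _), rfl⟩

theorem exists_tripods {k r : ℕ} (X : HairyLieGraph H k r) (hX : X.lieDegree = k) :
    ∃ v : Fin k → Tripod H, ∀ i, X.tree i = (v i).tree := by
  have h (i : Fin k) : (X.tree i).vertices = 1 := by
    have h₁ : ∀ i ∈ Finset.univ, 1 ≤ (X.tree i).vertices := fun i _ => by simp [Tree.vertices]
    have h₂ : ∑ i : Fin k, 1 = ∑ i, (X.tree i).vertices := by
      rw [HairyLieGraph.lieDegree] at hX; simp [hX]
    exact ((Finset.sum_eq_sum_iff_of_le h₁).1 h₂ i (Finset.mem_univ i)).symm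
  choose v hv using fun i => Tree.exists_tripod (h i)
  exact ⟨v, hv⟩

/-- An invariant function whose form satisfies the three-term relation descends to the two-loop
space. -/
theorem IsInvariant.exists_loopSpace_map (hf : IsInvariant f) (hb : IsBalanced Θ)
    (h₃ : IsThreeTerm Θ) (hΘ : ∀ t u v w, f ((thetaGraph t u v w).tree 0) =
      Θ (pureTensor t) (pureTensor u) (pureTensor v) (pureTensor w)) :
    ∃ φ : LoopSpace H 2 →ₗ[ℚ] M, ∀ X, φ (LoopSpace.ofGraph X) = f (X.tree 0) := by
  have h₁ : Submodule.span ℚ {x : HairyLieGraph H 1 2 →₀ ℚ | HairyLieGraph.Rel x} ≤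
      LinearMap.ker (Finsupp.lift M ℚ _ fun X : HairyLieGraph H 1 2 => f (X.tree 0)) :=
    Submodule.span_le.2 fun x hx => hf.lift_eq_zero hx
  have h₂ : loopImage H 2 ≤ LinearMap.ker (Submodule.liftQ _ _ h₁) := by
    refine Submodule.span_le.2 ?_
    rintro _ ⟨j, X, hX, rfl⟩
    obtain ⟨v, hv⟩ := exists_tripods X hX
    refine (lift_betaIter (f := f) (fun _ => rfl) X (fun i => v i.succ) fun i => hv _).trans ?_
    have hends (a : ℕ) (b : Bool) : tripodEnds a b (v 0 :: List.ofFn fun i : Fin j => v i.succ) =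
        if a ∈ X.edges then 1 else 0 := by
      rw [← X.sum_ends a b, ← List.ofFn_succ, tripodEnds, List.map_ofFn, List.sum_ofFn]
      simp only [Function.comp_apply, hv, Tripod.ends_tree]
    rw [hv]
    refine joinAll_tripod_eq_zero hf hb h₃ hΘ (fun a b => ?_) fun a => ?_
    · rw [hends]; split <;> omega
    · rw [hends, hends]
  exact ⟨Submodule.liftQ _ _ h₂, fun X => by
    simp [LoopSpace.ofGraph, HairyLieSpace.mk, HairyLieGraph.of]⟩

end Descent

section Class

variable {H : Type*} [AddCommGroup H] [Module ℚ H]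

theorem ofGraph_congr {X Y : HairyLieGraph H 1 2} (h : X.tree 0 = Y.tree 0) : X = Y := by
  have ht : X.tree = Y.tree := funext fun i => by rw [Subsingleton.elim i 0, h]
  have he : X.edges = Y.edges := by
    ext e
    have h₁ := X.sum_ends e true
    have h₂ := Y.sum_ends e true
    rw [ht] at h₁
    by_cases hX : e ∈ X.edges <;> by_cases hY : e ∈ Y.edges <;> simp_all
  cases X; cases Y; simp_all

/-- The graph that consists of a tree with two dotted edges. -/
def Tree.HasEdges.graph {T : Tree H} {e e' : ℕ} (h : T.HasEdges e e') : HairyLieGraph H 1 2 where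
  tree _ := T
  edges := {e, e'}
  card_edges := Finset.card_pair h.1
  sum_ends a s := by simp [h.2]

open Classical in
/-- The class of a tree in the two-loop space, if it has two dotted edges. -/
noncomputable def treeClass (T : Tree H) : LoopSpace H 2 :=
  if h : ∃ e e', T.HasEdges e e' then LoopSpace.ofGraph h.choose_spec.choose_spec.graph else 0

theorem treeClass_eq (X : HairyLieGraph H 1 2) : treeClass (X.tree 0) = LoopSpace.ofGraph X := by
  obtain ⟨e, e', -, h⟩ := X.exists_hasEdges
  have h' : ∃ e e', (X.tree 0).HasEdges e e' := ⟨e, e', h⟩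
  rw [treeClass, dif_pos h']
  exact congrArg _ (ofGraph_congr rfl)

theorem Tree.HasEdges.treeClass {T : Tree H} {e e' : ℕ} (h : T.HasEdges e e') :
    treeClass T = (loopImage H 2).mkQ (HairyLieSpace.mk H 1 2 h.graph.of) :=
  treeClass_eq h.graph

theorem treeClass_eq_zero {T : Tree H} (h : ¬ ∃ e e', T.HasEdges e e') : treeClass T = 0 := by
  rw [treeClass, dif_neg h]

theorem mk_rel {x : HairyLieGraph H 1 2 →₀ ℚ} (hx : HairyLieGraph.Rel x) :
    (loopImage H 2).mkQ (HairyLieSpace.mk H 1 2 x) = 0 := by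
  have : HairyLieSpace.mk H 1 2 x = 0 :=
    (Submodule.Quotient.mk_eq_zero _).2 (Submodule.subset_span hx)
  rw [this, map_zero]

theorem update_fin_one (X : Fin 1 → Tree H) (T : Tree H) :
    (fun _ => T) = Function.update X 0 T := by
  funext i
  rw [Subsingleton.elim i 0, Function.update_self]

theorem isInvariant_treeClass : IsInvariant (treeClass : Tree H → LoopSpace H 2) where
  rotate A B C := by
    have hc (a s) : Tree.ends a s ⟨A, B, C⟩ = Tree.ends a s ⟨B, C, A⟩ := by
      simp [Tree.ends]; omega
    by_cases h : ∃ e e', Tree.HasEdges ⟨A, B, C⟩ e e'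
    · obtain ⟨e, e', h⟩ := h
      rw [h.treeClass, (HasEdges_congr hc h).treeClass, ← sub_eq_zero, ← map_sub, ← map_sub]
      exact mk_rel (.rotate _ _ 0 A B C rfl (update_fin_one _ _))
    · rw [treeClass_eq_zero h, treeClass_eq_zero fun ⟨e, e', h'⟩ => h ⟨e, e',
        HasEdges_congr (fun a s => (hc a s).symm) h'⟩]
  rebase A B C D := by
    have hc (a s) : Tree.ends a s ⟨A, B, .node C D⟩ = Tree.ends a s ⟨.node A B, C, D⟩ := by
      simp [Tree.ends, RTree.ends]; omega
    by_cases h : ∃ e e', Tree.HasEdges ⟨A, B, .node C D⟩ e e'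
    · obtain ⟨e, e', h⟩ := h
      rw [h.treeClass, (HasEdges_congr hc h).treeClass, ← sub_eq_zero, ← map_sub, ← map_sub]
      exact mk_rel (.rebase _ _ 0 A B C D rfl (update_fin_one _ _))
    · rw [treeClass_eq_zero h, treeClass_eq_zero fun ⟨e, e', h'⟩ => h ⟨e, e',
        HasEdges_congr (fun a s => (hc a s).symm) h'⟩]
  ihx A B C D := by
    have hc (a s) : Tree.ends a s ⟨A, B, .node C D⟩ = Tree.ends a s ⟨.node D A, B, C⟩ := by
      simp [Tree.ends, RTree.ends]; omega
    have hc' (a s) : Tree.ends a s ⟨A, B, .node C D⟩ = Tree.ends a s ⟨.node D B, A, C⟩ := by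
      simp [Tree.ends, RTree.ends]; omega
    by_cases h : ∃ e e', Tree.HasEdges ⟨A, B, .node C D⟩ e e'
    · obtain ⟨e, e', h⟩ := h
      rw [h.treeClass, (HasEdges_congr hc h).treeClass, (HasEdges_congr hc' h).treeClass,
        ← map_sub, ← map_sub, ← map_add, ← map_add]
      exact mk_rel (.ihx _ _ _ 0 A B C D rfl (update_fin_one _ _) (update_fin_one _ _))
    · rw [treeClass_eq_zero h, treeClass_eq_zero fun ⟨e, e', h'⟩ => h ⟨e, e',
          HasEdges_congr (fun a s => (hc a s).symm) h'⟩,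
        treeClass_eq_zero fun ⟨e, e', h'⟩ => h ⟨e, e',
          HasEdges_congr (fun a s => (hc' a s).symm) h'⟩]
      simp
  as A B C := by
    have hc (a s) : Tree.ends a s ⟨A, B, C⟩ = Tree.ends a s ⟨B, A, C⟩ := by
      simp [Tree.ends]; omega
    by_cases h : ∃ e e', Tree.HasEdges ⟨A, B, C⟩ e e'
    · obtain ⟨e, e', h⟩ := h
      rw [h.treeClass, (HasEdges_congr hc h).treeClass, ← map_add, ← map_add]
      exact mk_rel (.as _ _ 0 A B C rfl (update_fin_one _ _))
    · rw [treeClass_eq_zero h, treeClass_eq_zero fun ⟨e, e', h'⟩ => h ⟨e, e',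
        HasEdges_congr (fun a s => (hc a s).symm) h'⟩, add_zero]
  add a b B C := by
    by_cases h : ∃ e e', Tree.HasEdges ⟨.leaf (.hair (a + b)), B, C⟩ e e'
    · obtain ⟨e, e', h⟩ := h
      have h₁ : Tree.HasEdges ⟨.leaf (.hair a), B, C⟩ e e' := HasEdges_congr (fun a s => rfl) h
      have h₂ : Tree.HasEdges ⟨.leaf (.hair b), B, C⟩ e e' := HasEdges_congr (fun a s => rfl) h
      rw [h.treeClass, h₁.treeClass, h₂.treeClass, ← sub_eq_zero, ← map_add, ← map_add,
        ← map_sub, ← map_sub]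
      exact mk_rel (.add _ _ _ 0 a b B C rfl (update_fin_one _ _) (update_fin_one _ _))
    · rw [treeClass_eq_zero h, treeClass_eq_zero (T := ⟨.leaf (.hair a), B, C⟩)
          fun ⟨e, e', h'⟩ => h ⟨e, e', HasEdges_congr (fun a s => rfl) h'⟩,
        treeClass_eq_zero (T := ⟨.leaf (.hair b), B, C⟩)
          fun ⟨e, e', h'⟩ => h ⟨e, e', HasEdges_congr (fun a s => rfl) h'⟩, add_zero]
  smul c a B C := by
    by_cases h : ∃ e e', Tree.HasEdges ⟨.leaf (.hair (c • a)), B, C⟩ e e'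
    · obtain ⟨e, e', h⟩ := h
      have h₁ : Tree.HasEdges ⟨.leaf (.hair a), B, C⟩ e e' := HasEdges_congr (fun a s => rfl) h
      rw [h.treeClass, h₁.treeClass, ← sub_eq_zero, ← map_smul, ← map_smul, ← map_sub, ← map_sub]
      exact mk_rel (.smul _ _ 0 c a B C rfl (update_fin_one _ _))
    · rw [treeClass_eq_zero h, treeClass_eq_zero (T := ⟨.leaf (.hair a), B, C⟩)
          fun ⟨e, e', h'⟩ => h ⟨e, e', HasEdges_congr (fun a s => rfl) h'⟩, smul_zero]
  support T h := by
    by_contra hc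
    exact h (treeClass_eq_zero hc)
  rename σ T := by
    by_cases h : ∃ e e', T.HasEdges e e'
    · obtain ⟨e, e', h⟩ := h
      rw [h.treeClass, (h.rename σ).treeClass, eq_comm, ← sub_eq_zero, ← map_sub, ← map_sub]
      exact mk_rel (.rename _ _ σ fun _ => rfl)
    · rw [treeClass_eq_zero h, treeClass_eq_zero]
      rintro ⟨e, e', h'⟩
      have := h'.rename σ.symm
      rw [Tree.mapLabel_rename_symm] at this
      exact h ⟨_, _, this⟩
  flip d T hd := by
    by_cases h : ∃ e e', T.HasEdges e e'
    · obtain ⟨e, e', h⟩ := h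
      have hd' : d = e ∨ d = e' := by
        by_contra hc
        rw [h.2] at hd
        simp [hc] at hd
      rw [h.treeClass, (h.flip d).treeClass, eq_neg_iff_add_eq_zero, add_comm, ← map_add, ← map_add]
      exact mk_rel (.flip _ _ d (by simpa [Tree.HasEdges.graph] using hd') fun _ => rfl)
    · rw [treeClass_eq_zero h, treeClass_eq_zero, neg_zero]
      rintro ⟨e, e', h'⟩
      refine h ⟨e, e', h'.1, fun a s => ?_⟩
      have := h'.2 a (if a = d then !s else s)
      rw [Tree.ends_mapLabel_flip] at this
      by_cases ha : a = d <;> simpa [ha] using this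

end Class

/-! ### Joining tripods to a tree in the two-loop space -/

section Unglue

variable {H : Type*} [AddCommGroup H] [Module ℚ H]

/-- Every tree with more than one trivalent vertex has a trivalent vertex that is adjacent to two
univalent vertices. -/
theorem exists_cherry (M : Type*) [AddCommGroup M] [Module ℚ M] {T : Tree H}
    (hT : T.vertices ≠ 1) : ∃ (l l' : Label H) (A B : RTree H),
      (∀ a b, T.ends a b = Tree.ends a b ⟨.node (.leaf l) (.leaf l'), A, B⟩) ∧
      T.vertices = Tree.vertices ⟨.node (.leaf l) (.leaf l'), A, B⟩ ∧
      ∀ f : Tree H → M, IsLocal f → f T = f ⟨.node (.leaf l) (.leaf l'), A, B⟩ := by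
  have key (R : RTree H) : ∀ X Y : RTree H, (∃ l, R = .leaf l) ∨
      ∃ (l l' : Label H) (A B : RTree H),
        (∀ a b, Tree.ends a b ⟨R, X, Y⟩ = Tree.ends a b ⟨.node (.leaf l) (.leaf l'), A, B⟩) ∧
        Tree.vertices ⟨R, X, Y⟩ = Tree.vertices ⟨.node (.leaf l) (.leaf l'), A, B⟩ ∧
        ∀ f : Tree H → M, IsLocal f → f ⟨R, X, Y⟩ = f ⟨.node (.leaf l) (.leaf l'), A, B⟩ := by
    induction R with
    | leaf l => exact fun X Y => .inl ⟨l, rfl⟩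
    | node A B hA hB =>
      intro X Y
      right
      rcases hA B (.node X Y) with ⟨l, rfl⟩ | ⟨l, l', A', B', h₁, h₂, h₃⟩
      · rcases hB (.node X Y) (.leaf l) with ⟨l', rfl⟩ | ⟨l₁, l₂, A', B', h₁, h₂, h₃⟩
        · exact ⟨l, l', X, Y, fun _ _ => rfl, rfl, fun _ _ => rfl⟩
        · refine ⟨l₁, l₂, A', B', fun a b => ?_, ?_, fun f hf => ?_⟩
          · rw [← h₁]; simp [Tree.ends, RTree.ends]; omega
          · rw [← h₂]; simp [Tree.vertices, RTree.vertices]; omega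
          · rw [← h₃ f hf, ← hf.rebase, hf.rotate]
      · refine ⟨l, l', A', B', fun a b => ?_, ?_, fun f hf => ?_⟩
        · rw [← h₁]; simp [Tree.ends, RTree.ends]; omega
        · rw [← h₂]; simp [Tree.vertices, RTree.vertices]; omega
        · rw [← h₃ f hf, hf.rebase]
  obtain ⟨A, B, C⟩ := T
  rcases key A B C with ⟨l₁, rfl⟩ | ⟨l, l', A', B', h₁, h₂, h₃⟩
  · rcases key B C (.leaf l₁) with ⟨l₂, rfl⟩ | ⟨l, l', A', B', h₁, h₂, h₃⟩
    · rcases key C (.leaf l₁) (.leaf l₂) with ⟨l₃, rfl⟩ | ⟨l, l', A', B', h₁, h₂, h₃⟩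
      · simp [Tree.vertices, RTree.vertices] at hT
      · refine ⟨l, l', A', B', fun a b => ?_, ?_, fun f hf => ?_⟩
        · rw [← h₁]; simp [Tree.ends]; omega
        · rw [← h₂]; simp [Tree.vertices]; omega
        · rw [← h₃ f hf, hf.rotate, hf.rotate]
    · refine ⟨l, l', A', B', fun a b => ?_, ?_, fun f hf => ?_⟩
      · rw [← h₁]; simp [Tree.ends]; omega
      · rw [← h₂]; simp [Tree.vertices, RTree.vertices]
      · rw [← h₃ f hf, hf.rotate]
  · exact ⟨l, l', A', B', h₁, h₂, h₃⟩

theorem joinAt_eq_zero {M : Type*} [AddCommGroup M] [Module ℚ M] {g : Tree H → M} {l : Label H}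
    {R : RTree H} {T : Tree H} (h : ∀ a b, l.isEnd a b ≠ 0 → T.ends a (!b) = 0) :
    joinAt g l R T = 0 := by
  cases l with
  | hair a => rfl
  | dotted e s =>
    rw [joinAt, if_pos (h e s (by simp [isEnd_dotted]))]

/-- The relation in the two-loop space that the image of a graph all of whose trees are tripods
under an iterate of `β` is zero. -/
theorem joinAll_treeClass_tripod {v : Tripod H} {L : List (Tripod H)} {E : Finset ℕ}
    (hE : E.card = 2 + L.length)
    (h : ∀ a b, tripodEnds a b (v :: L) = if a ∈ E then 1 else 0) :
    joinAll treeClass L v.tree = 0 := by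
  set X : HairyLieGraph H (L.length + 1) (2 + L.length) :=
    { tree := fun j => ((v :: L).get j).tree
      edges := E
      card_edges := hE
      sum_ends := fun a b => by
        rw [← h, tripodEnds, ← List.sum_ofFn]
        congr 1
        conv_rhs => rw [← List.ofFn_get (v :: L)]
        rw [List.map_ofFn]
        rfl } with hX
  have h₁ : Finsupp.lift (LoopSpace H 2) ℚ _ (fun X : HairyLieGraph H 1 2 => treeClass (X.tree 0)) =
      (loopImage H 2).mkQ ∘ₗ HairyLieSpace.mk H 1 2 := by
    refine Finsupp.lhom_ext' fun Y => LinearMap.ext_ring ?_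
    simp [treeClass_eq, LoopSpace.ofGraph, HairyLieGraph.of]
  have h₂ := lift_betaIter (f := treeClass) (fun _ => rfl) X (fun i => L.get i) fun i => rfl
  rw [List.ofFn_get, h₁] at h₂
  refine h₂.symm.trans ?_
  refine (Submodule.Quotient.mk_eq_zero _).2 (Submodule.subset_span ⟨_, X, ?_, rfl⟩)
  simp [HairyLieGraph.lieDegree, hX, Tripod.tree, Tree.vertices, RTree.vertices]

/-- The relation in the two-loop space that the image of a graph under an iterate of `β` is zero
holds for all graphs whose first tree is an arbitrary tree without dotted edges and whose other
trees are tripods: the first tree is itself the result of gluing tripods along dotted edges, in a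
single way. -/
theorem joinAll_treeClass_eq_zero {T : Tree H} {L : List (Tripod H)} {E : Finset ℕ}
    (hE : E.card = 2 + L.length)
    (h : ∀ a b, T.ends a b + tripodEnds a b L = if a ∈ E then 1 else 0)
    (hT : ∀ a b, T.ends a b ≠ 0 → T.ends a (!b) = 0) : joinAll treeClass L T = 0 := by
  generalize hn : T.vertices = n
  induction n generalizing T L E with
  | zero => simp [Tree.vertices] at hn
  | succ n ih =>
    by_cases h1 : T.vertices = 1
    · obtain ⟨v, rfl⟩ := Tree.exists_tripod h1
      exact joinAll_treeClass_tripod hE fun a b => by rw [tripodEnds_cons, ← h, Tripod.ends_tree]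
    · obtain ⟨l, l', A, B, he, hv, hf⟩ := exists_cherry (LoopSpace H 2) h1
      rw [hf _ (isInvariant_treeClass.toIsLocal.joinAll L)]
      obtain ⟨e, heE⟩ := Infinite.exists_notMem_finset E
      have hsum (a : ℕ) (b : Bool) : T.ends a b = l.isEnd a b + l'.isEnd a b +
          (A.ends a b + B.ends a b) := by
        rw [he]; simp only [Tree.ends, RTree.ends]; omega
      have h₀ (b : Bool) : l.isEnd e b = 0 ∧ l'.isEnd e b = 0 ∧ A.ends e b = 0 ∧ B.ends e b = 0 := by
        have h₁ := h e b
        have h₂ := hsum e b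
        rw [if_neg heE] at h₁
        omega
      set T₀ : Tree H := ⟨.leaf (.dotted e true), A, B⟩ with hT₀
      have hT₀e (a : ℕ) (b : Bool) : T₀.ends a b = oneEnd e true a b + (A.ends a b + B.ends a b) := by
        rw [hT₀]; simp only [Tree.ends, ends_leaf_dotted]; omega
      have hsub : T₀.subst e true (.node (.leaf l) (.leaf l')) =
          ⟨.node (.leaf l) (.leaf l'), A, B⟩ := by
        rw [hT₀, Tree.subst, RTree.subst_of_ends (h₀ _).2.2.1, RTree.subst_of_ends (h₀ _).2.2.2,
          RTree.subst_dotted, if_pos ⟨rfl, rfl⟩]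
      have hzero {l₀ : Label H} (R : RTree H) (hl : ∀ a b, l₀.isEnd a b ≤ l.isEnd a b + l'.isEnd a b) :
          joinAt (joinAll treeClass L) l₀ R T₀ = 0 := by
        refine joinAt_eq_zero fun a b hab => ?_
        have hae : a ≠ e := by
          rintro rfl
          have := hl a b
          have := h₀ b
          omega
        have h₁ := hT a b (by have := hl a b; have := hsum a b; omega)
        rw [hsum] at h₁
        rw [hT₀e, oneEnd_of_ne hae]
        omega
      have hj : joinAll treeClass ((.dotted e false, l, l') :: L) T₀ =
          joinAll treeClass L ⟨.node (.leaf l) (.leaf l'), A, B⟩ := by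
        rw [joinAll, joinTripod, hzero _ fun a b => Nat.le_add_right _ _,
          hzero _ fun a b => Nat.le_add_left _ _, add_zero, add_zero, ← hsub]
        simp [joinAt, hT₀e]
      rw [← hj]
      refine ih (E := insert e E) ?_ (fun a b => ?_) (fun a b hab => ?_) ?_
      · rw [Finset.card_insert_of_notMem heE, hE, List.length_cons]; omega
      · rw [tripodEnds_cons, hT₀e, Tripod.ends, isEnd_dotted]
        have h₁ := h a b
        rw [hsum] at h₁
        by_cases hae : a = e
        · subst hae
          have := h₀ b
          rw [if_neg heE] at h₁
          rw [if_pos (Finset.mem_insert_self _ _)]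
          cases b <;> simp [oneEnd] <;> omega
        · rw [oneEnd_of_ne hae, oneEnd_of_ne hae]
          simp only [Finset.mem_insert, hae, false_or]
          omega
      · by_cases hae : a = e
        · subst hae
          have hf := h₀ false
          have ht := h₀ true
          rw [hT₀e] at hab ⊢
          cases b
          · rw [hf.2.2.1, hf.2.2.2] at hab
            simp [oneEnd] at hab
          · rw [Bool.not_true, hf.2.2.1, hf.2.2.2]
            simp [oneEnd]
        · rw [hT₀e, oneEnd_of_ne hae] at hab ⊢
          have h₁ := hT a b (by rw [hsum]; omega)
          rw [hsum] at h₁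
          omega
      · rw [hv] at hn
        simp only [hT₀, Tree.vertices, RTree.vertices] at hn ⊢
        omega

/-- The case of a path tree at all of whose dotted ends the dotted edges start. -/
theorem pathVal_joinAll_treeClass {Z Y : RTree H} {Rs : List (RTree H)} {L : List (Tripod H)}
    {E : Finset ℕ} (hE : E.card = 2 + L.length)
    (h : ∀ a b, Z.ends a b + listEnds a b Rs + Y.ends a b + tripodEnds a b L =
      if a ∈ E then 1 else 0)
    (hT : ∀ a, Z.ends a false + listEnds a false Rs + Y.ends a false = 0) :
    pathVal (joinAll treeClass L) Z Rs Y = 0 := by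
  rw [pathVal_congr (g := fun _ => 0) fun T hTe => joinAll_treeClass_eq_zero hE
    (fun a b => by rw [hTe, h]) fun a b hab => ?_]
  · cases Rs <;> rfl
  · cases b
    · exact absurd (by rw [hTe, hT]) hab
    · rw [hTe]; exact hT a

end Unglue

/-! ### The three-term relation in the two-loop space -/

section ClassRelations

variable {H : Type*} [AddCommGroup H] [Module ℚ H]

theorem joinTripod_eq_join₂ {M : Type*} [AddCommGroup M] [Module ℚ M] {g : Tree H → M}
    {e₁ e₂ : ℕ} {s₁ s₂ : Bool} {l : Label H} {T : Tree H} (h₁ : T.ends e₁ s₁ ≠ 0)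
    (h₂ : T.ends e₂ s₂ ≠ 0) (hl : ∀ a b, l.isEnd a b ≠ 0 → T.ends a (!b) = 0) :
    joinTripod g (.dotted e₁ (!s₁), .dotted e₂ (!s₂), l) T = join₂ g e₁ s₁ e₂ s₂ (.leaf l) T := by
  simp only [joinTripod, joinAt_eq_zero hl, add_zero]
  simp [joinAt, join₂, h₁, h₂]

theorem isEnd_hair (a : H) (e : ℕ) (s : Bool) : (Label.hair a).isEnd e s = 0 := rfl

/-- Gluing a path tree with three dotted ends to the tripod with their other ends gives the relation
that becomes `IsThreeTerm.tripod`. -/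
theorem join₃_treeClass (α γ : List H) :
    pathVal (join₃ (treeClass (H := H)) 0 true 1 true 2 true) (.leaf (.dotted 0 true))
      (hairs α ++ .leaf (.dotted 1 true) :: hairs γ) (.leaf (.dotted 2 true)) = 0 := by
  rw [← pathVal_joinAll_treeClass (Z := .leaf (.dotted 0 true)) (Y := .leaf (.dotted 2 true))
    (Rs := hairs α ++ .leaf (.dotted 1 true) :: hairs γ) (E := Finset.range 3)
    (L := [(.dotted 0 false, .dotted 1 false, .dotted 2 false)]) rfl (fun a b => ?_) fun a => ?_]
  · refine pathVal_congr fun T hT => ?_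
    have h₁ : T.ends 0 true ≠ 0 := by rw [hT]; simp [ends_leaf_dotted]
    have h₂ : T.ends 1 true ≠ 0 := by rw [hT]; simp [ends_leaf_dotted]
    have h₃ : T.ends 2 true ≠ 0 := by rw [hT]; simp [ends_leaf_dotted]
    simp [joinAll, joinTripod, joinAt, h₁, h₂, h₃, join₃]
  · simp only [listEnds_append, listEnds_hairs, listEnds_cons, ends_leaf_dotted, tripodEnds_cons,
      tripodEnds_nil, Tripod.ends, isEnd_dotted, oneEnd, Finset.mem_range]
    rcases a with _ | _ | _ | a <;> cases b <;> simp
  · simp [ends_leaf_dotted, oneEnd]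

/-- Glue a path tree with four dotted ends to two tripods with the other ends: the tripod at the two
ends of the path closes it up with one more branch `l` at either end, and the other tripod has the
hair `k`. -/
theorem join₂_treeClass (k : H) {l : Label H} {Rs : List (RTree H)} (hne : Rs ≠ [])
    (hl : ∀ a, l.isEnd a false = 0)
    (h : ∀ a b, listEnds a b Rs + l.isEnd a b = oneEnd 2 true a b + oneEnd 3 true a b) :
    pathVal (join₂ treeClass 2 true 3 true (.leaf (.hair k))) (.leaf (.dotted 1 false))
        (.leaf l :: Rs) (.leaf (.dotted 1 true)) +
      pathVal (join₂ treeClass 2 true 3 true (.leaf (.hair k))) (.leaf (.dotted 0 true))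
        (Rs ++ [.leaf l]) (.leaf (.dotted 0 false)) = 0 := by
  have hz (a : ℕ) (ha : a = 0 ∨ a = 1) (b : Bool) : listEnds a b Rs = 0 := by
    have := h a b
    rcases ha with rfl | rfl <;> simp [oneEnd] at this <;> exact this.1
  have h₁ := (isInvariant_treeClass.toIsLocal.join₂ 2 true 3 true
    (.leaf (.hair k))).pathVal_join₂_ends (e₁ := 0) (e₂ := 1) (s₁ := true) (s₂ := true) zero_ne_one
    (hz 0 (.inl rfl)) (hz 1 (.inr rfl)) hne (.leaf l)
  simp only [Bool.not_true, endSign_true, one_smul] at h₁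
  rw [← h₁]
  rw [← pathVal_joinAll_treeClass (Z := .leaf (.dotted 0 true)) (Y := .leaf (.dotted 1 true))
    (Rs := Rs) (E := Finset.range 4)
    (L := [(.dotted 0 false, .dotted 1 false, l), (.dotted 2 false, .dotted 3 false, .hair k)])
    rfl (fun a b => ?_) fun a => ?_]
  · refine pathVal_congr fun T hT => ?_
    have hTf (a : ℕ) : T.ends a false = 0 := by
      have := h a false
      rw [hT]
      simp [ends_leaf_dotted, oneEnd] at this ⊢
      exact this.1
    have e₀ : T.ends 0 true ≠ 0 := by rw [hT]; simp [ends_leaf_dotted]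
    have e₁ : T.ends 1 true ≠ 0 := by rw [hT]; simp [ends_leaf_dotted]
    have hl' : ∀ a b, l.isEnd a b ≠ 0 → T.ends a (!b) = 0 := fun a b hab => by
      cases b
      · exact absurd (hl a) hab
      · exact hTf a
    have key (R : RTree H) (e : ℕ) (he : e = 0 ∨ e = 1) (hR : ∀ a b, R.ends a b =
        l.isEnd a b + oneEnd (1 - e) false a b) :
        join₂ (treeClass (H := H)) 2 true 3 true (.leaf (.hair k)) (T.subst e true R) =
        joinTripod treeClass (.dotted 2 false, .dotted 3 false, .hair k) (T.subst e true R) := by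
      have hd (d : ℕ) (hd : d = 2 ∨ d = 3) : (T.subst e true R).ends d true ≠ 0 := by
        have h₂ := Tree.ends_subst e true R T d true
        have h₃ := h d true
        have h₄ := hT d true
        have h₅ : T.ends e true ≠ 0 := by rcases he with rfl | rfl <;> assumption
        have h₆ : d ≠ e := by omega
        have h₇ : l.isEnd d true ≤ T.ends e true * l.isEnd d true :=
          Nat.le_mul_of_pos_left _ (Nat.pos_of_ne_zero h₅)
        rw [hR, mul_add] at h₂
        rw [ends_leaf_dotted, ends_leaf_dotted] at h₄
        rcases hd with rfl | rfl <;> simp [oneEnd, h₆] at h₂ h₃ h₄ <;> omega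
      refine (joinTripod_eq_join₂ (s₁ := true) (s₂ := true) (hd 2 (.inl rfl)) (hd 3 (.inr rfl))
        fun a b hab => ?_).symm
      simp [isEnd_hair] at hab
    simp only [joinAll]
    rw [show joinTripod (joinTripod treeClass (.dotted 2 false, .dotted 3 false, .hair k))
      (.dotted 0 false, .dotted 1 false, l) T = _ from
        joinTripod_eq_join₂ (s₁ := true) (s₂ := true) e₀ e₁ hl']
    rw [join₂.eq_1 (join₂ _ _ _ _ _ _), key _ 0 (.inl rfl) fun a b => by
        simp [RTree.ends, isEnd_dotted, add_comm],
      key _ 1 (.inr rfl) fun a b => by simp [RTree.ends, isEnd_dotted]]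
    rfl
  · have h₂ := h a b
    simp only [ends_leaf_dotted, tripodEnds_cons, tripodEnds_nil, Tripod.ends, isEnd_dotted,
      isEnd_hair, Finset.mem_range] at h₂ ⊢
    have h₃ : oneEnd 0 true a b + oneEnd 1 true a b + (oneEnd 2 true a b + oneEnd 3 true a b) +
        (oneEnd 0 false a b + oneEnd 1 false a b + (oneEnd 2 false a b + oneEnd 3 false a b)) =
        if a < 4 then 1 else 0 := by
      simp only [oneEnd]
      rcases a with _ | _ | _ | _ | a <;> cases b <;> simp
    omega
  · have h₂ := h a false
    simp [ends_leaf_dotted, oneEnd] at h₂ ⊢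
    exact h₂.1

/-- The form that describes the classes of the theta graphs satisfies the three-term relation. -/
theorem isThreeTerm_of_treeClass {Θ : FourForm H (LoopSpace H 2)} (hb : IsBalanced Θ)
    (hΘ : ∀ t u v w, treeClass ((thetaGraph t u v w).tree 0) =
      Θ (pureTensor t) (pureTensor u) (pureTensor v) (pureTensor w)) : IsThreeTerm Θ := by
  have hf := isInvariant_treeClass (H := H)
  have v₁ (k : H) (e : ℕ) (he : e < 2) (s : Bool) (α β γ : List H) :=
    hf.pathVal_join₂ hb hΘ (e := e) (e₁ := 2) (e₂ := 3) (by omega) (by omega) (by omega) s true true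
      (K := .leaf (.hair k)) (fun _ _ => rfl) α β γ
  refine hb.isThreeTerm (fun α γ => ?_) (fun k x α β γ => ?_) fun k β γ => ?_
  · induction α using tensor_induction_pure with
    | add x y hx hy =>
      simp only [map_add, antipode_add, LinearMap.add_apply]
      linear_combination (norm := abel) hx + hy
    | smul c x hx =>
      simp only [map_smul, antipode_smul, LinearMap.smul_apply, ← smul_add, hx, smul_zero]
    | pure α =>
    induction γ using tensor_induction_pure with
    | add x y hx hy =>
      simp only [map_add, LinearMap.add_apply]
      linear_combination (norm := abel) hx + hy
    | smul c x hx =>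
      simp only [map_smul, LinearMap.smul_apply, ← smul_add, hx, smul_zero]
    | pure γ =>
      have h₁ := hf.pathVal_join₃ hb hΘ (e₁ := 0) (e₂ := 1) (e₃ := 2) (by omega) (by omega)
        (by omega) true true true α γ
      rw [join₃_treeClass] at h₁
      rw [endSign_true, mul_one, mul_one, neg_smul, one_smul, zero_eq_neg] at h₁
      exact h₁
  · induction α using tensor_induction_pure with
    | add a b ha hb =>
      simp only [slide, mul_add, map_add, LinearMap.add_apply] at ha hb ⊢
      linear_combination (norm := abel) ha + hb
    | smul c a ha =>
      simp only [slide, mul_smul_comm, map_smul, LinearMap.smul_apply, ← smul_sub] at ha ⊢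
      rw [ha]
    | pure α =>
    induction β using tensor_induction_pure with
    | add a b ha hb =>
      simp only [slide, map_add, LinearMap.add_apply] at ha hb ⊢
      linear_combination (norm := abel) ha + hb
    | smul c a ha =>
      simp only [slide, map_smul, LinearMap.smul_apply, ← smul_sub] at ha ⊢
      rw [ha]
    | pure β =>
    induction γ using tensor_induction_pure with
    | add a b ha hb =>
      simp only [slide, add_mul, map_add, LinearMap.add_apply] at ha hb ⊢
      linear_combination (norm := abel) ha + hb
    | smul c a ha =>
      simp only [slide, smul_mul_assoc, map_smul, LinearMap.smul_apply, ← smul_sub] at ha ⊢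
      rw [ha]
    | pure γ =>
      have h₁ := join₂_treeClass k (l := .hair x) (Rs := hairs α ++ .leaf (.dotted 2 true) ::
        (hairs β ++ .leaf (.dotted 3 true) :: hairs γ)) (by simp) (fun _ => rfl)
        (by simp [ends_leaf_dotted, isEnd_hair])
      have h₂ := (v₁ k 1 (by omega) false (x :: α) β γ).1
      have h₃ := (v₁ k 0 (by omega) true α β (γ ++ [x])).1
      simp only [hairs, List.map_cons, List.map_append, List.map_nil, List.cons_append,
        List.append_assoc, Bool.not_false, Bool.not_true] at h₁ h₂ h₃
      rw [h₂, h₃] at h₁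
      simp only [lieVal_hair, endSign_true, endSign_false, pureTensor_cons, pureTensor_append,
        pureTensor_nil, mul_one, one_smul, neg_smul, neg_add_eq_zero] at h₁
      exact h₁
  · induction β using tensor_induction_pure with
    | add a b ha hb =>
      simp only [slide, map_add, LinearMap.add_apply] at ha hb ⊢
      linear_combination (norm := abel) ha + hb
    | smul c a ha =>
      simp only [slide, map_smul, LinearMap.smul_apply, ← smul_sub, ← smul_add] at ha ⊢
      rw [ha, smul_zero]
    | pure β =>
    induction γ using tensor_induction_pure with
    | add a b ha hb =>
      simp only [slide, map_add, LinearMap.add_apply] at ha hb ⊢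
      linear_combination (norm := abel) ha + hb
    | smul c a ha =>
      simp only [slide, map_smul, LinearMap.smul_apply, ← smul_sub, ← smul_add] at ha ⊢
      rw [ha, smul_zero]
    | pure γ =>
      have h₁ := join₂_treeClass k (l := .dotted 2 true)
        (Rs := hairs β ++ .leaf (.dotted 3 true) :: hairs γ) (by simp)
        (fun _ => by simp [isEnd_dotted, oneEnd])
        (fun a b => by simp [ends_leaf_dotted, isEnd_dotted]; omega)
      have h₂ := (v₁ k 1 (by omega) false [] β γ).1
      have h₃ := (v₁ k 0 (by omega) true β γ []).2
      simp only [hairs, List.map_nil, List.cons_append,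
        List.append_assoc, Bool.not_false, Bool.not_true, List.nil_append] at h₁ h₂ h₃
      rw [h₂, h₃] at h₁
      simp only [lieVal_hair, endSign_true, endSign_false, pureTensor_nil, mul_one, one_smul,
        neg_smul] at h₁
      rw [← neg_add, neg_eq_zero] at h₁
      exact h₁

end ClassRelations

/-! ### The presentation -/

section Generation

variable {H : Type*} [AddCommGroup H] [Module ℚ H]

theorem span_ofGraph :
    Submodule.span ℚ (Set.range (LoopSpace.ofGraph : HairyLieGraph H 1 2 → LoopSpace H 2)) = ⊤ := by
  refine Submodule.eq_top_iff'.2 fun y => ?_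
  obtain ⟨y, rfl⟩ := Submodule.mkQ_surjective _ y
  obtain ⟨x, rfl⟩ := Submodule.mkQ_surjective _ y
  induction x using Finsupp.induction_linear with
  | zero => simp
  | add x y hx hy => simpa using Submodule.add_mem _ hx hy
  | single X c =>
    rw [← Finsupp.smul_single_one, map_smul, map_smul]
    exact Submodule.smul_mem _ _ (Submodule.subset_span ⟨X, rfl⟩)

theorem IsLocal.map {M N : Type*} [AddCommGroup M] [Module ℚ M] [AddCommGroup N] [Module ℚ N]
    {f : Tree H → M} (hf : IsLocal f) (φ : M →ₗ[ℚ] N) : IsLocal fun T => φ (f T) where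
  rotate A B C := by rw [hf.rotate]
  rebase A B C D := by rw [hf.rebase]
  ihx A B C D := by rw [← map_sub, ← map_add, hf.ihx, map_zero]
  as A B C := by rw [← map_add, hf.as, map_zero]
  add a b B C := by rw [hf.add, map_add]
  smul c a B C := by rw [hf.smul, map_smul]

theorem pathVal_map {M N : Type*} [AddCommGroup M] [Module ℚ M] [AddCommGroup N] [Module ℚ N]
    (f : Tree H → M) (φ : M →ₗ[ℚ] N) (Z : RTree H) (Rs : List (RTree H)) (Y : RTree H) :
    pathVal (fun T => φ (f T)) Z Rs Y = φ (pathVal f Z Rs Y) := by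
  cases Rs <;> simp [pathVal]

/-- Four-linear forms with values in a subspace: the theta symbols with hairs on the middle edge
have values in the same subspace. -/
theorem mid_mem {M : Type*} [AddCommGroup M] [Module ℚ M] {Θ : FourForm H M} {S : Submodule ℚ M}
    (hS : ∀ t u v w, Θ t u v w ∈ S) (m t u v w : TensorAlgebra ℚ H) : mid Θ m t u v w ∈ S := by
  induction m using tensor_induction_left generalizing t u with
  | one => simpa using hS t u v w
  | ι_mul a m ih => rw [mid_ι_mul]; exact S.sub_mem (ih _ _) (ih _ _)
  | add x y hx hy => simpa using S.add_mem (hx t u) (hy t u)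
  | smul c x hx => simpa using S.smul_mem c (hx t u)

/-- The two-loop space is generated by the classes of the theta graphs. -/
theorem treeClass_mem {Θ : FourForm H (LoopSpace H 2)}
    (hΘ : ∀ t u v w, treeClass ((thetaGraph t u v w).tree 0) =
      Θ (pureTensor t) (pureTensor u) (pureTensor v) (pureTensor w))
    {S : Submodule ℚ (LoopSpace H 2)} (hS : ∀ t u v w, Θ t u v w ∈ S)
    (X : HairyLieGraph H 1 2) : LoopSpace.ofGraph X ∈ S := by
  obtain ⟨e, e', -, h⟩ := X.exists_hasEdges
  have hl : IsLocal fun T : Tree H => S.mkQ (treeClass T) := isInvariant_treeClass.toIsLocal.map _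
  rw [← treeClass_eq, ← Submodule.Quotient.mk_eq_zero]
  refine hl.eq_zero_of_words h.1 true (fun s' α β γ => ?_) h.2
  have h₁ := isInvariant_treeClass.pathVal_thetaPath hΘ h.1 true s' α [] β γ []
  simp only [thetaPath, hairsLeft, hairsRight, List.foldr_nil, List.foldl_nil] at h₁
  rw [pathVal_map, h₁]
  exact (Submodule.Quotient.mk_eq_zero S).2 (S.smul_mem _ (mid_mem hS _ _ _ _ _))

end Generation

section Presentation

variable {H : Type*} [AddCommGroup H] [Module ℚ H] {M : Type*} [AddCommGroup M] [Module ℚ M]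
  {Θ : FourForm H M}

theorem exists_list_tmul (z : TensorAlgebra ℚ H ⊗[ℚ] TensorAlgebra ℚ H) :
    ∃ d : List (TensorAlgebra ℚ H × TensorAlgebra ℚ H),
      z = (d.map fun p => p.1 ⊗ₜ[ℚ] p.2).sum := by
  induction z using TensorProduct.induction_on with
  | zero => exact ⟨[], by simp⟩
  | tmul x y => exact ⟨[(x, y)], by simp⟩
  | add x y hx hy =>
    obtain ⟨d, rfl⟩ := hx
    obtain ⟨d', rfl⟩ := hy
    exact ⟨d ++ d', by simp⟩

theorem lift_list_tmul (B : TensorAlgebra ℚ H →ₗ[ℚ] TensorAlgebra ℚ H →ₗ[ℚ] M)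
    (d : List (TensorAlgebra ℚ H × TensorAlgebra ℚ H)) :
    TensorProduct.lift B (d.map fun p => p.1 ⊗ₜ[ℚ] p.2).sum = (d.map fun p => B p.1 p.2).sum := by
  induction d with
  | nil => simp
  | cons p d ih => simp [ih]

theorem sum_map_sum_comm {α β : Type*} (l : List α) (l' : List β) (g : α → β → M) :
    (l.map fun a => (l'.map fun b => g a b).sum).sum =
      (l'.map fun b => (l.map fun a => g a b).sum).sum := by
  induction l with
  | nil => simp
  | cons a l ih => simp [ih, List.sum_map_add]

/-- The Sweedler sums in the relation spread the hairs `t` and `v` over the two arms next to an end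
of the middle edge; for a balanced form this amounts to putting all of them on the middle edge. -/
theorem IsBalanced.sum_sweedler (hb : IsBalanced Θ) {t v : TensorAlgebra ℚ H}
    (s u r w : TensorAlgebra ℚ H) {dt dv : List (TensorAlgebra ℚ H × TensorAlgebra ℚ H)}
    (ht : coproduct H t = (dt.map fun p => p.1 ⊗ₜ[ℚ] p.2).sum)
    (hv : coproduct H v = (dv.map fun p => p.1 ⊗ₜ[ℚ] p.2).sum) :
    (dt.map fun p => (dv.map fun q =>
      Θ (s * antipode p.1) (p.2 * u) (antipode q.1 * r) (w * q.2)).sum).sum =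
      mid Θ (antipode t * antipode v) s u r w := by
  have h₁ (q : TensorAlgebra ℚ H × TensorAlgebra ℚ H) :
      (dt.map fun p => Θ (s * antipode p.1) (p.2 * u) (antipode q.1 * r) (w * q.2)).sum =
        mid Θ (antipode t) s u (antipode q.1 * r) (w * q.2) := by
    have := lift_coproduct_lower (Θ := Θ) u (antipode q.1 * r) (w * q.2) s t
      (LinearMap.mk₂ ℚ (fun p x => Θ (s * antipode p) (x * u) (antipode q.1 * r) (w * q.2))
        (fun x y z => by simp [mul_add]) (fun c x y => by simp) (fun x y z => by simp [add_mul])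
        (fun c x y => by simp)) (fun p r => by simp)
    rw [ht, lift_list_tmul] at this
    simpa using this
  have h₂ := hb.lift_coproduct_upper (antipode t) s u v r w
    (LinearMap.mk₂ ℚ (fun p x => mid Θ (antipode t) s u (antipode p * r) (w * x))
        (fun x y z => by simp [add_mul]) (fun c x y => by simp) (fun x y z => by simp [mul_add])
        (fun c x y => by simp)) (fun p r => by simp)
  rw [hv, lift_list_tmul] at h₂
  rw [← h₂, sum_map_sum_comm]
  simp only [LinearMap.mk₂_apply, h₁]

/-- The antipode is an anti-homomorphism of coalgebras. -/
theorem coproduct_antipode (u : TensorAlgebra ℚ H) : coproduct H (antipode u) =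
    TensorProduct.comm ℚ _ _ (TensorProduct.map antipodeₗ antipodeₗ (coproduct H u)) := by
  induction u using tensor_induction_left with
  | one => simp [Algebra.TensorProduct.one_def]
  | ι_mul a u ih =>
    have key (z : TensorAlgebra ℚ H ⊗[ℚ] TensorAlgebra ℚ H) :
        TensorProduct.comm ℚ _ _ (TensorProduct.map antipodeₗ antipodeₗ
          (coproduct H (TensorAlgebra.ι ℚ a) * z)) =
        TensorProduct.comm ℚ _ _ (TensorProduct.map antipodeₗ antipodeₗ z) *
          -coproduct H (TensorAlgebra.ι ℚ a) := by
      induction z using TensorProduct.induction_on with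
      | zero => simp
      | tmul x y =>
        simp [coproduct, add_mul, mul_add, TensorProduct.tmul_neg, TensorProduct.neg_tmul]
      | add x y hx hy => rw [mul_add, map_add, map_add, hx, hy, map_add, map_add, add_mul]
    rw [antipode_mul, antipode_ι, map_mul, map_mul, key, ih, map_neg]
  | add x y hx hy => simp [hx, hy]
  | smul c x hx => simp [hx]

theorem coproduct_antipode_list {u : TensorAlgebra ℚ H}
    {du : List (TensorAlgebra ℚ H × TensorAlgebra ℚ H)}
    (hu : coproduct H u = (du.map fun p => p.1 ⊗ₜ[ℚ] p.2).sum) : coproduct H (antipode u) =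
      ((du.map fun p => (antipode p.2, antipode p.1)).map fun p => p.1 ⊗ₜ[ℚ] p.2).sum := by
  rw [coproduct_antipode, hu]
  simp [map_list_sum, Function.comp_def]

/-- The second term of the three-term relation in Sweedler notation. -/
theorem IsBalanced.sum_sweedler_left (hb : IsBalanced Θ) {t v : TensorAlgebra ℚ H}
    (u w : TensorAlgebra ℚ H) {dt dv : List (TensorAlgebra ℚ H × TensorAlgebra ℚ H)}
    (ht : coproduct H t = (dt.map fun p => p.1 ⊗ₜ[ℚ] p.2).sum)
    (hv : coproduct H v = (dv.map fun p => p.1 ⊗ₜ[ℚ] p.2).sum) :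
    (dt.map fun p => (dv.map fun q =>
      Θ (antipode p.1) (p.2 * u) (antipode q.1) (w * q.2)).sum).sum =
      mid Θ (antipode t * antipode v) 1 u 1 w := by
  simpa using hb.sum_sweedler 1 u 1 w ht hv

/-- The third term of the three-term relation in Sweedler notation. -/
theorem IsBalanced.sum_sweedler_right (hb : IsBalanced Θ) (t v : TensorAlgebra ℚ H)
    {u w : TensorAlgebra ℚ H} {du dw : List (TensorAlgebra ℚ H × TensorAlgebra ℚ H)}
    (hu : coproduct H u = (du.map fun p => p.1 ⊗ₜ[ℚ] p.2).sum)
    (hw : coproduct H w = (dw.map fun p => p.1 ⊗ₜ[ℚ] p.2).sum) :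
    (du.map fun p => (dw.map fun q =>
      Θ (t * p.2) (antipode p.1) (q.2 * v) (antipode q.1)).sum).sum = mid Θ (u * w) t 1 v 1 := by
  simpa [Function.comp_def] using
    hb.sum_sweedler t 1 v 1 (coproduct_antipode_list hu) (coproduct_antipode_list hw)

/-- The three-term relation in Sweedler notation. -/
theorem IsBalanced.isThreeTerm_iff (hb : IsBalanced Θ) : IsThreeTerm Θ ↔
    ∀ (t u v w : TensorAlgebra ℚ H)
      (dt du dv dw : List (TensorAlgebra ℚ H × TensorAlgebra ℚ H)),
      coproduct H t = (dt.map fun p => p.1 ⊗ₜ[ℚ] p.2).sum →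
      coproduct H u = (du.map fun p => p.1 ⊗ₜ[ℚ] p.2).sum →
      coproduct H v = (dv.map fun p => p.1 ⊗ₜ[ℚ] p.2).sum →
      coproduct H w = (dw.map fun p => p.1 ⊗ₜ[ℚ] p.2).sum →
      Θ t u v w + (dt.map fun p => (dv.map fun q =>
          Θ (antipode p.1) (p.2 * u) (antipode q.1) (w * q.2)).sum).sum +
        (du.map fun p => (dw.map fun q =>
          Θ (t * p.2) (antipode p.1) (q.2 * v) (antipode q.1)).sum).sum = 0 := by
  constructor
  · intro h t u v w dt du dv dw ht hu hv hw
    rw [hb.sum_sweedler_left u w ht hv, hb.sum_sweedler_right t v hu hw, h]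
  · intro h t u v w
    obtain ⟨dt, ht⟩ := exists_list_tmul (coproduct H t)
    obtain ⟨du, hu⟩ := exists_list_tmul (coproduct H u)
    obtain ⟨dv, hv⟩ := exists_list_tmul (coproduct H v)
    obtain ⟨dw, hw⟩ := exists_list_tmul (coproduct H w)
    have := h t u v w dt du dv dw ht hu hv hw
    rwa [hb.sum_sweedler_left u w ht hv, hb.sum_sweedler_right t v hu hw] at this

/-- The linear map from the space of symbols that is given by a form. -/
noncomputable def evalSymbols (Θ : FourForm H M) : Symbols H →ₗ[ℚ] M :=
  Finsupp.linearCombination ℚ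
    fun p : TensorAlgebra ℚ H × TensorAlgebra ℚ H × TensorAlgebra ℚ H × TensorAlgebra ℚ H =>
      Θ p.1 p.2.1 p.2.2.1 p.2.2.2

@[simp] theorem evalSymbols_symbol (t u v w : TensorAlgebra ℚ H) :
    evalSymbols Θ (symbol t u v w) = Θ t u v w := by
  simp [evalSymbols, symbol]

theorem evalSymbols_rel (hb : IsBalanced Θ) (h₃ : IsThreeTerm Θ) {x : Symbols H}
    (hx : ThetaRel x) : evalSymbols Θ x = 0 := by
  cases hx with
  | three t u v w dt du dv dw ht hu hv hw =>
    have := hb.isThreeTerm_iff.1 h₃ t u v w dt du dv dw ht hu hv hw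
    simpa [map_list_sum, Function.comp_def] using this
  | reflect₁ t u v w => simpa [sub_eq_zero] using hb.reflect₁ t u v w
  | reflect₂ t u v w => simpa [sub_eq_zero] using hb.reflect₂ t u v w
  | handle t u v w a => simpa [sub_eq_zero] using hb.handle t u v w a
  | _ => simp

variable (H) in
/-- The space presented by the symbols and the relations. -/
abbrev ThetaSpace : Type _ := Symbols H ⧸ Submodule.span ℚ {x : Symbols H | ThetaRel x}

theorem mkQ_thetaRel {x : Symbols H} (hx : ThetaRel x) :
    (Submodule.span ℚ {x : Symbols H | ThetaRel x}).mkQ x = 0 :=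
  (Submodule.Quotient.mk_eq_zero _).2 (Submodule.subset_span hx)

variable (H) in
/-- The form with values in the presented space that is given by the symbols. -/
noncomputable def universalForm : FourForm H (ThetaSpace H) :=
  LinearMap.mk₂ ℚ (fun t u => LinearMap.mk₂ ℚ
      (fun v w => (Submodule.span ℚ {x : Symbols H | ThetaRel x}).mkQ (symbol t u v w))
      (fun x y z => by simpa [sub_eq_zero] using mkQ_thetaRel (.add₃ t u x y z))
      (fun c x y => by simpa [sub_eq_zero] using mkQ_thetaRel (.smul₃ c t u x y))
      (fun x y z => by simpa [sub_eq_zero] using mkQ_thetaRel (.add₄ t u x y z))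
      (fun c x y => by simpa [sub_eq_zero] using mkQ_thetaRel (.smul₄ c t u x y)))
    (fun x y z => LinearMap.ext₂ fun v w => by
      simpa [sub_eq_zero] using mkQ_thetaRel (.add₁ x y z v w))
    (fun c x y => LinearMap.ext₂ fun v w => by
      simpa [sub_eq_zero] using mkQ_thetaRel (.smul₁ c x y v w))
    (fun x y z => LinearMap.ext₂ fun v w => by
      simpa [sub_eq_zero] using mkQ_thetaRel (.add₂ x y z v w))
    (fun c x y => LinearMap.ext₂ fun v w => by
      simpa [sub_eq_zero] using mkQ_thetaRel (.smul₂ c x y v w))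

theorem universalForm_apply (t u v w : TensorAlgebra ℚ H) : universalForm H t u v w =
    (Submodule.span ℚ {x : Symbols H | ThetaRel x}).mkQ (symbol t u v w) := rfl

theorem isBalanced_universalForm : IsBalanced (universalForm H) where
  reflect₁ t u v w := by
    simp only [universalForm_apply]
    rw [← sub_eq_zero, ← map_sub]
    exact mkQ_thetaRel (.reflect₁ t u v w)
  reflect₂ t u v w := by
    simp only [universalForm_apply]
    rw [← sub_eq_zero, ← map_sub]
    exact mkQ_thetaRel (.reflect₂ t u v w)
  handle t u v w a := by
    simp only [universalForm_apply]
    rw [← sub_eq_zero, ← map_sub, ← map_sub, ← map_sub]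
    exact mkQ_thetaRel (.handle t u v w a)

theorem isThreeTerm_universalForm : IsThreeTerm (universalForm H) := by
  rw [isBalanced_universalForm.isThreeTerm_iff]
  intro t u v w dt du dv dw ht hu hv hw
  have := mkQ_thetaRel (.three t u v w dt du dv dw ht hu hv hw)
  simp only [map_add, map_list_sum, List.map_map, Function.comp_def] at this
  exact this

theorem evalSymbols_universalForm :
    evalSymbols (universalForm H) = (Submodule.span ℚ {x : Symbols H | ThetaRel x}).mkQ := by
  refine Finsupp.lhom_ext' fun p => LinearMap.ext_ring ?_
  simp [evalSymbols, universalForm_apply, symbol]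

/-- An identity between four-linear forms holds if it holds on pure tensors. -/
theorem FourForm.map_eq_of_pure {N : Type*} [AddCommGroup N] [Module ℚ N] {φ : M →ₗ[ℚ] N}
    {Θ' : FourForm H N} (h : ∀ t u v w : List H,
      φ (Θ (pureTensor t) (pureTensor u) (pureTensor v) (pureTensor w)) =
        Θ' (pureTensor t) (pureTensor u) (pureTensor v) (pureTensor w))
    (t u v w : TensorAlgebra ℚ H) : φ (Θ t u v w) = Θ' t u v w := by
  induction t using tensor_induction_pure with
  | add x y hx hy => simp [hx, hy]
  | smul c x hx => simp [hx]
  | pure t =>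
  induction u using tensor_induction_pure with
  | add x y hx hy => simp [hx, hy]
  | smul c x hx => simp [hx]
  | pure u =>
  induction v using tensor_induction_pure with
  | add x y hx hy => simp [hx, hy]
  | smul c x hx => simp [hx]
  | pure v =>
  induction w using tensor_induction_pure with
  | add x y hx hy => simp [hx, hy]
  | smul c x hx => simp [hx]
  | pure w => exact h t u v w

end Presentation

end HairyLie

theorem theorem1p1 (H : Type*) [AddCommGroup H] [Module ℚ H] :
    ∃ Θ : TensorAlgebra ℚ H →ₗ[ℚ] TensorAlgebra ℚ H →ₗ[ℚ] TensorAlgebra ℚ H →ₗ[ℚ]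
        TensorAlgebra ℚ H →ₗ[ℚ] HairyLie.LoopSpace H 2,
      -- `Θ` is the multilinear extension of the classes of the theta graphs
      (∀ t u v w : List H,
        Θ (HairyLie.pureTensor t) (HairyLie.pureTensor u)
            (HairyLie.pureTensor v) (HairyLie.pureTensor w) =
          HairyLie.LoopSpace.ofGraph (HairyLie.thetaGraph t u v w)) ∧
      -- the elements `Θ(t,u,v,w)` generate the `2`-loop space
      Submodule.span ℚ {x | ∃ t u v w, x = Θ t u v w} = ⊤ ∧
      -- all linear relations between them are consequences of the listed ones
      LinearMap.ker (Finsupp.linearCombination ℚ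
          fun p : TensorAlgebra ℚ H × TensorAlgebra ℚ H × TensorAlgebra ℚ H × TensorAlgebra ℚ H =>
            Θ p.1 p.2.1 p.2.2.1 p.2.2.2) =
        Submodule.span ℚ {x : HairyLie.Symbols H | HairyLie.ThetaRel x} := by
  obtain ⟨Θ, hb, hΘ⟩ := (HairyLie.isInvariant_treeClass (H := H)).exists_form
  have h₃ := HairyLie.isThreeTerm_of_treeClass hb hΘ
  have hg (t u v w : List H) := (hΘ t u v w).symm.trans
    (HairyLie.treeClass_eq (HairyLie.thetaGraph t u v w))
  refine ⟨Θ, hg, ?_, le_antisymm ?_ ?_⟩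
  · refine top_unique ?_
    rw [← HairyLie.span_ofGraph, Submodule.span_le]
    rintro _ ⟨X, rfl⟩
    refine HairyLie.treeClass_mem hΘ (fun t u v w => Submodule.subset_span ?_) X
    exact ⟨t, u, v, w, rfl⟩
  · -- The universal form gives a linear map on the two-loop space that is a one-sided inverse.
    have hb' := HairyLie.isBalanced_universalForm (H := H)
    obtain ⟨φ, hφ⟩ := hb'.isInvariant_realize.exists_loopSpace_map hb'
      HairyLie.isThreeTerm_universalForm hb'.realize_thetaGraph
    have hφΘ : ∀ t u v w, φ (Θ t u v w) = HairyLie.universalForm H t u v w :=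
      HairyLie.FourForm.map_eq_of_pure fun t u v w => by
        rw [hg, hφ, hb'.realize_thetaGraph]
    intro x hx
    rw [← Submodule.Quotient.mk_eq_zero, ← Submodule.mkQ_apply,
      ← HairyLie.evalSymbols_universalForm]
    have h : HairyLie.evalSymbols (HairyLie.universalForm H) = φ ∘ₗ HairyLie.evalSymbols Θ := by
      refine Finsupp.lhom_ext' fun p => LinearMap.ext_ring ?_
      simp [HairyLie.evalSymbols, hφΘ]
    rw [h, LinearMap.comp_apply, show HairyLie.evalSymbols Θ x = 0 from hx, map_zero]
  · exact Submodule.span_le.2 fun x hx => HairyLie.evalSymbols_rel hb h₃ hx
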